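/- Let $t_0,t_3,x^*>0$, $\omega=e^{2\pi i/3}$, $\Sigma_1=\{z\in\mathbb C: z^3\in[0,(x^*)^3]\}$ and $\Sigma_2=\{z\in\mathbb C: z^3\in(-\infty,0]\}$. Let $I(\mu,\nu)=\iint\log\frac1{|x-y|}\,d\mu(x)\,d\nu(y)$ and $I(\mu)=I(\mu,\mu)$, and let $(\mu_1^*,\mu_2^*)$ be a minimizer of $$E(\mu_1,\mu_2)=I(\mu_1)+I(\mu_2)-I(\mu_1,\mu_2)+\frac1{t_0}\int\Big(\frac{2}{3\sqrt{t_3}}|z|^{3/2}-\frac{t_3}{3}z^3\Big)d\mu_1(z)$$ among all pairs of measures with $\int d\mu_1=1$, $\operatorname{supp}\mu_1\subset\Sigma_1$, $\int d\mu_2=\frac12$, $\operatorname{supp}\mu_2\subset\Sigma_2$, for which the integrals $I(\mu_1),I(\mu_2),I(\mu_1,\mu_2)$ converge absolutely. Put $F_k(z)=\int\frac{d\mu_k^*(\zeta)}{z-\zeta}$ and, with the principal branch of $z^{1/2}$, $$\xi_1=t_3z^2+t_0F_1,\qquad \xi_2=\pm\tfrac{1}{\sqrt{t_3}}z^{1/2}+t_0(F_2-F_1),\qquad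 \xi_3=\mp\tfrac1{\sqrt{t_3}}z^{1/2}-t_0F_2,$$ on $\mathbb C\setminus\Sigma_1$, $\mathbb C\setminus(\Sigma_1\cup\Sigma_2)$, $\mathbb C\setminus\Sigma_2$ respectively, where the upper signs hold for $|\arg z|<\pi/3$ and the lower signs for $\pi/3<|\arg z|<\pi$. Let $\mathcal R$ be the three-sheeted Riemann surface with sheets $\overline{\mathbb C}\setminus\Sigma_1$, $\overline{\mathbb C}\setminus(\Sigma_1\cup\Sigma_2)$, $\overline{\mathbb C}\setminus\Sigma_2$, where sheets $k$ and $k+1$ are connected crosswise along $\Sigma_k$ ($k=1,2$). Suppose that $\operatorname{supp}(\mu_1^*)=\Sigma_1$ and that the density of $\mu_1^*$ with respect to arc length vanishes at the endpoints $\omega^jx^*$, $j=0,1,2$. Then $t_0\le t_{0,crit}:=\frac1{8t_3^2}$, and the following hold. (a) $\xi_1,\xi_2,\xi_3$ define a meromorphic function on $\mathcal R$ whose poles are exactly the points at infinity. (b) $\xi_1,\xi_2,\xi_3$ are the three solutions of $$\xi^3-t_3z^2\xi^2-\Big(t_0t_3+\frac1{t_3}\Big)z\xi+z^3+A=0,\qquad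 A=\frac{1+20t_0t_3^2-8t_0^2t_3^4-(1-8t_0t_3^2)^{3/2}}{32t_3^3}.$$ (c) $x^*=\frac{3}{4t_3}\big(1-\sqrt{1-8t_0t_3^2}\big)^{2/3}$. Put $\widehat x=\frac{3+\sqrt{1-8t_0t_3^2}}{4t_3}$. The finite branch points of the equation in (b) are exactly $z=\omega^jx^*$, $j=0,1,2$. The singular points of the affine curve in (b) are exactly $(z,\xi)=(\omega^j\widehat x,\omega^{2j}\widehat x)$, $j=0,1,2$, and they are nodes (ordinary double points) if $t_0<t_{0,crit}$. The zeros of the discriminant of the equation with respect to $\xi$ are exactly $z=\omega^jx^*$ and $z=\omega^j\widehat x$, $j=0,1,2$. (d) $\widehat x\ge x^*>0$, with equality $\widehat x=x^*$ if and only if $t_0=t_{0,crit}$, and $\xi_1(\omega^j\widehat x)=\xi_2(\omega^j\widehat x)=\omega^{2j}\widehat x$ for $j=0,1,2$. If $t_0=t_{0,crit}$, so that $\omega^j\widehat x=\omega^jx^*$ lies on the cut $\Sigma_1$, these values are understood as limits. -/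

import Mathlib

open MeasureTheory Filter Topology Polynomial
open scoped ENNReal

namespace CubicNMM

noncomputable section

/-! ### The sets and the vector equilibrium problem -/

/-- `ω = exp (2 π i / 3)`. -/
def omega : ℂ := Complex.exp (2 * Real.pi * Complex.I / 3)

/-- The compact star `Σ₁ = {z : z³ ∈ [0, x³]}`. -/
def Sigma1 (x : ℝ) : Set ℂ := {z | ∃ r : ℝ, 0 ≤ r ∧ r ≤ x ^ 3 ∧ z ^ 3 = (r : ℂ)}

/-- The unbounded star `Σ₂ = {z : z³ ∈ (-∞, 0]}`. -/
def Sigma2 : Set ℂ := {z | ∃ r : ℝ, r ≤ 0 ∧ z ^ 3 = (r : ℂ)}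

/-- The mutual logarithmic energy `I(μ, ν) = ∬ log (1 / |x - y|) dμ(x) dν(y)`;
`I(μ) = I(μ, μ)`. It is only used for pairs with `HasFiniteLogEnergy μ ν`. -/
def logEnergy (μ ν : Measure ℂ) : ℝ :=
  ∫ p : ℂ × ℂ, Real.log (1 / ‖p.1 - p.2‖) ∂(μ.prod ν)

/-- The double integral `∬ log (1 / |x - y|) dμ dν` converges absolutely. The kernel is `+∞` on the
diagonal (where the real logarithm of Mathlib is `0`), so the diagonal has to be a null set. -/
def HasFiniteLogEnergy (μ ν : Measure ℂ) : Prop :=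
  (μ.prod ν) (Set.diagonal ℂ) = 0 ∧
    Integrable (fun p : ℂ × ℂ => Real.log (1 / ‖p.1 - p.2‖)) (μ.prod ν)

/-- The energy functional `E(μ₁, μ₂)`. On `Σ₁` the number `z³` is real. -/
def energy (t0 t3 : ℝ) (μ1 μ2 : Measure ℂ) : ℝ :=
  logEnergy μ1 μ1 + logEnergy μ2 μ2 - logEnergy μ1 μ2 +
    1 / t0 * ∫ z : ℂ, (2 / (3 * √t3) * ‖z‖ ^ (3 / 2 : ℝ) - t3 / 3 * (z ^ 3).re) ∂μ1

/-- The pairs of measures that compete in the vector equilibrium problem. -/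
structure IsAdmissible (x : ℝ) (μ1 μ2 : Measure ℂ) : Prop where
  mass1 : μ1 Set.univ = 1
  supp1 : μ1.support ⊆ Sigma1 x
  mass2 : μ2 Set.univ = 1 / 2
  supp2 : μ2.support ⊆ Sigma2
  finite11 : HasFiniteLogEnergy μ1 μ1
  finite22 : HasFiniteLogEnergy μ2 μ2
  finite12 : HasFiniteLogEnergy μ1 μ2

/-- `(μ₁, μ₂)` is a minimizer of the vector equilibrium problem on `Σ₁`, `Σ₂`. -/
def IsEquilibriumPair (t0 t3 x : ℝ) (μ1 μ2 : Measure ℂ) : Prop :=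
  IsAdmissible x μ1 μ2 ∧
    ∀ ν1 ν2 : Measure ℂ, IsAdmissible x ν1 ν2 → energy t0 t3 μ1 μ2 ≤ energy t0 t3 ν1 ν2

/-- Arc length on `Σ₁ = [0, x] ∪ [0, ω x] ∪ [0, ω² x]`. -/
def arcLength (x : ℝ) : Measure ℂ :=
  ∑ j : Fin 3, (volume.restrict (Set.Icc 0 x)).map (fun s : ℝ => (s : ℂ) * omega ^ (j : ℕ))

/-- The density of `μ` with respect to arc length on `Σ₁` vanishes at the endpoints `ω ^ j x`. -/
def DensityVanishesAtEndpoints (x : ℝ) (μ : Measure ℂ) : Prop :=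
  ∃ ρ : ℂ → ℝ≥0∞, Measurable ρ ∧ μ = (arcLength x).withDensity ρ ∧
    ∀ j : Fin 3, Tendsto ρ (𝓝[Sigma1 x] (omega ^ (j : ℕ) * x)) (𝓝 0)

/-! ### The functions `ξ₁, ξ₂, ξ₃` -/

/-- The Cauchy transform `F(z) = ∫ dμ(ζ) / (z - ζ)`. -/
def cauchyTransform (μ : Measure ℂ) (z : ℂ) : ℂ := ∫ ζ : ℂ, 1 / (z - ζ) ∂μ

/-- `t₃^{-1/2} z^{1/2}` with the principal branch of the square root. -/
def sqrtTerm (t3 : ℝ) (z : ℂ) : ℂ := 1 / ((√t3 : ℝ) : ℂ) * z ^ (1 / 2 : ℂ)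

/-- The sector `S₀ : -π/3 < arg z < π/3`. Off `Σ₂`, the complement of `S₀` is `S₁ ∪ S₂`. -/
def S0 : Set ℂ := {z | z ≠ 0 ∧ -(Real.pi / 3) < z.arg ∧ z.arg < Real.pi / 3}

open Classical in
/-- The functions `ξ₁, ξ₂, ξ₃` (indexed by `0, 1, 2`). -/
def xi (t0 t3 : ℝ) (μ1 μ2 : Measure ℂ) : Fin 3 → ℂ → ℂ :=
  ![fun z => t3 * z ^ 2 + t0 * cauchyTransform μ1 z,
    fun z => (if z ∈ S0 then sqrtTerm t3 z else -sqrtTerm t3 z) +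
      t0 * (cauchyTransform μ2 z - cauchyTransform μ1 z),
    fun z => (if z ∈ S0 then -sqrtTerm t3 z else sqrtTerm t3 z) - t0 * cauchyTransform μ2 z]

/-- The finite part of the sheets `ℛ₁, ℛ₂, ℛ₃` (indexed by `0, 1, 2`). -/
def sheetDomain (x : ℝ) : Fin 3 → Set ℂ := ![(Sigma1 x)ᶜ, (Sigma1 x ∪ Sigma2)ᶜ, Sigma2ᶜ]

/-! ### The three-sheeted surface

The rays of argument `m π / 3`, `m = 0, …, 5`, contain all the cuts: the segment `[0, x]` of each
ray with `m` even is a branch of `Σ₁`, and each ray with `m` odd is a branch of `Σ₂`. Each of the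
three copies of the Riemann sphere is divided into the six closed sectors between consecutive rays,
and the resulting 18 pieces are glued along the rays: crosswise between the first two sheets
along `Σ₁`, crosswise between the last two sheets along `Σ₂`, and within each sheet along the edges
that do not belong to a cut of that sheet. -/

/-- `exp (i π / 3)`. -/
def zeta6 : ℂ := Complex.exp (Real.pi * Complex.I / 3)

/-- The closed sector `m π / 3 ≤ arg z ≤ (m + 1) π / 3` of the sphere, with `0` and `∞`. -/
def sector (m : Fin 6) : Set (OnePoint ℂ) :=
  {P | P = OnePoint.infty ∨ ∃ a b : ℝ, 0 ≤ a ∧ 0 ≤ b ∧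
    P = ((a * zeta6 ^ (m : ℕ) + b * zeta6 ^ ((m : ℕ) + 1) : ℂ) : OnePoint ℂ)}

/-- The segment `{a exp (i m π / 3) : 0 ≤ a ≤ x}`. -/
def innerRay (x : ℝ) (m : Fin 6) : Set (OnePoint ℂ) :=
  {P | ∃ a : ℝ, 0 ≤ a ∧ a ≤ x ∧ P = ((a * zeta6 ^ (m : ℕ) : ℂ) : OnePoint ℂ)}

/-- `{a exp (i m π / 3) : x ≤ a ≤ ∞}`. -/
def outerRay (x : ℝ) (m : Fin 6) : Set (OnePoint ℂ) :=
  {P | P = OnePoint.infty ∨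
    ∃ a : ℝ, x ≤ a ∧ P = ((a * zeta6 ^ (m : ℕ) : ℂ) : OnePoint ℂ)}

/-- The disjoint union of the 18 closed sectors: a sheet, a sector and a point of the sector. -/
abbrev Piece : Type := {p : Fin 3 × Fin 6 × OnePoint ℂ // p.2.2 ∈ sector p.2.1}

/-- The sheet of a point of a piece. -/
def Piece.sheet (p : Piece) : Fin 3 := p.1.1

/-- The number of the sector of a point of a piece. -/
def Piece.sec (p : Piece) : Fin 6 := p.1.2.1

/-- The underlying point of the Riemann sphere. -/
def Piece.pt (p : Piece) : OnePoint ℂ := p.1.2.2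

/-- The gluing of the edge of a sector along the ray of number `q.sec` with the edge of the
next sector along the same ray. -/
def Glue (x : ℝ) (p q : Piece) : Prop :=
  q.sec = p.sec + 1 ∧ q.pt = p.pt ∧
    ((Even (q.sec : ℕ) ∧ p.pt ∈ innerRay x q.sec ∧ q.sheet = Equiv.swap 0 1 p.sheet) ∨
     (Even (q.sec : ℕ) ∧ p.pt ∈ outerRay x q.sec ∧ q.sheet = p.sheet) ∨
     (Odd (q.sec : ℕ) ∧ p.pt ∈ outerRay 0 q.sec ∧ q.sheet = Equiv.swap 1 2 p.sheet))

/-- The three-sheeted surface `ℛ`. -/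
def Surface (x : ℝ) : Type := Quot (Glue x)

/-- The quotient topology. -/
instance (x : ℝ) : TopologicalSpace (Surface x) := inferInstanceAs (TopologicalSpace (Quot (Glue x)))

/-- The point of `ℛ` given by a point of a piece. -/
def Surface.mk (x : ℝ) (p : Piece) : Surface x := Quot.mk (Glue x) p

/-- The projection of `ℛ` onto the Riemann sphere. -/
def Surface.proj {x : ℝ} : Surface x → OnePoint ℂ :=
  Quot.lift Piece.pt (fun _ _ h => h.2.1.symm)

open Classical in
/-- `w ↦ 1 / w`, as a map from `ℂ` to the Riemann sphere. -/
def sphereInv (w : ℂ) : OnePoint ℂ := if w = 0 then OnePoint.infty else ((w⁻¹ : ℂ) : OnePoint ℂ)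

/-- The map `g` into the Riemann sphere is holomorphic near `w₀`: in one of the two standard
coordinates `u`, `1 / u` of the sphere it is an analytic function. -/
def SphereHolAt (g : ℂ → OnePoint ℂ) (w0 : ℂ) : Prop :=
  ∃ h : ℂ → ℂ, AnalyticAt ℂ h w0 ∧
    (g =ᶠ[𝓝 w0] (fun w => ((h w : ℂ) : OnePoint ℂ)) ∨ g =ᶠ[𝓝 w0] (fun w => sphereInv (h w)))

/-- The charts of the complex structure of `ℛ`: homeomorphisms of open subsets of `ℛ` onto open
subsets of `ℂ` in which the projection to the sphere is holomorphic. -/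
def IsComplexChart {x : ℝ} (e : OpenPartialHomeomorph (Surface x) ℂ) : Prop :=
  ∀ w ∈ e.target, SphereHolAt (fun u => (e.symm u).proj) w

/-- Meromorphic functions on `ℛ`, as maps to the sphere: every point lies in a chart in
which the function is holomorphic as a map into the sphere, and `f` is not identically `∞`. -/
def IsMeromorphicOnSurface {x : ℝ} (f : Surface x → OnePoint ℂ) : Prop :=
  (∃ P, f P ≠ OnePoint.infty) ∧
    ∀ P : Surface x, ∃ e : OpenPartialHomeomorph (Surface x) ℂ, P ∈ e.source ∧ IsComplexChart e ∧
      SphereHolAt (fun u => f (e.symm u)) (e P)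

/-! ### The spectral curve -/

/-- The constant `A`. -/
def constA (t0 t3 : ℝ) : ℝ :=
  (1 + 20 * t0 * t3 ^ 2 - 8 * t0 ^ 2 * t3 ^ 4 - (1 - 8 * t0 * t3 ^ 2) ^ (3 / 2 : ℝ)) /
    (32 * t3 ^ 3)

/-- The explicit value of `x^*`. -/
def xStar (t0 t3 : ℝ) : ℝ := 3 / (4 * t3) * (1 - √(1 - 8 * t0 * t3 ^ 2)) ^ (2 / 3 : ℝ)

/-- The explicit value of `x̂`. -/
def xHat (t0 t3 : ℝ) : ℝ := (3 + √(1 - 8 * t0 * t3 ^ 2)) / (4 * t3)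

/-- The cubic polynomial `ξ³ - t₃ z² ξ² - (t₀ t₃ + 1 / t₃) z ξ + z³ + A` in `ξ`. -/
def spectralPoly (t0 t3 A : ℝ) (z : ℂ) : ℂ[X] :=
  X ^ 3 - C ((t3 : ℂ) * z ^ 2) * X ^ 2 - C (((t0 * t3 + 1 / t3 : ℝ) : ℂ) * z) * X +
    C (z ^ 3 + (A : ℂ))

/-- `z₀` is a (finite) branch point of the monic cubic equation `Q z (ξ) = 0`: the three solutions
cannot be chosen as analytic functions of `z` near `z₀`. -/
def IsBranchPoint (Q : ℂ → ℂ[X]) (z0 : ℂ) : Prop :=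
  ¬ ∃ g : Fin 3 → ℂ → ℂ, (∀ i, AnalyticAt ℂ (g i) z0) ∧
    ∀ᶠ z in 𝓝 z0, Q z = ∏ i, (X - C (g i z))

/-- `(z, ξ)` is a singular point of the plane curve `P = 0`. -/
def IsSingularPoint (P : ℂ → ℂ → ℂ) (z ξ : ℂ) : Prop :=
  P z ξ = 0 ∧ deriv (fun u => P u ξ) z = 0 ∧ deriv (fun v => P z v) ξ = 0

/-- `(z, ξ)` is a node of the plane curve `P = 0`: a singular point with two distinct tangents,
that is, with nondegenerate Hessian. -/
def IsNode (P : ℂ → ℂ → ℂ) (z ξ : ℂ) : Prop :=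
  IsSingularPoint P z ξ ∧
    iteratedDeriv 2 (fun u => P u ξ) z * iteratedDeriv 2 (fun v => P z v) ξ -
      (deriv (fun u => deriv (fun v => P u v) ξ) z) ^ 2 ≠ 0

end

end CubicNMM

open CubicNMM

/-!
The minimiser is pinned down by convexity, its Cauchy transforms by a variational (loop) equation,
and the resulting algebraic curve by its rational parametrisation.

*Symmetry.* The logarithmic energy is a superposition of Gaussian energies, which are positive by
Fourier inversion (`eq_of_energyDist_nonpos`). Comparison with a symmetrised competitor therefore
shows that `μ₁` is invariant under rotation by `ω` and that `μ₂` is half the balayage of `μ₁` onto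
`Σ₂` (`IsEquilibriumPair.rotInv_and_eq`). In the coordinate `v = z ^ (3 / 2)` the balayage is a
mixture of Cauchy distributions, so both Cauchy transforms are expressed by one function `Kfun`, an
affine image of the Stieltjes transform of the law of `|z| ^ (3 / 2)` under `μ₁`: for a suitable
root `q` of `z` one has `ξ₂ = q K(q³)`, `ξ₃ = -q K(-q³)` and `ξ₁ + ξ₂ + ξ₃ = t₃ z²`.

*Loop equation.* The first variation of the energy along the vector fields
`y (X² - y²) / (v² - y²)`, where `X = x ^ (3 / 2)`, gives a quadratic relation between the
Stieltjes transform at `v` and at `-v`, up to a multiple of `(v² - X²)⁻¹`. The multiple is zero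
because the density vanishes at the endpoints (`IsEquilibriumPair.loop_equation`). By this relation
the function `v (K³ - t₃ v K² - (t₀ t₃ + 1 / t₃) K)` is even, hence entire, and Liouville's theorem
identifies it with `-v² - A` for a constant `A` (`IsLoopLaw.exists_curve`). This is the cubic.

*Discriminant.* As a polynomial in `s = z³` the discriminant vanishes at `s = x³`. Its other two
roots coincide (`IsLoopLaw.exists_double_root`): away from `[0, x³]` it is the square of a
holomorphic function, and on `[0, x³]` it is nonpositive, since where it is positive the measure
vanishes. Solving for the coefficients leaves a parameter `γ` (`IsCurveParam`), and the curve is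
parametrised by `u ↦ (γ² / t₃ (2 u + u⁻²), γ / t₃ (u⁻¹ + 4 γ³ u²))`.

*The surface.* The first component has three branches over the sector `0 ≤ arg z ≤ π / 3`, with
values in three explicit regions. The images of these regions under the six rotations and
reflections tile the sphere in the way in which the sheets are glued (`surfaceHomeo`), and the
second component is the meromorphic function of (a). Its branches are matched with the `ξₖ` by
connectedness of the sector and a comparison of sizes at one real point (`IsXiTriple.eq_branch`).
Finally `8 γ³ ≤ 1`, because `ξ₂ / √z` is monotone on the real axis to the right of the cut
(`IsXiTriple.le`); this fixes the sign of `√(1 - 8 t₀ t₃²)` and puts the nodes outside the cut.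
-/

namespace CubicNMM
open Real (exp log exp_pos exp_le_exp log_inv log_pow log_nonneg norm_eq_abs log_le_log log_mul
  norm_of_nonneg log_div sq_sqrt rpow_natCast rpow_mul log_abs sqrt_pos sqrt_nonneg)
open Complex (I ofReal_re exp_add I_sq conj_ofReal conj_mul' inv_def norm_real sq_norm
  normSq_apply ofReal_pow isometry_ofReal abs_re_le_norm real_smul add_re re_ofReal_mul
  im_ofReal_mul neg_re ofReal_sub abs_im_le_norm sub_re sub_im ofReal_neg norm_def ofReal_im
  inv_im inv_re continuous_re normSq continuous_im add_im mul_im re_ofNat im_ofNat mul_re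
  normSq_pos conj_im one_re one_im normSq_ofReal conj_conj conj_re I_im I_re)
open ENNReal (ofReal ofReal_one ofReal_le_ofReal ofReal_add add_lt_top mul_lt_top ofReal_lt_top
  toReal_inv toReal_ofNat)
open Set (univ Ioi Ioc toFinite Icc mem_ofPred_eq)
open OnePoint (infty coe_ne_infty continuous_coe)
open Function (uncurry Injective comp_def)
open scoped Real ComplexConjugate

noncomputable section

/-! ### Positivity of the logarithmic energy -/

/-- The mutual Gaussian energy `∬ exp (-t |x - y|²) dμ dν`. -/
def gaussEnergy (t : ℝ) (μ ν : Measure ℂ) : ℝ := ∫ p : ℂ × ℂ, exp (-t * ‖p.1 - p.2‖ ^ 2) ∂(μ.prod ν)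

lemma integrable_gauss_complex {b : ℝ} (hb : 0 < b) :
    Integrable (fun v : ℂ => exp (-b * ‖v‖ ^ 2)) := by
  have := (GaussianFourier.integrable_cexp_neg_mul_sq_norm_add (V := ℂ) (b := b)
    (by simpa using hb) 0 0).norm
  refine this.congr (ae_of_all _ fun v => ?_)
  simp only [zero_mul, add_zero, Complex.norm_exp]; norm_cast

lemma gauss_eq_fourier {t : ℝ} (ht : 0 < t) (w : ℂ) :
    ((exp (-t * ‖w‖ ^ 2) : ℝ) : ℂ) = ((4 * π * t : ℝ) : ℂ)⁻¹ *
      ∫ v : ℂ, ((exp (-(1 / (4 * t)) * ‖v‖ ^ 2) : ℝ) : ℂ) *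
        Complex.exp ((inner ℝ w v : ℝ) * I) := by
  have hb : 0 < (((1 / (4 * t) : ℝ)) : ℂ).re := by rw [ofReal_re]; positivity
  have h := GaussianFourier.integral_cexp_neg_mul_sq_norm_add (V := ℂ) hb I w
  have h2 : (∫ v : ℂ, ((exp (-(1 / (4 * t)) * ‖v‖ ^ 2) : ℝ) : ℂ) *
        Complex.exp ((inner ℝ w v : ℝ) * I)) =
      (π / (((1 / (4 * t) : ℝ)) : ℂ)) ^ (Module.finrank ℝ ℂ / 2 : ℂ) *
        Complex.exp (I ^ 2 * ‖w‖ ^ 2 / (4 * (((1 / (4 * t) : ℝ)) : ℂ))) := by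
    rw [← h]
    refine integral_congr_ae (ae_of_all _ fun v => ?_)
    simp only
    rw [Complex.ofReal_exp, ← exp_add]; congr 1; push_cast; ring
  rw [h2, Complex.finrank_real_complex]
  have : (t : ℂ) ≠ 0 := by exact_mod_cast ht.ne'
  have : (π : ℂ) ≠ 0 := by exact_mod_cast Real.pi_ne_zero
  have e1 : ((2 : ℕ) / 2 : ℂ) = 1 := by norm_num
  rw [e1, Complex.cpow_one, Complex.ofReal_exp]
  have e2 : I ^ 2 * ‖w‖ ^ 2 / (4 * (((1 / (4 * t) : ℝ)) : ℂ)) =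
      ((-t * ‖w‖ ^ 2 : ℝ) : ℂ) := by
    rw [I_sq]; push_cast; field_simp
  rw [e2]; push_cast; field_simp

lemma gaussEnergy_eq_fourier {t : ℝ} (ht : 0 < t) (μ ν : Measure ℂ) [IsFiniteMeasure μ]
    [IsFiniteMeasure ν] :
    (gaussEnergy t μ ν : ℂ) = ((4 * π * t : ℝ) : ℂ)⁻¹ *
      ∫ v : ℂ, ((exp (-(1 / (4 * t)) * ‖v‖ ^ 2) : ℝ) : ℂ) *
        (charFun μ v * conj (charFun ν v)) := by
  have hg : Integrable (fun v : ℂ => ((exp (-(1 / (4 * t)) * ‖v‖ ^ 2) : ℝ) : ℂ)) :=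
    (integrable_gauss_complex (b := 1 / (4 * t)) (by positivity)).ofReal
  have hint : Integrable (uncurry fun (p : ℂ × ℂ) v =>
      ((exp (-(1 / (4 * t)) * ‖v‖ ^ 2) : ℝ) : ℂ) *
        Complex.exp ((inner ℝ (p.1 - p.2) v : ℝ) * I)) ((μ.prod ν).prod volume) := by
    have h1 : Integrable (fun z : (ℂ × ℂ) × ℂ =>
        1 * ((exp (-(1 / (4 * t)) * ‖z.2‖ ^ 2) : ℝ) : ℂ))
        ((μ.prod ν).prod volume) := (integrable_const (1 : ℂ)).mul_prod hg
    refine h1.mono ?_ (ae_of_all _ ?_)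
    · refine Continuous.aestronglyMeasurable ?_
      simp only [Function.uncurry_def]; fun_prop
    · rintro ⟨p, v⟩
      simp [uncurry, Complex.norm_exp]
  unfold gaussEnergy
  rw [← integral_complex_ofReal]
  simp_rw [gauss_eq_fourier ht]
  rw [integral_const_mul, integral_integral_swap hint]; congr 1
  refine integral_congr_ae (ae_of_all _ fun v => ?_)
  simp only
  rw [integral_const_mul]; congr 1
  have : ∀ p : ℂ × ℂ, Complex.exp ((inner ℝ (p.1 - p.2) v : ℝ) * I) =
      Complex.exp ((inner ℝ p.1 v : ℝ) * I) *
        conj (Complex.exp ((inner ℝ p.2 v : ℝ) * I)) := by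
    intro p
    rw [← Complex.exp_conj, ← exp_add, inner_sub_left]; congr 1
    simp only [map_mul, Complex.conj_I, conj_ofReal]; push_cast; ring
  simp_rw [this]
  rw [integral_prod_mul (fun x : ℂ => Complex.exp ((inner ℝ x v : ℝ) * I))
    (fun y : ℂ => conj (Complex.exp ((inner ℝ y v : ℝ) * I))), integral_conj]
  rfl

lemma integrable_gauss_charFun {b : ℝ} (hb : 0 < b) (μ ν : Measure ℂ) [IsFiniteMeasure μ]
    [IsFiniteMeasure ν] :
    Integrable (fun v : ℂ => ((exp (-b * ‖v‖ ^ 2) : ℝ) : ℂ) *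
        (charFun μ v * conj (charFun ν v))) := by
  have hg : Integrable (fun v : ℂ => ((exp (-b * ‖v‖ ^ 2) : ℝ) : ℂ)) :=
    (integrable_gauss_complex hb).ofReal
  refine hg.mul_bdd (c := μ.real univ * ν.real univ) ?_ (ae_of_all _ fun v => ?_)
  · exact (continuous_charFun.mul
      (Complex.continuous_conj.comp continuous_charFun)).aestronglyMeasurable
  · rw [norm_mul, RCLike.norm_conj]
    exact mul_le_mul (norm_charFun_le v) (norm_charFun_le v) (norm_nonneg _) measureReal_nonneg

/-- The squared distance of two measures in the Gaussian energy. -/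
def gaussDist (t : ℝ) (μ ν : Measure ℂ) : ℝ :=
  gaussEnergy t μ μ + gaussEnergy t ν ν - 2 * gaussEnergy t μ ν

lemma integrable_gauss_sq {b : ℝ} (hb : 0 < b) (μ ν : Measure ℂ) [IsFiniteMeasure μ]
    [IsFiniteMeasure ν] :
    Integrable (fun v : ℂ => exp (-b * ‖v‖ ^ 2) * ‖charFun μ v - charFun ν v‖ ^ 2) := by
  refine (integrable_gauss_complex hb).mul_bdd (c := (μ.real univ + ν.real univ) ^ 2) ?_
    (ae_of_all _ fun v => ?_)
  · exact ((continuous_charFun.sub continuous_charFun).norm.pow 2).aestronglyMeasurable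
  · rw [norm_pow, norm_norm]; gcongr
    exact (norm_sub_le _ _).trans (add_le_add (norm_charFun_le v) (norm_charFun_le v))

lemma gaussDist_eq_fourier {t : ℝ} (ht : 0 < t) (μ ν : Measure ℂ) [IsFiniteMeasure μ]
    [IsFiniteMeasure ν] :
    gaussDist t μ ν = (4 * π * t)⁻¹ *
      ∫ v : ℂ, exp (-(1 / (4 * t)) * ‖v‖ ^ 2) * ‖charFun μ v - charFun ν v‖ ^ 2 := by
  have hb : 0 < 1 / (4 * t) := by positivity
  have hsymm : gaussEnergy t ν μ = gaussEnergy t μ ν := by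
    unfold gaussEnergy
    rw [← integral_prod_swap]
    refine integral_congr_ae (ae_of_all _ fun p => ?_)
    simp [norm_sub_rev]
  have key : (gaussDist t μ ν : ℂ) = (((4 * π * t)⁻¹ *
      ∫ v : ℂ, exp (-(1 / (4 * t)) * ‖v‖ ^ 2) * ‖charFun μ v - charFun ν v‖ ^ 2 : ℝ) : ℂ) := by
    have : gaussDist t μ ν = gaussEnergy t μ μ + gaussEnergy t ν ν - gaussEnergy t μ ν
        - gaussEnergy t ν μ := by rw [hsymm]; unfold gaussDist; ring
    rw [this]; push_cast
    rw [gaussEnergy_eq_fourier ht, gaussEnergy_eq_fourier ht, gaussEnergy_eq_fourier ht,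
      gaussEnergy_eq_fourier ht, ← mul_add, ← mul_sub, ← mul_sub,
      ← integral_add (integrable_gauss_charFun hb μ μ) (integrable_gauss_charFun hb ν ν),
      ← integral_sub _ (integrable_gauss_charFun hb μ ν),
      ← integral_sub _ (integrable_gauss_charFun hb ν μ)]
    · rw [← integral_complex_ofReal]; push_cast; congr 1
      refine integral_congr_ae (ae_of_all _ fun v => ?_)
      simp only
      rw [← conj_mul' (charFun μ v - charFun ν v), map_sub]; ring
    · exact ((integrable_gauss_charFun hb μ μ).add (integrable_gauss_charFun hb ν ν)).sub
        (integrable_gauss_charFun hb μ ν)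
    · exact (integrable_gauss_charFun hb μ μ).add (integrable_gauss_charFun hb ν ν)
  exact_mod_cast key

lemma gaussDist_nonneg {t : ℝ} (ht : 0 < t) (μ ν : Measure ℂ) [IsFiniteMeasure μ]
    [IsFiniteMeasure ν] : 0 ≤ gaussDist t μ ν := by
  rw [gaussDist_eq_fourier ht]
  exact mul_nonneg (by positivity) (integral_nonneg fun v => by positivity)

lemma eq_of_gaussDist_eq_zero {t : ℝ} (ht : 0 < t) (μ ν : Measure ℂ) [IsFiniteMeasure μ]
    [IsFiniteMeasure ν] (h : gaussDist t μ ν = 0) : μ = ν := by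
  rw [gaussDist_eq_fourier ht, mul_eq_zero, or_iff_right (by positivity)] at h
  have hcont : Continuous (fun v : ℂ =>
      exp (-(1 / (4 * t)) * ‖v‖ ^ 2) * ‖charFun μ v - charFun ν v‖ ^ 2) := by
    have : Continuous (charFun μ) := continuous_charFun
    have : Continuous (charFun ν) := continuous_charFun
    fun_prop
  rw [integral_eq_zero_iff_of_nonneg (fun v => by positivity)
    (integrable_gauss_sq (by positivity) μ ν)] at h
  have h0 := (hcont.ae_eq_iff_eq volume continuous_zero).1 h
  refine Measure.ext_of_charFun (funext fun v => ?_)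
  have := congrFun h0 v
  simp only [Pi.zero_apply, mul_eq_zero, Real.exp_ne_zero, false_or, pow_eq_zero_iff, ne_eq,
    OfNat.ofNat_ne_zero, not_false_eq_true, norm_eq_zero, sub_eq_zero] at this
  exact this

/-- The kernel whose integral over `t > 0` is `- log r`. -/
def logKer (t r : ℝ) : ℝ := (exp (-t * r ^ 2) - exp (-t)) / (2 * t)

lemma abs_logKer_le {t r : ℝ} (ht : 0 < t) :
    |logKer t r| ≤ |r ^ 2 - 1| / 2 * exp (-(min (r ^ 2) 1) * t) := by
  have key : ∀ a b : ℝ, a ≤ b →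
      exp (-t * a) - exp (-t * b) ≤ t * (b - a) * exp (-a * t) := by
    intro a b hab
    have h1 : exp (-t * b) = exp (-a * t) * exp (-(t * (b - a))) := by
      rw [← Real.exp_add]; congr 1; ring
    have h2 : exp (-t * a) = exp (-a * t) := by congr 1; ring
    have := Real.add_one_le_exp (-(t * (b - a)))
    rw [h1, h2]
    nlinarith [exp_pos (-a * t)]
  have mono : ∀ a b : ℝ, a ≤ b → exp (-t * b) ≤ exp (-t * a) := by
    intro a b hab
    apply exp_le_exp.2; nlinarith
  unfold logKer
  rw [abs_div, abs_of_pos (by positivity : (0 : ℝ) < 2 * t), div_le_iff₀ (by positivity)]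
  rcases le_total (r ^ 2) 1 with h | h
  · have h1 := key _ _ h
    have h2 := mono _ _ h
    simp only [mul_one] at h1 h2
    rw [min_eq_left h, abs_of_nonneg (by linarith), abs_of_nonpos (by linarith)]; linarith
  · have h1 := key _ _ h
    have h2 := mono _ _ h
    simp only [mul_one] at h1 h2
    rw [min_eq_right h, abs_of_nonpos (by linarith), abs_of_nonneg (by linarith)]; linarith

lemma measurable_logKer : Measurable (fun p : ℝ × ℝ => logKer p.1 p.2) := by
  unfold logKer; fun_prop

lemma integrableOn_logKer {r : ℝ} (hr : 0 < r) :
    IntegrableOn (fun t => logKer t r) (Ioi 0) := by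
  have h1 : IntegrableOn (fun t : ℝ => |r ^ 2 - 1| / 2 * exp (-(min (r ^ 2) 1) * t)) (Ioi 0) :=
    (exp_neg_integrableOn_Ioi 0 (by positivity)).const_mul _
  refine h1.mono'
    (measurable_logKer.comp (measurable_id.prodMk measurable_const)).aestronglyMeasurable
    ((ae_restrict_iff' measurableSet_Ioi).2 (ae_of_all _ fun t ht => ?_))
  exact abs_logKer_le ht

lemma integral_logKer {r : ℝ} (hr : 0 < r) :
    ∫ t in Ioi (0 : ℝ), logKer t r = -log r := by
  have hf : Continuous fun x : ℝ => exp (-x) := by fun_prop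
  have hker : ∀ t : ℝ, t⁻¹ • (exp (-(r ^ 2 * t)) - exp (-(1 * t))) = 2 * logKer t r := by
    intro t
    unfold logKer
    rw [smul_eq_mul, one_mul, show -(r ^ 2 * t) = -t * r ^ 2 by ring, mul_div_assoc']
    rw [mul_div_mul_left _ _ two_ne_zero, div_eq_inv_mul]
  have h := Frullani.integral_Ioi_eq (f := fun x : ℝ => exp (-x)) (a := r ^ 2) (b := 1)
    (L := 1) (R := 0)
    (hf.locallyIntegrable.locallyIntegrableOn _) (by positivity) one_pos
    ((hf.tendsto' 0 1 (by simp)).mono_left nhdsWithin_le_nhds) Real.tendsto_exp_neg_atTop_nhds_zero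
    (by simp_rw [hker]; exact (integrableOn_logKer hr).const_mul 2)
  simp_rw [hker] at h
  rw [integral_const_mul, one_div, log_inv, log_pow] at h
  simp only [smul_eq_mul, Nat.cast_ofNat] at h; linarith

lemma logKer_nonneg {t r : ℝ} (ht : 0 < t) (hr : 0 ≤ r) (h : r ≤ 1) : 0 ≤ logKer t r := by
  refine div_nonneg (sub_nonneg.2 (exp_le_exp.2 ?_)) (by positivity)
  nlinarith [pow_le_one₀ hr h (n := 2)]

lemma logKer_nonpos {t r : ℝ} (ht : 0 < t) (h : 1 ≤ r) : logKer t r ≤ 0 := by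
  refine div_nonpos_of_nonpos_of_nonneg (sub_nonpos.2 (exp_le_exp.2 ?_)) (by positivity)
  nlinarith [one_le_pow₀ h (n := 2)]

lemma integral_abs_logKer {r : ℝ} (hr : 0 < r) :
    ∫ t in Ioi (0 : ℝ), |logKer t r| = |log r| := by
  rcases le_total r 1 with h | h
  · rw [abs_of_nonpos (Real.log_nonpos hr.le h), ← integral_logKer hr]
    refine setIntegral_congr_fun measurableSet_Ioi fun t ht => ?_
    exact abs_of_nonneg (logKer_nonneg ht hr.le h)
  · rw [abs_of_nonneg (log_nonneg h), ← neg_neg (log r), ← integral_logKer hr, ← integral_neg]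
    refine setIntegral_congr_fun measurableSet_Ioi fun t ht => ?_
    exact abs_of_nonpos (logKer_nonpos ht h)

lemma HasFiniteLogEnergy.integrable_logKer {μ ν : Measure ℂ} [IsFiniteMeasure μ]
    [IsFiniteMeasure ν] (h : HasFiniteLogEnergy μ ν) :
    Integrable (uncurry fun (p : ℂ × ℂ) (t : ℝ) => logKer t ‖p.1 - p.2‖)
      ((μ.prod ν).prod (volume.restrict (Ioi 0))) := by
  have hne : ∀ᵐ p : ℂ × ℂ ∂(μ.prod ν), 0 < ‖p.1 - p.2‖ := by
    have : ∀ᵐ p : ℂ × ℂ ∂(μ.prod ν), p ∉ Set.diagonal ℂ := measure_eq_zero_iff_ae_notMem.1 h.1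
    filter_upwards [this] with p hp
    rw [norm_pos_iff, sub_ne_zero]
    exact hp
  have hm : Measurable (uncurry fun (p : ℂ × ℂ) (t : ℝ) => logKer t ‖p.1 - p.2‖) := by
    simp only [Function.uncurry_def, logKer]; fun_prop
  have hm' : AEStronglyMeasurable (uncurry fun (p : ℂ × ℂ) (t : ℝ) =>
      logKer t ‖p.1 - p.2‖) ((μ.prod ν).prod (volume.restrict (Ioi 0))) :=
    hm.aestronglyMeasurable
  refine (integrable_prod_iff hm').2 ⟨?_, ?_⟩
  · filter_upwards [hne] with p hp
    change Integrable (fun t => logKer t ‖p.1 - p.2‖) (volume.restrict (Ioi 0))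
    exact (integrableOn_logKer hp).integrable
  · refine h.2.norm.congr ?_
    filter_upwards [hne] with p hp
    simp only [uncurry, norm_eq_abs]
    rw [integral_abs_logKer hp, one_div, log_inv, abs_neg]

lemma HasFiniteLogEnergy.logEnergy_eq {μ ν : Measure ℂ} [IsFiniteMeasure μ]
    [IsFiniteMeasure ν] (h : HasFiniteLogEnergy μ ν) :
    logEnergy μ ν = ∫ t in Ioi (0 : ℝ), ∫ p : ℂ × ℂ, logKer t ‖p.1 - p.2‖ ∂(μ.prod ν) := by
  have hne : ∀ᵐ p : ℂ × ℂ ∂(μ.prod ν), 0 < ‖p.1 - p.2‖ := by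
    have : ∀ᵐ p : ℂ × ℂ ∂(μ.prod ν), p ∉ Set.diagonal ℂ := measure_eq_zero_iff_ae_notMem.1 h.1
    filter_upwards [this] with p hp
    rw [norm_pos_iff, sub_ne_zero]
    exact hp
  rw [← integral_integral_swap h.integrable_logKer]
  refine integral_congr_ae ?_
  filter_upwards [hne] with p hp
  rw [integral_logKer hp, one_div, log_inv]

lemma integral_logKer_prod {t : ℝ} (ht : 0 < t) (μ ν : Measure ℂ) [IsFiniteMeasure μ]
    [IsFiniteMeasure ν] :
    ∫ p : ℂ × ℂ, logKer t ‖p.1 - p.2‖ ∂(μ.prod ν) =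
      (gaussEnergy t μ ν - exp (-t) * (μ.real univ * ν.real univ)) / (2 * t) := by
  unfold logKer gaussEnergy
  rw [integral_div, integral_sub, integral_const, smul_eq_mul]
  · congr 2
    rw [mul_comm, measureReal_def, ← Set.univ_prod_univ, Measure.prod_prod, ENNReal.toReal_mul,
      ← measureReal_def, ← measureReal_def]
  · refine (integrable_const (1 : ℝ)).mono' (Continuous.aestronglyMeasurable (by fun_prop))
      (ae_of_all _ fun p => ?_)
    rw [norm_eq_abs, Real.abs_exp, Real.exp_le_one_iff]
    nlinarith [sq_nonneg ‖p.1 - p.2‖]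
  · exact integrable_const _

/-- The squared distance of two measures in the logarithmic energy. -/
def energyDist (μ ν : Measure ℂ) : ℝ := logEnergy μ μ + logEnergy ν ν - 2 * logEnergy μ ν

lemma energyDist_eq {μ ν : Measure ℂ} [IsFiniteMeasure μ] [IsFiniteMeasure ν]
    (h1 : HasFiniteLogEnergy μ μ) (h2 : HasFiniteLogEnergy ν ν) (h3 : HasFiniteLogEnergy μ ν)
    (hmass : μ univ = ν univ) :
    IntegrableOn (fun t => gaussDist t μ ν / (2 * t)) (Ioi 0) ∧
    energyDist μ ν = ∫ t in Ioi (0 : ℝ), gaussDist t μ ν / (2 * t) := by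
  have i1 := h1.integrable_logKer.integral_prod_right
  have i2 := h2.integrable_logKer.integral_prod_right
  have i3 := h3.integrable_logKer.integral_prod_right
  simp only [uncurry] at i1 i2 i3
  have hm : μ.real univ = ν.real univ := by simp [measureReal_def, hmass]
  have hcongr : ∀ t ∈ Ioi (0 : ℝ), (∫ p : ℂ × ℂ, logKer t ‖p.1 - p.2‖ ∂(μ.prod μ)) +
      (∫ p : ℂ × ℂ, logKer t ‖p.1 - p.2‖ ∂(ν.prod ν)) -
      2 * (∫ p : ℂ × ℂ, logKer t ‖p.1 - p.2‖ ∂(μ.prod ν)) = gaussDist t μ ν / (2 * t) := by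
    intro t ht
    rw [integral_logKer_prod ht, integral_logKer_prod ht, integral_logKer_prod ht, hm]
    unfold gaussDist; ring
  refine ⟨((i1.add i2).sub (i3.const_mul 2)).congr
    ((ae_restrict_iff' measurableSet_Ioi).2 (ae_of_all _ hcongr)), ?_⟩
  have e := integral_sub (i1.add i2) (i3.const_mul 2)
  simp only [Pi.add_apply] at e
  rw [integral_add i1 i2, integral_const_mul, ← h1.logEnergy_eq, ← h2.logEnergy_eq,
    ← h3.logEnergy_eq] at e
  rw [← setIntegral_congr_fun measurableSet_Ioi hcongr, e]; rfl

lemma energyDist_nonneg {μ ν : Measure ℂ} [IsFiniteMeasure μ] [IsFiniteMeasure ν]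
    (h1 : HasFiniteLogEnergy μ μ) (h2 : HasFiniteLogEnergy ν ν) (h3 : HasFiniteLogEnergy μ ν)
    (hmass : μ univ = ν univ) : 0 ≤ energyDist μ ν := by
  rw [(energyDist_eq h1 h2 h3 hmass).2]
  refine setIntegral_nonneg measurableSet_Ioi fun t ht => ?_
  have ht' : (0 : ℝ) < t := ht
  exact div_nonneg (gaussDist_nonneg ht' μ ν) (by positivity)

/-- The logarithmic energy is strictly positive definite on differences of measures of equal
mass. -/
lemma eq_of_energyDist_nonpos {μ ν : Measure ℂ} [IsFiniteMeasure μ] [IsFiniteMeasure ν]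
    (h1 : HasFiniteLogEnergy μ μ) (h2 : HasFiniteLogEnergy ν ν) (h3 : HasFiniteLogEnergy μ ν)
    (hmass : μ univ = ν univ) (h : energyDist μ ν ≤ 0) : μ = ν := by
  obtain ⟨hi, he⟩ := energyDist_eq h1 h2 h3 hmass
  have h0 : energyDist μ ν = 0 := le_antisymm h (energyDist_nonneg h1 h2 h3 hmass)
  have hnn : ∀ᵐ t ∂(volume.restrict (Ioi (0 : ℝ))), 0 ≤ gaussDist t μ ν / (2 * t) :=
    (ae_restrict_iff' measurableSet_Ioi).2 (ae_of_all _ fun t (ht : 0 < t) =>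
      div_nonneg (gaussDist_nonneg ht μ ν) (by positivity))
  rw [he, integral_eq_zero_iff_of_nonneg_ae hnn hi] at h0
  have hpos : ∀ᵐ t ∂(volume.restrict (Ioi (0 : ℝ))), 0 < t :=
    (ae_restrict_iff' measurableSet_Ioi).2 (ae_of_all _ fun t ht => ht)
  have : (ae (volume.restrict (Ioi (0 : ℝ)))).NeBot := by
    rw [ae_neBot, Ne, Measure.restrict_eq_zero]; simp
  obtain ⟨t, ht0, ht⟩ := (h0.and hpos).exists
  refine eq_of_gaussDist_eq_zero ht μ ν ?_
  simp only [Pi.zero_apply, div_eq_zero_iff] at ht0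
  rcases ht0 with h | h
  · exact h
  · linarith

/-! ### Measures of finite logarithmic energy -/

/-- The positive definite part `∫_1^∞ exp (-t r²) dt / (2 t)` of `- log r`. -/
def tailKer (r : ℝ) : ℝ≥0∞ := ∫⁻ t in Ioi (1 : ℝ), ofReal (exp (-t * r ^ 2) / (2 * t))

@[fun_prop]
lemma measurable_tailKer : Measurable tailKer := by
  unfold tailKer
  exact Measurable.lintegral_prod_right' (f := fun p : ℝ × ℝ =>
    ofReal (exp (-p.2 * p.1 ^ 2) / (2 * p.2))) (by fun_prop)

lemma ofReal_abs_log_le (r : ℝ) (hr : 0 ≤ r) :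
    ofReal |log r| ≤ 1 + tailKer r + ofReal (log (1 + r)) := by
  rcases hr.eq_or_lt with rfl | hr
  · simp
  rcases le_total r 1 with h | h
  · refine le_add_right ?_
    rw [abs_of_nonpos (Real.log_nonpos hr.le h), ← integral_logKer hr,
      ofReal_integral_eq_lintegral_ofReal (integrableOn_logKer hr)
        ((ae_restrict_iff' measurableSet_Ioi).2 (ae_of_all _ fun t ht => logKer_nonneg ht hr.le h)),
      ← Set.Ioc_union_Ioi_eq_Ioi (zero_le_one' ℝ),
      lintegral_union measurableSet_Ioi (Set.Ioc_disjoint_Ioi le_rfl)]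
    refine add_le_add ?_ ?_
    · calc _ ≤ ∫⁻ t in Ioc (0 : ℝ) 1, 1 := by
            refine setLIntegral_mono measurable_const fun t ht => ?_
            rw [← ofReal_one]
            refine ofReal_le_ofReal ((le_abs_self _).trans ((abs_logKer_le ht.1).trans ?_))
            have h1 : |r ^ 2 - 1| / 2 ≤ 1 := by rw [abs_of_nonpos (by nlinarith)]; nlinarith
            have h2 : exp (-(min (r ^ 2) 1) * t) ≤ 1 := by
              rw [Real.exp_le_one_iff]
              have : 0 ≤ min (r ^ 2) 1 * t := mul_nonneg (by positivity) ht.1.le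
              linarith
            exact mul_le_one₀ h1 (exp_pos _).le h2
        _ = 1 := by simp
    · refine setLIntegral_mono (by fun_prop) fun t ht => ofReal_le_ofReal ?_
      have : (0 : ℝ) < t := lt_trans one_pos ht
      unfold logKer; gcongr
      linarith [exp_pos (-t)]
  · refine le_add_left ?_
    rw [abs_of_nonneg (log_nonneg h)]
    exact ofReal_le_ofReal (log_le_log hr (by linarith))

lemma tailKer_le {r : ℝ} (hr : 0 < r) : tailKer r ≤ ofReal |log r| + 1 := by
  rw [← integral_abs_logKer hr, ofReal_integral_eq_lintegral_ofReal (integrableOn_logKer hr).abs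
        (ae_of_all _ fun t => abs_nonneg _)]
  calc tailKer r ≤ ∫⁻ t in Ioi (1 : ℝ),
        (ofReal |logKer t r| + ofReal (exp (-t))) := by
        refine setLIntegral_mono ?_ fun t ht => ?_
        · have : Measurable fun t => logKer t r :=
            measurable_logKer.comp (measurable_id.prodMk measurable_const)
          fun_prop
        · have : (1 : ℝ) < t := ht
          rw [← ofReal_add (abs_nonneg _) (exp_pos _).le]
          refine ofReal_le_ofReal ?_
          have h1 : exp (-t * r ^ 2) / (2 * t) = logKer t r + exp (-t) / (2 * t) := by
            unfold logKer; ring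
          rw [h1]
          refine add_le_add (le_abs_self _) (div_le_self (exp_pos _).le (by linarith))
    _ = (∫⁻ t in Ioi (1 : ℝ), ofReal |logKer t r|) +
        ∫⁻ t in Ioi (1 : ℝ), ofReal (exp (-t)) :=
        lintegral_add_right _ (by fun_prop)
    _ ≤ _ := by
        refine add_le_add (lintegral_mono_set (Set.Ioi_subset_Ioi zero_le_one)) ?_
        rw [← ofReal_integral_eq_lintegral_ofReal (integrableOn_exp_neg_Ioi 1)
          (ae_of_all _ fun t => (exp_pos _).le), integral_exp_neg_Ioi]
        rw [← ofReal_one]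
        exact ofReal_le_ofReal (Real.exp_le_one_iff.2 (by norm_num))

lemma tailKer_zero : tailKer 0 = ⊤ := by
  by_contra h
  have h1 : IntegrableOn (fun t : ℝ => 1 / (2 * t)) (Ioi 1) := by
    refine ⟨Measurable.aestronglyMeasurable (by fun_prop), ?_⟩
    rw [hasFiniteIntegral_iff_ofReal]
    · unfold tailKer at h
      simpa [lt_top_iff_ne_top] using h
    · exact (ae_restrict_iff' measurableSet_Ioi).2 (ae_of_all _ fun t (ht : 1 < t) => by
        have : 0 < t := by linarith
        simp only [Pi.zero_apply]; positivity)
  have h2 : IntegrableOn (fun t : ℝ => 2 * (1 / (2 * t))) (Ioi 1) := h1.const_mul 2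
  refine not_integrableOn_Ioi_inv (a := 1) (h2.congr_fun (fun t _ => ?_) measurableSet_Ioi)
  simp only
  rw [one_div, mul_inv]; ring

/-- The mutual energy for the kernel `tailKer`. -/
def tailEnergy (μ ν : Measure ℂ) : ℝ≥0∞ := ∫⁻ p : ℂ × ℂ, tailKer ‖p.1 - p.2‖ ∂(μ.prod ν)

lemma tailEnergy_eq (μ ν : Measure ℂ) [IsFiniteMeasure μ] [IsFiniteMeasure ν] :
    tailEnergy μ ν = ∫⁻ t in Ioi (1 : ℝ), ofReal (gaussEnergy t μ ν / (2 * t)) := by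
  unfold tailEnergy tailKer
  rw [lintegral_lintegral_swap (by fun_prop)]
  refine setLIntegral_congr_fun measurableSet_Ioi fun t (ht : 1 < t) => ?_
  have : 0 < t := by linarith
  unfold gaussEnergy
  rw [← integral_div, ofReal_integral_eq_lintegral_ofReal]
  · refine Integrable.div_const ?_ _
    refine (integrable_const (1 : ℝ)).mono' (Continuous.aestronglyMeasurable (by fun_prop))
      (ae_of_all _ fun p => ?_)
    rw [norm_eq_abs, Real.abs_exp, Real.exp_le_one_iff]
    nlinarith [sq_nonneg ‖p.1 - p.2‖]
  · exact ae_of_all _ fun p => by simp only [Pi.zero_apply]; positivity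

/-- By positive definiteness of the Gaussian kernel, mutual energies are controlled by
self-energies. -/
lemma two_mul_tailEnergy_le (μ ν : Measure ℂ) [IsFiniteMeasure μ] [IsFiniteMeasure ν] :
    2 * tailEnergy μ ν ≤ tailEnergy μ μ + tailEnergy ν ν := by
  have hm : ∀ μ ν : Measure ℂ, [IsFiniteMeasure μ] → [IsFiniteMeasure ν] →
      Measurable fun t => ofReal (gaussEnergy t μ ν / (2 * t)) := by
    intro μ ν _ _
    have : Measurable fun t => gaussEnergy t μ ν := by
      unfold gaussEnergy
      refine StronglyMeasurable.measurable ?_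
      refine StronglyMeasurable.integral_prod_right' (f := fun p : ℝ × ℂ × ℂ =>
        exp (-p.1 * ‖p.2.1 - p.2.2‖ ^ 2)) ?_
      exact Measurable.stronglyMeasurable (by fun_prop)
    fun_prop
  have hnn : ∀ t (μ ν : Measure ℂ), 0 ≤ gaussEnergy t μ ν := fun t μ ν =>
    integral_nonneg fun p => (exp_pos _).le
  rw [tailEnergy_eq, tailEnergy_eq, tailEnergy_eq, ← lintegral_const_mul _ (hm μ ν),
    ← lintegral_add_left (hm μ μ)]
  refine setLIntegral_mono ((hm μ μ).add (hm ν ν)) fun t (ht : 1 < t) => ?_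
  have ht' : 0 < t := by linarith
  have h := gaussDist_nonneg ht' μ ν
  unfold gaussDist at h
  rw [← ofReal_add (div_nonneg (hnn _ _ _) (by positivity))
    (div_nonneg (hnn _ _ _) (by positivity)), show (2 : ℝ≥0∞) = ofReal 2 by simp,
    ← ENNReal.ofReal_mul two_pos.le]
  refine ofReal_le_ofReal ?_
  rw [← add_div, mul_div_assoc']; gcongr; linarith

/-- Finite measures whose logarithmic energy and logarithmic moment converge absolutely. -/
structure IsLogFinite (μ : Measure ℂ) : Prop where
  finite : IsFiniteMeasure μ
  tail : tailEnergy μ μ < ⊤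
  growth : ∫⁻ x, ofReal (log (1 + ‖x‖)) ∂μ < ⊤

lemma IsLogFinite.tailEnergy_lt_top {μ ν : Measure ℂ} (hμ : IsLogFinite μ) (hν : IsLogFinite ν) :
    tailEnergy μ ν < ⊤ := by
  have := hμ.finite
  have := hν.finite
  refine lt_of_le_of_lt ?_ ((two_mul_tailEnergy_le μ ν).trans_lt (add_lt_top.2 ⟨hμ.tail, hν.tail⟩))
  rw [two_mul]
  exact le_self_add

lemma log_one_add_norm_sub_le (x y : ℂ) :
    log (1 + ‖x - y‖) ≤ log (1 + ‖x‖) + log (1 + ‖y‖) := by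
  rw [← log_mul (by positivity) (by positivity)]
  refine log_le_log (by positivity) ?_
  nlinarith [norm_sub_le x y, mul_nonneg (norm_nonneg x) (norm_nonneg y)]

lemma IsLogFinite.hasFiniteLogEnergy {μ ν : Measure ℂ} (hμ : IsLogFinite μ) (hν : IsLogFinite ν) :
    HasFiniteLogEnergy μ ν := by
  have := hμ.finite
  have := hν.finite
  have ht := hμ.tailEnergy_lt_top hν
  constructor
  · have : ∀ᵐ p : ℂ × ℂ ∂(μ.prod ν), tailKer ‖p.1 - p.2‖ < ⊤ := ae_lt_top (by fun_prop) ht.ne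
    rw [measure_eq_zero_iff_ae_notMem]
    filter_upwards [this] with p hp hd
    rw [Set.mem_diagonal_iff] at hd
    simp [hd, tailKer_zero] at hp
  · refine ⟨Measurable.aestronglyMeasurable (by fun_prop), ?_⟩
    rw [hasFiniteIntegral_iff_norm]
    calc _ ≤ ∫⁻ p : ℂ × ℂ, ((1 + tailKer ‖p.1 - p.2‖) + (ofReal (log (1 + ‖p.1‖)) * 1 +
          1 * ofReal (log (1 + ‖p.2‖)))) ∂(μ.prod ν) := by
          refine lintegral_mono fun p => ?_
          rw [one_div, log_inv, norm_neg, norm_eq_abs, mul_one, one_mul]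
          refine (ofReal_abs_log_le _ (norm_nonneg _)).trans (add_le_add le_rfl ?_)
          rw [← ofReal_add (log_nonneg (by linarith [norm_nonneg p.1]))
            (log_nonneg (by linarith [norm_nonneg p.2]))]
          exact ofReal_le_ofReal (log_one_add_norm_sub_le _ _)
      _ < ⊤ := by
          rw [lintegral_add_left (by fun_prop), lintegral_add_left (by fun_prop),
            lintegral_add_left (by fun_prop), 
            lintegral_prod_mul (f := fun x : ℂ => ofReal (log (1 + ‖x‖)))
              (g := fun _ => 1) (by fun_prop) (by fun_prop),
            lintegral_prod_mul (f := fun _ => 1)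
              (g := fun x : ℂ => ofReal (log (1 + ‖x‖))) (by fun_prop) (by fun_prop)]
          simp only [lintegral_const, one_mul]
          refine add_lt_top.2 ⟨add_lt_top.2 ⟨measure_lt_top _ _, ht⟩,
            add_lt_top.2 ⟨mul_lt_top hμ.growth (measure_lt_top _ _),
              mul_lt_top (measure_lt_top _ _) hν.growth⟩⟩

lemma HasFiniteLogEnergy.isLogFinite {μ : Measure ℂ} [IsFiniteMeasure μ]
    (h : HasFiniteLogEnergy μ μ) : IsLogFinite μ := by
  have hint : ∫⁻ p : ℂ × ℂ, ofReal |log ‖p.1 - p.2‖| ∂(μ.prod μ) < ⊤ := by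
    have := h.2.2
    rw [hasFiniteIntegral_iff_norm] at this
    simpa [log_inv] using this
  have hne : ∀ᵐ p : ℂ × ℂ ∂(μ.prod μ), 0 < ‖p.1 - p.2‖ := by
    have : ∀ᵐ p : ℂ × ℂ ∂(μ.prod μ), p ∉ Set.diagonal ℂ := measure_eq_zero_iff_ae_notMem.1 h.1
    filter_upwards [this] with p hp
    rw [norm_pos_iff, sub_ne_zero]
    exact hp
  refine ⟨inferInstance, ?_, ?_⟩
  · calc tailEnergy μ μ ≤ ∫⁻ p : ℂ × ℂ, (ofReal |log ‖p.1 - p.2‖| + 1) ∂(μ.prod μ) := by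
          refine lintegral_mono_ae ?_
          filter_upwards [hne] with p hp using tailKer_le hp
      _ < ⊤ := by
          rw [lintegral_add_right _ measurable_const, lintegral_const, one_mul]
          exact add_lt_top.2 ⟨hint, measure_lt_top _ _⟩
  · rcases eq_or_ne μ 0 with rfl | h0
    · simp
    have : NeBot (ae μ) := ae_neBot.2 h0
    rw [lintegral_prod_symm' _ (by fun_prop)] at hint
    have := ae_lt_top (Measurable.lintegral_prod_left' (f := fun p : ℂ × ℂ =>
      ofReal |log ‖p.1 - p.2‖|) (by fun_prop)) hint.ne
    obtain ⟨y, hy⟩ := this.exists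
    calc _ ≤ ∫⁻ x, (ofReal (log (1 + ‖y‖) + log 2) +
          ofReal |log ‖x - y‖|) ∂μ := by
          refine lintegral_mono fun x => ?_
          have hy0 : 0 ≤ log (1 + ‖y‖) := log_nonneg (by linarith [norm_nonneg y])
          rw [← ofReal_add (add_nonneg hy0 (log_nonneg one_le_two)) (abs_nonneg _)]
          refine ofReal_le_ofReal ?_
          have : log (1 + ‖x‖) ≤ log (1 + ‖x - y‖) + log (1 + ‖y‖) := by
            have := log_one_add_norm_sub_le (x - y) (-y)
            rwa [sub_neg_eq_add, sub_add_cancel, norm_neg] at this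
          have : log (1 + ‖x - y‖) ≤ log 2 + |log ‖x - y‖| := by
            rcases le_total ‖x - y‖ 1 with h | h
            · have : log (1 + ‖x - y‖) ≤ log 2 := log_le_log (by positivity) (by linarith)
              linarith [abs_nonneg (log ‖x - y‖)]
            · rw [abs_of_nonneg (log_nonneg h), ← log_mul two_ne_zero (by positivity)]
              exact log_le_log (by positivity) (by linarith)
          linarith
      _ < ⊤ := by
          rw [lintegral_add_left measurable_const, lintegral_const]
          exact add_lt_top.2 ⟨mul_lt_top ofReal_lt_top (measure_lt_top _ _), hy⟩

lemma IsLogFinite.add {μ ν : Measure ℂ} (hμ : IsLogFinite μ) (hν : IsLogFinite ν) :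
    IsLogFinite (μ + ν) := by
  have := hμ.finite
  have := hν.finite
  refine ⟨inferInstance, ?_, ?_⟩
  · unfold tailEnergy
    rw [Measure.prod_add, Measure.add_prod, Measure.add_prod, lintegral_add_measure,
      lintegral_add_measure, lintegral_add_measure]
    exact add_lt_top.2 ⟨add_lt_top.2 ⟨hμ.tail, hν.tailEnergy_lt_top hμ⟩,
      add_lt_top.2 ⟨hμ.tailEnergy_lt_top hν, hν.tail⟩⟩
  · rw [lintegral_add_measure]
    exact add_lt_top.2 ⟨hμ.growth, hν.growth⟩

lemma IsLogFinite.smul {μ : Measure ℂ} (hμ : IsLogFinite μ) {c : ℝ≥0∞} (hc : c ≠ ⊤) :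
    IsLogFinite (c • μ) := by
  have := hμ.finite
  have hf : IsFiniteMeasure (c • μ) := μ.smul_finite hc
  refine ⟨hf, ?_, ?_⟩
  · unfold tailEnergy
    rw [Measure.prod_smul_right, Measure.prod_smul_left, lintegral_smul_measure,
      lintegral_smul_measure]
    exact mul_lt_top hc.lt_top (mul_lt_top hc.lt_top hμ.tail)
  · rw [lintegral_smul_measure]
    exact mul_lt_top hc.lt_top hμ.growth

lemma logEnergy_comm (μ ν : Measure ℂ) [SFinite μ] [SFinite ν] :
    logEnergy μ ν = logEnergy ν μ := by
  unfold logEnergy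
  rw [← integral_prod_swap]
  simp [norm_sub_rev]

lemma logEnergy_add_left {μ ν κ : Measure ℂ} (hμ : IsLogFinite μ) (hν : IsLogFinite ν)
    (hκ : IsLogFinite κ) : logEnergy (μ + ν) κ = logEnergy μ κ + logEnergy ν κ := by
  have := hμ.finite
  have := hν.finite
  have := hκ.finite
  unfold logEnergy
  rw [Measure.add_prod, integral_add_measure (hμ.hasFiniteLogEnergy hκ).2
    (hν.hasFiniteLogEnergy hκ).2]

lemma logEnergy_add_right {μ ν κ : Measure ℂ} (hμ : IsLogFinite μ) (hν : IsLogFinite ν)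
    (hκ : IsLogFinite κ) : logEnergy κ (μ + ν) = logEnergy κ μ + logEnergy κ ν := by
  have := hμ.finite
  have := hν.finite
  have := hκ.finite
  rw [logEnergy_comm, logEnergy_add_left hμ hν hκ, logEnergy_comm μ, logEnergy_comm ν]

lemma logEnergy_smul_left (μ κ : Measure ℂ) [SFinite μ] [SFinite κ] (c : ℝ≥0∞) :
    logEnergy (c • μ) κ = c.toReal * logEnergy μ κ := by
  unfold logEnergy
  rw [Measure.prod_smul_left, integral_smul_measure, smul_eq_mul]

lemma logEnergy_smul_right (μ κ : Measure ℂ) [SFinite μ] [SFinite κ] (c : ℝ≥0∞) :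
    logEnergy κ (c • μ) = c.toReal * logEnergy κ μ := by
  unfold logEnergy
  rw [Measure.prod_smul_right, integral_smul_measure, smul_eq_mul]

lemma tailEnergy_map_le (μ : Measure ℂ) [IsFiniteMeasure μ] (f : ℂ → ℂ) (hf : Measurable f) :
    tailEnergy (μ.map f) (μ.map f) = ∫⁻ p : ℂ × ℂ, tailKer ‖f p.1 - f p.2‖ ∂(μ.prod μ) := by
  unfold tailEnergy
  rw [Measure.map_prod_map _ _ hf hf, lintegral_map (by fun_prop) (by fun_prop)]; rfl

lemma IsLogFinite.map_rotation {μ : Measure ℂ} (hμ : IsLogFinite μ) {c : ℂ} (hc : ‖c‖ = 1) :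
    IsLogFinite (μ.map (fun z => c * z)) := by
  have := hμ.finite
  have hm : Measurable (fun z : ℂ => c * z) := by fun_prop
  refine ⟨Measure.isFiniteMeasure_map _ _, ?_, ?_⟩
  · rw [tailEnergy_map_le _ _ hm]
    simp_rw [← mul_sub, norm_mul, hc, one_mul]
    exact hμ.tail
  · rw [lintegral_map (by fun_prop) hm]
    simp_rw [norm_mul, hc, one_mul]
    exact hμ.growth

lemma logEnergy_map_rotation (μ ν : Measure ℂ) [IsFiniteMeasure μ] [IsFiniteMeasure ν] {c : ℂ}
    (hc : ‖c‖ = 1) :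
    logEnergy (μ.map (fun z => c * z)) (ν.map (fun z => c * z)) = logEnergy μ ν := by
  have hm : Measurable (fun z : ℂ => c * z) := by fun_prop
  unfold logEnergy
  rw [Measure.map_prod_map _ _ hm hm, integral_map (by fun_prop)
    (Measurable.aestronglyMeasurable (by fun_prop))]
  simp [Prod.map, ← mul_sub, hc]

/-! ### Averages over the unit circle -/

/-- The uniform probability measure on the unit circle. -/
def circleUnif : Measure ℂ :=
  (ofReal (2 * π)⁻¹ • volume.restrict (Ioc 0 (2 * π))).map (circleMap 0 1)

instance : IsProbabilityMeasure circleUnif := by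
  have hpi : 0 < 2 * π := by positivity
  have : IsProbabilityMeasure
      (ofReal (2 * π)⁻¹ • volume.restrict (Ioc 0 (2 * π))) := by
    constructor
    rw [Measure.smul_apply, Measure.restrict_apply_univ, Real.volume_Ioc, smul_eq_mul, sub_zero,
      ← ENNReal.ofReal_mul (by positivity), inv_mul_cancel₀ hpi.ne', ofReal_one]
  exact Measure.isProbabilityMeasure_map (continuous_circleMap 0 1).aemeasurable

lemma ae_circleUnif_of_countable {p : ℂ → Prop} {s : Set ℂ} (hs : s.Countable)
    (h : ∀ ζ, ‖ζ‖ = 1 → ζ ∉ s → p ζ) : ∀ᵐ ζ ∂circleUnif, p ζ := by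
  have h1 : ∀ᵐ ζ ∂circleUnif, ζ ∉ s := by
    rw [← measure_eq_zero_iff_ae_notMem]
    refine (measure_biUnion_null_iff (s := fun i : ℂ => {i}) hs).2 (fun a _ => ?_) |> fun h => by
      simpa using h
    unfold circleUnif
    rw [Measure.map_apply (continuous_circleMap 0 1).measurable (measurableSet_singleton a),
      Measure.smul_apply, Measure.restrict_apply
        ((continuous_circleMap 0 1).measurable (measurableSet_singleton a))]
    have hsub : (circleMap 0 1 ⁻¹' {a} ∩ Ioc 0 (2 * π)).Subsingleton := by
      rintro x ⟨hx, hx'⟩ y ⟨hy, hy'⟩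
      have := injOn_circleMap_of_abs_sub_le (c := 0) (R := 1) one_ne_zero
        (a := 0) (b := 2 * π) (by rw [zero_sub, abs_neg, abs_of_pos Real.two_pi_pos])
      rw [Set.uIoc_of_le Real.two_pi_pos.le] at this
      exact this hx' hy' (hx.trans hy.symm)
    rw [hsub.measure_zero, smul_zero]
  have h2 : ∀ᵐ ζ ∂circleUnif, ‖ζ‖ = 1 := by
    unfold circleUnif
    rw [ae_map_iff (continuous_circleMap 0 1).aemeasurable
      (measurableSet_eq_fun measurable_norm measurable_const)]
    exact ae_of_all _ fun θ => by simp
  filter_upwards [h1, h2] with ζ h3 h4 using h ζ h4 h3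

lemma integral_circleUnif {E : Type*} [NormedAddCommGroup E] [NormedSpace ℝ E] {f : ℂ → E}
    (hf : AEStronglyMeasurable f circleUnif) :
    ∫ ζ, f ζ ∂circleUnif = Real.circleAverage f 0 1 := by
  unfold circleUnif at *
  rw [integral_map (continuous_circleMap 0 1).aemeasurable hf, integral_smul_measure,
    ENNReal.toReal_ofReal (by positivity), Real.circleAverage,
    intervalIntegral.integral_of_le (by positivity)]

lemma integrable_circleUnif_iff {E : Type*} [NormedAddCommGroup E] {f : ℂ → E}
    (hf : AEStronglyMeasurable f circleUnif) :
    Integrable f circleUnif ↔ CircleIntegrable f 0 1 := by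
  unfold circleUnif at *
  rw [integrable_map_measure hf (continuous_circleMap 0 1).aemeasurable, CircleIntegrable,
    intervalIntegrable_iff, Set.uIoc_of_le (by positivity), IntegrableOn,
    integrable_smul_measure (by simp; positivity) (by simp)]
  rfl

lemma integrable_log_norm_sub_circleUnif (a : ℂ) :
    Integrable (fun ζ => log ‖ζ - a‖) circleUnif := by
  rw [integrable_circleUnif_iff (Measurable.aestronglyMeasurable (by fun_prop))]
  exact circleIntegrable_log_norm_sub_const 1

lemma integral_log_norm_sub_circleUnif {a : ℂ} (ha : ‖a‖ ≤ 1) :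
    ∫ ζ, log ‖ζ - a‖ ∂circleUnif = 0 := by
  rw [integral_circleUnif (Measurable.aestronglyMeasurable (by fun_prop)),
    circleAverage_log_norm_sub_const_eq_posLog, Real.posLog_eq_zero_iff]
  simpa using ha

/-- `|ζ - 1| / |ζ + 1|`; for `ζ` uniform on the unit circle this is the absolute value of a
standard Cauchy variable. -/
def cauchyRatio (ζ : ℂ) : ℝ := ‖ζ - 1‖ / ‖ζ + 1‖

lemma cauchyRatio_nonneg (ζ : ℂ) : 0 ≤ cauchyRatio ζ := by unfold cauchyRatio; positivity

@[fun_prop]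
lemma measurable_cauchyRatio : Measurable cauchyRatio := by unfold cauchyRatio; fun_prop

lemma cauchyRatio_sq {ζ : ℂ} (hζ : ‖ζ‖ = 1) :
    ((cauchyRatio ζ ^ 2 : ℝ) : ℂ) = -((ζ - 1) / (ζ + 1)) ^ 2 := by
  have : ζ ≠ 0 := norm_pos_iff.1 (by rw [hζ]; exact one_pos)
  have hconj : conj ζ = ζ⁻¹ := by rw [inv_def, Complex.normSq_eq_norm_sq, hζ]; simp
  have h : conj ((ζ - 1) / (ζ + 1)) = -((ζ - 1) / (ζ + 1)) := by
    rw [map_div₀, map_sub, map_add, map_one, hconj]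
    rcases eq_or_ne (ζ + 1) 0 with h1 | h1
    · have : ζ = -1 := by linear_combination h1
      subst this; norm_num
    · have h2 : ζ⁻¹ + 1 ≠ 0 := by
        intro h2; apply h1; field_simp at h2; linear_combination h2
      rw [div_eq_iff h2, neg_mul, div_mul_eq_mul_div, eq_comm, neg_eq_iff_eq_neg, div_eq_iff h1]
      field_simp; ring
  have h2 := conj_mul' ((ζ - 1) / (ζ + 1))
  rw [h, norm_div] at h2
  unfold cauchyRatio
  push_cast at h2 ⊢
  rw [← h2]; ring

/-- The logarithmic potentials of the Cauchy distribution: up to constants, the integrand is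
`log ‖ζ - a‖ + log ‖ζ - conj a‖ - 2 log ‖ζ + 1‖` for a point `a` of the closed unit disc. -/
lemma integral_log_norm_cauchyRatio {α β : ℂ} (h0 : α + β ≠ 0) (h : ‖α - β‖ ≤ ‖α + β‖) :
    ∫ ζ, log ‖α ^ 2 + β ^ 2 * ((cauchyRatio ζ ^ 2 : ℝ) : ℂ)‖ ∂circleUnif = 2 * log ‖α + β‖ := by
  set a : ℂ := -((α - β) / (α + β)) with ha
  have ha1 : ‖a‖ ≤ 1 := by rw [ha, norm_neg, norm_div]; exact div_le_one_of_le₀ h (norm_nonneg _)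
  have i1 := integrable_log_norm_sub_circleUnif a
  have i2 := integrable_log_norm_sub_circleUnif (conj a)
  have i3 := integrable_log_norm_sub_circleUnif (-1)
  have i0 : Integrable (fun _ : ℂ => 2 * log ‖α + β‖) circleUnif := integrable_const _
  have i01 : Integrable (fun ζ => 2 * log ‖α + β‖ + log ‖ζ - a‖) circleUnif := i0.add i1
  have i012 : Integrable (fun ζ => 2 * log ‖α + β‖ + log ‖ζ - a‖ + log ‖ζ - conj a‖)
    circleUnif := i01.add i2
  have hae : ∀ᵐ ζ ∂circleUnif, log ‖α ^ 2 + β ^ 2 * ((cauchyRatio ζ ^ 2 : ℝ) : ℂ)‖ =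
      2 * log ‖α + β‖ + log ‖ζ - a‖ + log ‖ζ - conj a‖ - 2 * log ‖ζ - (-1)‖ := by
    refine ae_circleUnif_of_countable (s := {a, conj a, -1}) (toFinite _).countable ?_
    intro ζ hζ hs
    simp only [Set.mem_insert_iff, Set.mem_singleton_iff, not_or, ← sub_ne_zero (a := ζ)] at hs
    obtain ⟨h1, h2, h3⟩ := hs
    have hn : ‖1 - a * ζ‖ = ‖ζ - conj a‖ := by
      have := conj_mul' ζ
      rw [hζ] at this
      rw [← RCLike.norm_conj (ζ - _), map_sub, conj_conj, ← mul_one ‖_ - a‖, ← hζ, ← norm_mul]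
      congr 1
      push_cast at this
      linear_combination -this
    rw [cauchyRatio_sq hζ, show α ^ 2 + β ^ 2 * -((ζ - 1) / (ζ + 1)) ^ 2 =
      (α + β) ^ 2 * (ζ - a) * (1 - a * ζ) / (ζ - (-1)) ^ 2 by
        rw [ha]; rw [sub_neg_eq_add ζ 1] at h3 ⊢; field_simp; ring,
      norm_div, norm_mul, norm_mul, hn,
      norm_pow, norm_pow, log_div, log_mul, log_mul, log_pow, log_pow]
    any_goals simp_all
  rw [integral_congr_ae hae, integral_sub i012 (i3.const_mul 2), integral_add i01 i2,
    integral_add i0 i1, integral_const_mul 2 fun ζ => log ‖ζ - (-1)‖,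
    integral_log_norm_sub_circleUnif ha1, integral_log_norm_sub_circleUnif (by simpa),
    integral_log_norm_sub_circleUnif (by simp)]
  simp

lemma integral_log_cauchyRatio {b y : ℝ} (hy : 0 < y) :
    ∫ ζ, log |b ^ 2 - y ^ 2 * cauchyRatio ζ ^ 2| ∂circleUnif = log (b ^ 2 + y ^ 2) := by
  have n (c : ℝ) (hc : c ^ 2 = y ^ 2) : ‖(b + c * I : ℂ)‖ ^ 2 = b ^ 2 + y ^ 2 := by
    rw [sq_norm, Complex.normSq_add_mul_I, hc]
  have n1 := n y rfl
  have n2 := n (-y) (neg_sq y)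
  have := integral_log_norm_cauchyRatio (α := b) (β := y * I)
    (fun h => by rw [h, norm_zero] at n1; nlinarith) (by
      rw [← sq_le_sq₀ (norm_nonneg _) (norm_nonneg _), n1, ← n2]; push_cast; rw [neg_mul]; rfl)
  rw [← n1, log_pow, Nat.cast_ofNat, ← this]
  congr! 3 with ζ
  rw [← norm_eq_abs, ← norm_real, mul_pow, I_sq]; push_cast; congr 1; ring

lemma integral_log_cauchyRatio' {y w : ℝ} (hy : 0 < y) (hw : 0 < w) :
    ∫ ζ, log (y ^ 2 + w ^ 2 * cauchyRatio ζ ^ 2) ∂circleUnif = 2 * log (y + w) := by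
  have := integral_log_norm_cauchyRatio (α := y) (β := w) (by norm_cast; positivity) (by
    norm_cast; rw [norm_eq_abs, norm_eq_abs, ← sq_le_sq]; nlinarith)
  norm_cast at this
  simpa only [norm_eq_abs, log_abs] using this

lemma integral_inv_cauchyRatio {v : ℂ} {y : ℝ} (hv : 0 < v.re) (hy : 0 < y) :
    ∫ ζ, 1 / (v ^ 2 + y ^ 2 * ((cauchyRatio ζ ^ 2 : ℝ) : ℂ)) ∂circleUnif =
      1 / (v * (v + y)) := by
  have hlt : ‖v - y‖ < ‖v + y‖ := by
    rw [← sq_lt_sq₀ (norm_nonneg _) (norm_nonneg _), sq_norm, sq_norm, normSq_apply, normSq_apply]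
    simp
    nlinarith [mul_pos hv hy]
  have : v ≠ 0 := fun h => by simp [h] at hv
  have : v + y ≠ 0 := norm_pos_iff.1 (lt_of_le_of_lt (norm_nonneg _) hlt)
  set G : ℂ → ℂ := fun ζ => (ζ + 1) / ((v - y) * ζ + (v + y)) with hG
  have hden : ∀ ζ : ℂ, ‖ζ‖ ≤ 1 → (v - y) * ζ + (v + y) ≠ 0 := by
    intro ζ hζ h
    have : ‖v + y‖ ≤ ‖v - y‖ := by
      have h1 : v + y = -((v - y) * ζ) := by linear_combination h
      rw [h1, norm_neg, norm_mul]
      exact mul_le_of_le_one_right (norm_nonneg _) hζ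
    linarith
  have hGd : DiffContOnCl ℂ G (Metric.ball 0 |1|) := by
    refine DifferentiableOn.diffContOnCl fun ζ hζ => ?_
    have hζ' : ‖ζ‖ ≤ 1 := by
      have := Metric.closure_ball_subset_closedBall hζ
      simpa using this
    have := hden ζ hζ'
    exact DifferentiableAt.differentiableWithinAt (by fun_prop (disch := assumption))
  have hGa : Real.circleAverage G 0 1 = 1 / (v + y) := by rw [hGd.circleAverage]; simp [hG]
  have hGc : ContinuousOn G (Metric.sphere 0 |1|) := by
    refine hGd.continuousOn.mono ?_
    rw [closure_ball _ (by simp)]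
    exact Metric.sphere_subset_closedBall
  have hGi : CircleIntegrable G 0 1 := by
    refine ContinuousOn.circleIntegrable zero_le_one ?_
    simpa using hGc
  have hGinv : CircleIntegrable (fun ζ => G ζ⁻¹) 0 1 := by
    refine ContinuousOn.circleIntegrable zero_le_one ?_
    refine hGc.comp (ContinuousOn.inv₀ continuousOn_id ?_) ?_
    · rintro z hz rfl; simp at hz
    · intro z hz; simp at hz ⊢; simp [hz]
  have hGa' := Real.circleAverage_zero_one_congr_inv.trans hGa
  have hae : ∀ᵐ ζ ∂circleUnif, 1 / (v ^ 2 + y ^ 2 * ((cauchyRatio ζ ^ 2 : ℝ) : ℂ)) =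
      (1 / (2 * v)) • (G ζ + G ζ⁻¹) := by
    refine ae_circleUnif_of_countable (s := {-1}) (toFinite _).countable fun ζ hζ' h1 => ?_
    have : ζ ≠ 0 := norm_pos_iff.1 (by rw [hζ']; exact one_pos)
    rw [Set.mem_singleton_iff] at h1
    have : ζ + 1 ≠ 0 := fun h => h1 (by linear_combination h)
    have := hden ζ hζ'.le
    have d2 := hden ζ⁻¹ (by rw [norm_inv, hζ', inv_one])
    have d2' : (v - y) + (v + y) * ζ ≠ 0 := by
      intro h; apply d2; field_simp; linear_combination h
    simp only [hG, smul_eq_mul]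
    rw [cauchyRatio_sq hζ']
    have e1 : v ^ 2 + y ^ 2 * -((ζ - 1) / (ζ + 1)) ^ 2 =
        ((v - y) * ζ + (v + y)) * ((v - y) + (v + y) * ζ) / (ζ + 1) ^ 2 := by
      field_simp; ring
    have e2 : (ζ⁻¹ + 1) / ((v - y) * ζ⁻¹ + (v + y)) = (ζ + 1) / ((v - y) + (v + y) * ζ) := by
      rw [div_eq_div_iff d2 d2']; field_simp; ring
    rw [e1, e2]
    have hPQ : ((v - y) * ζ + (v + y)) + ((v - y) + (v + y) * ζ) = 2 * v * (ζ + 1) := by ring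
    generalize (v - y) * ζ + (v + y) = P at *
    generalize (v - y) + (v + y) * ζ = Q at *
    field_simp
    linear_combination -hPQ
  rw [integral_congr_ae hae, integral_circleUnif (by simp only [hG]; fun_prop),
    Real.circleAverage_fun_smul, Real.circleAverage_fun_add hGi hGinv, hGa, hGa']
  rw [smul_eq_mul]; field_simp; ring

/-! ### The stars and rotation-invariant measures -/

lemma omega_eq : omega = -1 / 2 + (√3 / 2 : ℝ) * I := by
  have h : (2 * π * I / 3 : ℂ) = ((π - π / 3 : ℝ) : ℂ) * I := by push_cast; ring
  rw [omega, h, Complex.exp_mul_I, ← Complex.ofReal_cos, ← Complex.ofReal_sin, Real.cos_pi_sub,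
    Real.sin_pi_sub, Real.cos_pi_div_three, Real.sin_pi_div_three]
  push_cast; ring

lemma sqrt_three_sq_complex : ((√3 : ℝ) : ℂ) ^ 2 = 3 := by
  rw [← ofReal_pow, sq_sqrt (by norm_num)]; norm_num

lemma omega_quadratic : 1 + omega + omega ^ 2 = 0 := by
  rw [omega_eq]; push_cast
  linear_combination (1 / 4 * I ^ 2) * sqrt_three_sq_complex + 3 / 4 * I_sq

lemma omega_cube : omega ^ 3 = 1 := by linear_combination (omega - 1) * omega_quadratic

lemma norm_omega : ‖omega‖ = 1 := by
  have h : (2 * π * I / 3 : ℂ) = ((2 * π / 3 : ℝ) : ℂ) * I := by push_cast; ring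
  rw [omega, h, Complex.norm_exp_ofReal_mul_I]

lemma prod_sub_omega (z s : ℂ) :
    (z - s) * (z - omega * s) * (z - omega ^ 2 * s) = z ^ 3 - s ^ 3 := by
  linear_combination (-z ^ 2 * s + omega * z * s ^ 2) * omega_quadratic - s ^ 3 * omega_cube

lemma isClosed_Sigma1 (x : ℝ) : IsClosed (Sigma1 x) := by
  have : Sigma1 x = (fun z : ℂ => z ^ 3) ⁻¹' (Complex.ofReal '' Icc 0 (x ^ 3)) := by
    ext z
    simp only [Sigma1, mem_ofPred_eq, Set.mem_preimage, Set.mem_image, Set.mem_Icc]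
    constructor
    · rintro ⟨r, h1, h2, h3⟩; exact ⟨r, ⟨h1, h2⟩, h3.symm⟩
    · rintro ⟨r, ⟨h1, h2⟩, h3⟩; exact ⟨r, h1, h2, h3.symm⟩
  rw [this]
  exact (isometry_ofReal.isClosedEmbedding.isClosedMap _ isClosed_Icc).preimage (by fun_prop)

lemma isClosed_Sigma2 : IsClosed Sigma2 := by
  have : Sigma2 = (fun z : ℂ => z ^ 3) ⁻¹' (Complex.ofReal '' Set.Iic 0) := by
    ext z
    simp only [Sigma2, mem_ofPred_eq, Set.mem_preimage, Set.mem_image, Set.mem_Iic]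
    constructor
    · rintro ⟨r, h1, h3⟩; exact ⟨r, h1, h3.symm⟩
    · rintro ⟨r, h1, h3⟩; exact ⟨r, h1, h3.symm⟩
  rw [this]
  exact (isometry_ofReal.isClosedEmbedding.isClosedMap _ isClosed_Iic).preimage (by fun_prop)

lemma cube_of_mem_Sigma1 {x : ℝ} {s : ℂ} (hs : s ∈ Sigma1 x) : s ^ 3 = ((‖s‖ ^ 3 : ℝ) : ℂ) := by
  obtain ⟨r, h0, -, h⟩ := hs
  rw [h, ← norm_pow, h, norm_real, norm_of_nonneg h0]

lemma cube_of_mem_Sigma2 {s : ℂ} (hs : s ∈ Sigma2) : s ^ 3 = ((-‖s‖ ^ 3 : ℝ) : ℂ) := by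
  obtain ⟨r, h0, h⟩ := hs
  rw [h, ← norm_pow, h, norm_real, Real.norm_of_nonpos h0, neg_neg]

lemma norm_le_of_mem_Sigma1 {x : ℝ} (hx : 0 < x) {s : ℂ} (hs : s ∈ Sigma1 x) : ‖s‖ ≤ x := by
  obtain ⟨r, h0, h1, h⟩ := hs
  have : ‖s‖ ^ 3 = r := by rw [← norm_pow, h, norm_real, norm_of_nonneg h0]
  exact le_of_pow_le_pow_left₀ (n := 3) (by norm_num) hx.le (by linarith)

lemma measure_compl_of_support_subset {μ : Measure ℂ} {S : Set ℂ} (h : μ.support ⊆ S) : μ Sᶜ = 0 :=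
  measure_mono_null (Set.compl_subset_compl.2 h) Measure.measure_compl_support

lemma support_subset_of_measure_compl {μ : Measure ℂ} {S : Set ℂ} (hS : IsClosed S)
    (h : μ Sᶜ = 0) : μ.support ⊆ S :=
  Measure.support_subset_of_isClosed hS h

lemma HasFiniteLogEnergy.measure_singleton {μ : Measure ℂ} [SFinite μ]
    (h : HasFiniteLogEnergy μ μ) (a : ℂ) : μ {a} = 0 := by
  have : (μ.prod μ) ({a} ×ˢ {a}) = 0 := by
    refine measure_mono_null ?_ h.1
    rintro ⟨p, q⟩ ⟨hp, hq⟩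
    simp only [Set.mem_singleton_iff] at hp hq
    simp [hp, hq]
  rw [Measure.prod_prod] at this
  exact mul_self_eq_zero.1 this

/-- Invariance of a measure under the rotation by the angle `2π/3`. -/
def RotInv (μ : Measure ℂ) : Prop := μ.map (fun z => omega * z) = μ

lemma measurable_omega_mul : Measurable (fun z : ℂ => omega * z) := by fun_prop

lemma RotInv.integral_comp {μ : Measure ℂ} (h : RotInv μ) {E : Type*} [NormedAddCommGroup E]
    [NormedSpace ℝ E] {f : ℂ → E} (hf : AEStronglyMeasurable f μ) :
    ∫ s, f (omega * s) ∂μ = ∫ s, f s ∂μ := by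
  have h1 := integral_map (μ := μ) (φ := fun z => omega * z) (f := f)
    measurable_omega_mul.aemeasurable (by rw [h]; exact hf)
  rw [h] at h1
  exact h1.symm

lemma RotInv.integrable_comp {μ : Measure ℂ} (h : RotInv μ) {E : Type*} [NormedAddCommGroup E]
    {f : ℂ → E} (hf : Integrable f μ) : Integrable (fun s => f (omega * s)) μ := by
  rw [← h] at hf
  exact hf.comp_measurable measurable_omega_mul

lemma RotInv.integral_eq_third {μ : Measure ℂ} (h : RotInv μ) {E : Type*} [NormedAddCommGroup E]
    [NormedSpace ℝ E] {f : ℂ → E} (hf : Integrable f μ) :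
    (3 : ℝ) • ∫ s, f s ∂μ = ∫ s, (f s + f (omega * s) + f (omega ^ 2 * s)) ∂μ := by
  have h1 := h.integrable_comp hf
  have h2 := h.integrable_comp h1
  have e2 : (fun s => f (omega * (omega * s))) = fun s => f (omega ^ 2 * s) := by
    funext s; congr 1; ring
  rw [e2] at h2
  have h12 : Integrable (fun s => f s + f (omega * s)) μ := hf.add h1
  rw [integral_add h12 h2, integral_add hf h1, h.integral_comp hf.1]
  have := h.integral_comp h1.1
  rw [e2, h.integral_comp hf.1] at this
  rw [this]
  module

/-- The average of a measure over the three rotations. -/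
def symmetrize (μ : Measure ℂ) : Measure ℂ :=
  (3⁻¹ : ℝ≥0∞) • (μ + μ.map (fun z => omega * z) + (μ.map (fun z => omega * z)).map
    (fun z => omega * z))

lemma rotInv_symmetrize (μ : Measure ℂ) : RotInv (symmetrize μ) := by
  unfold RotInv symmetrize
  rw [Measure.map_smul, Measure.map_add _ _ measurable_omega_mul,
    Measure.map_add _ _ measurable_omega_mul]
  have : ((μ.map (fun z => omega * z)).map (fun z => omega * z)).map (fun z => omega * z) = μ := by
    rw [Measure.map_map measurable_omega_mul measurable_omega_mul,
      Measure.map_map (measurable_omega_mul.comp measurable_omega_mul) measurable_omega_mul]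
    have : ((fun z : ℂ => omega * z) ∘ fun z => omega * z) ∘ (fun z => omega * z) = id := by
      funext z
      simp only [Function.comp, id]
      linear_combination z * omega_cube
    rw [this, Measure.map_id]
  rw [this]; congr 1
  abel

lemma IsLogFinite.symmetrize {μ : Measure ℂ} (h : IsLogFinite μ) : IsLogFinite (symmetrize μ) :=
  ((h.add (h.map_rotation norm_omega)).add
    ((h.map_rotation norm_omega).map_rotation norm_omega)).smul (by simp)

lemma symmetrize_univ (μ : Measure ℂ) : symmetrize μ univ = μ univ := by
  simp only [symmetrize, Measure.smul_apply, Measure.add_apply, smul_eq_mul]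
  rw [Measure.map_apply measurable_omega_mul MeasurableSet.univ,
    Measure.map_apply measurable_omega_mul MeasurableSet.univ, Set.preimage_univ,
    Measure.map_apply measurable_omega_mul MeasurableSet.univ, Set.preimage_univ]
  rw [show μ univ + μ univ + μ univ = 3 * μ univ by ring, ← mul_assoc,
    ENNReal.inv_mul_cancel (by simp) (by simp), one_mul]

lemma omega_mul_mem_Sigma1 {x : ℝ} {s : ℂ} : omega * s ∈ Sigma1 x ↔ s ∈ Sigma1 x := by
  simp [Sigma1, mul_pow, omega_cube]

lemma symmetrize_compl_Sigma1 {μ : Measure ℂ} {x : ℝ} (h : μ (Sigma1 x)ᶜ = 0) :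
    symmetrize μ (Sigma1 x)ᶜ = 0 := by
  have hm : MeasurableSet (Sigma1 x)ᶜ := (isClosed_Sigma1 x).measurableSet.compl
  have hp : (fun z : ℂ => omega * z) ⁻¹' (Sigma1 x)ᶜ = (Sigma1 x)ᶜ := by
    ext z; simp [omega_mul_mem_Sigma1]
  simp only [symmetrize, Measure.smul_apply, Measure.add_apply, smul_eq_mul]
  have h1 : (μ.map fun z => omega * z) (Sigma1 x)ᶜ = 0 := by
    rw [Measure.map_apply measurable_omega_mul hm, hp, h]
  rw [Measure.map_apply (μ := μ.map _) measurable_omega_mul hm, hp, h1, h]; simp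

lemma RotInv.logEnergy_map {μ κ : Measure ℂ} [IsFiniteMeasure μ] [IsFiniteMeasure κ]
    (h : RotInv κ) : logEnergy (μ.map (fun z => omega * z)) κ = logEnergy μ κ := by
  conv_lhs => rw [← h]
  exact logEnergy_map_rotation μ κ norm_omega

lemma RotInv.logEnergy_symmetrize {μ κ : Measure ℂ} (h : RotInv κ) (hμ : IsLogFinite μ)
    (hκ : IsLogFinite κ) : logEnergy (symmetrize μ) κ = logEnergy μ κ := by
  have := hμ.finite
  have := hκ.finite
  have h1 := hμ.map_rotation norm_omega
  have := h1.finite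
  have h2 := h1.map_rotation norm_omega
  have := h2.finite
  unfold symmetrize
  rw [logEnergy_smul_left, logEnergy_add_left (hμ.add h1) h2 hκ, logEnergy_add_left hμ h1 hκ,
    h.logEnergy_map, h.logEnergy_map, h.logEnergy_map, toReal_inv]
  simp; ring

/-! ### Half of the balayage of a measure on `Σ₁` onto `Σ₂` -/

/-- The map which carries `s` to a point of `Σ₂` at a random distance from the origin. -/
def sweepMap (p : ℂ × ℂ) : ℂ := -((cauchyRatio p.2 ^ (2 / 3 : ℝ) : ℝ) : ℂ) * p.1

@[fun_prop]
lemma measurable_sweepMap : Measurable sweepMap := by unfold sweepMap; fun_prop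

/-- Half of the balayage onto `Σ₂` of a rotation-invariant measure on `Σ₁`: in the coordinate
`z ^ (3 / 2)` a point mass at `y > 0` is swept to the Cauchy distribution of scale `y` on the
imaginary axis. -/
def halfBalayage (μ : Measure ℂ) : Measure ℂ := (2⁻¹ : ℝ≥0∞) • (μ.prod circleUnif).map sweepMap

instance (μ : Measure ℂ) [IsFiniteMeasure μ] : IsFiniteMeasure (halfBalayage μ) :=
  Measure.smul_finite _ (by simp)

lemma halfBalayage_univ (μ : Measure ℂ) [SFinite μ] :
    halfBalayage μ univ = 2⁻¹ * μ univ := by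
  unfold halfBalayage
  rw [Measure.smul_apply, Measure.map_apply (by fun_prop) MeasurableSet.univ, Set.preimage_univ,
    ← Set.univ_prod_univ, Measure.prod_prod, measure_univ (μ := circleUnif), mul_one, smul_eq_mul]

lemma cauchyRatio_rpow_cube (ζ : ℂ) : (cauchyRatio ζ ^ (2 / 3 : ℝ)) ^ 3 = cauchyRatio ζ ^ 2 := by
  rw [← rpow_natCast, ← rpow_mul (cauchyRatio_nonneg ζ), ← rpow_natCast]; norm_num

lemma sweepMap_cube (s ζ : ℂ) : sweepMap (s, ζ) ^ 3 = -((cauchyRatio ζ ^ 2 : ℝ) : ℂ) * s ^ 3 := by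
  unfold sweepMap
  rw [mul_pow, ← cauchyRatio_rpow_cube]; push_cast; ring

lemma halfBalayage_compl_Sigma2 {μ : Measure ℂ} [SFinite μ] {x : ℝ} (h : μ (Sigma1 x)ᶜ = 0) :
    halfBalayage μ Sigma2ᶜ = 0 := by
  unfold halfBalayage
  rw [Measure.smul_apply, Measure.map_apply (by fun_prop) isClosed_Sigma2.measurableSet.compl,
    smul_eq_mul]
  refine mul_eq_zero_of_right _ (measure_mono_null (t := (Sigma1 x)ᶜ ×ˢ univ) ?_ ?_)
  · rintro ⟨s, ζ⟩ hp
    refine ⟨fun hs => hp ?_, trivial⟩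
    obtain ⟨r, h0, -, h⟩ := hs
    refine ⟨-(cauchyRatio ζ ^ 2 * r), ?_, ?_⟩
    · have := mul_nonneg (sq_nonneg (cauchyRatio ζ)) h0
      linarith
    · simp only at h
      rw [sweepMap_cube, h]; push_cast; ring
  · rw [Measure.prod_prod, h, zero_mul]

lemma RotInv.balayage {μ : Measure ℂ} [SFinite μ] (h : RotInv μ) : RotInv (halfBalayage μ) := by
  unfold RotInv halfBalayage
  have h1 : μ.prod circleUnif = (μ.prod circleUnif).map (Prod.map (fun z => omega * z) id) := by
    rw [← Measure.map_prod_map _ _ measurable_omega_mul measurable_id, h, Measure.map_id]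
  rw [Measure.map_smul, Measure.map_map measurable_omega_mul measurable_sweepMap]
  conv_rhs => rw [h1, Measure.map_map measurable_sweepMap (by fun_prop)]
  congr 2
  funext p
  simp [sweepMap]; ring

lemma integrable_abs_log_cauchyRatio :
    Integrable (fun ζ => |log (cauchyRatio ζ ^ (2 / 3 : ℝ))|) circleUnif := by
  have h := (((integrable_log_norm_sub_circleUnif 1).sub
    (integrable_log_norm_sub_circleUnif (-1))).const_mul (2 / 3)).abs
  refine h.congr (ae_circleUnif_of_countable (s := {1, -1}) (toFinite _).countable ?_)
  intro ζ _ hs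
  simp only [Set.mem_insert_iff, Set.mem_singleton_iff, not_or] at hs
  have p1 : 0 < ‖ζ - 1‖ := norm_pos_iff.2 (sub_ne_zero.2 hs.1)
  have p2 : 0 < ‖ζ - (-1)‖ := norm_pos_iff.2 (sub_ne_zero.2 hs.2)
  have p3 : ‖ζ - (-1)‖ = ‖ζ + 1‖ := by rw [sub_neg_eq_add]
  rw [p3] at p2
  simp only [Pi.sub_apply, p3]
  unfold cauchyRatio
  rw [Real.log_rpow (by positivity), log_div p1.ne' p2.ne']

lemma ae_cauchyRatio_pos : ∀ᵐ ζ ∂circleUnif, 0 < cauchyRatio ζ := by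
  refine ae_circleUnif_of_countable (s := {1, -1}) (toFinite _).countable ?_
  intro ζ _ hs
  simp only [Set.mem_insert_iff, Set.mem_singleton_iff, not_or] at hs
  have p1 : 0 < ‖ζ - 1‖ := norm_pos_iff.2 (sub_ne_zero.2 hs.1)
  have p2 : 0 < ‖ζ - (-1)‖ := norm_pos_iff.2 (sub_ne_zero.2 hs.2)
  rw [sub_neg_eq_add] at p2
  exact div_pos p1 p2

lemma lintegral_abs_log_cauchyRatio :
    ∫⁻ ζ, ofReal |log (cauchyRatio ζ ^ (2 / 3 : ℝ))| ∂circleUnif < ⊤ := by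
  have := integrable_abs_log_cauchyRatio.2
  rw [hasFiniteIntegral_iff_norm] at this
  simpa using this

/-- Dilations change the energy for `tailKer` at most logarithmically. -/
lemma IsLogFinite.exists_tailEnergy_dilate_le {μ : Measure ℂ} (h : IsLogFinite μ) :
    ∃ C : ℝ≥0∞, C < ⊤ ∧ ∀ c : ℝ, c ≠ 0 →
      tailEnergy (μ.map (fun z => c * z)) (μ.map (fun z => c * z)) ≤
        C + ofReal |log (|c|)| * (μ.prod μ) univ := by
  have := h.finite
  have hfe := h.hasFiniteLogEnergy h
  have hint : ∫⁻ p : ℂ × ℂ, ofReal |log ‖p.1 - p.2‖| ∂(μ.prod μ) < ⊤ := by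
    have := hfe.2.2
    rw [hasFiniteIntegral_iff_norm] at this
    simpa [log_inv] using this
  have hne : ∀ᵐ p : ℂ × ℂ ∂(μ.prod μ), 0 < ‖p.1 - p.2‖ := by
    have : ∀ᵐ p : ℂ × ℂ ∂(μ.prod μ), p ∉ Set.diagonal ℂ := measure_eq_zero_iff_ae_notMem.1 hfe.1
    filter_upwards [this] with p hp
    rw [norm_pos_iff, sub_ne_zero]
    exact hp
  refine ⟨∫⁻ p : ℂ × ℂ, (ofReal |log ‖p.1 - p.2‖| + 1) ∂(μ.prod μ), ?_, ?_⟩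
  · rw [lintegral_add_right _ measurable_const, lintegral_const, one_mul]
    exact add_lt_top.2 ⟨hint, measure_lt_top _ _⟩
  · intro c hc
    rw [tailEnergy_map_le _ _ (by fun_prop), ← lintegral_const,
      ← lintegral_add_right _ measurable_const]
    refine lintegral_mono_ae ?_
    filter_upwards [hne] with p hp
    have hc' : 0 < |c| := abs_pos.2 hc
    rw [← mul_sub, norm_mul, norm_real, norm_eq_abs]
    refine (tailKer_le (by positivity)).trans ?_
    rw [log_mul hc'.ne' hp.ne', add_right_comm]; gcongr
    rw [← ofReal_add (abs_nonneg _) (abs_nonneg _), add_comm]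
    exact ofReal_le_ofReal (abs_add_le _ _)

lemma tailEnergy_map_eq {α : Type*} [MeasurableSpace α] (μ ν : Measure α) [IsFiniteMeasure μ]
    [IsFiniteMeasure ν] {f : α → ℂ} (hf : Measurable f) :
    tailEnergy (μ.map f) (ν.map f) = ∫⁻ p, ∫⁻ q, tailKer ‖f p - f q‖ ∂ν ∂μ := by
  have hmeas : Measurable fun q : α × α => tailKer ‖f q.1 - f q.2‖ := by fun_prop
  unfold tailEnergy
  rw [Measure.map_prod_map _ _ hf hf, lintegral_map (by fun_prop) (by fun_prop)]
  exact lintegral_prod _ hmeas.aemeasurable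

/-- Tonelli's theorem for a double integral over a product, with the order of the two middle
integrations interchanged. -/
lemma lintegral_prod_prod_comm {α β : Type*} [MeasurableSpace α] [MeasurableSpace β]
    (μ : Measure α) (θ : Measure β) [SFinite μ] [SFinite θ]
    (k : (α × β) × α × β → ℝ≥0∞) (hk : Measurable k) :
    ∫⁻ p, ∫⁻ q, k (p, q) ∂(μ.prod θ) ∂(μ.prod θ) =
      ∫⁻ b, ∫⁻ b', ∫⁻ a, ∫⁻ a', k ((a, b), (a', b')) ∂μ ∂μ ∂θ ∂θ := by
  rw [lintegral_prod_symm _ hk.lintegral_prod_right'.aemeasurable]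
  refine lintegral_congr fun b => ?_
  have h1 : ∀ a, ∫⁻ q, k ((a, b), q) ∂(μ.prod θ) =
      ∫⁻ b', ∫⁻ a', k ((a, b), (a', b')) ∂μ ∂θ := fun a =>
    lintegral_prod_symm _ (hk.comp (measurable_const.prodMk measurable_id)).aemeasurable
  simp_rw [h1]
  have h2 : Measurable fun r : (α × β) × α => k ((r.1.1, b), (r.2, r.1.2)) := hk.comp (by fun_prop)
  exact lintegral_lintegral_swap (f := fun a b' => ∫⁻ a', k ((a, b), (a', b')) ∂μ)
    h2.lintegral_prod_right'.aemeasurable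

/-- The energy for `tailKer` is convex, so that the energy of a mixture is at most the mean of the
energies. -/
lemma tailEnergy_map_prod_le {α β : Type*} [MeasurableSpace α] [MeasurableSpace β]
    (μ : Measure α) (θ : Measure β) [IsFiniteMeasure μ] [IsProbabilityMeasure θ]
    {f : α × β → ℂ} (hf : Measurable f) :
    tailEnergy ((μ.prod θ).map f) ((μ.prod θ).map f) ≤
      ∫⁻ b, tailEnergy (μ.map fun a => f (a, b)) (μ.map fun a => f (a, b)) ∂θ := by
  set e : β → β → ℝ≥0∞ := fun b b' =>
    tailEnergy (μ.map fun a => f (a, b)) (μ.map fun a => f (a, b')) with he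
  have hk : Measurable fun q : (α × β) × α × β => tailKer ‖f q.1 - f q.2‖ := by fun_prop
  have hee : ∀ b b', e b b' = ∫⁻ a, ∫⁻ a', tailKer ‖f (a, b) - f (a', b')‖ ∂μ ∂μ := by
    intro b b'
    have h1 : Measurable fun a => f (a, b) := by fun_prop
    have h2 : Measurable fun a => f (a, b') := by fun_prop
    have h3 : Measurable fun q : α × α => tailKer ‖f (q.1, b) - f (q.2, b')‖ := by fun_prop
    simp only [he, tailEnergy]
    rw [Measure.map_prod_map _ _ h1 h2, lintegral_map (by fun_prop) (by fun_prop)]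
    exact lintegral_prod _ h3.aemeasurable
  have hem : Measurable fun q : β × β => e q.1 q.2 := by
    simp_rw [hee]
    have h3 : Measurable fun q : ((β × β) × α) × α =>
      tailKer ‖f (q.1.2, q.1.1.1) - f (q.2, q.1.1.2)‖ := by fun_prop
    exact h3.lintegral_prod_right'.lintegral_prod_right'
  have : Measurable fun b => e b b := hem.comp (measurable_id.prodMk measurable_id)
  have hA : tailEnergy ((μ.prod θ).map f) ((μ.prod θ).map f) = ∫⁻ b, ∫⁻ b', e b b' ∂θ ∂θ := by
    rw [tailEnergy_map_eq _ _ hf, lintegral_prod_prod_comm μ θ _ hk]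
    simp_rw [hee]
  have h2 : 2 * tailEnergy ((μ.prod θ).map f) ((μ.prod θ).map f) ≤ 2 * ∫⁻ b, e b b ∂θ := by
    rw [hA, ← lintegral_const_mul _ hem.lintegral_prod_right']
    calc _ ≤ ∫⁻ b, (e b b + ∫⁻ b', e b' b' ∂θ) ∂θ := by
          refine lintegral_mono fun b => ?_
          have h1 : Measurable fun b' => e b b' := hem.comp (measurable_const.prodMk measurable_id)
          calc 2 * ∫⁻ b', e b b' ∂θ = ∫⁻ b', 2 * e b b' ∂θ := (lintegral_const_mul _ h1).symm
            _ ≤ ∫⁻ b', (e b b + e b' b') ∂θ := lintegral_mono fun b' => two_mul_tailEnergy_le _ _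
            _ = _ := by
                rw [lintegral_add_left measurable_const, lintegral_const, measure_univ, mul_one]
      _ = _ := by
          rw [lintegral_add_right _ measurable_const, lintegral_const, measure_univ, mul_one,
            two_mul]
  exact (ENNReal.mul_le_mul_iff_right (by simp) (by simp)).1 h2

lemma IsLogFinite.balayage {μ : Measure ℂ} (h : IsLogFinite μ) :
    IsLogFinite (halfBalayage μ) := by
  have := h.finite
  unfold halfBalayage
  refine IsLogFinite.smul ⟨inferInstance, ?_, ?_⟩ (by simp)
  · set ν : ℂ → Measure ℂ := fun ζ =>
      μ.map (fun z => ((-(cauchyRatio ζ ^ (2 / 3 : ℝ)) : ℝ) : ℂ) * z) with hν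
    obtain ⟨C, hC, hle⟩ := h.exists_tailEnergy_dilate_le
    have hD : ∫⁻ ζ, tailEnergy (ν ζ) (ν ζ) ∂circleUnif < ⊤ := by
      calc _ ≤ ∫⁻ ζ, (C + ofReal |log (cauchyRatio ζ ^ (2 / 3 : ℝ))| *
            (μ.prod μ) univ) ∂circleUnif := by
            refine lintegral_mono_ae ?_
            filter_upwards [ae_cauchyRatio_pos] with ζ hζ
            have hpos : 0 < cauchyRatio ζ ^ (2 / 3 : ℝ) := Real.rpow_pos_of_pos hζ _
            refine (hle _ (neg_ne_zero.2 hpos.ne')).trans ?_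
            rw [abs_neg, abs_of_pos hpos]
        _ < ⊤ := by
            rw [lintegral_add_left measurable_const, lintegral_const, measure_univ, mul_one,
              lintegral_mul_const _ (by fun_prop)]
            exact add_lt_top.2 ⟨hC, mul_lt_top lintegral_abs_log_cauchyRatio (measure_lt_top _ _)⟩
    have h2 := tailEnergy_map_prod_le μ circleUnif measurable_sweepMap
    have h3 : ∀ ζ, μ.map (fun s => sweepMap (s, ζ)) = ν ζ := fun ζ => by
      simp [hν, sweepMap]
    simp_rw [h3] at h2
    exact h2.trans_lt hD
  · rw [lintegral_map (by fun_prop) measurable_sweepMap]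
    calc _ ≤ ∫⁻ p : ℂ × ℂ, (ofReal (log (1 + ‖p.1‖)) * 1 + 1 *
          (ofReal (log 2) +
            ofReal |log (cauchyRatio p.2 ^ (2 / 3 : ℝ))|)) ∂(μ.prod circleUnif) := by
          refine lintegral_mono fun p => ?_
          rw [mul_one, one_mul]
          have h1 : 0 ≤ log (1 + ‖p.1‖) := log_nonneg (by linarith [norm_nonneg p.1])
          rw [← ofReal_add (log_nonneg one_le_two) (abs_nonneg _),
            ← ofReal_add h1 (add_nonneg (log_nonneg one_le_two) (abs_nonneg _))]
          refine ofReal_le_ofReal ?_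
          set τ := cauchyRatio p.2 ^ (2 / 3 : ℝ)
          have hτ0 : 0 ≤ τ := Real.rpow_nonneg (cauchyRatio_nonneg _) _
          have h2 : log (1 + ‖sweepMap p‖) ≤ log (1 + ‖p.1‖) + log (1 + τ) := by
            rw [← log_mul (by positivity) (by positivity)]
            refine log_le_log (by positivity) ?_
            unfold sweepMap
            rw [norm_mul, norm_neg, norm_real, norm_of_nonneg hτ0]
            nlinarith [norm_nonneg p.1]
          have h3 : log (1 + τ) ≤ log 2 + |log τ| := by
            rcases le_total τ 1 with h | h
            · have : log (1 + τ) ≤ log 2 := log_le_log (by positivity) (by linarith)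
              linarith [abs_nonneg (log τ)]
            · rw [abs_of_nonneg (log_nonneg h), ← log_mul two_ne_zero (by positivity)]
              exact log_le_log (by positivity) (by linarith)
          linarith
      _ < ⊤ := by
          rw [lintegral_add_left (by fun_prop),
            lintegral_prod_mul (f := fun x : ℂ => ofReal (log (1 + ‖x‖)))
              (g := fun _ => 1) (by fun_prop) (by fun_prop),
            lintegral_prod_mul (f := fun _ => 1) (g := fun ζ : ℂ => ofReal (log 2) +
                ofReal |log (cauchyRatio ζ ^ (2 / 3 : ℝ))|)
              (by fun_prop) (by fun_prop), lintegral_add_left measurable_const]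
          simp only [lintegral_const, one_mul, measure_univ, mul_one]
          exact add_lt_top.2 ⟨h.growth, mul_lt_top (measure_lt_top _ _)
            (add_lt_top.2 ⟨ofReal_lt_top, lintegral_abs_log_cauchyRatio⟩)⟩

/-! ### Symmetry of the minimiser and the second measure -/

lemma rotation_log_sum {w s : ℂ} (h : w ^ 3 ≠ s ^ 3) :
    log ‖w - s‖ + log ‖w - omega * s‖ + log ‖w - omega ^ 2 * s‖ =
      log ‖w ^ 3 - s ^ 3‖ := by
  have h0 : (w - s) * (w - omega * s) * (w - omega ^ 2 * s) ≠ 0 := by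
    rw [prod_sub_omega]; exact sub_ne_zero.2 h
  have := left_ne_zero_of_mul (left_ne_zero_of_mul h0)
  have := right_ne_zero_of_mul (left_ne_zero_of_mul h0)
  have := right_ne_zero_of_mul h0
  rw [← prod_sub_omega, norm_mul, norm_mul, log_mul, log_mul] <;> simp_all

lemma RotInv.three_mul_integral_log {μ : Measure ℂ} (h : RotInv μ) {w : ℂ}
    (hi : Integrable (fun s => log ‖w - s‖) μ) (hne : ∀ᵐ s ∂μ, w ^ 3 ≠ s ^ 3) :
    3 * ∫ s, log ‖w - s‖ ∂μ = ∫ s, log ‖w ^ 3 - s ^ 3‖ ∂μ ∧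
      Integrable (fun s => log ‖w ^ 3 - s ^ 3‖) μ := by
  have h1 := h.integrable_comp hi
  have h2 := h.integrable_comp h1
  have e2 : (fun s => log ‖w - omega * (omega * s)‖) =
      fun s => log ‖w - omega ^ 2 * s‖ := by
    funext s; congr 3; ring
  rw [e2] at h2
  have hae : ∀ᵐ s ∂μ, log ‖w - s‖ + log ‖w - omega * s‖ +
      log ‖w - omega ^ 2 * s‖ = log ‖w ^ 3 - s ^ 3‖ := by
    filter_upwards [hne] with s hs using rotation_log_sum hs
  constructor
  · rw [← integral_congr_ae hae]
    exact h.integral_eq_third hi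
  · exact ((hi.add h1).add h2).congr hae

lemma ae_cube_ne {μ : Measure ℂ} (h0 : ∀ a : ℂ, μ {a} = 0) (c : ℂ) : ∀ᵐ s ∂μ, c ≠ s ^ 3 := by
  have hroots : {s : ℂ | c = s ^ 3}.Countable := by
    have : {s : ℂ | c = s ^ 3} ⊆ ((X ^ 3 - C c : ℂ[X]).rootSet ℂ) := by
      intro s hs
      rw [Polynomial.mem_rootSet]
      refine ⟨Polynomial.X_pow_sub_C_ne_zero (by norm_num) c, ?_⟩
      simp only [mem_ofPred_eq] at hs
      simp [hs]
    exact ((Polynomial.rootSet_finite _ _).subset this).countable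
  have : μ {s : ℂ | c = s ^ 3} = 0 := by
    rw [← Set.biUnion_of_singleton {s : ℂ | c = s ^ 3}]
    exact (measure_biUnion_null_iff hroots).2 fun a _ => h0 a
  rw [ae_iff]
  simpa using this

/-- On `Σ₂` the logarithmic potential of `μ` is twice that of `halfBalayage μ`. -/
lemma RotInv.two_mul_integral_log_halfBalayage {μ : Measure ℂ} (h : RotInv μ)
    (hfin : IsLogFinite μ) {x : ℝ} (hμ : μ (Sigma1 x)ᶜ = 0) {w : ℂ} (hw : w ∈ Sigma2) (hw0 : w ≠ 0)
    (hi : Integrable (fun s => log ‖w - s‖) μ)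
    (hi' : Integrable (fun s => log ‖w - s‖) (halfBalayage μ)) :
    2 * ∫ s, log ‖w - s‖ ∂(halfBalayage μ) = ∫ s, log ‖w - s‖ ∂μ := by
  have := hfin.finite
  have hs1 := (hfin.hasFiniteLogEnergy hfin).measure_singleton
  have hf2 := hfin.balayage
  have hs2 := (hf2.hasFiniteLogEnergy hf2).measure_singleton
  obtain ⟨e1, -⟩ := h.three_mul_integral_log hi (ae_cube_ne hs1 _)
  obtain ⟨e2, i2⟩ := h.balayage.three_mul_integral_log hi' (ae_cube_ne hs2 _)
  have hmeas : Measurable fun s : ℂ => log ‖w ^ 3 - s ^ 3‖ := by fun_prop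
  unfold halfBalayage at i2
  rw [integrable_smul_measure (by simp) (by simp),
    integrable_map_measure hmeas.aestronglyMeasurable measurable_sweepMap.aemeasurable] at i2
  have : ∫ s, log ‖w ^ 3 - s ^ 3‖ ∂(halfBalayage μ) =
      2⁻¹ * ∫ s, log ‖w ^ 3 - s ^ 3‖ ∂μ := by
    unfold halfBalayage
    rw [integral_smul_measure, integral_map measurable_sweepMap.aemeasurable
      hmeas.aestronglyMeasurable]
    rw [show ∫ p, log ‖w ^ 3 - sweepMap p ^ 3‖ ∂(μ.prod circleUnif) =
      ∫ s, ∫ ζ, log ‖w ^ 3 - sweepMap (s, ζ) ^ 3‖ ∂circleUnif ∂μ from integral_prod _ i2]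
    simp only [toReal_inv, toReal_ofNat, smul_eq_mul]; congr 1
    refine integral_congr_ae ?_
    have hmem : ∀ᵐ s ∂μ, s ∈ Sigma1 x := hμ
    have hne : ∀ᵐ s ∂μ, s ≠ 0 := by rw [ae_iff]; simpa using hs1 0
    filter_upwards [hmem, hne] with s hs hs0
    have : 0 < ‖s‖ := norm_pos_iff.2 hs0
    have : 0 < ‖w‖ := norm_pos_iff.2 hw0
    have key := integral_log_cauchyRatio (b := √(‖w‖ ^ 3)) (y := √(‖s‖ ^ 3)) (by positivity)
    rw [sq_sqrt (by positivity), sq_sqrt (by positivity)] at key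
    have r1 : ∀ ζ, ‖w ^ 3 - sweepMap (s, ζ) ^ 3‖ = |‖w‖ ^ 3 - ‖s‖ ^ 3 * cauchyRatio ζ ^ 2| := by
      intro ζ
      rw [sweepMap_cube, cube_of_mem_Sigma1 hs, cube_of_mem_Sigma2 hw, ← norm_eq_abs,
        ← norm_real, ← norm_neg]
      congr 1; push_cast; ring
    have r2 : ‖w ^ 3 - s ^ 3‖ = ‖w‖ ^ 3 + ‖s‖ ^ 3 := by
      have hp : 0 ≤ ‖w‖ ^ 3 + ‖s‖ ^ 3 := by positivity
      rw [cube_of_mem_Sigma1 hs, cube_of_mem_Sigma2 hw, ← abs_of_nonneg hp, ← norm_eq_abs,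
        ← norm_real, ← norm_neg]
      congr 1; push_cast; ring
    simp only [r1, r2, key]
  linarith

lemma logEnergy_eq_neg_integral {κ ν : Measure ℂ} [SFinite κ] [SFinite ν]
    (h : HasFiniteLogEnergy κ ν) :
    logEnergy κ ν = -∫ w, ∫ s, log ‖w - s‖ ∂ν ∂κ := by
  unfold logEnergy
  rw [integral_prod _ h.2]
  simp [log_inv, integral_neg]

lemma HasFiniteLogEnergy.ae_integrable {κ ν : Measure ℂ} [SFinite κ] [SFinite ν]
    (h : HasFiniteLogEnergy κ ν) :
    ∀ᵐ w ∂κ, Integrable (fun s => log ‖w - s‖) ν := by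
  filter_upwards [h.2.prod_right_ae] with w hw
  have := hw.neg
  refine this.congr (ae_of_all _ fun s => ?_)
  simp [log_inv]

lemma RotInv.two_mul_logEnergy_halfBalayage {μ κ : Measure ℂ} (h : RotInv μ)
    (hfin : IsLogFinite μ) {x : ℝ} (hμ : μ (Sigma1 x)ᶜ = 0) (hκ : IsLogFinite κ)
    (hκ2 : κ Sigma2ᶜ = 0) :
    2 * logEnergy κ (halfBalayage μ) = logEnergy κ μ := by
  have := hfin.finite
  have := hκ.finite
  have hf1 := hκ.hasFiniteLogEnergy hfin
  have hf2 := hκ.hasFiniteLogEnergy hfin.balayage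
  rw [logEnergy_eq_neg_integral hf1, logEnergy_eq_neg_integral hf2, mul_neg, ← integral_const_mul]
  congr 1
  refine integral_congr_ae ?_
  have hmem : ∀ᵐ s ∂κ, s ∈ Sigma2 := hκ2
  have hne : ∀ᵐ s ∂κ, s ≠ 0 := by
    rw [ae_iff]; simpa using (hκ.hasFiniteLogEnergy hκ).measure_singleton 0
  filter_upwards [hmem, hne, hf1.ae_integrable, hf2.ae_integrable] with w h1 h2 h3 h4
  exact h.two_mul_integral_log_halfBalayage hfin hμ h1 h2 h3 h4

/-- The external field. -/
def field (t3 : ℝ) (z : ℂ) : ℝ := 2 / (3 * √t3) * ‖z‖ ^ (3 / 2 : ℝ) - t3 / 3 * (z ^ 3).re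

@[fun_prop]
lemma measurable_field (t3 : ℝ) : Measurable (field t3) := by unfold field; fun_prop

lemma field_omega (t3 : ℝ) (z : ℂ) : field t3 (omega * z) = field t3 z := by
  simp [field, mul_pow, omega_cube, norm_omega]

lemma integrable_field {μ : Measure ℂ} [IsFiniteMeasure μ] {x : ℝ} (hx : 0 < x)
    (hμ : μ (Sigma1 x)ᶜ = 0) (t3 : ℝ) : Integrable (field t3) μ := by
  refine Integrable.of_bound (measurable_field t3).aestronglyMeasurable
    (|2 / (3 * √t3)| * x ^ (3 / 2 : ℝ) + |t3 / 3| * x ^ 3) ?_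
  have hmem : ∀ᵐ s ∂μ, s ∈ Sigma1 x := hμ
  filter_upwards [hmem] with s hs
  have := norm_le_of_mem_Sigma1 hx hs
  unfold field
  refine (norm_sub_le _ _).trans ?_
  rw [norm_mul, norm_mul, norm_eq_abs (2 / (3 * √t3)), norm_eq_abs (t3 / 3)]; gcongr
  · rw [norm_of_nonneg (by positivity)]; gcongr
  · rw [norm_eq_abs]
    refine (abs_re_le_norm _).trans ?_
    rw [norm_pow]; gcongr

lemma integral_field_symmetrize {μ : Measure ℂ} [IsFiniteMeasure μ] {x : ℝ} (hx : 0 < x)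
    (hμ : μ (Sigma1 x)ᶜ = 0) (t3 : ℝ) :
    ∫ z, field t3 z ∂(symmetrize μ) = ∫ z, field t3 z ∂μ := by
  have hi := integrable_field hx hμ t3
  have hm : AEStronglyMeasurable (field t3) (μ.map fun z => omega * z) :=
    (measurable_field t3).aestronglyMeasurable
  have hm2 : AEStronglyMeasurable (field t3) ((μ.map fun z => omega * z).map fun z => omega * z) :=
    (measurable_field t3).aestronglyMeasurable
  have i1 : Integrable (field t3) (μ.map fun z => omega * z) := by
    rw [integrable_map_measure hm measurable_omega_mul.aemeasurable]
    exact hi.congr (ae_of_all _ fun z => (field_omega t3 z).symm)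
  have i2 : Integrable (field t3) ((μ.map fun z => omega * z).map fun z => omega * z) := by
    rw [integrable_map_measure hm2 measurable_omega_mul.aemeasurable]
    exact i1.congr (ae_of_all _ fun z => (field_omega t3 z).symm)
  have j1 : ∫ z, field t3 z ∂(μ.map fun z => omega * z) = ∫ z, field t3 z ∂μ := by
    rw [integral_map measurable_omega_mul.aemeasurable hm]
    simp_rw [field_omega]
  have j2 : ∫ z, field t3 z ∂((μ.map fun z => omega * z).map fun z => omega * z) =
      ∫ z, field t3 z ∂μ := by
    rw [integral_map measurable_omega_mul.aemeasurable hm2]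
    simp_rw [field_omega]
    exact j1
  unfold symmetrize
  rw [integral_smul_measure, integral_add_measure (hi.add_measure i1) i2,
    integral_add_measure hi i1, j1, j2]
  simp; ring

lemma energy_eq_field (t0 t3 : ℝ) (μ1 μ2 : Measure ℂ) :
    energy t0 t3 μ1 μ2 = logEnergy μ1 μ1 + logEnergy μ2 μ2 - logEnergy μ1 μ2 +
      1 / t0 * ∫ z, field t3 z ∂μ1 := rfl

lemma isAdmissible_halfBalayage {μ : Measure ℂ} {x : ℝ} (hfin : IsLogFinite μ)
    (hmass : μ univ = 1) (hμ : μ (Sigma1 x)ᶜ = 0) :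
    IsAdmissible x μ (halfBalayage μ) := by
  have := hfin.finite
  have hb := hfin.balayage
  exact
    { mass1 := hmass
      supp1 := support_subset_of_measure_compl (isClosed_Sigma1 x) hμ
      mass2 := by rw [halfBalayage_univ, hmass, mul_one, one_div]
      supp2 := support_subset_of_measure_compl isClosed_Sigma2 (halfBalayage_compl_Sigma2 hμ)
      finite11 := hfin.hasFiniteLogEnergy hfin
      finite22 := hb.hasFiniteLogEnergy hb
      finite12 := hfin.hasFiniteLogEnergy hb }

lemma IsAdmissible.isLogFinite {x : ℝ} {μ1 μ2 : Measure ℂ} (h : IsAdmissible x μ1 μ2) :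
    IsLogFinite μ1 ∧ IsLogFinite μ2 := by
  have : IsFiniteMeasure μ1 := ⟨by rw [h.mass1]; simp⟩
  have : IsFiniteMeasure μ2 := ⟨by rw [h.mass2]; simp⟩
  exact ⟨h.finite11.isLogFinite, h.finite22.isLogFinite⟩

/-- The energy of a pair exceeds that of the symmetrised pair by two squared distances. -/
lemma IsAdmissible.energy_sub_eq {t0 t3 x : ℝ} (hx : 0 < x) {μ1 μ2 : Measure ℂ}
    (h : IsAdmissible x μ1 μ2) :
    energy t0 t3 μ1 μ2 - energy t0 t3 (symmetrize μ1) (halfBalayage (symmetrize μ1)) =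
      3 / 4 * energyDist μ1 (symmetrize μ1) + energyDist (μ2 + (2⁻¹ : ℝ≥0∞) • symmetrize μ1)
          (halfBalayage (symmetrize μ1) + (2⁻¹ : ℝ≥0∞) • μ1) := by
  obtain ⟨f1, f2⟩ := h.isLogFinite
  have := f1.finite
  have := f2.finite
  have hμ := measure_compl_of_support_subset h.supp1
  have hμ2 := measure_compl_of_support_subset h.supp2
  have fm := f1.symmetrize
  have := fm.finite
  have fn := fm.balayage
  have := fn.finite
  have hr := rotInv_symmetrize μ1
  have hm := symmetrize_compl_Sigma1 hμ
  rw [energy_eq_field, energy_eq_field, integral_field_symmetrize hx hμ]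
  have := hr.logEnergy_symmetrize f1 fm
  have a2 := hr.balayage.logEnergy_symmetrize f1 fn
  have := hr.two_mul_logEnergy_halfBalayage fm hm f2 hμ2
  have := hr.two_mul_logEnergy_halfBalayage fm hm fn (halfBalayage_compl_Sigma2 hm)
  have two : (2⁻¹ : ℝ≥0∞) ≠ ⊤ := by simp
  set m := symmetrize μ1
  set n := halfBalayage m
  have hf1 := f1.smul two
  have hfm := fm.smul two
  have := hf1.finite
  have := hfm.finite
  unfold energyDist
  rw [logEnergy_add_left f2 hfm (f2.add hfm), logEnergy_add_right f2 hfm f2,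
    logEnergy_add_right f2 hfm hfm, logEnergy_add_left fn hf1 (fn.add hf1),
    logEnergy_add_right fn hf1 fn, logEnergy_add_right fn hf1 hf1,
    logEnergy_add_left f2 hfm (fn.add hf1), logEnergy_add_right fn hf1 f2,
    logEnergy_add_right fn hf1 hfm]
  simp only [logEnergy_smul_left, logEnergy_smul_right, toReal_inv, toReal_ofNat]
  rw [logEnergy_comm m μ2, logEnergy_comm μ1 n, logEnergy_comm m n, logEnergy_comm m μ1,
    logEnergy_comm μ1 μ2]
  rw [logEnergy_comm m n, logEnergy_comm μ1 n] at a2; linarith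

/-- Symmetry of the minimiser, from the strict convexity of the energy. -/
theorem IsEquilibriumPair.rotInv_and_eq {t0 t3 x : ℝ} (hx : 0 < x) {μ1 μ2 : Measure ℂ}
    (h : IsEquilibriumPair t0 t3 x μ1 μ2) : RotInv μ1 ∧ μ2 = halfBalayage μ1 := by
  obtain ⟨hadm, hmin⟩ := h
  obtain ⟨f1, f2⟩ := hadm.isLogFinite
  have := f1.finite
  have := f2.finite
  have hμ := measure_compl_of_support_subset hadm.supp1
  have fm := f1.symmetrize
  have := fm.finite
  have fn := fm.balayage
  have := fn.finite
  have hm := symmetrize_compl_Sigma1 hμ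
  have hmass : symmetrize μ1 univ = 1 := by rw [symmetrize_univ, hadm.mass1]
  have := hmin _ _ (isAdmissible_halfBalayage fm hmass hm)
  have := hadm.energy_sub_eq (t0 := t0) (t3 := t3) hx
  have two : (2⁻¹ : ℝ≥0∞) ≠ ⊤ := by simp
  have g1 := f2.add (fm.smul two)
  have g2 := fn.add (f1.smul two)
  have := g1.finite
  have := g2.finite
  have := (f1.smul two).finite
  have m1 : μ1 univ = symmetrize μ1 univ := (symmetrize_univ μ1).symm
  have m2 : (μ2 + (2⁻¹ : ℝ≥0∞) • symmetrize μ1) univ =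
      (halfBalayage (symmetrize μ1) + (2⁻¹ : ℝ≥0∞) • μ1) univ := by
    simp only [Measure.add_apply, Measure.smul_apply, hmass, hadm.mass1, hadm.mass2,
      halfBalayage_univ, smul_eq_mul, one_div, mul_one]
  have := energyDist_nonneg (f1.hasFiniteLogEnergy f1) (fm.hasFiniteLogEnergy fm)
    (f1.hasFiniteLogEnergy fm) m1
  have := energyDist_nonneg (g1.hasFiniteLogEnergy g1) (g2.hasFiniteLogEnergy g2)
    (g1.hasFiniteLogEnergy g2) m2
  have e1 := eq_of_energyDist_nonpos (f1.hasFiniteLogEnergy f1) (fm.hasFiniteLogEnergy fm)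
    (f1.hasFiniteLogEnergy fm) m1 (by linarith)
  have e2 := eq_of_energyDist_nonpos (g1.hasFiniteLogEnergy g1) (g2.hasFiniteLogEnergy g2)
    (g1.hasFiniteLogEnergy g2) m2 (by linarith)
  refine ⟨?_, ?_⟩
  · unfold RotInv
    rw [e1]
    exact rotInv_symmetrize μ1
  · rw [← e1] at e2
    ext s hs
    have := congrArg (fun κ : Measure ℂ => κ s) e2
    simp only [Measure.add_apply] at this
    exact (ENNReal.add_left_inj (measure_ne_top _ _)).1 this

/-! ### The radial law and the Cauchy transforms -/

/-- The coordinate `|s| ^ (3 / 2)` on `Σ₁`, whose square is `s³`. -/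
def rad (s : ℂ) : ℝ := ‖s‖ ^ (3 / 2 : ℝ)

lemma continuous_rad : Continuous rad := by
  unfold rad
  exact continuous_norm.rpow_const fun _ => Or.inr (by norm_num)

@[fun_prop]
lemma measurable_rad : Measurable rad := continuous_rad.measurable

lemma rad_nonneg (s : ℂ) : 0 ≤ rad s := by unfold rad; positivity

lemma rpow_three_halves_sq {r : ℝ} (hr : 0 ≤ r) : (r ^ (3 / 2 : ℝ)) ^ 2 = r ^ 3 := by
  rw [← rpow_natCast, ← rpow_mul hr, ← rpow_natCast]; norm_num

lemma rad_sq (s : ℂ) : rad s ^ 2 = ‖s‖ ^ 3 := rpow_three_halves_sq (norm_nonneg s)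

lemma rad_pos {s : ℂ} (hs : s ≠ 0) : 0 < rad s := Real.rpow_pos_of_pos (norm_pos_iff.2 hs) _

lemma cube_eq_rad_sq {x : ℝ} {s : ℂ} (hs : s ∈ Sigma1 x) : s ^ 3 = (rad s : ℂ) ^ 2 := by
  rw [cube_of_mem_Sigma1 hs, ← rad_sq]; push_cast; rfl

/-- The law of `rad` under `μ`. -/
def radialLaw (μ : Measure ℂ) : Measure ℝ := μ.map rad

instance (μ : Measure ℂ) [IsProbabilityMeasure μ] : IsProbabilityMeasure (radialLaw μ) :=
  Measure.isProbabilityMeasure_map measurable_rad.aemeasurable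

lemma radialLaw_compl_Icc {μ : Measure ℂ} {x : ℝ} (hx : 0 < x) (hμ : μ (Sigma1 x)ᶜ = 0) :
    radialLaw μ (Icc 0 (x ^ (3 / 2 : ℝ)))ᶜ = 0 := by
  rw [radialLaw, Measure.map_apply measurable_rad measurableSet_Icc.compl]
  refine measure_mono_null ?_ hμ
  intro s hs hs1
  refine hs ⟨rad_nonneg s, ?_⟩
  have := norm_le_of_mem_Sigma1 hx hs1
  unfold rad; gcongr

lemma radialLaw_singleton {μ : Measure ℂ} {x : ℝ} (hμ : μ (Sigma1 x)ᶜ = 0)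
    (h0 : ∀ a : ℂ, μ {a} = 0) (y : ℝ) : radialLaw μ {y} = 0 := by
  rw [radialLaw, Measure.map_apply measurable_rad (measurableSet_singleton y)]
  have h1 := ae_cube_ne h0 (y ^ 2)
  have hmem : ∀ᵐ s ∂μ, s ∈ Sigma1 x := hμ
  have h2 : ∀ᵐ s ∂μ, rad s ≠ y := by
    filter_upwards [h1, hmem] with s hs hs1 hy
    rw [cube_eq_rad_sq hs1, hy] at hs
    exact hs rfl
  exact measure_eq_zero_iff_ae_notMem.2 h2

lemma radialLaw_pos_of_isOpen {μ : Measure ℂ} {x : ℝ} (hx : 0 < x) (hsupp : μ.support = Sigma1 x)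
    {U : Set ℝ} (hU : IsOpen U) {y : ℝ} (hy : y ∈ U) (hy0 : 0 ≤ y) (hyX : y ≤ x ^ (3 / 2 : ℝ)) :
    0 < radialLaw μ U := by
  rw [radialLaw, Measure.map_apply measurable_rad hU.measurableSet]
  set r : ℝ := y ^ (2 / 3 : ℝ) with hr
  have hr0 : 0 ≤ r := by positivity
  have hrad : rad r = y := by
    unfold rad
    rw [norm_real, norm_of_nonneg hr0, hr, ← rpow_mul hy0]; norm_num
  have : r ≤ x := by
    have : y ^ (2 / 3 : ℝ) ≤ (x ^ (3 / 2 : ℝ)) ^ (2 / 3 : ℝ) := by gcongr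
    rwa [← rpow_mul hx.le, show (3 / 2 * (2 / 3) : ℝ) = 1 by norm_num, Real.rpow_one] at this
  have hmem : (r : ℂ) ∈ μ.support := by
    rw [hsupp]
    exact ⟨r ^ 3, by positivity, by gcongr, by push_cast; rfl⟩
  rw [Measure.mem_support_iff_forall] at hmem
  refine hmem _ ((hU.preimage continuous_rad).mem_nhds ?_)
  simpa [hrad] using hy

lemma integrable_one_div_sub {α : Type*} [MeasurableSpace α] {μ : Measure α} [IsFiniteMeasure μ]
    {f : α → ℂ} (hf : Measurable f) {S : Set ℂ} (hS : IsClosed S) (hfS : ∀ᵐ a ∂μ, f a ∈ S) {z : ℂ}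
    (hz : z ∉ S) : Integrable (fun a => 1 / (z - f a)) μ := by
  obtain ⟨δ, hδ, hb⟩ := Metric.isOpen_iff.1 hS.isOpen_compl z hz
  refine Integrable.of_bound
    (measurable_const.div (measurable_const.sub hf)).aestronglyMeasurable (1 / δ) ?_
  filter_upwards [hfS] with a ha
  rw [norm_div, norm_one]
  refine one_div_le_one_div_of_le hδ ?_
  by_contra hlt
  have hmem : f a ∈ Metric.ball z δ := by
    rw [Metric.mem_ball, dist_comm, dist_eq_norm]
    exact not_le.1 hlt
  exact hb hmem ha

/-- The Cauchy transform of a measure on the line. -/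
def stieltjes (m : Measure ℝ) (v : ℂ) : ℂ := ∫ y, 1 / (v - y) ∂m

/-- The interval `[0, X]` as a set of complex numbers. -/
def segC (X : ℝ) : Set ℂ := Complex.ofReal '' Icc 0 X

lemma isClosed_segC (X : ℝ) : IsClosed (segC X) :=
  isometry_ofReal.isClosedEmbedding.isClosedMap _ isClosed_Icc

lemma ae_mem_segC {m : Measure ℝ} {X : ℝ} (h : m (Icc (0 : ℝ) X)ᶜ = 0) :
    ∀ᵐ y : ℝ ∂m, (y : ℂ) ∈ segC X := by
  have : ∀ᵐ y ∂m, y ∈ Icc (0 : ℝ) X := h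
  filter_upwards [this] with y hy using Set.mem_image_of_mem _ hy

lemma integrable_stieltjes {m : Measure ℝ} [IsFiniteMeasure m] {X : ℝ}
    (h : m (Icc (0 : ℝ) X)ᶜ = 0) {v : ℂ} (hv : v ∉ segC X) :
    Integrable (fun y : ℝ => 1 / (v - y)) m :=
  integrable_one_div_sub (f := Complex.ofReal) (by fun_prop) (isClosed_segC X) (ae_mem_segC h) hv

lemma sum_inv_rotation {z s : ℂ} (h : z ^ 3 ≠ s ^ 3) :
    1 / (z - s) + 1 / (z - omega * s) + 1 / (z - omega ^ 2 * s) =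
      3 * z ^ 2 * (1 / (z ^ 3 - s ^ 3)) := by
  have h0 : (z - s) * (z - omega * s) * (z - omega ^ 2 * s) ≠ 0 := by
    rw [prod_sub_omega]; exact sub_ne_zero.2 h
  have h1 := left_ne_zero_of_mul (left_ne_zero_of_mul h0)
  have h2 := right_ne_zero_of_mul (left_ne_zero_of_mul h0)
  have h3 := right_ne_zero_of_mul h0
  have e : ∀ a b c : ℂ, a ≠ 0 → b ≠ 0 → c ≠ 0 →
      1 / a + 1 / b + 1 / c = (b * c + a * c + a * b) * (1 / (a * b * c)) := by
    intro a b c ha hb hc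
    field_simp
  rw [← prod_sub_omega, e _ _ _ h1 h2 h3]; congr 1
  linear_combination (-2 * z * s + omega * s ^ 2) * omega_quadratic

lemma RotInv.cauchyTransform_eq {μ : Measure ℂ} (h : RotInv μ) [IsFiniteMeasure μ] {S : Set ℂ}
    (hS : IsClosed S) (hμ : μ Sᶜ = 0) {z : ℂ} (hz : z ∉ S) (hne : ∀ᵐ s ∂μ, z ^ 3 ≠ s ^ 3) :
    cauchyTransform μ z = z ^ 2 * ∫ s, 1 / (z ^ 3 - s ^ 3) ∂μ := by
  have hmem : ∀ᵐ s ∂μ, id s ∈ S := hμ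
  have h1 := h.integral_eq_third (integrable_one_div_sub measurable_id hS hmem hz)
  have h2 : ∫ s, (1 / (z - id s) + 1 / (z - id (omega * s)) + 1 / (z - id (omega ^ 2 * s))) ∂μ =
      ∫ s, 3 * z ^ 2 * (1 / (z ^ 3 - s ^ 3)) ∂μ := by
    refine integral_congr_ae ?_
    filter_upwards [hne] with s hs using sum_inv_rotation hs
  rw [h2, integral_const_mul] at h1
  unfold cauchyTransform
  simp only [id, real_smul] at h1
  push_cast at h1
  linear_combination h1 / 3

lemma not_mem_segC_of_sq {x : ℝ} (hx : 0 < x) {z q : ℂ} (hq : q ^ 2 = z) (hz : z ∉ Sigma1 x) :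
    q ^ 3 ∉ segC (x ^ (3 / 2 : ℝ)) ∧ -q ^ 3 ∉ segC (x ^ (3 / 2 : ℝ)) := by
  have key : ∀ w : ℂ, w ^ 2 = z ^ 3 → w ∉ segC (x ^ (3 / 2 : ℝ)) := by
    rintro w hw ⟨y, ⟨h0, h1⟩, rfl⟩
    refine hz ⟨y ^ 2, by positivity, ?_, ?_⟩
    · rw [← rpow_three_halves_sq hx.le]; gcongr
    · rw [← hw]; push_cast; rfl
  exact ⟨key _ (by rw [← hq]; ring), key _ (by rw [← hq]; ring)⟩

/-- The Cauchy transform of a rotation-invariant measure on `Σ₁`. -/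
lemma RotInv.cauchyTransform_fst {μ : Measure ℂ} (h : RotInv μ) [IsFiniteMeasure μ] {x : ℝ}
    (hx : 0 < x) (hμ : μ (Sigma1 x)ᶜ = 0) {z q : ℂ} (hq : q ^ 2 = z) (hz : z ∉ Sigma1 x) :
    cauchyTransform μ z =
      q * (stieltjes (radialLaw μ) (q ^ 3) - stieltjes (radialLaw μ) (-q ^ 3)) / 2 := by
  have hmem : ∀ᵐ s ∂μ, s ∈ Sigma1 x := hμ
  have hz3 : ∀ s ∈ Sigma1 x, z ^ 3 ≠ s ^ 3 := by
    rintro s ⟨r, h0, h1, h2⟩ h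
    exact hz ⟨r, h0, h1, by rw [h, h2]⟩
  have : q ≠ 0 := by
    rintro rfl
    exact hz ⟨0, le_rfl, by positivity, by rw [← hq]; norm_num⟩
  have : IsFiniteMeasure (radialLaw μ) := Measure.isFiniteMeasure_map _ _
  obtain ⟨n1, n2⟩ := not_mem_segC_of_sq hx hq hz
  have i1 := integrable_stieltjes (radialLaw_compl_Icc hx hμ) n1
  have i2 := integrable_stieltjes (radialLaw_compl_Icc hx hμ) n2
  rw [h.cauchyTransform_eq (isClosed_Sigma1 x) hμ hz (by
    filter_upwards [hmem] with s hs using hz3 s hs)]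
  unfold stieltjes
  rw [← integral_sub i1 i2]
  unfold radialLaw
  rw [integral_map measurable_rad.aemeasurable (by fun_prop),
    mul_div_right_comm, ← integral_const_mul, ← integral_const_mul]
  refine integral_congr_ae ?_
  filter_upwards [hmem] with s hs
  have e0 := hz3 s hs
  have hz3' : z ^ 3 = q ^ 3 * q ^ 3 := by rw [← hq]; ring
  rw [hz3', cube_eq_rad_sq hs, ← sub_ne_zero,
    show q ^ 3 * q ^ 3 - (rad s : ℂ) ^ 2 = (q ^ 3 - rad s) * (q ^ 3 + rad s) by ring] at e0
  have := left_ne_zero_of_mul e0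
  have e2 := right_ne_zero_of_mul e0
  have : -q ^ 3 - (rad s : ℂ) ≠ 0 := by
    rw [show -q ^ 3 - (rad s : ℂ) = -(q ^ 3 + rad s) by ring]; exact neg_ne_zero.2 e2
  rw [hz3', cube_eq_rad_sq hs,
    show q ^ 3 * q ^ 3 - (rad s : ℂ) ^ 2 = (q ^ 3 - rad s) * (q ^ 3 + rad s) by ring, ← hq,
    show -q ^ 3 - (rad s : ℂ) = -(q ^ 3 + rad s) by ring]
  field_simp; ring

/-- The Cauchy transform of half of the balayage. -/
lemma RotInv.cauchyTransform_snd {μ : Measure ℂ} (h : RotInv μ) (hf : IsLogFinite μ) {x : ℝ}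
    (hμ : μ (Sigma1 x)ᶜ = 0) {z q : ℂ} (hq : q ^ 2 = z) (hre : 0 < (q ^ 3).re)
    (hz : z ∉ Sigma2) :
    cauchyTransform (halfBalayage μ) z =
      -(q * stieltjes (radialLaw μ) (-q ^ 3) / 2) := by
  have := hf.finite
  have hf2 := hf.balayage
  have hs1 := (hf.hasFiniteLogEnergy hf).measure_singleton
  have hs2 := (hf2.hasFiniteLogEnergy hf2).measure_singleton
  have hmem : ∀ᵐ s ∂μ, s ∈ Sigma1 x := hμ
  have hne : ∀ᵐ s ∂μ, s ≠ 0 := by rw [ae_iff]; simpa using hs1 0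
  have hc2 := halfBalayage_compl_Sigma2 hμ
  have hz3' : z ^ 3 = (q ^ 3) ^ 2 := by rw [← hq]; ring
  have : q ≠ 0 := by
    rintro rfl
    norm_num at hre
  rw [h.balayage.cauchyTransform_eq isClosed_Sigma2 hc2 hz (ae_cube_ne hs2 _)]
  unfold halfBalayage
  have hmeas : Measurable fun s : ℂ => 1 / (z ^ 3 - s ^ 3) := by fun_prop
  have hint : Integrable (fun s : ℂ => 1 / (z ^ 3 - s ^ 3)) ((μ.prod circleUnif).map sweepMap) := by
    have hS : IsClosed (Complex.ofReal '' Set.Iic 0) :=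
      isometry_ofReal.isClosedEmbedding.isClosedMap _ isClosed_Iic
    refine integrable_one_div_sub (f := fun s : ℂ => s ^ 3) (by fun_prop) hS ?_ ?_
    · have : ((μ.prod circleUnif).map sweepMap) Sigma2ᶜ = 0 := by
        unfold halfBalayage at hc2
        simpa using hc2
      have hm2 : ∀ᵐ s ∂((μ.prod circleUnif).map sweepMap), s ∈ Sigma2 := this
      filter_upwards [hm2] with s ⟨r, h1, h2⟩
      exact ⟨r, h1, h2.symm⟩
    · rintro ⟨r, h1, h2⟩
      exact hz ⟨r, h1, h2.symm⟩
  have hint' := hint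
  rw [integrable_map_measure hmeas.aestronglyMeasurable measurable_sweepMap.aemeasurable] at hint'
  rw [integral_smul_measure, integral_map measurable_sweepMap.aemeasurable
    hmeas.aestronglyMeasurable]
  rw [show ∫ p, 1 / (z ^ 3 - sweepMap p ^ 3) ∂(μ.prod circleUnif) =
      ∫ s, ∫ ζ, 1 / (z ^ 3 - sweepMap (s, ζ) ^ 3) ∂circleUnif ∂μ from integral_prod _ hint']
  have inner : ∀ᵐ s ∂μ, ∫ ζ, 1 / (z ^ 3 - sweepMap (s, ζ) ^ 3) ∂circleUnif =
      1 / (q ^ 3 * (q ^ 3 + rad s)) := by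
    filter_upwards [hmem, hne] with s hs hs0
    rw [← integral_inv_cauchyRatio hre (rad_pos hs0)]; congr 1
    funext ζ
    rw [sweepMap_cube, cube_eq_rad_sq hs, hz3']; ring
  rw [integral_congr_ae inner]
  unfold stieltjes radialLaw
  rw [integral_map measurable_rad.aemeasurable (Measurable.aestronglyMeasurable (by fun_prop))]
  simp only [toReal_inv, toReal_ofNat, real_smul, Complex.ofReal_inv, Complex.ofReal_ofNat]
  rw [← integral_const_mul, ← integral_const_mul, mul_div_right_comm, ← integral_const_mul,
    ← integral_neg]
  congr 1
  funext s
  have : q ^ 3 + (rad s : ℂ) ≠ 0 := by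
    intro h0
    have := congrArg Complex.re h0
    simp only [add_re, ofReal_re, Complex.zero_re] at this
    linarith [rad_nonneg s]
  rw [show -q ^ 3 - (rad s : ℂ) = -(q ^ 3 + rad s) by ring, ← hq]; field_simp

/-- The square root of `z` whose cube has positive real part, for `z ∉ Σ₂`. -/
def qroot (z : ℂ) : ℂ := open Classical in if z ∈ S0 then z ^ (1 / 2 : ℂ) else -z ^ (1 / 2 : ℂ)

lemma cpow_half_sq (z : ℂ) : (z ^ (1 / 2 : ℂ)) ^ 2 = z := by
  rw [one_div]
  exact Complex.cpow_ofNat_inv_pow z 2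

lemma qroot_sq (z : ℂ) : qroot z ^ 2 = z := by
  unfold qroot
  split_ifs
  · exact cpow_half_sq z
  · rw [neg_sq, cpow_half_sq]

lemma re_cpow_half_cube {z : ℂ} (hz : z ≠ 0) : ((z ^ (1 / 2 : ℂ)) ^ 3).re =
    exp (3 / 2 * log ‖z‖) * Real.cos (3 / 2 * z.arg) := by
  rw [Complex.cpow_def_of_ne_zero hz, ← Complex.exp_nat_mul, Complex.exp_re]
  have h1 : (((3 : ℕ) : ℂ) * (Complex.log z * (1 / 2))).re = 3 / 2 * log ‖z‖ := by
    rw [show ((3 : ℕ) : ℂ) * (Complex.log z * (1 / 2)) = ((3 / 2 : ℝ) : ℂ) * Complex.log z by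
      push_cast; ring, re_ofReal_mul, Complex.log_re]
  have h2 : (((3 : ℕ) : ℂ) * (Complex.log z * (1 / 2))).im = 3 / 2 * z.arg := by
    rw [show ((3 : ℕ) : ℂ) * (Complex.log z * (1 / 2)) = ((3 / 2 : ℝ) : ℂ) * Complex.log z by
      push_cast; ring, im_ofReal_mul, Complex.log_im]
  rw [h1, h2]

lemma re_ne_zero_of_sq {z q : ℂ} (hq : q ^ 2 = z) (hz : z ∉ Sigma2) : (q ^ 3).re ≠ 0 := by
  intro h
  refine hz ⟨-(q ^ 3).im ^ 2, by nlinarith [sq_nonneg (q ^ 3).im], ?_⟩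
  have h1 : q ^ 3 = (q ^ 3).im * I := by apply Complex.ext <;> simp [h]
  rw [← hq, show (q ^ 2) ^ 3 = (q ^ 3) ^ 2 by ring, h1]
  simp only [mul_pow, I_sq]; push_cast; simp

lemma zero_mem_Sigma2 : (0 : ℂ) ∈ Sigma2 := ⟨0, le_rfl, by norm_num⟩

lemma re_qroot_cube_pos {z : ℂ} (hz : z ∉ Sigma2) : 0 < (qroot z ^ 3).re := by
  have hz0 : z ≠ 0 := by
    rintro rfl
    exact hz zero_mem_Sigma2
  refine lt_of_le_of_ne ?_ (re_ne_zero_of_sq (qroot_sq z) hz).symm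
  have := Real.pi_pos
  have hb := Complex.arg_mem_Ioc z
  unfold qroot
  split_ifs with h
  · obtain ⟨-, h1, h2⟩ := h
    rw [re_cpow_half_cube hz0]
    exact mul_nonneg (exp_pos _).le (Real.cos_nonneg_of_mem_Icc ⟨by linarith, by linarith⟩)
  · rw [show (-z ^ (1 / 2 : ℂ)) ^ 3 = -(z ^ (1 / 2 : ℂ)) ^ 3 by ring, neg_re,
      re_cpow_half_cube hz0, ← mul_neg]
    refine mul_nonneg (exp_pos _).le (neg_nonneg.2 ?_)
    by_cases hc : π / 3 ≤ z.arg
    · exact Real.cos_nonpos_of_pi_div_two_le_of_le (by linarith) (by linarith [hb.2])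
    · have : z.arg ≤ -(π / 3) := by
        by_contra hc3
        exact h ⟨hz0, not_le.1 hc3, not_le.1 hc⟩
      rw [← Real.cos_neg]
      exact Real.cos_nonpos_of_pi_div_two_le_of_le (by linarith) (by linarith [hb.1])

lemma eq_qroot_of_sq {z q : ℂ} (hq : q ^ 2 = z) (hre : 0 < (q ^ 3).re) (hz : z ∉ Sigma2) :
    q = qroot z := by
  rcases sq_eq_sq_iff_eq_or_eq_neg.1 (hq.trans (qroot_sq z).symm) with h | h
  · exact h
  · have := re_qroot_cube_pos hz
    rw [h, show (-qroot z) ^ 3 = -(qroot z) ^ 3 by ring, neg_re] at hre; linarith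

/-- The function `K(v) = t₃^{-1/2} - (t₀ / 2) ∫ dm(y) / (v - y)` with `m` the radial law. In the
coordinate `v = z^{3/2}` it carries all three functions `ξ`. -/
def Kfun (t0 t3 : ℝ) (m : Measure ℝ) (v : ℂ) : ℂ :=
  ((1 / √t3 : ℝ) : ℂ) - (t0 / 2 : ℂ) * stieltjes m v

section
variable {μ : Measure ℂ} {t0 t3 x : ℝ}

lemma xi_zero_eq (h : RotInv μ) [IsFiniteMeasure μ] (hx : 0 < x) (hμ : μ (Sigma1 x)ᶜ = 0)
    (ν : Measure ℂ) {z q : ℂ} (hq : q ^ 2 = z) (hz : z ∉ Sigma1 x) :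
    xi t0 t3 μ ν 0 z = q * (t3 * q ^ 3 - Kfun t0 t3 (radialLaw μ) (q ^ 3) +
      Kfun t0 t3 (radialLaw μ) (-q ^ 3)) := by
  simp only [xi, Matrix.cons_val_zero]
  rw [h.cauchyTransform_fst hx hμ hq hz, ← hq]; unfold Kfun; ring

lemma xi_one_eq (h : RotInv μ) (hf : IsLogFinite μ) (hx : 0 < x) (hμ : μ (Sigma1 x)ᶜ = 0)
    {z : ℂ} (hz : z ∉ Sigma1 x ∪ Sigma2) :
    xi t0 t3 μ (halfBalayage μ) 1 z =
      qroot z * Kfun t0 t3 (radialLaw μ) (qroot z ^ 3) := by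
  have := hf.finite
  simp only [Set.mem_union, not_or] at hz
  simp only [xi, Matrix.cons_val_one, Matrix.cons_val_zero]
  rw [h.cauchyTransform_fst hx hμ (qroot_sq z) hz.1,
    h.cauchyTransform_snd hf hμ (qroot_sq z) (re_qroot_cube_pos hz.2) hz.2]
  unfold Kfun
  by_cases hS : z ∈ S0
  · rw [if_pos hS, show qroot z = z ^ (1 / 2 : ℂ) from if_pos hS]
    unfold sqrtTerm; push_cast; ring
  · rw [if_neg hS, show qroot z = -z ^ (1 / 2 : ℂ) from if_neg hS]
    unfold sqrtTerm; push_cast; ring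

lemma xi_two_eq (h : RotInv μ) (hf : IsLogFinite μ) (hμ : μ (Sigma1 x)ᶜ = 0)
    {z : ℂ} (hz : z ∉ Sigma2) :
    xi t0 t3 μ (halfBalayage μ) 2 z =
      -(qroot z * Kfun t0 t3 (radialLaw μ) (-qroot z ^ 3)) := by
  have := hf.finite
  simp only [xi, Matrix.cons_val]
  rw [h.cauchyTransform_snd hf hμ (qroot_sq z) (re_qroot_cube_pos hz) hz]; unfold Kfun
  by_cases hS : z ∈ S0
  · rw [if_pos hS, show qroot z = z ^ (1 / 2 : ℂ) from if_pos hS]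
    unfold sqrtTerm; push_cast; ring
  · rw [if_neg hS, show qroot z = -z ^ (1 / 2 : ℂ) from if_neg hS]
    unfold sqrtTerm; push_cast; ring

end

/-! ### The energy in terms of the radial law -/

lemma integral_radialLaw_prod (κ μ : Measure ℂ) [IsFiniteMeasure κ] [IsFiniteMeasure μ]
    {f : ℝ × ℝ → ℝ} (hf : Measurable f) :
    ∫ p, f p ∂((radialLaw κ).prod (radialLaw μ)) =
      ∫ p : ℂ × ℂ, f (rad p.1, rad p.2) ∂(κ.prod μ) := by
  unfold radialLaw
  rw [Measure.map_prod_map _ _ measurable_rad measurable_rad,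
    integral_map (by fun_prop) hf.aestronglyMeasurable]
  rfl

lemma integrable_radialLaw_prod (κ μ : Measure ℂ) [IsFiniteMeasure κ] [IsFiniteMeasure μ]
    {f : ℝ × ℝ → ℝ} (hf : Measurable f) :
    Integrable f ((radialLaw κ).prod (radialLaw μ)) ↔
      Integrable (fun p : ℂ × ℂ => f (rad p.1, rad p.2)) (κ.prod μ) := by
  unfold radialLaw
  rw [Measure.map_prod_map _ _ measurable_rad measurable_rad,
    integrable_map_measure hf.aestronglyMeasurable (by fun_prop)]
  rfl

lemma ae_prod_of_forall {α β : Type*} [MeasurableSpace α] [MeasurableSpace β] {μ : Measure α}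
    {ν : Measure β} [SFinite ν] {p : α × β → Prop} (hp : MeasurableSet {q | p q})
    (h : ∀ᵐ a ∂μ, ∀ᵐ b ∂ν, p (a, b)) : ∀ᵐ q ∂(μ.prod ν), p q :=
  (Measure.ae_prod_iff_ae_ae hp).2 h

lemma ae_prod_and {α β : Type*} [MeasurableSpace α] [MeasurableSpace β] {μ : Measure α}
    {ν : Measure β} [SFinite ν] {p : α → Prop} {q : β → Prop} (hp : ∀ᵐ a ∂μ, p a)
    (hq : ∀ᵐ b ∂ν, q b) : ∀ᵐ r ∂(μ.prod ν), p r.1 ∧ q r.2 :=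
  (Measure.quasiMeasurePreserving_fst.ae hp).and (Measure.quasiMeasurePreserving_snd.ae hq)

lemma RotInv.three_mul_logEnergy {κ ν : Measure ℂ} (h : RotInv ν) (hκ : IsLogFinite κ)
    (hν : IsLogFinite ν) :
    Integrable (fun p : ℂ × ℂ => log ‖p.1 ^ 3 - p.2 ^ 3‖) (κ.prod ν) ∧
      3 * logEnergy κ ν = -∫ p : ℂ × ℂ, log ‖p.1 ^ 3 - p.2 ^ 3‖ ∂(κ.prod ν) := by
  have := hκ.finite
  have := hν.finite
  have hf := hκ.hasFiniteLogEnergy hν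
  have hs := (hν.hasFiniteLogEnergy hν).measure_singleton
  have i0 : Integrable (fun p : ℂ × ℂ => log ‖p.1 - p.2‖) (κ.prod ν) :=
    hf.2.neg.congr (ae_of_all _ fun p => by simp [log_inv])
  have hm : MeasurePreserving (fun p : ℂ × ℂ => (p.1, omega * p.2)) (κ.prod ν) (κ.prod ν) :=
    (MeasurePreserving.id κ).prod ⟨measurable_omega_mul, h⟩
  have i1 : Integrable (fun p : ℂ × ℂ => log ‖p.1 - omega * p.2‖) (κ.prod ν) :=
    hm.integrable_comp_of_integrable i0
  have i2 : Integrable (fun p : ℂ × ℂ => log ‖p.1 - omega ^ 2 * p.2‖) (κ.prod ν) := by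
    refine (hm.integrable_comp_of_integrable i1).congr (ae_of_all _ fun p => ?_)
    simp only [Function.comp]
    congr 3; ring
  have e1 : ∫ p : ℂ × ℂ, log ‖p.1 - omega * p.2‖ ∂(κ.prod ν) =
      ∫ p : ℂ × ℂ, log ‖p.1 - p.2‖ ∂(κ.prod ν) := by
    have := integral_map (μ := κ.prod ν) (φ := fun p : ℂ × ℂ => (p.1, omega * p.2))
      (f := fun p : ℂ × ℂ => log ‖p.1 - p.2‖) (by fun_prop)
      (Measurable.aestronglyMeasurable (by fun_prop))
    rw [hm.map_eq] at this
    exact this.symm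
  have e2 : ∫ p : ℂ × ℂ, log ‖p.1 - omega ^ 2 * p.2‖ ∂(κ.prod ν) =
      ∫ p : ℂ × ℂ, log ‖p.1 - p.2‖ ∂(κ.prod ν) := by
    rw [← e1]
    have := integral_map (μ := κ.prod ν) (φ := fun p : ℂ × ℂ => (p.1, omega * p.2))
      (f := fun p : ℂ × ℂ => log ‖p.1 - omega * p.2‖) (by fun_prop)
      (Measurable.aestronglyMeasurable (by fun_prop))
    rw [hm.map_eq] at this
    rw [this]; congr 1
    funext p
    congr 3; ring
  have hae : ∀ᵐ p : ℂ × ℂ ∂(κ.prod ν), log ‖p.1 - p.2‖ + log ‖p.1 - omega * p.2‖ +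
      log ‖p.1 - omega ^ 2 * p.2‖ = log ‖p.1 ^ 3 - p.2 ^ 3‖ := by
    have : ∀ᵐ p : ℂ × ℂ ∂(κ.prod ν), p.1 ^ 3 ≠ p.2 ^ 3 :=
      ae_prod_of_forall (measurableSet_eq_fun (by fun_prop) (by fun_prop)).compl
        (ae_of_all _ fun w => ae_cube_ne hs (w ^ 3))
    filter_upwards [this] with p hp using rotation_log_sum hp
  have i01 : Integrable (fun p : ℂ × ℂ => log ‖p.1 - p.2‖ + log ‖p.1 - omega * p.2‖)
    (κ.prod ν) := i0.add i1
  refine ⟨(i01.add i2).congr hae, ?_⟩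
  rw [← integral_congr_ae hae, integral_add i01 i2, integral_add i0 i1, e1, e2]
  unfold logEnergy
  simp only [one_div, log_inv, integral_neg]; ring

lemma norm_cube_sub_cube {x : ℝ} {w s : ℂ} (hw : w ∈ Sigma1 x) (hs : s ∈ Sigma1 x) :
    ‖w ^ 3 - s ^ 3‖ = |rad w ^ 2 - rad s ^ 2| := by
  rw [cube_eq_rad_sq hw, cube_eq_rad_sq hs, ← norm_eq_abs, ← norm_real]; congr 1; push_cast; rfl

lemma ae_mem_Sigma1 {μ : Measure ℂ} {x : ℝ} (hμ : μ (Sigma1 x)ᶜ = 0) : ∀ᵐ s ∂μ, s ∈ Sigma1 x := hμ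

/-- The energy `I(μ)` of a rotation-invariant measure on `Σ₁` in terms of its radial law. -/
lemma RotInv.three_mul_logEnergy_radial {κ : Measure ℂ} (h : RotInv κ) (hκ : IsLogFinite κ) {x : ℝ}
    (hκ1 : κ (Sigma1 x)ᶜ = 0) :
    Integrable (fun p : ℝ × ℝ => log |p.1 ^ 2 - p.2 ^ 2|) ((radialLaw κ).prod (radialLaw κ)) ∧
      3 * logEnergy κ κ =
        -∫ p, log |p.1 ^ 2 - p.2 ^ 2| ∂((radialLaw κ).prod (radialLaw κ)) := by
  have := hκ.finite
  obtain ⟨i, e⟩ := h.three_mul_logEnergy hκ hκ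
  have hm := ae_mem_Sigma1 hκ1
  have hae : ∀ᵐ p : ℂ × ℂ ∂(κ.prod κ), log ‖p.1 ^ 3 - p.2 ^ 3‖ =
      log |rad p.1 ^ 2 - rad p.2 ^ 2| := by
    filter_upwards [ae_prod_and hm hm] with p hp
    rw [norm_cube_sub_cube hp.1 hp.2]
  have hmeas : Measurable fun p : ℝ × ℝ => log |p.1 ^ 2 - p.2 ^ 2| := by simp_rw [log_abs]; fun_prop
  rw [integrable_radialLaw_prod _ _ hmeas, integral_radialLaw_prod _ _ hmeas, e,
    integral_congr_ae hae]
  exact ⟨i.congr hae, rfl⟩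

/-- The mutual energy with half of the balayage, in terms of the radial laws. -/
lemma RotInv.three_mul_logEnergy_halfBalayage {κ μ : Measure ℂ} (hμ : RotInv μ)
    (fκ : IsLogFinite κ) (fμ : IsLogFinite μ) {x : ℝ} (hκ1 : κ (Sigma1 x)ᶜ = 0)
    (hμ1 : μ (Sigma1 x)ᶜ = 0)
    (hi : Integrable (fun p : ℝ × ℝ => log (p.1 + p.2)) ((radialLaw κ).prod (radialLaw μ))) :
    3 * logEnergy κ (halfBalayage μ) =
      -∫ p, log (p.1 + p.2) ∂((radialLaw κ).prod (radialLaw μ)) := by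
  have := fκ.finite
  have := fμ.finite
  have hsκ := (fκ.hasFiniteLogEnergy fκ).measure_singleton
  have hsμ := (fμ.hasFiniteLogEnergy fμ).measure_singleton
  obtain ⟨i, e⟩ := hμ.balayage.three_mul_logEnergy fκ fμ.balayage
  have hneκ : ∀ᵐ s ∂κ, s ≠ 0 := by rw [ae_iff]; simpa using hsκ 0
  have hneμ : ∀ᵐ s ∂μ, s ≠ 0 := by rw [ae_iff]; simpa using hsμ 0
  have hmeas : Measurable fun p : ℝ × ℝ => log (p.1 + p.2) := by fun_prop
  rw [integrable_radialLaw_prod _ _ hmeas] at hi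
  rw [integral_radialLaw_prod _ _ hmeas, e, integral_prod _ i, integral_prod _ hi]; congr 1
  refine integral_congr_ae ?_
  filter_upwards [ae_mem_Sigma1 hκ1, hneκ, i.prod_right_ae] with w hw hw0 hiw
  have hm : Measurable fun s : ℂ => log ‖w ^ 3 - s ^ 3‖ := by fun_prop
  unfold halfBalayage at hiw ⊢
  rw [integrable_smul_measure (by simp) (by simp),
    integrable_map_measure hm.aestronglyMeasurable measurable_sweepMap.aemeasurable] at hiw
  rw [integral_smul_measure, integral_map measurable_sweepMap.aemeasurable hm.aestronglyMeasurable]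
  rw [show ∫ p, log ‖w ^ 3 - sweepMap p ^ 3‖ ∂(μ.prod circleUnif) =
      ∫ s, ∫ ζ, log ‖w ^ 3 - sweepMap (s, ζ) ^ 3‖ ∂circleUnif ∂μ from integral_prod _ hiw]
  have inner : ∀ᵐ s ∂μ, ∫ ζ, log ‖w ^ 3 - sweepMap (s, ζ) ^ 3‖ ∂circleUnif =
      2 * log (rad w + rad s) := by
    filter_upwards [ae_mem_Sigma1 hμ1, hneμ] with s hs hs0
    rw [← integral_log_cauchyRatio' (rad_pos hw0) (rad_pos hs0)]; congr 1
    funext ζ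
    have hp : 0 ≤ rad w ^ 2 + rad s ^ 2 * cauchyRatio ζ ^ 2 := by positivity
    rw [sweepMap_cube, cube_eq_rad_sq hs, cube_eq_rad_sq hw, ← abs_of_nonneg hp,
      ← norm_eq_abs, ← norm_real]
    congr 2; push_cast; ring
  rw [integral_congr_ae inner, integral_const_mul]; simp

lemma integral_field_eq {κ : Measure ℂ} {x : ℝ} (hκ1 : κ (Sigma1 x)ᶜ = 0) (t3 : ℝ) :
    ∫ z, field t3 z ∂κ = ∫ y, (2 / (3 * √t3) * y - t3 / 3 * y ^ 2) ∂(radialLaw κ) := by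
  unfold radialLaw
  rw [integral_map measurable_rad.aemeasurable (by fun_prop)]
  refine integral_congr_ae ?_
  filter_upwards [ae_mem_Sigma1 hκ1] with s hs
  unfold field
  rw [cube_eq_rad_sq hs, ← ofReal_pow, ofReal_re]; rfl

lemma tailKer_anti {r s : ℝ} (hr : 0 ≤ r) (h : r ≤ s) : tailKer s ≤ tailKer r := by
  unfold tailKer
  refine setLIntegral_mono_ae (by fun_prop) (ae_of_all _ fun t ht => ?_)
  have : (0 : ℝ) < t := lt_trans one_pos ht
  refine ofReal_le_ofReal ?_
  gcongr ?_ / _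
  refine exp_le_exp.2 ?_
  have : r ^ 2 ≤ s ^ 2 := by gcongr
  nlinarith

/-- A measure on `Σ₁` has finite energy as soon as the energy of its radial law is finite. -/
lemma isLogFinite_of_radial {μ : Measure ℂ} [IsFiniteMeasure μ] {x : ℝ} (hx : 0 < x)
    (hμ : μ (Sigma1 x)ᶜ = 0)
    (hi : Integrable (fun p : ℝ × ℝ => log |p.1 ^ 2 - p.2 ^ 2|) ((radialLaw μ).prod (radialLaw μ)))
    (h0 : ∀ y, radialLaw μ {y} = 0) : IsLogFinite μ := by
  have : IsFiniteMeasure (radialLaw μ) := Measure.isFiniteMeasure_map _ _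
  have hm := ae_mem_Sigma1 hμ
  refine ⟨inferInstance, ?_, ?_⟩
  · have hmeas : Measurable fun p : ℝ × ℝ => log |p.1 ^ 2 - p.2 ^ 2| := by
      simp_rw [log_abs]; fun_prop
    rw [integrable_radialLaw_prod _ _ hmeas] at hi
    have hne : ∀ᵐ p : ℂ × ℂ ∂(μ.prod μ), rad p.1 ≠ rad p.2 := by
      refine ae_prod_of_forall (measurableSet_eq_fun (by fun_prop) (by fun_prop)).compl
        (ae_of_all _ fun w => ?_)
      have := h0 (rad w)
      unfold radialLaw at this
      rw [Measure.map_apply measurable_rad (measurableSet_singleton _)] at this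
      filter_upwards [measure_eq_zero_iff_ae_notMem.1 this] with s hs h
      exact hs h.symm
    set c : ℝ := 4 * x ^ 2 with hc
    have hc0 : 0 < c := by positivity
    unfold tailEnergy
    calc _ ≤ ∫⁻ p : ℂ × ℂ, (ofReal |log (|rad p.1 ^ 2 - rad p.2 ^ 2|)| +
          (ofReal |log c| + 1)) ∂(μ.prod μ) := by
          refine lintegral_mono_ae ?_
          filter_upwards [ae_prod_and hm hm, hne] with p hp hpn
          have hd : 0 < |rad p.1 ^ 2 - rad p.2 ^ 2| := by
            rw [abs_pos, sub_ne_zero]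
            intro h
            exact hpn ((sq_eq_sq₀ (rad_nonneg _) (rad_nonneg _)).1 h)
          have hle : |rad p.1 ^ 2 - rad p.2 ^ 2| / c ≤ ‖p.1 - p.2‖ := by
            rw [div_le_iff₀ hc0, ← norm_cube_sub_cube hp.1 hp.2, ← prod_sub_omega, norm_mul,
              norm_mul, mul_assoc]
            have := norm_le_of_mem_Sigma1 hx hp.1
            have := norm_le_of_mem_Sigma1 hx hp.2
            have : ‖p.1 - omega * p.2‖ ≤ 2 * x := by
              refine (norm_sub_le _ _).trans ?_
              rw [norm_mul, norm_omega]; linarith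
            have : ‖p.1 - omega ^ 2 * p.2‖ ≤ 2 * x := by
              refine (norm_sub_le _ _).trans ?_
              rw [norm_mul, norm_pow, norm_omega]; linarith
            gcongr
            calc _ ≤ (2 * x) * (2 * x) := by gcongr
              _ = c := by rw [hc]; ring
          refine (tailKer_anti (by positivity) hle).trans ((tailKer_le (by positivity)).trans ?_)
          rw [← add_assoc, log_div hd.ne' hc0.ne', ← ofReal_add (abs_nonneg _) (abs_nonneg _)]
          gcongr
          exact abs_sub _ _
      _ < ⊤ := by
          rw [lintegral_add_right _ measurable_const, lintegral_const]
          refine add_lt_top.2 ⟨?_, mul_lt_top (by simp) (measure_lt_top _ _)⟩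
          have := hi.2
          rw [hasFiniteIntegral_iff_norm] at this
          simpa using this
  · calc _ ≤ ∫⁻ _, ofReal (log (1 + x)) ∂μ := by
          refine lintegral_mono_ae ?_
          filter_upwards [hm] with s hs
          refine ofReal_le_ofReal (log_le_log (by positivity) ?_)
          linarith [norm_le_of_mem_Sigma1 hx hs]
      _ < ⊤ := by
          rw [lintegral_const]
          exact mul_lt_top (by simp) (measure_lt_top _ _)

lemma abs_log_add_le {X y y' : ℝ} (h0 : 0 ≤ y) (h1 : y ≤ X) (h2 : 0 ≤ y') (h3 : y' ≤ X)
    (hne : y ≠ y') :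
    |log (y + y')| ≤ |log (2 * X)| + |log (|y ^ 2 - y' ^ 2|)| := by
  have hpos : 0 < y + y' := by
    rcases h0.eq_or_lt with h | h
    · rcases h2.eq_or_lt with h' | h'
      · exact absurd (h.symm.trans h') hne
      · linarith
    · linarith
  have hd : 0 < |y ^ 2 - y' ^ 2| := by
    rw [abs_pos, sub_ne_zero]
    intro h
    exact hne ((sq_eq_sq₀ h0 h2).1 h)
  have : log (y + y') ≤ log (2 * X) := log_le_log hpos (by linarith)
  have : log |y ^ 2 - y' ^ 2| ≤ 2 * log (y + y') := by
    rw [← Real.log_rpow hpos]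
    refine log_le_log hd ?_
    rw [show ((y + y') ^ (2 : ℝ)) = (y + y') ^ 2 by norm_cast, abs_le]
    constructor <;> nlinarith
  rw [abs_le]
  constructor
  · have := neg_abs_le (log |y ^ 2 - y' ^ 2|)
    have := abs_nonneg (log (2 * X))
    have := abs_nonneg (log |y ^ 2 - y' ^ 2|)
    linarith
  · have := le_abs_self (log (2 * X))
    have := abs_nonneg (log |y ^ 2 - y' ^ 2|)
    linarith

/-! ### The first variation of the energy -/

lemma abs_log_one_add_sub_le {t : ℝ} (ht : |t| ≤ 1 / 2) : |log (1 + t) - t| ≤ 2 * t ^ 2 := by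
  have h := Real.abs_log_sub_add_sum_range_le (x := -t) (by rw [abs_neg]; linarith) 1
  simp only [Finset.range_one, Finset.sum_singleton, abs_neg, sub_neg_eq_add] at h; norm_num at h
  have e : |log (1 + t) - t| = |-t + log (1 + t)| := by rw [sub_eq_add_neg, add_comm]
  rw [e]
  refine h.trans ?_
  rw [div_le_iff₀ (by linarith)]
  nlinarith [sq_nonneg t]

/-- A radial vector field `h(y) = y k(y)` on `[0, X]` which generates deformations of measures on
the star: it is Lipschitz and vanishes at `0` and at `X`. -/
structure IsVariation (X L : ℝ) (k : ℝ → ℝ) : Prop where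
  measurable : Measurable k
  nonneg : 0 ≤ L
  bound : ∀ y, |k y| ≤ L
  endpoint : ∀ y ∈ Icc 0 X, |y * k y| ≤ L * (X - y)
  lipschitz : ∀ y ∈ Icc 0 X, ∀ y' ∈ Icc 0 X, |y * k y - y' * k y'| ≤ L * |y - y'|

/-- The divided difference of `y k(y)`. -/
def quotA (k : ℝ → ℝ) (p : ℝ × ℝ) : ℝ := (p.1 * k p.1 - p.2 * k p.2) / (p.1 - p.2)

/-- The divided difference of the odd extension of `y k(y)` at `y` and `-y'`. -/
def quotB (k : ℝ → ℝ) (p : ℝ × ℝ) : ℝ := (p.1 * k p.1 + p.2 * k p.2) / (p.1 + p.2)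

/-- The part of `quotB` that comes from the variation of the first variable. -/
def quotC (k : ℝ → ℝ) (p : ℝ × ℝ) : ℝ := p.1 * k p.1 / (p.1 + p.2)

/-- The pairs of distinct points of `(0, X]`. -/
def goodPair (X : ℝ) (p : ℝ × ℝ) : Prop := p.1 ∈ Ioc 0 X ∧ p.2 ∈ Ioc 0 X ∧ p.1 ≠ p.2

lemma ae_goodPair {m : Measure ℝ} [SFinite m] {X : ℝ} (hm : m (Icc 0 X)ᶜ = 0)
    (h0 : ∀ y, m {y} = 0) : ∀ᵐ p ∂(m.prod m), goodPair X p := by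
  have h1 : ∀ᵐ y ∂m, y ∈ Icc 0 X := hm
  have h2 : ∀ᵐ y ∂m, y ≠ 0 := by rw [ae_iff]; simpa using h0 0
  have h3 : ∀ᵐ y ∂m, y ∈ Ioc 0 X := by
    filter_upwards [h1, h2] with y hy hy0
    exact ⟨lt_of_le_of_ne hy.1 hy0.symm, hy.2⟩
  have h4 : ∀ᵐ p : ℝ × ℝ ∂(m.prod m), p.1 ≠ p.2 := by
    refine ae_prod_of_forall (measurableSet_eq_fun (by fun_prop) (by fun_prop)).compl
      (ae_of_all _ fun w => ?_)
    filter_upwards [measure_eq_zero_iff_ae_notMem.1 (h0 w)] with s hs h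
    exact hs h.symm
  filter_upwards [ae_prod_and h3 h3, h4] with p hp hne
  exact ⟨hp.1, hp.2, hne⟩

section
variable {X L : ℝ} {k : ℝ → ℝ}

lemma IsVariation.measurable_quotA (hk : IsVariation X L k) : Measurable (quotA k) := by
  have := hk.measurable
  unfold quotA; fun_prop

lemma IsVariation.measurable_quotB (hk : IsVariation X L k) : Measurable (quotB k) := by
  have := hk.measurable
  unfold quotB; fun_prop

lemma IsVariation.measurable_quotC (hk : IsVariation X L k) : Measurable (quotC k) := by
  have := hk.measurable
  unfold quotC; fun_prop

lemma IsVariation.abs_quotA_le (hk : IsVariation X L k) {p : ℝ × ℝ} (hp : goodPair X p) :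
    |quotA k p| ≤ L := by
  obtain ⟨h1, h2, h3⟩ := hp
  have : 0 < |p.1 - p.2| := abs_pos.2 (sub_ne_zero.2 h3)
  unfold quotA
  rw [abs_div, div_le_iff₀ this]
  exact hk.lipschitz _ ⟨h1.1.le, h1.2⟩ _ ⟨h2.1.le, h2.2⟩

lemma IsVariation.abs_mul_le (hk : IsVariation X L k) {y : ℝ} (hy : 0 ≤ y) :
    |y * k y| ≤ L * y := by
  rw [abs_mul, abs_of_nonneg hy, mul_comm]; gcongr
  exact hk.bound y

lemma IsVariation.abs_quotB_le (hk : IsVariation X L k) {p : ℝ × ℝ} (hp : goodPair X p) :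
    |quotB k p| ≤ L := by
  obtain ⟨h1, h2, h3⟩ := hp
  have : 0 < p.1 + p.2 := add_pos h1.1 h2.1
  unfold quotB
  rw [abs_div, abs_of_pos this, div_le_iff₀ this]
  refine (abs_add_le _ _).trans ?_
  linarith [hk.abs_mul_le h1.1.le, hk.abs_mul_le h2.1.le]

lemma IsVariation.abs_quotC_le (hk : IsVariation X L k) {p : ℝ × ℝ} (hp : goodPair X p) :
    |quotC k p| ≤ L := by
  obtain ⟨h1, h2, h3⟩ := hp
  have : 0 < p.1 + p.2 := add_pos h1.1 h2.1
  unfold quotC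
  rw [abs_div, abs_of_pos this, div_le_iff₀ this]
  have := mul_nonneg hk.nonneg h2.1.le
  linarith [hk.abs_mul_le h1.1.le]

/-- The deformation of `[0, X]` along `y k(y)`. -/
def flow (k : ℝ → ℝ) (ε y : ℝ) : ℝ := y * (1 + ε * k y)

lemma abs_eps_mul_le {L ε t : ℝ} (hε : |ε| * L ≤ 1 / 2)
    (ht : |t| ≤ L) : |ε * t| ≤ 1 / 2 := by
  rw [abs_mul]
  exact (mul_le_mul_of_nonneg_left ht (abs_nonneg ε)).trans hε

lemma one_add_pos_of_abs_le {t : ℝ} (h : |t| ≤ 1 / 2) : 0 < 1 + t := by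
  have := (abs_le.1 h).1
  linarith

lemma IsVariation.log_flow_sq_sub (hk : IsVariation X L k) {ε : ℝ} (hε : |ε| * L ≤ 1 / 2)
    {p : ℝ × ℝ} (hp : goodPair X p) :
    log |flow k ε p.1 ^ 2 - flow k ε p.2 ^ 2| = log |p.1 ^ 2 - p.2 ^ 2| +
      log (1 + ε * quotA k p) + log (1 + ε * quotB k p) := by
  have ha := one_add_pos_of_abs_le (abs_eps_mul_le hε (hk.abs_quotA_le hp))
  have hb := one_add_pos_of_abs_le (abs_eps_mul_le hε (hk.abs_quotB_le hp))
  obtain ⟨h1, h2, h3⟩ := hp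
  have d1 : p.1 - p.2 ≠ 0 := sub_ne_zero.2 h3
  have d2 : p.1 + p.2 ≠ 0 := (add_pos h1.1 h2.1).ne'
  have e : flow k ε p.1 ^ 2 - flow k ε p.2 ^ 2 =
      (p.1 ^ 2 - p.2 ^ 2) * (1 + ε * quotA k p) * (1 + ε * quotB k p) := by
    have ea : (p.1 - p.2) * (1 + ε * quotA k p) = flow k ε p.1 - flow k ε p.2 := by
      unfold quotA flow; field_simp; ring
    have eb : (p.1 + p.2) * (1 + ε * quotB k p) = flow k ε p.1 + flow k ε p.2 := by
      unfold quotB flow; field_simp; ring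
    rw [show (p.1 ^ 2 - p.2 ^ 2) * (1 + ε * quotA k p) * (1 + ε * quotB k p) =
      ((p.1 - p.2) * (1 + ε * quotA k p)) * ((p.1 + p.2) * (1 + ε * quotB k p)) by ring, ea, eb]
    ring
  have d3 : p.1 ^ 2 - p.2 ^ 2 ≠ 0 := by
    rw [show p.1 ^ 2 - p.2 ^ 2 = (p.1 - p.2) * (p.1 + p.2) by ring]
    exact mul_ne_zero d1 d2
  rw [log_abs, log_abs, e, log_mul (mul_ne_zero d3 ha.ne') hb.ne', log_mul d3 ha.ne']

lemma IsVariation.log_flow_add (hk : IsVariation X L k) {ε : ℝ} (hε : |ε| * L ≤ 1 / 2)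
    {p : ℝ × ℝ} (hp : goodPair X p) :
    log (flow k ε p.1 + p.2) = log (p.1 + p.2) + log (1 + ε * quotC k p) := by
  have hc := one_add_pos_of_abs_le (abs_eps_mul_le hε (hk.abs_quotC_le hp))
  obtain ⟨h1, h2, h3⟩ := hp
  have d2 : p.1 + p.2 ≠ 0 := (add_pos h1.1 h2.1).ne'
  rw [← log_mul d2 hc.ne']; congr 1
  unfold quotC flow; field_simp; ring

lemma IsVariation.measurable_flow (hk : IsVariation X L k) (ε : ℝ) : Measurable (flow k ε) := by
  have := hk.measurable
  unfold flow; fun_prop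

lemma integrable_log_one_add {α : Type*} [MeasurableSpace α] {μ : Measure α} [IsFiniteMeasure μ]
    {f : α → ℝ} (hf : Measurable f) (hb : ∀ᵐ a ∂μ, |f a| ≤ 1 / 2) :
    Integrable (fun a => log (1 + f a)) μ := by
  refine Integrable.of_bound (Measurable.aestronglyMeasurable (by fun_prop)) 1 ?_
  filter_upwards [hb] with a ha
  have h1 := abs_log_one_add_sub_le ha
  rw [norm_eq_abs]
  rw [abs_le] at h1 ha ⊢
  constructor <;> nlinarith [ha.1, ha.2]

end

/-- The map of the star which induces `flow` on the radial coordinate. -/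
def starFlow (k : ℝ → ℝ) (ε : ℝ) (s : ℂ) : ℂ := (((1 + ε * k (rad s)) ^ (2 / 3 : ℝ) : ℝ) : ℂ) * s

section
variable {x L : ℝ} {k : ℝ → ℝ}

lemma IsVariation.measurable_starFlow {X : ℝ} (hk : IsVariation X L k) (ε : ℝ) :
    Measurable (starFlow k ε) := by
  have := hk.measurable
  unfold starFlow; fun_prop

lemma IsVariation.rad_starFlow {X : ℝ} (hk : IsVariation X L k) {ε : ℝ} (hε : |ε| * L ≤ 1 / 2)
    (s : ℂ) : rad (starFlow k ε s) = flow k ε (rad s) := by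
  have h := (one_add_pos_of_abs_le (abs_eps_mul_le hε (hk.bound (rad s)))).le
  unfold starFlow flow
  rw [rad, norm_mul, norm_real, norm_of_nonneg (by positivity),
    Real.mul_rpow (by positivity) (norm_nonneg _), ← rpow_mul h]
  norm_num
  rw [mul_comm]; rfl

lemma IsVariation.flow_mem {X : ℝ} (hk : IsVariation X L k) {ε : ℝ} (hε : |ε| * L ≤ 1 / 2) {y : ℝ}
    (hy : y ∈ Icc 0 X) : flow k ε y ∈ Icc 0 X := by
  have h := (one_add_pos_of_abs_le (abs_eps_mul_le hε (hk.bound y))).le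
  refine ⟨mul_nonneg hy.1 h, ?_⟩
  have := hk.endpoint y hy
  have h2 : |ε * (y * k y)| ≤ 1 / 2 * (X - y) := by
    rw [abs_mul]
    calc _ ≤ |ε| * (L * (X - y)) := by gcongr
      _ = |ε| * L * (X - y) := by ring
      _ ≤ _ := mul_le_mul_of_nonneg_right hε (by linarith [hy.2])
  have := (abs_le.1 h2).2
  unfold flow
  linarith [hy.2]

lemma IsVariation.starFlow_mem (hx : 0 < x) (hk : IsVariation (x ^ (3 / 2 : ℝ)) L k) {ε : ℝ}
    (hε : |ε| * L ≤ 1 / 2) {s : ℂ} (hs : s ∈ Sigma1 x) : starFlow k ε s ∈ Sigma1 x := by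
  have hr : rad s ∈ Icc 0 (x ^ (3 / 2 : ℝ)) := by
    refine ⟨rad_nonneg s, ?_⟩
    have := norm_le_of_mem_Sigma1 hx hs
    unfold rad; gcongr
  have h := (one_add_pos_of_abs_le (abs_eps_mul_le hε (hk.bound (rad s)))).le
  have hf := hk.flow_mem hε hr
  refine ⟨flow k ε (rad s) ^ 2, by positivity, ?_, ?_⟩
  · rw [← rpow_three_halves_sq hx.le]
    have := hf.1
    have := hf.2
    gcongr
  · unfold starFlow
    rw [mul_pow, cube_eq_rad_sq hs, ← ofReal_pow, ← rpow_natCast, ← rpow_mul h]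
    norm_num [flow]; ring

lemma starFlow_omega (k : ℝ → ℝ) (ε : ℝ) (s : ℂ) :
    starFlow k ε (omega * s) = omega * starFlow k ε s := by
  have : rad (omega * s) = rad s := by simp [rad, norm_omega]
  unfold starFlow
  rw [this]; ring

end

lemma RotInv.map_starFlow {μ : Measure ℂ} (h : RotInv μ) {X L : ℝ} {k : ℝ → ℝ}
    (hk : IsVariation X L k) (ε : ℝ) : RotInv (μ.map (starFlow k ε)) := by
  have hm := hk.measurable_starFlow ε
  unfold RotInv
  rw [Measure.map_map measurable_omega_mul hm]
  conv_rhs => rw [← h, Measure.map_map hm measurable_omega_mul]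
  congr 1
  funext s
  exact (starFlow_omega k ε s).symm

lemma map_starFlow_compl {μ : Measure ℂ} {x L : ℝ} (hx : 0 < x) (hμ : μ (Sigma1 x)ᶜ = 0)
    {k : ℝ → ℝ} (hk : IsVariation (x ^ (3 / 2 : ℝ)) L k) {ε : ℝ} (hε : |ε| * L ≤ 1 / 2) :
    μ.map (starFlow k ε) (Sigma1 x)ᶜ = 0 := by
  rw [Measure.map_apply (hk.measurable_starFlow ε) (isClosed_Sigma1 x).measurableSet.compl]
  refine measure_mono_null ?_ hμ
  intro s hs hs1
  exact hs (hk.starFlow_mem hx hε hs1)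

lemma radialLaw_map_starFlow {μ : Measure ℂ} {X L : ℝ} {k : ℝ → ℝ} (hk : IsVariation X L k) {ε : ℝ}
    (hε : |ε| * L ≤ 1 / 2) :
    radialLaw (μ.map (starFlow k ε)) = (radialLaw μ).map (flow k ε) := by
  unfold radialLaw
  rw [Measure.map_map measurable_rad (hk.measurable_starFlow ε),
    Measure.map_map (hk.measurable_flow ε) measurable_rad]
  congr 1
  funext s
  exact hk.rad_starFlow hε s

lemma IsVariation.map_flow_singleton {X L : ℝ} {k : ℝ → ℝ} (hk : IsVariation X L k) {ε : ℝ}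
    (hε : |ε| * L ≤ 1 / 2) {m : Measure ℝ} (hm : m (Icc 0 X)ᶜ = 0) (h0 : ∀ y, m {y} = 0)
    (c : ℝ) : m.map (flow k ε) {c} = 0 := by
  rw [Measure.map_apply (hk.measurable_flow ε) (measurableSet_singleton c)]
  have hinj : Set.InjOn (flow k ε) (Icc 0 X) := by
    intro y hy y' hy' he
    have := hk.lipschitz y hy y' hy'
    have h2 : |ε * (y * k y - y' * k y')| ≤ 1 / 2 * |y - y'| := by
      rw [abs_mul]
      calc _ ≤ |ε| * (L * |y - y'|) := by gcongr
        _ = |ε| * L * |y - y'| := by ring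
        _ ≤ _ := mul_le_mul_of_nonneg_right hε (abs_nonneg _)
    have h3 : ε * (y * k y - y' * k y') = -(y - y') := by
      unfold flow at he; linarith
    rw [h3, abs_neg] at h2
    have : |y - y'| = 0 := le_antisymm (by linarith) (abs_nonneg _)
    exact sub_eq_zero.1 (abs_eq_zero.1 this)
  by_cases hc : ∃ y0 ∈ Icc 0 X, flow k ε y0 = c
  · obtain ⟨y0, hy0, rfl⟩ := hc
    refine measure_mono_null (t := (Icc 0 X)ᶜ ∪ {y0}) ?_ (measure_union_null hm (h0 y0))
    intro y hy
    by_cases hyI : y ∈ Icc 0 X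
    · exact Or.inr (hinj hyI hy0 hy)
    · exact Or.inl hyI
  · refine measure_mono_null ?_ hm
    intro y hy hyI
    exact hc ⟨y, hyI, hy⟩

/-- The integrand of the difference quotient of the energy along `flow`. -/
def energyVariation (t0 t3 : ℝ) (k : ℝ → ℝ) (ε : ℝ) (p : ℝ × ℝ) : ℝ :=
  1 / 3 * (-log (1 + ε * quotA k p) - log (1 + ε * quotB k p) + log (1 + ε * quotC k p)) +
  1 / t0 * ((2 / (3 * √t3) * flow k ε p.1 - t3 / 3 * flow k ε p.1 ^ 2) -
    (2 / (3 * √t3) * p.1 - t3 / 3 * p.1 ^ 2))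

section
variable {t0 t3 x L : ℝ} {k : ℝ → ℝ} {μ : Measure ℂ}

/-- The energy of the deformed pair. -/
lemma RotInv.energy_map_starFlow (h : RotInv μ) [IsProbabilityMeasure μ] (fμ : IsLogFinite μ)
    (hx : 0 < x) (hμ : μ (Sigma1 x)ᶜ = 0) (hk : IsVariation (x ^ (3 / 2 : ℝ)) L k) {ε : ℝ}
    (hε : |ε| * L ≤ 1 / 2) :
    IsAdmissible x (μ.map (starFlow k ε)) (halfBalayage μ) ∧
    Integrable (energyVariation t0 t3 k ε) ((radialLaw μ).prod (radialLaw μ)) ∧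
    energy t0 t3 (μ.map (starFlow k ε)) (halfBalayage μ) =
      energy t0 t3 μ (halfBalayage μ) +
        ∫ p, energyVariation t0 t3 k ε p ∂((radialLaw μ).prod (radialLaw μ)) := by
  set X := x ^ (3 / 2 : ℝ)
  set m := radialLaw μ
  set A := fun p : ℝ × ℝ => log (1 + ε * quotA k p)
  set B := fun p : ℝ × ℝ => log (1 + ε * quotB k p)
  set Q := fun p : ℝ × ℝ => log (1 + ε * quotC k p)
  set M := m.prod m
  set κ := μ.map (starFlow k ε)
  have : IsProbabilityMeasure κ :=
    Measure.isProbabilityMeasure_map (hk.measurable_starFlow ε).aemeasurable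
  have hmI : m (Icc 0 X)ᶜ = 0 := radialLaw_compl_Icc hx hμ
  have hm0 : ∀ y, m {y} = 0 := radialLaw_singleton hμ (fμ.hasFiniteLogEnergy fμ).measure_singleton
  have hmκ : radialLaw κ = m.map (flow k ε) := radialLaw_map_starFlow hk hε
  have hκ1 : κ (Sigma1 x)ᶜ = 0 := map_starFlow_compl hx hμ hk hε
  have hflow := hk.measurable_flow ε
  have hgood := ae_goodPair hmI hm0
  have iA : Integrable A M := integrable_log_one_add (hk.measurable_quotA.const_mul ε) (by
      filter_upwards [hgood] with p hp using abs_eps_mul_le hε (hk.abs_quotA_le hp))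
  have iB : Integrable B M := integrable_log_one_add (hk.measurable_quotB.const_mul ε) (by
      filter_upwards [hgood] with p hp using abs_eps_mul_le hε (hk.abs_quotB_le hp))
  have iC : Integrable Q M := integrable_log_one_add (hk.measurable_quotC.const_mul ε) (by
      filter_upwards [hgood] with p hp using abs_eps_mul_le hε (hk.abs_quotC_le hp))
  have mlog : Measurable fun p : ℝ × ℝ => log |p.1 ^ 2 - p.2 ^ 2| := by simp_rw [log_abs]; fun_prop
  have mlog2 : Measurable fun p : ℝ × ℝ => log (p.1 + p.2) := by fun_prop
  -- the self-energy of the deformed measure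
  obtain ⟨i0, e0⟩ := h.three_mul_logEnergy_radial fμ hμ
  have i0AB : Integrable (fun p : ℝ × ℝ => log |p.1 ^ 2 - p.2 ^ 2| + A p) M := i0.add iA
  have haeJ : ∀ᵐ p ∂M, log |p.1 ^ 2 - p.2 ^ 2| + A p +
      B p = log |flow k ε p.1 ^ 2 - flow k ε p.2 ^ 2| := by
    filter_upwards [hgood] with p hp using (hk.log_flow_sq_sub hε hp).symm
  have iJ : Integrable (fun p : ℝ × ℝ => log |flow k ε p.1 ^ 2 - flow k ε p.2 ^ 2|)
      M := (i0AB.add iB).congr haeJ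
  have iκ : Integrable (fun p : ℝ × ℝ => log |p.1 ^ 2 - p.2 ^ 2|)
      ((radialLaw κ).prod (radialLaw κ)) := by
    rw [hmκ, Measure.map_prod_map _ _ hflow hflow,
      integrable_map_measure mlog.aestronglyMeasurable (by fun_prop)]
    exact iJ
  have fκ : IsLogFinite κ := isLogFinite_of_radial hx hκ1 iκ (by
    rw [hmκ]; exact hk.map_flow_singleton hε hmI hm0)
  obtain ⟨-, eκ⟩ := (h.map_starFlow hk ε).three_mul_logEnergy_radial fκ hκ1
  have : 3 * logEnergy κ κ = 3 * logEnergy μ μ - ∫ p, A p ∂M -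
      ∫ p, B p ∂M := by
    have : ∫ p, log |p.1 ^ 2 - p.2 ^ 2| ∂((radialLaw κ).prod (radialLaw κ)) =
        ∫ p, log |flow k ε p.1 ^ 2 - flow k ε p.2 ^ 2| ∂M := by
      rw [hmκ, Measure.map_prod_map _ _ hflow hflow,
        integral_map (by fun_prop) mlog.aestronglyMeasurable]
      rfl
    rw [eκ, e0, this, ← integral_congr_ae haeJ, integral_add i0AB iB, integral_add i0 iA]; ring
  -- the mutual energy
  have i1 : Integrable (fun p : ℝ × ℝ => log (p.1 + p.2)) M := by
    refine ((integrable_const |log (2 * X)|).add i0.norm).mono' mlog2.aestronglyMeasurable ?_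
    filter_upwards [hgood] with p hp
    exact abs_log_add_le hp.1.1.le hp.1.2 hp.2.1.1.le hp.2.1.2 hp.2.2
  have haeC : ∀ᵐ p ∂M, log (p.1 + p.2) + Q p =
      log (flow k ε p.1 + p.2) := by
    filter_upwards [hgood] with p hp using (hk.log_flow_add hε hp).symm
  have hmapC : (radialLaw κ).prod m = M.map (Prod.map (flow k ε) id) := by
    rw [hmκ, ← Measure.map_prod_map _ _ hflow measurable_id, Measure.map_id]
  have iκC : Integrable (fun p : ℝ × ℝ => log (p.1 + p.2)) ((radialLaw κ).prod m) := by
    rw [hmapC, integrable_map_measure mlog2.aestronglyMeasurable (by fun_prop)]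
    exact (i1.add iC).congr haeC
  have : 3 * logEnergy κ (halfBalayage μ) = 3 * logEnergy μ (halfBalayage μ) -
        ∫ p, Q p ∂M := by
    have : ∫ p, log (p.1 + p.2) ∂((radialLaw κ).prod m) =
        ∫ p, log (flow k ε p.1 + p.2) ∂M := by
      rw [hmapC, integral_map (by fun_prop) mlog2.aestronglyMeasurable]; rfl
    rw [h.three_mul_logEnergy_halfBalayage fκ fμ hκ1 hμ iκC,
      h.three_mul_logEnergy_halfBalayage fμ fμ hμ hμ i1, this, ← integral_congr_ae haeC,
      integral_add i1 iC]
    ring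
  -- the external field
  set V : ℝ → ℝ := fun y => 2 / (3 * √t3) * y - t3 / 3 * y ^ 2
  have hVc : Continuous V := by fun_prop
  have hIcc : ∀ᵐ y ∂m, y ∈ Icc 0 X := hmI
  obtain ⟨b, hb⟩ := isCompact_Icc.exists_bound_of_continuousOn (s := Icc 0 X) hVc.continuousOn
  have iV : Integrable V m := Integrable.of_bound hVc.measurable.aestronglyMeasurable b (by
    filter_upwards [hIcc] with y hy using hb y hy)
  have iVf : Integrable (fun y => V (flow k ε y)) m :=
    Integrable.of_bound (hVc.measurable.comp hflow).aestronglyMeasurable b (by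
      filter_upwards [hIcc] with y hy using hb _ (hk.flow_mem hε hy))
  have eV : ∫ z, field t3 z ∂κ = ∫ y, V (flow k ε y) ∂m := by
    rw [integral_field_eq hκ1, hmκ, integral_map hflow.aemeasurable
      hVc.measurable.aestronglyMeasurable]
  have eV0 : ∫ z, field t3 z ∂μ = ∫ y, V y ∂m := integral_field_eq hμ t3
  have iVd : Integrable (fun p : ℝ × ℝ => V (flow k ε p.1) - V p.1) M := (iVf.sub iV).comp_fst m
  have eVd : ∫ p : ℝ × ℝ, (V (flow k ε p.1) - V p.1) ∂M =
      ∫ y, V (flow k ε y) ∂m - ∫ y, V y ∂m := by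
    rw [← integral_sub iVf iV, integral_fun_fst (fun y => V (flow k ε y) - V y)]; simp
  have iAB : Integrable (fun p => -A p - B p) M := iA.neg.sub iB
  have iABC : Integrable (fun p => -A p - B p + Q p) M := iAB.add iC
  have iAn : Integrable (fun p => -A p) M := iA.neg
  have fn := fμ.balayage
  refine ⟨?_, (iABC.const_mul (1 / 3)).add (iVd.const_mul (1 / t0)), ?_⟩
  · have hb := isAdmissible_halfBalayage fμ measure_univ hμ
    exact
      { mass1 := measure_univ
        supp1 := support_subset_of_measure_compl (isClosed_Sigma1 x) hκ1
        mass2 := hb.mass2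
        supp2 := hb.supp2
        finite11 := fκ.hasFiniteLogEnergy fκ
        finite22 := hb.finite22
        finite12 := fκ.hasFiniteLogEnergy fn }
  · have : ∫ p, energyVariation t0 t3 k ε p ∂M = 1 / 3 * (-∫ p, A p ∂M - ∫ p, B p ∂M +
          ∫ p, Q p ∂M) +
        1 / t0 * (∫ y, V (flow k ε y) ∂m - ∫ y, V y ∂m) := by
      rw [← eVd, ← integral_neg, ← integral_sub iAn iB, ← integral_add iAB iC,
        ← integral_const_mul, ← integral_const_mul,
        ← integral_add (iABC.const_mul (1 / 3)) (iVd.const_mul (1 / t0))]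
      rfl
    rw [this, energy_eq_field, energy_eq_field, eV, eV0]; linarith

end

/-- The derivative of `energyVariation` at `ε = 0`. -/
def energyLin (t0 t3 : ℝ) (k : ℝ → ℝ) (p : ℝ × ℝ) : ℝ :=
  1 / 3 * (-quotA k p - quotB k p + quotC k p +
    2 / t0 * ((1 / √t3 - t3 * p.1) * (p.1 * k p.1)))

lemma eq_zero_of_forall_small {D M L : ℝ} (hM : 0 ≤ M) (hL : 0 ≤ L)
    (h : ∀ ε : ℝ, |ε| * L ≤ 1 / 2 → 0 ≤ ε * D + M * ε ^ 2) : D = 0 := by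
  by_contra hD
  have hD2 : 0 < D ^ 2 := by positivity
  set t : ℝ := 1 / (2 * (M + |D| * L + 1)) with ht
  have : 0 ≤ |D| * L := by positivity
  have ht0 : 0 < t := by positivity
  have : t * (2 * (M + |D| * L + 1)) = 1 := by rw [ht]; field_simp
  have := h (-(D * t)) (by
    rw [abs_neg, abs_mul, abs_of_pos ht0]
    nlinarith)
  have : 0 ≤ t * D ^ 2 * (M * t - 1) := by nlinarith
  have h3 : M * t < 1 := by nlinarith
  nlinarith [mul_pos (mul_pos ht0 hD2) (sub_pos.2 h3)]

section
variable {t0 t3 X L : ℝ} {k : ℝ → ℝ}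

lemma IsVariation.abs_energyVariation_sub_le (hk : IsVariation X L k) {ε : ℝ}
    (hε : |ε| * L ≤ 1 / 2) {p : ℝ × ℝ} (hp : goodPair X p) :
    |energyVariation t0 t3 k ε p - ε * energyLin t0 t3 k p| ≤
      (2 * L ^ 2 + |1 / t0 * (t3 / 3)| * (L * X) ^ 2) * ε ^ 2 := by
  have key : ∀ t, |t| ≤ L → |log (1 + ε * t) - ε * t| ≤ 2 * L ^ 2 * ε ^ 2 := by
    intro t ht
    refine (abs_log_one_add_sub_le (abs_eps_mul_le hε ht)).trans ?_
    have : t ^ 2 ≤ L ^ 2 := sq_le_sq' (abs_le.1 ht).1 (abs_le.1 ht).2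
    rw [mul_pow]
    nlinarith [sq_nonneg ε, mul_nonneg (sq_nonneg ε) (sub_nonneg.2 this)]
  have kA := key _ (hk.abs_quotA_le hp)
  have kB := key _ (hk.abs_quotB_le hp)
  have kC := key _ (hk.abs_quotC_le hp)
  have kh : |p.1 * k p.1| ≤ L * X :=
    (hk.abs_mul_le hp.1.1.le).trans (mul_le_mul_of_nonneg_left hp.1.2 hk.nonneg)
  have : (p.1 * k p.1) ^ 2 ≤ (L * X) ^ 2 := sq_le_sq' (abs_le.1 kh).1 (abs_le.1 kh).2
  have e : energyVariation t0 t3 k ε p - ε * energyLin t0 t3 k p =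
      1 / 3 * (-(log (1 + ε * quotA k p) - ε * quotA k p) -
        (log (1 + ε * quotB k p) - ε * quotB k p) +
        (log (1 + ε * quotC k p) - ε * quotC k p)) -
      1 / t0 * (t3 / 3) * ((p.1 * k p.1) ^ 2 * ε ^ 2) := by
    unfold energyVariation energyLin flow; ring
  rw [e]
  refine (abs_sub _ _).trans ?_
  have : |1 / 3 * (-(log (1 + ε * quotA k p) - ε * quotA k p) -
        (log (1 + ε * quotB k p) - ε * quotB k p) +
        (log (1 + ε * quotC k p) - ε * quotC k p))| ≤ 2 * L ^ 2 * ε ^ 2 := by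
    rw [abs_le] at kA kB kC ⊢
    constructor <;> linarith [kA.1, kA.2, kB.1, kB.2, kC.1, kC.2]
  have : |1 / t0 * (t3 / 3) * ((p.1 * k p.1) ^ 2 * ε ^ 2)| ≤
      |1 / t0 * (t3 / 3)| * (L * X) ^ 2 * ε ^ 2 := by
    rw [abs_mul, abs_of_nonneg (a := (p.1 * k p.1) ^ 2 * ε ^ 2) (by positivity), mul_assoc]; gcongr
  linarith

lemma integrable_of_goodPair {m : Measure ℝ} [IsFiniteMeasure m] (hm : m (Icc 0 X)ᶜ = 0)
    (h0 : ∀ y, m {y} = 0) {E : Type*} [NormedAddCommGroup E] {f : ℝ × ℝ → E}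
    (hf : AEStronglyMeasurable f (m.prod m)) (C : ℝ) (hC : ∀ p, goodPair X p → ‖f p‖ ≤ C) :
    Integrable f (m.prod m) :=
  Integrable.of_bound hf C (by filter_upwards [ae_goodPair hm h0] with p hp using hC p hp)

lemma IsVariation.integrable_field (hk : IsVariation X L k) {m : Measure ℝ} [IsFiniteMeasure m]
    (hm : m (Icc 0 X)ᶜ = 0) : Integrable (fun y => (1 / √t3 - t3 * y) * (y * k y)) m := by
  have := hk.measurable
  have hIcc : ∀ᵐ y ∂m, y ∈ Icc 0 X := hm
  refine Integrable.of_bound (by fun_prop) ((|1 / √t3| + |t3| * X) * (L * X)) ?_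
  filter_upwards [hIcc] with y hy
  rw [norm_eq_abs, abs_mul]
  have h1 : |y * k y| ≤ L * X :=
    (hk.abs_mul_le hy.1).trans (mul_le_mul_of_nonneg_left hy.2 hk.nonneg)
  have h2 : |1 / √t3 - t3 * y| ≤ |1 / √t3| + |t3| * X := by
    refine (abs_sub _ _).trans ?_
    rw [abs_mul _ y, abs_of_nonneg hy.1]
    have := hy.2
    gcongr
  exact mul_le_mul h2 h1 (abs_nonneg _) ((abs_nonneg _).trans h2)

lemma IsEquilibriumPair.radialLaw_null {x : ℝ} {μ ν : Measure ℂ} (hx : 0 < x)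
    (h : IsEquilibriumPair t0 t3 x μ ν) : IsProbabilityMeasure μ ∧
      radialLaw μ (Icc 0 (x ^ (3 / 2 : ℝ)))ᶜ = 0 ∧ ∀ y, radialLaw μ {y} = 0 := by
  have hμ := measure_compl_of_support_subset h.1.supp1
  have fμ := h.1.isLogFinite.1
  have hprob : IsProbabilityMeasure μ := ⟨h.1.mass1⟩
  exact ⟨hprob, radialLaw_compl_Icc hx hμ,
    radialLaw_singleton hμ (fμ.hasFiniteLogEnergy fμ).measure_singleton⟩

/-- The first variation of the energy vanishes at the minimiser. -/
theorem IsEquilibriumPair.integral_quot_eq {x : ℝ} {μ ν : Measure ℂ} (hx : 0 < x)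
    (h : IsEquilibriumPair t0 t3 x μ ν) (hk : IsVariation (x ^ (3 / 2 : ℝ)) L k) :
    ∫ p, (quotA k p + 1 / 2 * quotB k p) ∂((radialLaw μ).prod (radialLaw μ)) =
      2 / t0 * ∫ y, (1 / √t3 - t3 * y) * (y * k y) ∂(radialLaw μ) := by
  obtain ⟨hrot, hν⟩ := h.rotInv_and_eq hx
  obtain ⟨fμ, -⟩ := h.1.isLogFinite
  have : IsProbabilityMeasure μ := ⟨h.1.mass1⟩
  have hμ := measure_compl_of_support_subset h.1.supp1
  set X := x ^ (3 / 2 : ℝ)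
  set m := radialLaw μ
  set M := m.prod m
  set G := fun y => (1 / √t3 - t3 * y) * (y * k y)
  have hmI : m (Icc 0 X)ᶜ = 0 := radialLaw_compl_Icc hx hμ
  have hm0 : ∀ y, m {y} = 0 := radialLaw_singleton hμ (fμ.hasFiniteLogEnergy fμ).measure_singleton
  have hgood := ae_goodPair hmI hm0
  have iA : Integrable (quotA k) M := integrable_of_goodPair hmI hm0
    hk.measurable_quotA.aestronglyMeasurable L fun p hp => hk.abs_quotA_le hp
  have iB : Integrable (quotB k) M := integrable_of_goodPair hmI hm0
    hk.measurable_quotB.aestronglyMeasurable L fun p hp => hk.abs_quotB_le hp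
  have iC : Integrable (quotC k) M := integrable_of_goodPair hmI hm0
    hk.measurable_quotC.aestronglyMeasurable L fun p hp => hk.abs_quotC_le hp
  have iG : Integrable G m := hk.integrable_field hmI
  have iGp : Integrable (fun p : ℝ × ℝ => G p.1) M := iG.comp_fst m
  have iAB : Integrable (fun p => -quotA k p - quotB k p) M := iA.neg.sub iB
  have iABC : Integrable (fun p => -quotA k p - quotB k p + quotC k p) M := iAB.add iC
  have iAn : Integrable (fun p => -quotA k p) M := iA.neg
  have iL : Integrable (energyLin t0 t3 k) M := (iABC.add (iGp.const_mul _)).const_mul _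
  have : ∫ p, energyLin t0 t3 k p ∂M = 0 := by
    refine eq_zero_of_forall_small (M := 2 * L ^ 2 + |1 / t0 * (t3 / 3)| * (L * X) ^ 2) (L := L)
      (by positivity) hk.nonneg fun ε hε => ?_
    obtain ⟨hadm, hi, he⟩ := hrot.energy_map_starFlow (t0 := t0) (t3 := t3) fμ hx hμ hk hε
    have hmin := h.2 _ _ hadm
    rw [hν, he] at hmin
    have h1 : 0 ≤ ∫ p, energyVariation t0 t3 k ε p ∂M := by linarith
    refine h1.trans ?_
    have iR : Integrable (fun p => ε * energyLin t0 t3 k p +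
        (2 * L ^ 2 + |1 / t0 * (t3 / 3)| * (L * X) ^ 2) * ε ^ 2) M :=
      (iL.const_mul ε).add (integrable_const _)
    refine (integral_mono_ae hi iR ?_).trans_eq ?_
    · filter_upwards [hgood] with p hp
      have := (abs_le.1 (hk.abs_energyVariation_sub_le (t0 := t0) (t3 := t3) hε hp)).2
      linarith
    · rw [integral_add (iL.const_mul ε) (integrable_const _), integral_const_mul]; simp
  have : 2 * ∫ p, quotC k p ∂M = ∫ p, quotB k p ∂M := by
    have hs : ∫ p, quotC k p.swap ∂M = ∫ p, quotC k p ∂M := integral_prod_swap (quotC k)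
    have iCs : Integrable (fun p => quotC k p.swap) M := iC.swap
    calc _ = ∫ p, quotC k p ∂M + ∫ p, quotC k p.swap ∂M := by rw [hs, two_mul]
      _ = _ := by
        rw [← integral_add iC iCs]
        refine integral_congr_ae ?_
        filter_upwards [hgood] with p hp
        have : p.1 + p.2 ≠ 0 := (add_pos hp.1.1 hp.2.1.1).ne'
        simp only [quotB, quotC, Prod.fst_swap, Prod.snd_swap]
        rw [add_comm p.2 p.1]; field_simp
  have : ∫ p, energyLin t0 t3 k p ∂M = 1 / 3 * (-∫ p, quotA k p ∂M - ∫ p, quotB k p ∂M +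
      ∫ p, quotC k p ∂M + 2 / t0 * ∫ y, G y ∂m) := by
    have e1 : ∫ p, G p.1 ∂M = ∫ y, G y ∂m := by rw [integral_fun_fst G]; simp
    rw [← e1, ← integral_neg, ← integral_sub iAn iB, ← integral_add iAB iC, ← integral_const_mul,
      ← integral_add iABC (iGp.const_mul _), ← integral_const_mul]
    rfl
  rw [integral_add iA (iB.const_mul _), integral_const_mul]; linarith

end

/-! ### The loop equation -/

section
variable {t0 t3 X L : ℝ}

/-- The first variation for a complex-valued vector field. -/
lemma IsEquilibriumPair.integral_quot_complex {x : ℝ} {μ ν : Measure ℂ} (hx : 0 < x)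
    (h : IsEquilibriumPair t0 t3 x μ ν) {k : ℝ → ℂ}
    (hre : IsVariation (x ^ (3 / 2 : ℝ)) L fun y => (k y).re)
    (him : IsVariation (x ^ (3 / 2 : ℝ)) L fun y => (k y).im) :
    ∫ p : ℝ × ℝ, ((p.1 * k p.1 - p.2 * k p.2) / (p.1 - p.2) +
        1 / 2 * ((p.1 * k p.1 + p.2 * k p.2) / (p.1 + p.2)) : ℂ)
        ∂((radialLaw μ).prod (radialLaw μ)) =
      2 / t0 * ∫ y : ℝ, (((1 / √t3 : ℝ) : ℂ) - t3 * y) * (y * k y) ∂(radialLaw μ) := by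
  obtain ⟨hprob, hmI, hm0⟩ := h.radialLaw_null hx
  set X := x ^ (3 / 2 : ℝ)
  set m := radialLaw μ
  have iQ : ∀ k : ℝ → ℝ, IsVariation X L k →
      Integrable (fun p => quotA k p + 1 / 2 * quotB k p) (m.prod m) := by
    intro k hk
    exact (integrable_of_goodPair hmI hm0 hk.measurable_quotA.aestronglyMeasurable L
      fun p hp => hk.abs_quotA_le hp).add ((integrable_of_goodPair hmI hm0
      hk.measurable_quotB.aestronglyMeasurable L fun p hp => hk.abs_quotB_le hp).const_mul _)
  have er := h.integral_quot_eq hx hre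
  have ei := h.integral_quot_eq hx him
  have ek : ∀ y, k y = ((k y).re : ℂ) + ((k y).im : ℂ) * I := fun y => (Complex.re_add_im _).symm
  have e1 : (fun p : ℝ × ℝ => ((p.1 * k p.1 - p.2 * k p.2) / (p.1 - p.2) +
        1 / 2 * ((p.1 * k p.1 + p.2 * k p.2) / (p.1 + p.2)) : ℂ)) = fun p =>
      ((quotA (fun y => (k y).re) p + 1 / 2 * quotB (fun y => (k y).re) p : ℝ) : ℂ) +
      ((quotA (fun y => (k y).im) p + 1 / 2 * quotB (fun y => (k y).im) p : ℝ) : ℂ) *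
        I := by
    funext p
    rw [ek p.1, ek p.2]
    simp only [quotA, quotB]; push_cast; ring
  have e2 : (fun y : ℝ => (((1 / √t3 : ℝ) : ℂ) - t3 * y) * (y * k y)) = fun y =>
      (((1 / √t3 - t3 * y) * (y * (k y).re) : ℝ) : ℂ) +
      (((1 / √t3 - t3 * y) * (y * (k y).im) : ℝ) : ℂ) * I := by
    funext y
    conv_lhs => rw [ek y]
    push_cast; ring
  rw [e1, e2, integral_add (iQ _ hre).ofReal ((iQ _ him).ofReal.mul_const _),
    integral_add (hre.integrable_field hmI).ofReal ((him.integrable_field hmI).ofReal.mul_const _),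
    integral_mul_const,
    integral_mul_const, integral_complex_ofReal, integral_complex_ofReal, integral_complex_ofReal,
    integral_complex_ofReal, er, ei]
  push_cast; ring

/-- The vector field `y (X² - y²) / (v² - y²)`, divided by `y`. -/
def loopField (X : ℝ) (v : ℂ) : ℝ → ℂ :=
  (Icc 0 X).indicator fun y => (X ^ 2 - y ^ 2) / (v ^ 2 - y ^ 2)

lemma sq_sub_sq_ne_zero {v : ℂ} (h1 : v ∉ segC X) (h2 : -v ∉ segC X) {y : ℝ}
    (hy : y ∈ Icc 0 X) : v - y ≠ 0 ∧ -v - y ≠ 0 ∧ v ^ 2 - y ^ 2 ≠ 0 := by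
  have a1 : v - y ≠ 0 := fun h => h1 ⟨y, hy, (sub_eq_zero.1 h).symm⟩
  have a2 : -v - y ≠ 0 := fun h => h2 ⟨y, hy, (sub_eq_zero.1 h).symm⟩
  refine ⟨a1, a2, ?_⟩
  rw [show v ^ 2 - y ^ 2 = -((v - y) * (-v - y)) by ring]
  exact neg_ne_zero.2 (mul_ne_zero a1 a2)

lemma exists_isVariation_loopField (hX : 0 < X) {v : ℂ} (h1 : v ∉ segC X) (h2 : -v ∉ segC X) :
    ∃ L, IsVariation X L (fun y => (loopField X v y).re) ∧
      IsVariation X L (fun y => (loopField X v y).im) := by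
  obtain ⟨δ, hδ, hle⟩ : ∃ δ : ℝ, 0 < δ ∧ ∀ y ∈ Icc 0 X, δ ≤ ‖v ^ 2 - y ^ 2‖ := by
    have hc : ContinuousOn (fun y : ℝ => ‖v ^ 2 - y ^ 2‖) (Icc 0 X) := by fun_prop
    obtain ⟨y0, hy0, hmin⟩ := isCompact_Icc.exists_isMinOn (Set.nonempty_Icc.2 hX.le) hc
    exact ⟨_, norm_pos_iff.2 (sq_sub_sq_ne_zero h1 h2 hy0).2.2, fun y hy => hmin hy⟩
  have hval : ∀ y ∈ Icc 0 X, loopField X v y =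
      (X ^ 2 - y ^ 2) / (v ^ 2 - y ^ 2) := fun y hy => by
    simp [loopField, Set.indicator_of_mem hy]
  set M : ℝ := ‖v‖ ^ 2 + X ^ 2
  have : 0 < M := by positivity
  set L : ℝ := 2 * X ^ 2 / δ + (1 + M * M / δ ^ 2) with hL
  have hL0 : 0 ≤ L := by positivity
  have hmeas : Measurable (loopField X v) := Measurable.indicator (by fun_prop) measurableSet_Icc
  have hb : ∀ y ∈ Icc 0 X, ‖loopField X v y‖ * y ≤ L * (X - y) ∧ ‖loopField X v y‖ ≤ L := by
    intro y hy
    have hd := hle y hy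
    have hp := hδ.trans_le hd
    have : 0 ≤ X - y := by linarith [hy.2]
    have hn : ‖(X : ℂ) ^ 2 - y ^ 2‖ = (X - y) * (X + y) := by
      rw [← ofReal_pow, ← ofReal_pow, ← ofReal_sub, norm_real, norm_of_nonneg (by nlinarith [hy.1])]
      ring
    rw [hval y hy, norm_div, hn]
    have : 2 * X ^ 2 ≤ L * δ := by
      rw [hL, add_mul, div_mul_cancel₀ _ hδ.ne']
      have : 0 ≤ (1 + M * M / δ ^ 2) * δ := by positivity
      linarith
    constructor
    · rw [div_mul_eq_mul_div, div_le_iff₀ hp]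
      have : L * δ ≤ L * ‖v ^ 2 - y ^ 2‖ := by gcongr
      have : (X + y) * y ≤ 2 * X ^ 2 := by nlinarith [hy.1, hy.2]
      have : (X + y) * y ≤ L * ‖v ^ 2 - y ^ 2‖ := by linarith
      nlinarith
    · rw [div_le_iff₀ hp]
      have : L * δ ≤ L * ‖v ^ 2 - y ^ 2‖ := by gcongr
      nlinarith [hy.1, hy.2]
  have hlip : ∀ y ∈ Icc 0 X, ∀ y' ∈ Icc 0 X,
      ‖y * loopField X v y - y' * loopField X v y'‖ ≤ L * |y - y'| := by
    intro y hy y' hy'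
    have := (sq_sub_sq_ne_zero h1 h2 hy).2.2
    have := (sq_sub_sq_ne_zero h1 h2 hy').2.2
    have e : y * loopField X v y - y' * loopField X v y' = ((y - y' : ℝ) : ℂ) *
        (1 + (X ^ 2 - v ^ 2) * (v ^ 2 + y * y') /
          ((v ^ 2 - y ^ 2) * (v ^ 2 - (y' : ℂ) ^ 2))) := by
      rw [hval y hy, hval y' hy']; push_cast; field_simp; ring
    rw [e, norm_mul, norm_real, norm_eq_abs, mul_comm]
    refine mul_le_mul_of_nonneg_right ?_ (abs_nonneg _)
    refine (norm_add_le _ _).trans ?_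
    rw [norm_one, norm_div, norm_mul, norm_mul]
    have : ‖X ^ 2 - v ^ 2‖ ≤ M := by
      refine (norm_sub_le _ _).trans ?_
      rw [norm_pow, norm_pow, norm_real, norm_of_nonneg hX.le]; linarith
    have : ‖v ^ 2 + y * y'‖ ≤ M := by
      refine (norm_add_le _ _).trans ?_
      rw [norm_pow, norm_mul, norm_real, norm_real, norm_of_nonneg hy.1, norm_of_nonneg hy'.1]
      nlinarith [hy.1, hy.2, hy'.1, hy'.2]
    have : ‖X ^ 2 - v ^ 2‖ * ‖v ^ 2 + y * y'‖ /
        (‖v ^ 2 - y ^ 2‖ * ‖v ^ 2 - (y' : ℂ) ^ 2‖) ≤ M * M / δ ^ 2 := by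
      rw [sq δ]
      have := hle y hy
      have := hle y' hy'
      gcongr
    have : 0 ≤ 2 * X ^ 2 / δ := by positivity
    linarith
  have hbound : ∀ y, ‖loopField X v y‖ ≤ L := by
    intro y
    by_cases hy : y ∈ Icc 0 X
    · exact (hb y hy).2
    · simp [loopField, Set.indicator_of_notMem hy, hL0]
  have hnorm : ∀ y ∈ Icc 0 X, ‖y * loopField X v y‖ ≤ L * (X - y) := by
    intro y hy
    rw [norm_mul, norm_real, norm_of_nonneg hy.1, mul_comm]
    exact (hb y hy).1
  refine ⟨L, ⟨Complex.measurable_re.comp hmeas, hL0, fun y => (abs_re_le_norm _).trans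
    (hbound y), fun y hy => ?_, fun y hy y' hy' => ?_⟩, ⟨Complex.measurable_im.comp hmeas, hL0,
    fun y => (abs_im_le_norm _).trans (hbound y), fun y hy => ?_, fun y hy y' hy' => ?_⟩⟩
  · rw [← re_ofReal_mul]
    exact (abs_re_le_norm _).trans (hnorm y hy)
  · rw [← re_ofReal_mul, ← re_ofReal_mul, ← sub_re]
    exact (abs_re_le_norm _).trans (hlip y hy y' hy')
  · rw [← im_ofReal_mul]
    exact (abs_im_le_norm _).trans (hnorm y hy)
  · rw [← im_ofReal_mul, ← im_ofReal_mul, ← sub_im]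
    exact (abs_im_le_norm _).trans (hlip y hy y' hy')

/-- The loop equation, up to a constant. -/
theorem IsEquilibriumPair.exists_loop_const {x : ℝ} {μ ν : Measure ℂ} (hx : 0 < x)
    (h : IsEquilibriumPair t0 t3 x μ ν) :
    ∃ κ : ℂ, ∀ v : ℂ, v ∉ segC (x ^ (3 / 2 : ℝ)) → -v ∉ segC (x ^ (3 / 2 : ℝ)) →
      (v ^ 2 - ((x ^ (3 / 2 : ℝ) : ℝ) : ℂ) ^ 2) *
        (1 / 2 * (stieltjes (radialLaw μ) v ^ 2 + stieltjes (radialLaw μ) (-v) ^ 2 -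
            stieltjes (radialLaw μ) v * stieltjes (radialLaw μ) (-v)) -
          1 / t0 * (((1 / √t3 : ℝ) : ℂ) *
            (stieltjes (radialLaw μ) v + stieltjes (radialLaw μ) (-v)) -
            t3 * (v * (stieltjes (radialLaw μ) v - stieltjes (radialLaw μ) (-v)) - 2))) = κ := by
  obtain ⟨hprob, hmI, hm0⟩ := h.radialLaw_null hx
  set X := x ^ (3 / 2 : ℝ)
  set m := radialLaw μ with hm
  have hX0 : 0 < X := by positivity
  have hIcc : ∀ᵐ y ∂m, y ∈ Icc 0 X := hmI
  set a : ℂ := ((1 / √t3 : ℝ) : ℂ)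
  refine ⟨3 / 2 - 2 / t0 * ∫ y : ℝ, (a - t3 * y) * y ∂m, fun v hv hv' => ?_⟩
  obtain ⟨L, hre, him⟩ := exists_isVariation_loopField hX0 hv hv'
  have hE := h.integral_quot_complex hx hre him
  rw [← hm] at hE
  have i1 : Integrable (fun y : ℝ => 1 / (v - y)) m := integrable_stieltjes hmI hv
  have i2 : Integrable (fun y : ℝ => 1 / (-v - y)) m := integrable_stieltjes hmI hv'
  have : v ≠ 0 := by
    rintro rfl
    exact hv ⟨0, ⟨le_rfl, hX0.le⟩, by simp⟩
  set p : ℝ → ℂ := fun y => 1 / (v - y) with hp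
  set n : ℝ → ℂ := fun y => 1 / (-v - y) with hn
  set P := stieltjes m v
  set N := stieltjes m (-v)
  have hpi : ∫ y, p y ∂m = P := rfl
  have hni : ∫ y, n y ∂m = N := rfl
  set D : ℂ := X ^ 2 - v ^ 2 with hD
  -- partial fractions of the vector field
  have hh : ∀ y ∈ Icc 0 X, y * loopField X v y = y + D * ((p y + n y) / 2) := by
    intro y hy
    obtain ⟨n1, n2, n3⟩ := sq_sub_sq_ne_zero hv hv' hy
    rw [loopField, Set.indicator_of_mem hy, hp, hn, hD]; field_simp; ring
  have hlhs : ∫ q : ℝ × ℝ, ((q.1 * loopField X v q.1 - q.2 * loopField X v q.2) / (q.1 - q.2) +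
      1 / 2 * ((q.1 * loopField X v q.1 + q.2 * loopField X v q.2) / (q.1 + q.2)) : ℂ) ∂(m.prod m) =
      3 / 2 + D * (1 / 2 * (P ^ 2 + N ^ 2 -
        P * N)) := by
    have hcongr : ∀ᵐ q : ℝ × ℝ ∂(m.prod m),
        ((q.1 * loopField X v q.1 - q.2 * loopField X v q.2) / (q.1 - q.2) +
        1 / 2 * ((q.1 * loopField X v q.1 + q.2 * loopField X v q.2) / (q.1 + q.2)) : ℂ) =
        3 / 2 + D * (1 / 2 * (p q.1 * p q.2) + 1 / 2 * (n q.1 * n q.2) -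
          (1 / 4 * (p q.1 * n q.2) + 1 / 4 * (n q.1 * p q.2))) := by
      filter_upwards [ae_goodPair hmI hm0] with q hq
      have I1 : q.1 ∈ Icc 0 X := ⟨hq.1.1.le, hq.1.2⟩
      have I2 : q.2 ∈ Icc 0 X := ⟨hq.2.1.1.le, hq.2.1.2⟩
      obtain ⟨a1, a2, -⟩ := sq_sub_sq_ne_zero hv hv' I1
      obtain ⟨b1, b2, -⟩ := sq_sub_sq_ne_zero hv hv' I2
      have d1 : (q.1 : ℂ) - q.2 ≠ 0 := by rw [sub_ne_zero]; exact_mod_cast hq.2.2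
      have d2 : (q.1 : ℂ) + q.2 ≠ 0 := by
        have := (add_pos hq.1.1 hq.2.1.1).ne'
        exact_mod_cast this
      have eA : (q.1 * loopField X v q.1 - q.2 * loopField X v q.2) / ((q.1 : ℂ) - q.2) =
          1 + D * (1 / 2 * (p q.1 * p q.2) + 1 / 2 * (n q.1 * n q.2)) := by
        rw [hh _ I1, hh _ I2, div_eq_iff d1, hp, hn]
        simp only
        generalize (q.1 : ℂ) = y at *
        generalize (q.2 : ℂ) = y' at *
        field_simp; ring
      have eB : (q.1 * loopField X v q.1 + q.2 * loopField X v q.2) / ((q.1 : ℂ) + q.2) =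
          1 - D * (1 / 2 * (p q.1 * n q.2) + 1 / 2 * (n q.1 * p q.2)) := by
        rw [hh _ I1, hh _ I2, div_eq_iff d2, hp, hn]
        simp only
        generalize (q.1 : ℂ) = y at *
        generalize (q.2 : ℂ) = y' at *
        field_simp; ring
      rw [eA, eB]; ring
    rw [integral_congr_ae hcongr]
    have j1 := (i1.mul_prod i1).const_mul (1 / 2 : ℂ)
    have j2 := (i2.mul_prod i2).const_mul (1 / 2 : ℂ)
    have j3 := (i1.mul_prod i2).const_mul (1 / 4 : ℂ)
    have j4 := (i2.mul_prod i1).const_mul (1 / 4 : ℂ)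
    have j12 : Integrable (fun q : ℝ × ℝ => 1 / 2 * (p q.1 * p q.2) + 1 / 2 * (n q.1 * n q.2))
      (m.prod m) := j1.add j2
    have j34 : Integrable (fun q : ℝ × ℝ => 1 / 4 * (p q.1 * n q.2) + 1 / 4 * (n q.1 * p q.2))
      (m.prod m) := j3.add j4
    have j5 : Integrable (fun q : ℝ × ℝ => 1 / 2 * (p q.1 * p q.2) + 1 / 2 * (n q.1 * n q.2) -
      (1 / 4 * (p q.1 * n q.2) + 1 / 4 * (n q.1 * p q.2))) (m.prod m) := j12.sub j34
    rw [integral_add (integrable_const _) (j5.const_mul D), integral_const_mul,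
      integral_sub j12 j34, integral_add j1 j2, integral_add j3 j4]
    simp only [integral_const_mul, integral_prod_mul, hpi, hni, integral_const, probReal_univ,
      one_smul]
    ring
  have hrhs : ∫ y : ℝ, (a - t3 * y) * (y * loopField X v y) ∂m =
      ∫ y : ℝ, (a - t3 * y) * y ∂m +
        D * (a / 2 * (P + N) -
          t3 * (-1 + v / 2 * (P - N))) := by
    have hcongr : ∀ᵐ y : ℝ ∂m, (a - t3 * y) * (y * loopField X v y) =
        (a - t3 * y) * y + D * (a / 2 * (p y + n y) -
          t3 * (-1 + v / 2 * (p y - n y))) := by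
      filter_upwards [hIcc] with y hy
      obtain ⟨n1, n2, n3⟩ := sq_sub_sq_ne_zero hv hv' hy
      rw [hh y hy, hp, hn]
      field_simp; ring
    rw [integral_congr_ae hcongr]
    have k0 : Integrable (fun y : ℝ => (a - t3 * y) * y) m := by
      obtain ⟨B, hB⟩ := isCompact_Icc.exists_bound_of_continuousOn (s := Icc 0 X)
        (f := fun y : ℝ => (a - t3 * y) * y) (by fun_prop)
      exact Integrable.of_bound (by fun_prop) B (by filter_upwards [hIcc] with y hy using hB y hy)
    have ks : Integrable (fun y => p y + n y) m := i1.add i2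
    have kd : Integrable (fun y => p y - n y) m := i1.sub i2
    have k1 := ks.const_mul (a / 2)
    have k2 : Integrable (fun y => -1 + v / 2 * (p y - n y)) m :=
      (integrable_const _).add (kd.const_mul _)
    have k3 := k2.const_mul (t3 : ℂ)
    have k4 : Integrable (fun y => a / 2 * (p y + n y) -
      t3 * (-1 + v / 2 * (p y - n y))) m := k1.sub k3
    rw [integral_add k0 (k4.const_mul D), integral_const_mul, integral_sub k1 k3,
      integral_const_mul, integral_const_mul, integral_add i1 i2,
      integral_add (integrable_const _) (kd.const_mul _), integral_const_mul, integral_sub i1 i2,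
      hpi, hni]
    simp
  rw [hlhs, hrhs] at hE
  linear_combination (-1 : ℂ) * hE

end

/-! ### Vanishing of the constant in the loop equation -/

lemma sqrt_mul_le_sub_rpow {x r : ℝ} (hr : 0 ≤ r) (hrx : r ≤ x) :
    √x * (x - r) ≤ x ^ (3 / 2 : ℝ) - r ^ (3 / 2 : ℝ) := by
  have key : ∀ y : ℝ, 0 ≤ y → y ^ (3 / 2 : ℝ) = y * √y := by
    intro y hy
    rw [Real.sqrt_eq_rpow, show (3 / 2 : ℝ) = 1 + 1 / 2 by norm_num,
      Real.rpow_add' hy (by norm_num), Real.rpow_one]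
  rw [key x (hr.trans hrx), key r hr]
  have : √r ≤ √x := Real.sqrt_le_sqrt hrx
  nlinarith

lemma lintegral_one_div_sqrt_lt_top {x : ℝ} (hx : 0 < x) :
    ∫⁻ r in Icc 0 x, ofReal (1 / √(x ^ (3 / 2 : ℝ) - r ^ (3 / 2 : ℝ))) < ⊤ := by
  have h1 : IntervalIntegrable (fun r : ℝ => (x - r) ^ (-(1 / 2) : ℝ)) volume 0 x := by
    have := (intervalIntegral.intervalIntegrable_rpow' (a := x) (b := 0) (r := -(1 / 2))
      (by norm_num)).comp_sub_left x
    simpa using this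
  have h2 : IntegrableOn (fun r : ℝ => 1 / √(√x) * (x - r) ^ (-(1 / 2) : ℝ)) (Icc 0 x) := by
    rw [integrableOn_Icc_iff_integrableOn_Ioc]
    exact ((intervalIntegrable_iff_integrableOn_Ioc_of_le hx.le).1 h1).const_mul _
  have h3 := h2.2
  rw [hasFiniteIntegral_iff_norm] at h3
  refine lt_of_le_of_lt (lintegral_mono_ae ?_) h3
  have hne : ∀ᵐ r : ℝ ∂(volume.restrict (Icc 0 x)), r ≠ x := by
    refine ae_restrict_of_ae ?_
    rw [ae_iff]; simp
  filter_upwards [ae_restrict_mem measurableSet_Icc, hne] with r hr hrx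
  have hlt : 0 < x - r := sub_pos.2 (lt_of_le_of_ne hr.2 hrx)
  have := sqrt_mul_le_sub_rpow hr.1 hr.2
  have hsx : 0 < √x := sqrt_pos.2 hx
  refine ofReal_le_ofReal ?_
  rw [norm_of_nonneg (by positivity), Real.rpow_neg hlt.le, ← Real.sqrt_eq_rpow,
    ← one_div, one_div_mul_one_div, ← Real.sqrt_mul hsx.le]
  have : 0 < √(√x * (x - r)) := sqrt_pos.2 (by positivity)
  gcongr

lemma lintegral_arcLength (x : ℝ) {f : ℂ → ℝ≥0∞} (hf : Measurable f) : ∫⁻ s, f s ∂(arcLength x) =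
      ∑ j : Fin 3, ∫⁻ r in Icc 0 x, f (r * omega ^ (j : ℕ)) := by
  unfold arcLength
  rw [lintegral_finsetSum_measure]
  refine Finset.sum_congr rfl fun j _ => ?_
  rw [lintegral_map hf (by fun_prop)]

lemma rad_ofReal_mul_omega_pow {r : ℝ} (hr : 0 ≤ r) (j : ℕ) :
    rad (r * omega ^ j) = r ^ (3 / 2 : ℝ) := by
  unfold rad
  rw [norm_mul, norm_pow, norm_omega, one_pow, mul_one, norm_real, norm_of_nonneg hr]

lemma omega_pow_cube (j : ℕ) : (omega ^ j) ^ 3 = 1 := by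
  rw [← pow_mul, mul_comm, pow_mul, omega_cube, one_pow]

lemma ofReal_mul_omega_pow_mem {x r : ℝ} (hr : r ∈ Icc 0 x) (j : ℕ) :
    r * omega ^ j ∈ Sigma1 x := by
  refine ⟨r ^ 3, pow_nonneg hr.1 3, ?_, ?_⟩
  · have := hr.1
    have := hr.2
    gcongr
  · rw [mul_pow, omega_pow_cube]; push_cast; ring

/-- The radial law does not charge the neighbourhood of its right endpoint too much. -/
lemma DensityVanishesAtEndpoints.integrable {x : ℝ} (hx : 0 < x) {μ : Measure ℂ}
    [IsProbabilityMeasure μ] (h : DensityVanishesAtEndpoints x μ) :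
    Integrable (fun y => 1 / √(x ^ (3 / 2 : ℝ) - y)) (radialLaw μ) := by
  obtain ⟨ρ, hρ, hμ, hlim⟩ := h
  set X := x ^ (3 / 2 : ℝ)
  have hmeas : Measurable fun y : ℝ => 1 / √(X - y) := by fun_prop
  have hδ : ∃ δ : ℝ, 0 < δ ∧ ∀ j : Fin 3, ∀ r ∈ Icc 0 x, x - δ < r →
      ρ (r * omega ^ (j : ℕ)) ≤ 1 := by
    have hj : ∀ j : Fin 3, ∀ᶠ δ in 𝓝[>] 0, ∀ r ∈ Icc 0 x, x - δ < r →
        ρ (r * omega ^ (j : ℕ)) ≤ 1 := by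
      intro j
      have h1 := (hlim j).eventually (Iic_mem_nhds (zero_lt_one' ℝ≥0∞))
      rw [Metric.nhdsWithin_basis_ball.eventually_iff] at h1
      obtain ⟨δ, hδ, h1⟩ := h1
      filter_upwards [Ioo_mem_nhdsGT hδ] with η hη r hr hr2
      refine h1 ⟨?_, ofReal_mul_omega_pow_mem hr j⟩
      rw [Metric.mem_ball, dist_eq_norm, mul_comm _ (x : ℂ), ← sub_mul, norm_mul, norm_pow,
        norm_omega, one_pow, mul_one, ← ofReal_sub, norm_real, norm_eq_abs, abs_lt]
      constructor <;> linarith [hr.2, hη.2]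
    exact ((eventually_all.2 hj).and self_mem_nhdsWithin).exists.imp fun δ h => ⟨h.2, h.1⟩
  obtain ⟨δ, hδ0, hδ⟩ := hδ
  set M : ℝ := 1 / √(√x * δ) with hM
  have : 0 < √x := sqrt_pos.2 hx
  set G : ℂ → ℝ≥0∞ := fun s => ofReal (1 / √(X - rad s)) with hG
  have hGm : Measurable G := by fun_prop
  have hpt : ∀ j : Fin 3, ∀ r ∈ Icc 0 x,
      ρ (r * omega ^ (j : ℕ)) * G (r * omega ^ (j : ℕ)) ≤
        ofReal M * ρ (r * omega ^ (j : ℕ)) + G (r * omega ^ (j : ℕ)) := by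
    intro j r hr
    by_cases hc : x - δ < r
    · refine le_add_left ?_
      calc _ ≤ 1 * G (r * omega ^ (j : ℕ)) := by
            gcongr
            exact hδ j r hr hc
        _ = _ := one_mul _
    · refine le_add_right ?_
      rw [mul_comm]; gcongr
      rw [hG]
      simp only
      rw [rad_ofReal_mul_omega_pow hr.1]
      refine ofReal_le_ofReal ?_
      have h1 := sqrt_mul_le_sub_rpow hr.1 hr.2
      have h2 : √x * δ ≤ √x * (x - r) := by
        have : δ ≤ x - r := by linarith
        gcongr
      have h3 : 0 < √(√x * δ) := sqrt_pos.2 (by positivity)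
      rw [hM]
      have : √(√x * δ) ≤ √(X - r ^ (3 / 2 : ℝ)) := Real.sqrt_le_sqrt (h2.trans h1)
      exact one_div_le_one_div_of_le h3 this
  have hG0 : ∫⁻ s, G s ∂(arcLength x) < ⊤ := by
    rw [lintegral_arcLength x hGm]
    refine ENNReal.sum_lt_top.2 fun j _ => ?_
    refine lt_of_eq_of_lt ?_ (lintegral_one_div_sqrt_lt_top hx)
    refine setLIntegral_congr_fun measurableSet_Icc fun r hr => ?_
    simp only [hG]
    rw [rad_ofReal_mul_omega_pow hr.1]
  have hfin : ∫⁻ s, G s ∂μ < ⊤ := by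
    rw [hμ, lintegral_withDensity_eq_lintegral_mul _ hρ hGm]
    calc ∫⁻ s, (ρ * G) s ∂(arcLength x) ≤
        ∫⁻ s, (ofReal M * ρ s + G s) ∂(arcLength x) := by
          rw [lintegral_arcLength x (hρ.mul hGm), lintegral_arcLength x (by fun_prop)]
          exact Finset.sum_le_sum fun j _ =>
            setLIntegral_mono_ae (by fun_prop) (ae_of_all _ fun r hr => hpt j r hr)
      _ < ⊤ := by
          rw [lintegral_add_right _ hGm, lintegral_const_mul _ hρ]
          refine add_lt_top.2 ⟨mul_lt_top ofReal_lt_top ?_, hG0⟩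
          have : μ univ < ⊤ := measure_lt_top _ _
          rw [hμ, withDensity_apply _ MeasurableSet.univ, Measure.restrict_univ] at this
          exact this
  unfold radialLaw
  rw [integrable_map_measure hmeas.aestronglyMeasurable measurable_rad.aemeasurable]
  refine ⟨(hmeas.comp measurable_rad).aestronglyMeasurable, ?_⟩
  rw [hasFiniteIntegral_iff_norm]
  refine lt_of_eq_of_lt (lintegral_congr fun s => ?_) hfin
  simp only [hG, Function.comp]
  rw [norm_of_nonneg (by positivity)]

lemma tendsto_sqrt_mul_stieltjes {m : Measure ℝ} [IsProbabilityMeasure m] {X : ℝ}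
    (hmI : m (Icc 0 X)ᶜ = 0) (hm0 : ∀ y, m {y} = 0)
    (hi : Integrable (fun y => 1 / √(X - y)) m) :
    Tendsto (fun v : ℝ => (√(v - X) : ℂ) * stieltjes m v) (𝓝[>] X) (𝓝 0) := by
  have hIcc : ∀ᵐ y ∂m, y ∈ Set.Ico 0 X := by
    have h1 : ∀ᵐ y ∂m, y ∈ Icc 0 X := hmI
    have h2 : ∀ᵐ y ∂m, y ≠ X := by rw [ae_iff]; simpa using hm0 X
    filter_upwards [h1, h2] with y hy hy0
    exact ⟨hy.1, lt_of_le_of_ne hy.2 hy0⟩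
  have e : (fun v : ℝ => (√(v - X) : ℂ) * stieltjes m v) =
      fun v : ℝ => ∫ y : ℝ, (√(v - X) : ℂ) * (1 / (v - y)) ∂m := by
    funext v
    rw [integral_const_mul]; rfl
  rw [e]
  have h0 : 0 = ∫ _ : ℝ, (0 : ℂ) ∂m := by simp
  rw [h0]
  refine tendsto_integral_filter_of_dominated_convergence (fun y => 1 / √(X - y))
    (Eventually.of_forall fun v => Measurable.aestronglyMeasurable (by fun_prop)) ?_ hi ?_
  · filter_upwards [self_mem_nhdsWithin] with v hv
    filter_upwards [hIcc] with y hy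
    have hv' : 0 < v - X := sub_pos.2 hv
    have hy' : 0 < X - y := sub_pos.2 hy.2
    have hvy : 0 < v - y := by linarith
    rw [norm_mul, norm_div, norm_one, ← ofReal_sub, norm_real, norm_real,
      norm_of_nonneg (sqrt_nonneg _), norm_of_nonneg hvy.le, mul_one_div,
      div_le_div_iff₀ hvy (sqrt_pos.2 hy'), one_mul]
    have h1 := sq_sqrt hv'.le
    have h2 := sq_sqrt hy'.le
    nlinarith [sq_nonneg (√(v - X) - √(X - y)), sqrt_nonneg (v - X), sqrt_nonneg (X - y),
      mul_nonneg (sqrt_nonneg (v - X)) (sqrt_nonneg (X - y))]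
  · filter_upwards [hIcc] with y hy
    have hne : (X : ℂ) - y ≠ 0 := by rw [sub_ne_zero]; exact_mod_cast hy.2.ne'
    have hc : ContinuousAt (fun v : ℝ => (√(v - X) : ℂ) * (1 / ((v : ℂ) - y))) X := by
      refine ContinuousAt.mul (by fun_prop) (ContinuousAt.div (by fun_prop) (by fun_prop) hne)
    have := hc.tendsto
    simp only [sub_self, Real.sqrt_zero, Complex.ofReal_zero, zero_mul] at this
    exact this.mono_left nhdsWithin_le_nhds

lemma norm_stieltjes_neg_le {m : Measure ℝ} [IsProbabilityMeasure m] {X v : ℝ}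
    (hmI : m (Icc 0 X)ᶜ = 0) (hv : 0 < v) : ‖stieltjes m (-v)‖ ≤ 1 / v := by
  have hIcc : ∀ᵐ y ∂m, y ∈ Icc 0 X := hmI
  unfold stieltjes
  refine (norm_integral_le_of_norm_le_const (C := 1 / v) ?_).trans (by simp)
  filter_upwards [hIcc] with y hy
  rw [norm_div, norm_one, ← ofReal_neg, ← ofReal_sub, norm_real,
    Real.norm_of_nonpos (by linarith [hy.1])]
  exact one_div_le_one_div_of_le hv (by linarith [hy.1])

lemma ofReal_not_mem_segC {X v : ℝ} (h : X < v) : (v : ℂ) ∉ segC X := by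
  rintro ⟨y, hy, hyv⟩
  have : y = v := by exact_mod_cast hyv
  linarith [hy.2]

lemma neg_ofReal_not_mem_segC {X v : ℝ} (h : 0 < v) : -(v : ℂ) ∉ segC X := by
  rintro ⟨y, hy, hyv⟩
  have : y = -v := by exact_mod_cast hyv
  linarith [hy.1]

/-- The loop equation, a quadratic relation between the values of `Kfun` at `v` and `-v`. -/
theorem IsEquilibriumPair.loop_equation {t0 t3 x : ℝ} {μ ν : Measure ℂ} (hx : 0 < x) (ht0 : 0 < t0)
    (ht3 : 0 < t3) (h : IsEquilibriumPair t0 t3 x μ ν) (hdens : DensityVanishesAtEndpoints x μ)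
    {v : ℂ} (hv : v ∉ segC (x ^ (3 / 2 : ℝ))) (hv' : -v ∉ segC (x ^ (3 / 2 : ℝ))) :
    t3 * v * (Kfun t0 t3 (radialLaw μ) v - Kfun t0 t3 (radialLaw μ) (-v)) -
      Kfun t0 t3 (radialLaw μ) v ^ 2 - Kfun t0 t3 (radialLaw μ) (-v) ^ 2 +
      Kfun t0 t3 (radialLaw μ) v * Kfun t0 t3 (radialLaw μ) (-v) =
    -((t0 * t3 + 1 / t3 : ℝ) : ℂ) := by
  obtain ⟨hprob, hmI, hm0⟩ := h.radialLaw_null hx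
  obtain ⟨κ, hκ⟩ := h.exists_loop_const hx
  have hi := hdens.integrable hx
  set X := x ^ (3 / 2 : ℝ)
  set m := radialLaw μ
  have hX0 : 0 < X := by positivity
  have hκ0 : κ = 0 := by
    have l1 := tendsto_sqrt_mul_stieltjes hmI hm0 hi
    have l0 : Tendsto (fun v : ℝ => (√(v - X) : ℂ)) (𝓝[>] X) (𝓝 0) := by
      have hc : ContinuousAt (fun v : ℝ => (√(v - X) : ℂ)) X := by fun_prop
      have := hc.tendsto
      simp only [sub_self, Real.sqrt_zero, Complex.ofReal_zero] at this
      exact this.mono_left nhdsWithin_le_nhds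
    have l2 : Tendsto (fun v : ℝ => (√(v - X) : ℂ) * stieltjes m (-v)) (𝓝[>] X) (𝓝 0) := by
      refine squeeze_zero_norm' (a := fun v => ‖(√(v - X) : ℂ)‖ * (1 / X)) ?_ ?_
      · filter_upwards [self_mem_nhdsWithin] with v hv
        rw [norm_mul]; gcongr
        exact (norm_stieltjes_neg_le hmI (hX0.trans hv)).trans
          (one_div_le_one_div_of_le hX0 (le_of_lt hv))
      · simpa using l0.norm.mul_const (1 / X)
    have lv : Tendsto (fun v : ℝ => (v : ℂ)) (𝓝[>] X) (𝓝 X) :=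
      (Complex.continuous_ofReal.tendsto X).mono_left nhdsWithin_le_nhds
    set a : ℂ := ((1 / √t3 : ℝ) : ℂ)
    have lim := (lv.add_const (X : ℂ)).mul
      ((((l1.pow 2).add (l2.pow 2)).sub (l1.mul l2)).const_mul (1 / 2 : ℂ) |>.sub
        ((((l0.mul (l1.add l2)).const_mul a).sub
          (((lv.mul (l0.mul (l1.sub l2))).sub ((l0.pow 2).const_mul 2)).const_mul
            (t3 : ℂ))).const_mul (1 / t0 : ℂ)))
    have hconst : Tendsto (fun _ : ℝ => κ) (𝓝[>] X) (𝓝 κ) := tendsto_const_nhds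
    have := tendsto_nhds_unique hconst (lim.congr' ?_)
    · rw [this]; ring
    · filter_upwards [self_mem_nhdsWithin] with v hv
      rw [← hκ v (ofReal_not_mem_segC hv) (neg_ofReal_not_mem_segC (hX0.trans hv))]
      have hs : (√(v - X) : ℂ) ^ 2 = v - X := by
        rw [← ofReal_pow, sq_sqrt (sub_pos.2 hv).le]; push_cast; rfl
      rw [show v ^ 2 - X ^ 2 = (v + X) * (√(v - X) : ℂ) ^ 2 by rw [hs]; ring]; ring
  have hne : v ^ 2 - X ^ 2 ≠ 0 := (sq_sub_sq_ne_zero hv hv' ⟨hX0.le, le_rfl⟩).2.2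
  have hQ := (mul_eq_zero.1 ((hκ v hv hv').trans hκ0)).resolve_left hne
  have : (t0 : ℂ) ≠ 0 := by exact_mod_cast ht0.ne'
  have : (t3 : ℂ) ≠ 0 := by exact_mod_cast ht3.ne'
  have ha2 : ((1 / √t3 : ℝ) : ℂ) ^ 2 = 1 / t3 := by
    rw [← ofReal_pow, div_pow, sq_sqrt ht3.le]; push_cast; ring
  unfold Kfun
  push_cast at hQ ha2 ⊢
  generalize stieltjes m v = H at *
  generalize stieltjes m (-v) = Hb at *
  generalize (1 / (√t3 : ℂ)) = a at *
  have hQ' : t0 ^ 2 * (1 / 2 * (H ^ 2 + Hb ^ 2 - H * Hb)) -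
      t0 * (a * (H + Hb) - t3 * (v * (H - Hb) - 2)) = 0 := by
    have := congrArg (fun z => (t0 : ℂ) ^ 2 * z) hQ
    simp only [mul_zero] at this
    rw [← this]; field_simp
  linear_combination (-1 / 2 : ℂ) * hQ' - ha2

/-! ### The cubic equation for `Kfun` -/

/-- The properties of the radial law of the minimiser that determine the spectral curve. -/
structure IsLoopLaw (t0 t3 X : ℝ) (m : Measure ℝ) : Prop where
  t0_pos : 0 < t0
  t3_pos : 0 < t3
  X_pos : 0 < X
  prob : IsProbabilityMeasure m
  compl : m (Icc 0 X)ᶜ = 0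
  null : ∀ y, m {y} = 0
  pos : ∀ a b, 0 ≤ a → a < b → b ≤ X → 0 < m (Set.Ioo a b)
  loop : ∀ v, v ∉ segC X → -v ∉ segC X →
    t3 * v * (Kfun t0 t3 m v - Kfun t0 t3 m (-v)) - Kfun t0 t3 m v ^ 2 - Kfun t0 t3 m (-v) ^ 2 +
      Kfun t0 t3 m v * Kfun t0 t3 m (-v) = -((t0 * t3 + 1 / t3 : ℝ) : ℂ)

theorem IsEquilibriumPair.isLoopLaw {t0 t3 x : ℝ} {μ ν : Measure ℂ} (hx : 0 < x) (ht0 : 0 < t0)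
    (ht3 : 0 < t3) (h : IsEquilibriumPair t0 t3 x μ ν) (hsupp : μ.support = Sigma1 x)
    (hdens : DensityVanishesAtEndpoints x μ) :
    IsLoopLaw t0 t3 (x ^ (3 / 2 : ℝ)) (radialLaw μ) := by
  obtain ⟨hprob, hmI, hm0⟩ := h.radialLaw_null hx
  refine ⟨ht0, ht3, by positivity, inferInstance, hmI, hm0, fun a b ha hab hb => ?_,
    fun v hv hv' => h.loop_equation hx ht0 ht3 hdens hv hv'⟩
  exact radialLaw_pos_of_isOpen hx hsupp isOpen_Ioo (y := (a + b) / 2)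
    ⟨by linarith, by linarith⟩ (by linarith) (by linarith)

/-- `stieltjes` on the real line. -/
def stieltjesR (m : Measure ℝ) (v : ℝ) : ℝ := ∫ y, 1 / (v - y) ∂m

/-- `Kfun` on the real line. -/
def KfunR (t0 t3 : ℝ) (m : Measure ℝ) (v : ℝ) : ℝ := 1 / √t3 - t0 / 2 * stieltjesR m v

lemma stieltjes_ofReal (m : Measure ℝ) (v : ℝ) : stieltjes m v = stieltjesR m v := by
  unfold stieltjes stieltjesR
  rw [← integral_complex_ofReal]; congr 1
  funext y
  push_cast; rfl

lemma Kfun_ofReal (t0 t3 : ℝ) (m : Measure ℝ) (v : ℝ) : Kfun t0 t3 m v = KfunR t0 t3 m v := by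
  unfold Kfun KfunR
  rw [stieltjes_ofReal]; push_cast; rfl

lemma stieltjes_conj (m : Measure ℝ) (v : ℂ) :
    stieltjes m (conj v) = conj (stieltjes m v) := by
  unfold stieltjes
  rw [← integral_conj]; congr 1
  funext y
  simp

lemma Kfun_conj (t0 t3 : ℝ) (m : Measure ℝ) (v : ℂ) :
    Kfun t0 t3 m (conj v) = conj (Kfun t0 t3 m v) := by
  unfold Kfun
  rw [stieltjes_conj]
  simp only [map_sub, map_mul, map_div₀, conj_ofReal, map_ofNat]

lemma hasDerivAt_stieltjes {m : Measure ℝ} [IsProbabilityMeasure m] {X : ℝ}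
    (h : m (Icc 0 X)ᶜ = 0) {v : ℂ} (hv : v ∉ segC X) :
    DifferentiableAt ℂ (stieltjes m) v := by
  obtain ⟨δ, hδ, hb⟩ := Metric.isOpen_iff.1 (isClosed_segC X).isOpen_compl v hv
  have hball : Metric.ball v (δ / 2) ∈ 𝓝 v := Metric.ball_mem_nhds v (by positivity)
  have hfar : ∀ᵐ y : ℝ ∂m, ∀ w ∈ Metric.ball v (δ / 2), δ / 2 ≤ ‖w - y‖ := by
    filter_upwards [ae_mem_segC h] with y hy w hw
    have : δ ≤ ‖v - y‖ := by
      by_contra hlt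
      have hmem : (y : ℂ) ∈ Metric.ball v δ := by
        rw [Metric.mem_ball, dist_comm, dist_eq_norm]
        exact not_le.1 hlt
      exact hb hmem hy
    rw [Metric.mem_ball, dist_comm, dist_eq_norm] at hw
    have := norm_add_le (v - w) (w - y)
    rw [sub_add_sub_cancel] at this; linarith
  have := hasDerivAt_integral_of_dominated_loc_of_deriv_le (μ := m) (𝕜 := ℂ)
    (F := fun (w : ℂ) (y : ℝ) => 1 / (w - y)) (F' := fun w y => -1 / (w - y) ^ 2)
    (x₀ := v) (bound := fun _ => 1 / (δ / 2) ^ 2) hball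
    (Eventually.of_forall fun w => Measurable.aestronglyMeasurable (by fun_prop))
    (integrable_stieltjes h hv) (Measurable.aestronglyMeasurable (by fun_prop)) ?_
    (integrable_const _) ?_
  · exact this.2.differentiableAt
  · filter_upwards [hfar] with y hy w hw
    have := hy w hw
    rw [norm_div, norm_neg, norm_one, norm_pow]; gcongr
  · filter_upwards [hfar] with y hy w hw
    have h0 : w - y ≠ 0 := by
      rw [← norm_pos_iff]
      exact lt_of_lt_of_le (by positivity) (hy w hw)
    have := ((hasDerivAt_id w).sub_const (y : ℂ)).inv h0
    simp only [one_div]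
    exact this

namespace IsLoopLaw
variable {t0 t3 X : ℝ} {m : Measure ℝ}

lemma differentiableAt (h : IsLoopLaw t0 t3 X m) {v : ℂ} (hv : v ∉ segC X) :
    DifferentiableAt ℂ (Kfun t0 t3 m) v := by
  have := h.prob
  unfold Kfun
  exact ((hasDerivAt_stieltjes h.compl hv).const_mul _).const_sub _

lemma ae_mem (h : IsLoopLaw t0 t3 X m) : ∀ᵐ y ∂m, y ∈ Ioc 0 X := by
  have h1 : ∀ᵐ y ∂m, y ∈ Icc 0 X := h.compl
  have h2 : ∀ᵐ y ∂m, y ≠ 0 := by rw [ae_iff]; simpa using h.null 0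
  filter_upwards [h1, h2] with y hy hy0
  exact ⟨lt_of_le_of_ne hy.1 hy0.symm, hy.2⟩

/-- The function `v (K³ - t₃ v K² - c K)`. -/
def curveFun (t0 t3 : ℝ) (m : Measure ℝ) (v : ℂ) : ℂ :=
  v * (Kfun t0 t3 m v ^ 3 - t3 * v * Kfun t0 t3 m v ^ 2 -
    ((t0 * t3 + 1 / t3 : ℝ) : ℂ) * Kfun t0 t3 m v)

lemma curveFun_neg (h : IsLoopLaw t0 t3 X m) {v : ℂ} (hv : v ∉ segC X) (hv' : -v ∉ segC X) :
    curveFun t0 t3 m (-v) = curveFun t0 t3 m v := by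
  unfold curveFun
  linear_combination (v * (Kfun t0 t3 m v + Kfun t0 t3 m (-v))) * h.loop v hv hv'

lemma tendsto_mul_Kfun (h : IsLoopLaw t0 t3 X m) :
    Tendsto (fun v => v * Kfun t0 t3 m v) (𝓝[{v | v.re ≤ 0}] 0) (𝓝 0) := by
  have := h.prob
  have key : Tendsto (fun v : ℂ => ∫ y : ℝ, v * (1 / (v - y)) ∂m) (𝓝[{v | v.re ≤ 0}] 0)
      (𝓝 (∫ _ : ℝ, (0 : ℂ) ∂m)) := by
    refine tendsto_integral_filter_of_dominated_convergence (fun _ => 1)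
      (Eventually.of_forall fun v => Measurable.aestronglyMeasurable (by fun_prop)) ?_
      (integrable_const _) ?_
    · filter_upwards [self_mem_nhdsWithin] with v hv
      filter_upwards [h.ae_mem] with y hy
      rw [norm_mul, norm_div, norm_one, mul_one_div]
      refine div_le_one_of_le₀ ?_ (norm_nonneg _)
      rw [norm_def, norm_def]
      refine Real.sqrt_le_sqrt ?_
      simp only [normSq_apply, sub_re, ofReal_re, sub_im, ofReal_im, sub_zero]
      have : v.re ≤ 0 := hv
      nlinarith [hy.1]
    · filter_upwards [h.ae_mem] with y hy
      have hne : (0 : ℂ) - y ≠ 0 := by rw [zero_sub, neg_ne_zero]; exact_mod_cast hy.1.ne'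
      have hc : ContinuousAt (fun v : ℂ => v * (1 / (v - (y : ℂ)))) 0 :=
        continuousAt_id.mul (continuousAt_const.div (by fun_prop) hne)
      have := hc.tendsto
      simp only [zero_mul] at this
      exact this.mono_left nhdsWithin_le_nhds
  have h2 : (fun v => v * Kfun t0 t3 m v) = fun v : ℂ => v * ((1 / √t3 : ℝ) : ℂ) -
      (t0 / 2 : ℂ) * ∫ y : ℝ, v * (1 / (v - y)) ∂m := by
    funext v
    unfold Kfun stieltjes
    rw [integral_const_mul]; ring
  have h3 : Tendsto (fun v : ℂ => v) (𝓝[{v | v.re ≤ 0}] 0) (𝓝 0) :=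
    tendsto_id.mono_left nhdsWithin_le_nhds
  rw [h2]
  simpa using (h3.mul_const ((1 / √t3 : ℝ) : ℂ)).sub (key.const_mul (t0 / 2 : ℂ))

lemma tendsto_curveFun_cocompact (h : IsLoopLaw t0 t3 X m) :
    ∃ l : ℂ, Tendsto (fun v => curveFun t0 t3 m v + v ^ 2) (cocompact ℂ) (𝓝 l) := by
  have := h.prob
  have := h.X_pos
  have : (t3 : ℂ) ≠ 0 := by exact_mod_cast h.t3_pos.ne'
  have : (cocompact ℂ).IsCountablyGenerated := by
    rw [← Metric.cobounded_eq_cocompact, ← comap_norm_atTop]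
    infer_instance
  have hlarge : ∀ᶠ v : ℂ in cocompact ℂ, 2 * X ≤ ‖v‖ :=
    tendsto_norm_cocompact_atTop.eventually_ge_atTop _
  have hinv : Tendsto (fun v : ℂ => v⁻¹) (cocompact ℂ) (𝓝 0) := tendsto_inv₀_cobounded.mono_left
    (Metric.cobounded_eq_cocompact (α := ℂ)).ge
  have hfar : ∀ v : ℂ, 2 * X ≤ ‖v‖ → ∀ y ∈ Ioc 0 X, ‖v‖ / 2 ≤ ‖v - y‖ := by
    intro v hv y hy
    have := norm_sub_norm_le v (y : ℂ)
    rw [norm_real, norm_of_nonneg hy.1.le] at this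
    linarith [hy.2]
  have hsub : ∀ v : ℂ, 2 * X ≤ ‖v‖ → v ∉ segC X := by
    rintro v hv ⟨y, hy, rfl⟩
    rw [norm_real, norm_of_nonneg hy.1] at hv
    linarith [hy.2]
  have hbd : ∀ v : ℂ, 2 * X ≤ ‖v‖ → ∀ᵐ y : ℝ ∂m, ‖v * y * (1 / (v - y))‖ ≤ 2 * X := by
    intro v hv
    filter_upwards [h.ae_mem] with y hy
    have h1 := hfar v hv y hy
    have h2 : 0 < ‖v - y‖ := by linarith
    rw [norm_mul, norm_mul, norm_div, norm_one, norm_real, norm_of_nonneg hy.1.le, mul_one_div,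
      div_le_iff₀ h2]
    nlinarith [hy.1, hy.2, norm_nonneg v]
  -- `v (v H(v) - 1)` tends to the first moment
  have key : Tendsto (fun v : ℂ => ∫ y : ℝ, v * y * (1 / (v - y)) ∂m) (cocompact ℂ)
      (𝓝 (∫ y : ℝ, (y : ℂ) ∂m)) := by
    refine tendsto_integral_filter_of_dominated_convergence (fun _ => 2 * X)
      (Eventually.of_forall fun v => by fun_prop) (hlarge.mono hbd) (integrable_const _) ?_
    · filter_upwards [h.ae_mem] with y hy
      have h1 : Tendsto (fun v : ℂ => y * (1 - y * v⁻¹)⁻¹) (cocompact ℂ)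
          (𝓝 ((y : ℂ) * (1 - (y : ℂ) * 0)⁻¹)) :=
        (((hinv.const_mul (y : ℂ)).const_sub 1).inv₀ (by simp)).const_mul (y : ℂ)
      simp only [mul_zero, sub_zero, inv_one, mul_one] at h1
      refine h1.congr' ?_
      filter_upwards [hlarge] with v hv
      have hv0 : v ≠ 0 := by rw [← norm_pos_iff]; linarith
      have hvy : v - y ≠ 0 := fun h0 => hsub v hv ⟨y, ⟨hy.1.le, hy.2⟩, (sub_eq_zero.1 h0).symm⟩
      field_simp
  set a : ℂ := ((1 / √t3 : ℝ) : ℂ) with ha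
  set u : ℂ → ℂ := fun v => -(t0 / 2 : ℂ) * ∫ y : ℝ, v * y * (1 / (v - y)) ∂m with hu
  have hu' : Tendsto u (cocompact ℂ) (𝓝 (-(t0 / 2 : ℂ) * ∫ y : ℝ, (y : ℂ) ∂m)) := key.const_mul _
  have hw : Tendsto (fun v => -(t0 / 2 : ℂ) + u v * v⁻¹) (cocompact ℂ) (𝓝 (-(t0 / 2 : ℂ))) := by
    simpa using (hu'.mul hinv).const_add (-(t0 / 2 : ℂ))
  have hk := hw.mul hinv
  refine ⟨_, Tendsto.congr' ?_ (((((hu'.const_mul (-2 * t3 * a)).add (hw.const_mul (3 * a ^ 2))).add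
    ((hw.mul hk).const_mul (3 * a))).add (hw.mul (hk.pow 2))).sub
    ((hw.pow 2).const_mul (t3 : ℂ)) |>.sub (hw.const_mul ((t0 * t3 + 1 / t3 : ℝ) : ℂ)))⟩
  filter_upwards [hlarge] with v hv
  have hv0 : v ≠ 0 := by rw [← norm_pos_iff]; linarith
  have hK : Kfun t0 t3 m v = a + (-(t0 / 2 : ℂ) + u v * v⁻¹) * v⁻¹ := by
    have hH : stieltjes m v = v⁻¹ + (∫ y : ℝ, v * y * (1 / (v - y)) ∂m) * v⁻¹ * v⁻¹ := by
      have e1 : ∀ᵐ y : ℝ ∂m, 1 / (v - y) = v⁻¹ + v * y * (1 / (v - y)) * (v⁻¹ * v⁻¹) := by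
        filter_upwards [h.ae_mem] with y hy
        have hvy : v - y ≠ 0 := fun h0 => hsub v hv ⟨y, ⟨hy.1.le, hy.2⟩, (sub_eq_zero.1 h0).symm⟩
        field_simp; ring
      have i1 : Integrable (fun y : ℝ => v * y * (1 / (v - y))) m :=
        Integrable.of_bound (by fun_prop) (2 * X) (hbd v hv)
      unfold stieltjes
      rw [integral_congr_ae e1, integral_add (integrable_const _) (i1.mul_const _),
        integral_mul_const]
      simp [mul_assoc]
    unfold Kfun
    rw [hH, hu]; ring
  have ha2 : a ^ 2 = 1 / t3 := by
    rw [ha, ← ofReal_pow, div_pow, sq_sqrt h.t3_pos.le]; push_cast; ring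
  unfold curveFun
  rw [hK]; push_cast
  generalize u v = U
  field_simp
  field_simp at ha2
  linear_combination (8 * t3 * v ^ 7 - 8 * a * v ^ 6) * ha2

end IsLoopLaw

namespace IsLoopLaw
variable {t0 t3 X : ℝ} {m : Measure ℝ}

lemma not_mem_segC_of_re_nonpos {v : ℂ} (h0 : v ≠ 0) (hv : v.re ≤ 0) : v ∉ segC X := by
  rintro ⟨y, hy, rfl⟩
  simp only [ofReal_re] at hv
  exact h0 (by rw [le_antisymm hv hy.1]; simp)

open Classical in
/-- The entire function `v² curveFun v`. -/
def curveExt (t0 t3 X : ℝ) (m : Measure ℝ) (v : ℂ) : ℂ :=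
  if v ∈ segC X then v ^ 2 * curveFun t0 t3 m (-v) else v ^ 2 * curveFun t0 t3 m v

lemma curveExt_eq {v : ℂ} (hv : v ∉ segC X) :
    curveExt t0 t3 X m v = v ^ 2 * curveFun t0 t3 m v := if_neg hv

lemma curveExt_eq_neg (h : IsLoopLaw t0 t3 X m) {v : ℂ} (hv : -v ∉ segC X) :
    curveExt t0 t3 X m v = v ^ 2 * curveFun t0 t3 m (-v) := by
  by_cases h1 : v ∈ segC X
  · exact if_pos h1
  · rw [curveExt_eq h1, h.curveFun_neg h1 hv]

lemma curveExt_zero : curveExt t0 t3 X m 0 = 0 := by simp [curveExt]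

lemma curveExt_neg (h : IsLoopLaw t0 t3 X m) (v : ℂ) :
    curveExt t0 t3 X m (-v) = curveExt t0 t3 X m v := by
  by_cases h0 : v = 0
  · simp [h0]
  rcases le_total v.re 0 with hv | hv
  · have h1 := not_mem_segC_of_re_nonpos (X := X) h0 hv
    rw [curveExt_eq h1, h.curveExt_eq_neg (by rwa [neg_neg]), neg_neg, neg_sq]
  · have h1 := not_mem_segC_of_re_nonpos (X := X) (neg_ne_zero.2 h0) (by simpa using hv)
    rw [curveExt_eq h1, h.curveExt_eq_neg h1, neg_sq]

lemma differentiable_curveExt (h : IsLoopLaw t0 t3 X m) :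
    Differentiable ℂ (curveExt t0 t3 X m) := by
  have hcurve : ∀ v, v ∉ segC X → DifferentiableAt ℂ (curveFun t0 t3 m) v := by
    intro v hv
    have := h.differentiableAt hv
    unfold curveFun; fun_prop
  have hopen := (isClosed_segC X).isOpen_compl
  have hne : ∀ v : ℂ, v ≠ 0 → DifferentiableAt ℂ (curveExt t0 t3 X m) v := by
    intro v h0
    by_cases hv : v ∈ segC X
    · have hv' : -v ∉ segC X := by
        refine not_mem_segC_of_re_nonpos (neg_ne_zero.2 h0) ?_
        obtain ⟨y, hy, rfl⟩ := hv
        simpa using hy.1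
      have hd : DifferentiableAt ℂ (fun w => w ^ 2 * curveFun t0 t3 m (-w)) v := by
        have : DifferentiableAt ℂ (fun w => curveFun t0 t3 m (-w)) v :=
          DifferentiableAt.comp v (f := fun w : ℂ => -w) (hcurve _ hv') (by fun_prop)
        fun_prop
      refine hd.congr_of_eventuallyEq ?_
      filter_upwards [(hopen.preimage continuous_neg).mem_nhds hv'] with w hw
      exact h.curveExt_eq_neg hw
    · have hd : DifferentiableAt ℂ (fun w => w ^ 2 * curveFun t0 t3 m w) v := by
        have := hcurve v hv
        fun_prop
      refine hd.congr_of_eventuallyEq ?_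
      filter_upwards [hopen.mem_nhds hv] with w hw
      exact curveExt_eq hw
  have hcont : ContinuousAt (curveExt t0 t3 X m) 0 := by
    have l1 := h.tendsto_mul_Kfun
    have l0 : Tendsto (fun v : ℂ => v) (𝓝[{v | v.re ≤ 0}] 0) (𝓝 0) :=
      tendsto_id.mono_left nhdsWithin_le_nhds
    have l2 : Tendsto (curveExt t0 t3 X m) (𝓝[{v | v.re ≤ 0}] 0) (𝓝 0) := by
      have := ((l1.pow 3).sub (((l0.pow 2).mul (l1.pow 2)).const_mul (t3 : ℂ))).sub
        (((l0.pow 2).mul l1).const_mul ((t0 * t3 + 1 / t3 : ℝ) : ℂ))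
      simp only [ne_eq, OfNat.ofNat_ne_zero, not_false_eq_true, zero_pow, mul_zero, sub_self] at this
      refine this.congr' ?_
      filter_upwards [self_mem_nhdsWithin] with v hv
      by_cases h0 : v = 0
      · simp [h0, curveExt_zero]
      · rw [curveExt_eq (not_mem_segC_of_re_nonpos h0 hv)]
        unfold curveFun; ring
    have l3 : Tendsto (curveExt t0 t3 X m) (𝓝[{v | 0 ≤ v.re}] 0) (𝓝 0) := by
      have hneg : Tendsto (fun v : ℂ => -v) (𝓝[{v | 0 ≤ v.re}] 0) (𝓝[{v | v.re ≤ 0}] 0) := by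
        refine tendsto_nhdsWithin_iff.2 ⟨?_, ?_⟩
        · have := (continuous_neg (G := ℂ)).tendsto 0
          rw [neg_zero] at this
          exact this.mono_left nhdsWithin_le_nhds
        · filter_upwards [self_mem_nhdsWithin] with v hv
          simpa using hv
      exact (l2.comp hneg).congr fun v => h.curveExt_neg v
    have l4 := l2.sup l3
    rw [← nhdsWithin_union, show {v : ℂ | v.re ≤ 0} ∪ {v | 0 ≤ v.re} = univ from
      Set.eq_univ_iff_forall.2 fun v : ℂ => le_total v.re 0, nhdsWithin_univ] at l4
    rwa [ContinuousAt, curveExt_zero]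
  rw [← differentiableOn_univ]
  refine (Complex.differentiableOn_compl_singleton_and_continuousAt_iff (c := 0)
    Filter.univ_mem).1 ⟨fun v hv => (hne v hv.2).differentiableWithinAt, hcont⟩

/-- The cubic equation, with a constant that is not yet known. -/
theorem exists_curve (h : IsLoopLaw t0 t3 X m) :
    ∃ A : ℝ, ∀ v, v ∉ segC X → curveFun t0 t3 m v = -v ^ 2 - A := by
  set G := curveExt t0 t3 X m with hG
  have hd : Differentiable ℂ G := h.differentiable_curveExt
  have hds : ∀ f : ℂ → ℂ, Differentiable ℂ f → Differentiable ℂ (dslope f 0) := by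
    intro f hf
    rw [← differentiableOn_univ] at hf ⊢
    exact (Complex.differentiableOn_dslope Filter.univ_mem).2 hf
  have h1 := hds _ hd
  have h2 := hds _ h1
  have hderiv : deriv G 0 = 0 := by
    have e : (fun v => G (-v)) = G := funext fun v => h.curveExt_neg v
    have := deriv_comp_neg G 0
    rw [e, neg_zero] at this
    exact self_eq_neg.1 this
  have hval : ∀ v, v ∉ segC X → dslope (dslope G 0) 0 v = curveFun t0 t3 m v := by
    intro v hv
    have hv0 : v ≠ 0 := by
      rintro rfl
      exact hv ⟨0, ⟨le_rfl, h.X_pos.le⟩, by simp⟩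
    rw [dslope_of_ne _ hv0, slope_def_field, dslope_same, hderiv, dslope_of_ne _ hv0,
      slope_def_field, hG, curveExt_zero, curveExt_eq hv]
    field_simp; ring
  obtain ⟨l, hl⟩ := h.tendsto_curveFun_cocompact
  have hconst : ∀ v, dslope (dslope G 0) 0 v + v ^ 2 = l := by
    have hd3 : Differentiable ℂ fun v => dslope (dslope G 0) 0 v + v ^ 2 :=
      h2.add (differentiable_id.pow 2)
    refine fun v => hd3.apply_eq_of_tendsto_cocompact v (hl.congr' ?_)
    have hlarge : ∀ᶠ v : ℂ in cocompact ℂ, X + 1 ≤ ‖v‖ :=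
      tendsto_norm_cocompact_atTop.eventually_ge_atTop _
    filter_upwards [hlarge] with v hv
    rw [hval]
    rintro ⟨y, hy, rfl⟩
    rw [norm_real, norm_of_nonneg hy.1] at hv
    linarith [hy.2]
  have hA : ∀ v, v ∉ segC X → curveFun t0 t3 m v = l - v ^ 2 := fun v hv => by
    rw [← hval v hv, ← hconst v]; ring
  have hreal : l = (l.re : ℂ) := by
    have h3 := hA (-1) (not_mem_segC_of_re_nonpos (by norm_num) (by norm_num))
    have h4 : curveFun t0 t3 m (-1) = ((-1 * (KfunR t0 t3 m (-1) ^ 3 -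
        t3 * (-1) * KfunR t0 t3 m (-1) ^ 2 - (t0 * t3 + 1 / t3) * KfunR t0 t3 m (-1)) : ℝ) : ℂ) := by
      unfold curveFun
      rw [show (-1 : ℂ) = ((-1 : ℝ) : ℂ) by norm_num, Kfun_ofReal]; push_cast; ring
    have h5 : l = ((-1 * (KfunR t0 t3 m (-1) ^ 3 -
        t3 * (-1) * KfunR t0 t3 m (-1) ^ 2 - (t0 * t3 + 1 / t3) * KfunR t0 t3 m (-1)) + 1 : ℝ) : ℂ) := by
      rw [h4] at h3
      rw [Complex.ofReal_add, h3]; push_cast; ring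
    rw [h5, ofReal_re]
  refine ⟨-l.re, fun v hv => ?_⟩
  rw [hA v hv, ofReal_neg, ← hreal]; ring

end IsLoopLaw

/-! ### The discriminant -/

/-- With `s = v²`, this is `v²` times the discriminant of the cubic
`κ³ - t v κ² - c κ + (v + A / v)` that is satisfied by `Kfun`. -/
def ddisc {R : Type*} [CommRing R] (t c A s : R) : R :=
  4 * t ^ 3 * s ^ 3 + (4 * t ^ 3 * A + 18 * t * c + t ^ 2 * c ^ 2 - 27) * s ^ 2 +
    (18 * t * c * A + 4 * c ^ 3 - 54 * A) * s - 27 * A ^ 2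

/-- The derivative of `ddisc` with respect to `s`. -/
def ddiscDeriv {R : Type*} [CommRing R] (t c A s : R) : R :=
  12 * t ^ 3 * s ^ 2 + 2 * (4 * t ^ 3 * A + 18 * t * c + t ^ 2 * c ^ 2 - 27) * s +
    (18 * t * c * A + 4 * c ^ 3 - 54 * A)

lemma ddisc_eq_of_roots {R : Type*} [CommRing R] {t c A v k1 k2 k3 : R}
    (h1 : t * v = k1 + k2 + k3) (h2 : c = -(k1 * k2 + k1 * k3 + k2 * k3))
    (h3 : A = -v ^ 2 - v * (k1 * k2 * k3)) :
    ddisc t c A (v ^ 2) = (v * ((k1 - k2) * (k1 - k3) * (k2 - k3))) ^ 2 := by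
  have e : ddisc t c A (v ^ 2) = 4 * (t * v) ^ 3 * v ^ 3 + 4 * (t * v) ^ 3 * v * A +
      18 * (t * v) * c * v ^ 3 + (t * v) ^ 2 * c ^ 2 * v ^ 2 - 27 * v ^ 4 +
      18 * (t * v) * c * A * v + 4 * c ^ 3 * v ^ 2 - 54 * A * v ^ 2 - 27 * A ^ 2 := by
    unfold ddisc; ring
  rw [e, h1, h2, h3]; ring

namespace IsLoopLaw
variable {t0 t3 X A : ℝ} {m : Measure ℝ}

/-- The three roots of the cubic, up to permutation. -/
lemma roots (h : IsLoopLaw t0 t3 X m) (hA : ∀ v, v ∉ segC X → curveFun t0 t3 m v = -v ^ 2 - A)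
    {v : ℂ} (hv : v ∉ segC X) (hv' : -v ∉ segC X) :
    ((t0 * t3 + 1 / t3 : ℝ) : ℂ) = -(Kfun t0 t3 m v * (-Kfun t0 t3 m (-v)) +
      Kfun t0 t3 m v * (t3 * v - Kfun t0 t3 m v + Kfun t0 t3 m (-v)) +
      (-Kfun t0 t3 m (-v)) * (t3 * v - Kfun t0 t3 m v + Kfun t0 t3 m (-v))) ∧
    A = -v ^ 2 - v * (Kfun t0 t3 m v * (-Kfun t0 t3 m (-v)) *
      (t3 * v - Kfun t0 t3 m v + Kfun t0 t3 m (-v))) := by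
  have h1 := h.loop v hv hv'
  have h2 := hA v hv
  unfold curveFun at h2
  constructor
  · linear_combination h1
  · linear_combination h2 + v * Kfun t0 t3 m v * h1

/-- `v` times the square root of the discriminant. -/
def sqrtDisc (t0 t3 : ℝ) (m : Measure ℝ) (v : ℂ) : ℂ :=
  v * ((Kfun t0 t3 m v - (-Kfun t0 t3 m (-v))) *
    (Kfun t0 t3 m v - (t3 * v - Kfun t0 t3 m v + Kfun t0 t3 m (-v))) *
    ((-Kfun t0 t3 m (-v)) - (t3 * v - Kfun t0 t3 m v + Kfun t0 t3 m (-v))))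

lemma ddisc_eq (h : IsLoopLaw t0 t3 X m) (hA : ∀ v, v ∉ segC X → curveFun t0 t3 m v = -v ^ 2 - A)
    {v : ℂ} (hv : v ∉ segC X) (hv' : -v ∉ segC X) :
    ddisc (t3 : ℂ) ((t0 * t3 + 1 / t3 : ℝ) : ℂ) A (v ^ 2) = sqrtDisc t0 t3 m v ^ 2 := by
  obtain ⟨h1, h2⟩ := h.roots hA hv hv'
  exact ddisc_eq_of_roots (by ring) h1 h2

lemma ddisc_ofReal (t c A s : ℝ) :
    ddisc (t : ℂ) c A s = ((ddisc t c A s : ℝ) : ℂ) := by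
  unfold ddisc; push_cast; ring

lemma ddiscDeriv_eq_zero (h : IsLoopLaw t0 t3 X m)
    (hA : ∀ v, v ∉ segC X → curveFun t0 t3 m v = -v ^ 2 - A)
    {v : ℂ} (hv : v ∉ segC X) (hv' : -v ∉ segC X)
    (h0 : ddisc (t3 : ℂ) ((t0 * t3 + 1 / t3 : ℝ) : ℂ) A (v ^ 2) = 0) :
    ddiscDeriv (t3 : ℂ) ((t0 * t3 + 1 / t3 : ℝ) : ℂ) A (v ^ 2) = 0 := by
  have hv0 : v ≠ 0 := by
    rintro rfl
    exact hv ⟨0, ⟨le_rfl, h.X_pos.le⟩, by simp⟩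
  set c : ℂ := ((t0 * t3 + 1 / t3 : ℝ) : ℂ)
  have hopen := (isClosed_segC X).isOpen_compl
  have d1 : HasDerivAt (fun w => ddisc (t3 : ℂ) c A (w ^ 2))
      (ddiscDeriv (t3 : ℂ) c A (v ^ 2) * (2 * v)) v := by
    have hs : HasDerivAt (fun w : ℂ => w ^ 2) (2 * v) v := by simpa using hasDerivAt_pow 2 v
    have := ((((hs.pow 3).const_mul (4 * (t3 : ℂ) ^ 3)).add ((hs.pow 2).const_mul
      (4 * (t3 : ℂ) ^ 3 * A + 18 * t3 * c + (t3 : ℂ) ^ 2 * c ^ 2 - 27))).add (hs.const_mul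
      (18 * t3 * c * A + 4 * c ^ 3 - 54 * A))).sub_const (27 * (A : ℂ) ^ 2)
    refine this.congr_deriv ?_
    unfold ddiscDeriv; simp; ring
  have d2 : DifferentiableAt ℂ (sqrtDisc t0 t3 m) v := by
    have := h.differentiableAt hv
    have : DifferentiableAt ℂ (fun w => Kfun t0 t3 m (-w)) v :=
      DifferentiableAt.comp v (f := fun w : ℂ => -w) (h.differentiableAt hv') (by fun_prop)
    unfold sqrtDisc; fun_prop
  have d3 := d2.hasDerivAt.pow 2
  have hz : sqrtDisc t0 t3 m v = 0 := by
    rw [h.ddisc_eq hA hv hv'] at h0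
    exact pow_eq_zero_iff two_ne_zero |>.1 h0
  have hev : (fun w => ddisc (t3 : ℂ) c A (w ^ 2)) =ᶠ[𝓝 v] fun w => sqrtDisc t0 t3 m w ^ 2 := by
    filter_upwards [hopen.mem_nhds hv, (hopen.preimage continuous_neg).mem_nhds hv'] with w w1 w2
    exact h.ddisc_eq hA w1 w2
  have := d1.unique ((d3.congr_of_eventuallyEq hev))
  rw [hz] at this
  simpa [hv0] using this

/-- Beyond the support the three roots are real. -/
lemma ddisc_nonneg (h : IsLoopLaw t0 t3 X m)
    (hA : ∀ v, v ∉ segC X → curveFun t0 t3 m v = -v ^ 2 - A) {v : ℝ} (hv : X < v) :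
    0 ≤ ddisc t3 (t0 * t3 + 1 / t3) A (v ^ 2) := by
  have h1 := h.ddisc_eq hA (ofReal_not_mem_segC hv) (neg_ofReal_not_mem_segC (h.X_pos.trans hv))
  rw [← ofReal_pow, ddisc_ofReal] at h1
  unfold sqrtDisc at h1
  rw [← ofReal_neg, Kfun_ofReal, Kfun_ofReal] at h1
  norm_cast at h1
  rw [h1]; positivity

lemma measure_Icc_le (h : IsLoopLaw t0 t3 X m) (y : ℝ) {ε : ℝ} (hε : 0 < ε) :
    m.real (Icc (y - ε) (y + ε)) ≤
      4 * ε / t0 * |(Kfun t0 t3 m (y + ε * I)).im| := by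
  have := h.prob
  have := h.t0_pos
  set v : ℂ := y + ε * I with hv
  have hns : v ∉ segC X := by
    rintro ⟨u, -, hu⟩
    have := congrArg Complex.im hu
    simp [hv] at this
    exact hε.ne this
  have hi := integrable_stieltjes h.compl hns
  have him : -(stieltjes m v).im = ∫ u : ℝ, ε / ((y - u) ^ 2 + ε ^ 2) ∂m := by
    have h1 : (stieltjes m v).im = ∫ u : ℝ, (1 / (v - u)).im ∂m :=
      (Complex.imCLM.integral_comp_comm hi).symm
    rw [h1, ← integral_neg]; congr 1
    funext u
    have e : v - u = ((y - u : ℝ) : ℂ) + ε * I := by rw [hv]; push_cast; ring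
    rw [e, one_div, inv_im, Complex.normSq_add_mul_I]; simp; ring
  have hint : Integrable (fun u : ℝ => ε / ((y - u) ^ 2 + ε ^ 2)) m := by
    refine Integrable.of_bound (Measurable.aestronglyMeasurable (by fun_prop)) (ε / ε ^ 2)
      (ae_of_all _ fun u => ?_)
    rw [norm_of_nonneg (by positivity)]
    have := sq_nonneg (y - u)
    gcongr
    linarith
  have hle : m.real (Icc (y - ε) (y + ε)) * (1 / (2 * ε)) ≤ -(stieltjes m v).im := by
    rw [him]
    calc _ = ∫ u in Icc (y - ε) (y + ε), 1 / (2 * ε) ∂m := by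
          rw [setIntegral_const, smul_eq_mul]
      _ ≤ ∫ u in Icc (y - ε) (y + ε), ε / ((y - u) ^ 2 + ε ^ 2) ∂m := by
          refine setIntegral_mono_on (integrable_const _).integrableOn hint.integrableOn
            measurableSet_Icc fun u hu => ?_
          rw [div_le_div_iff₀ (by positivity) (by positivity)]
          have : (y - u) ^ 2 ≤ ε ^ 2 := sq_le_sq' (by linarith [hu.2]) (by linarith [hu.1])
          nlinarith
      _ ≤ _ := setIntegral_le_integral hint (ae_of_all _ fun u => by
          simp only [Pi.zero_apply]; positivity)
  have hK : (Kfun t0 t3 m v).im = t0 / 2 * -(stieltjes m v).im := by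
    unfold Kfun
    rw [sub_im, ofReal_im, show (t0 / 2 : ℂ) = ((t0 / 2 : ℝ) : ℂ) by push_cast; rfl, im_ofReal_mul]
    ring
  rw [hK]
  have := le_abs_self (t0 / 2 * -(stieltjes m v).im)
  have h2 : m.real (Icc (y - ε) (y + ε)) ≤ 2 * ε * -(stieltjes m v).im := by
    have := mul_le_mul_of_nonneg_left hle (by positivity : 0 ≤ 2 * ε)
    field_simp at this; linarith
  calc _ ≤ 2 * ε * -(stieltjes m v).im := h2
    _ = 4 * ε / t0 * (t0 / 2 * -(stieltjes m v).im) := by field_simp; ring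
    _ ≤ _ := by gcongr

end IsLoopLaw

/-- A measure with `m(I)³ ≤ C |I|⁴` on all intervals `I` vanishes, by repeated bisection. -/
lemma measureReal_Icc_eq_zero {m : Measure ℝ} [IsFiniteMeasure m] {a b C : ℝ}
    (hm : ∀ u w, a ≤ u → u ≤ w → w ≤ b → m.real (Icc u w) ^ 3 ≤ C * (w - u) ^ 4)
    (hab : a ≤ b) : m.real (Icc a b) = 0 := by
  have key : ∀ n : ℕ, ∀ u w, a ≤ u → u ≤ w → w ≤ b →
      m.real (Icc u w) ^ 3 ≤ C * (w - u) ^ 4 * (1 / 2) ^ n := by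
    intro n
    induction n with
    | zero => simpa using hm
    | succ n ih =>
      intro u w h1 h2 h3
      set p := (u + w) / 2 with hp
      have i1 := ih u p h1 (by linarith) (by linarith)
      have i2 := ih p w (by linarith) (by linarith) h3
      have hsub : m.real (Icc u w) ≤ m.real (Icc u p) + m.real (Icc p w) := by
        rw [← Set.Icc_union_Icc_eq_Icc (b := p) (by linarith) (by linarith)]
        exact measureReal_union_le _ _
      have n1 : 0 ≤ m.real (Icc u p) := measureReal_nonneg
      have n2 : 0 ≤ m.real (Icc p w) := measureReal_nonneg
      have e1 : p - u = (w - u) / 2 := by rw [hp]; ring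
      have e2 : w - p = (w - u) / 2 := by rw [hp]; ring
      rw [e1] at i1
      rw [e2] at i2
      generalize m.real (Icc u p) = α at *
      generalize m.real (Icc p w) = β at *
      calc m.real (Icc u w) ^ 3 ≤ (α + β) ^ 3 := pow_le_pow_left₀ measureReal_nonneg hsub 3
        _ ≤ 4 * (α ^ 3 + β ^ 3) := by
            nlinarith [mul_nonneg (add_nonneg n1 n2) (sq_nonneg (α - β))]
        _ ≤ 4 * (C * ((w - u) / 2) ^ 4 * (1 / 2) ^ n + C * ((w - u) / 2) ^ 4 * (1 / 2) ^ n) := by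
            linarith
        _ = C * (w - u) ^ 4 * (1 / 2) ^ (n + 1) := by ring
  have hlim : Tendsto (fun n : ℕ => C * (b - a) ^ 4 * (1 / 2 : ℝ) ^ n) atTop
      (𝓝 (C * (b - a) ^ 4 * 0)) :=
    (tendsto_pow_atTop_nhds_zero_of_lt_one (by norm_num) (by norm_num)).const_mul _
  rw [mul_zero] at hlim
  have := ge_of_tendsto' hlim fun n => key n a b le_rfl hab le_rfl
  have n0 : 0 ≤ m.real (Icc a b) := measureReal_nonneg
  exact pow_eq_zero_iff (n := 3) (by norm_num) |>.1 (le_antisymm this (by positivity))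

/-- A real cubic with positive discriminant is bounded below by the cube of the imaginary part. -/
lemma abs_im_pow_three_le {r b e : ℝ} (hΔ : 0 ≤ b ^ 2 - 4 * e) (κ : ℂ) :
    |κ.im| ^ 3 ≤ ‖(κ - r) * (κ ^ 2 + b * κ + e)‖ := by
  set d := √(b ^ 2 - 4 * e)
  have hd : (d : ℂ) ^ 2 = b ^ 2 - 4 * e := by
    have : d ^ 2 = b ^ 2 - 4 * e := sq_sqrt hΔ
    exact_mod_cast congrArg Complex.ofReal this
  have e1 : (κ - r) * (κ ^ 2 + b * κ + e) =
      (κ - r) * ((κ - ((-b + d) / 2 : ℝ)) * (κ - ((-b - d) / 2 : ℝ))) := by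
    push_cast
    linear_combination ((κ - r) / 4) * hd
  have key : ∀ u : ℝ, |κ.im| ≤ ‖κ - u‖ := fun u => by
    simpa using abs_im_le_norm (κ - u)
  rw [e1, norm_mul, norm_mul, pow_three]
  gcongr <;> exact key _

namespace IsLoopLaw
variable {t0 t3 X A : ℝ} {m : Measure ℝ}

/-- To the left of the support, `Kfun` is at least its value at infinity. -/
lemma le_re_Kfun (h : IsLoopLaw t0 t3 X m) {v : ℂ} (h0 : v ≠ 0) (hv : v.re ≤ 0) :
    1 / √t3 ≤ (Kfun t0 t3 m v).re := by
  have := h.prob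
  have hi := integrable_stieltjes h.compl (not_mem_segC_of_re_nonpos h0 hv)
  have h1 : (stieltjes m v).re = ∫ u : ℝ, (1 / (v - u)).re ∂m :=
    (Complex.reCLM.integral_comp_comm hi).symm
  have : (stieltjes m v).re ≤ 0 := by
    rw [h1]
    refine integral_nonpos_of_ae ?_
    filter_upwards [h.ae_mem] with u hu
    rw [one_div, inv_re]
    exact div_nonpos_of_nonpos_of_nonneg (by simp; linarith [hu.1]) (Complex.normSq_nonneg _)
  unfold Kfun
  rw [sub_re, show (t0 / 2 : ℂ) = ((t0 / 2 : ℝ) : ℂ) by push_cast; rfl, re_ofReal_mul, ofReal_re]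
  have := h.t0_pos
  nlinarith

set_option maxHeartbeats 1000000 in
/-- Where the discriminant is positive, the cubic has real roots only and its root `Kfun` at
distance `ε` from the real axis has imaginary part `O(ε^(1/3))`. -/
lemma measureReal_eq_zero_of_ddisc_pos (h : IsLoopLaw t0 t3 X m)
    (hA : ∀ v, v ∉ segC X → curveFun t0 t3 m v = -v ^ 2 - A) {a b : ℝ} (ha : 0 < a) (hab : a ≤ b)
    (hb : b ≤ X)
    (hD : ∀ y ∈ Icc a b, 0 < ddisc t3 (t0 * t3 + 1 / t3) A (y ^ 2)) :
    m.real (Icc a b) = 0 := by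
  have := h.prob
  have := h.X_pos
  have := h.t0_pos
  set c := t0 * t3 + 1 / t3 with hc
  set B := 1 + (|t3| * (2 * X) + |c| + (2 * X) + |A| / a) with hB
  have : 1 ≤ B := by rw [hB]; have := h.X_pos; linarith [show 0 ≤
    |t3| * (2 * X) + |c| + (2 * X) + |A| / a by positivity]
  set M := B ^ 3 + |t3| * (3 * X) * B ^ 2 + |c| * B + 3 * X with hM
  refine measureReal_Icc_eq_zero (C := (4 / t0) ^ 3 * (M / a) / 16) ?_ hab
  intro u w hu huw hw
  rcases huw.eq_or_lt with rfl | huw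
  · simp [measureReal_def, h.null]
  set ε := (w - u) / 2 with hε
  set y := (u + w) / 2 with hy
  have hε0 : 0 < ε := by rw [hε]; linarith
  have : ε ≤ X := by rw [hε]; linarith
  have hya : a ≤ y := by rw [hy]; linarith
  have hyb : y ≤ b := by rw [hy]; linarith
  have hy0 : 0 < y := ha.trans_le hya
  set v : ℂ := y + ε * I with hv
  have hns : v ∉ segC X := by
    rintro ⟨s, -, hs⟩
    have := congrArg Complex.im hs
    simp [hv] at this
    exact hε0.ne this
  set κ := Kfun t0 t3 m v with hκ
  have hcurve := hA v hns
  unfold curveFun at hcurve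
  rw [← hκ, ← hc] at hcurve
  have hvy : ‖v - y‖ = ε := by rw [hv]; simp [abs_of_pos hε0]
  have hvle : ‖v‖ ≤ 2 * X := by
    have := norm_add_le (v - y) (y : ℂ)
    rw [sub_add_cancel, hvy, norm_real, norm_of_nonneg hy0.le] at this; linarith
  have hvge : a ≤ ‖v‖ := by
    have := abs_re_le_norm v
    have hr : v.re = y := by simp [hv]
    rw [hr, abs_of_pos hy0] at this; linarith
  have : v ≠ 0 := norm_pos_iff.1 (ha.trans_le hvge)
  have : ‖κ‖ ≤ B := by
    by_cases h1 : ‖κ‖ ≤ 1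
    · linarith
    push Not at h1
    have e : κ ^ 3 = t3 * v * κ ^ 2 + c * κ - (v + A / v) := by
      field_simp
      linear_combination hcurve
    have n1 : ‖κ‖ ^ 3 ≤ |t3| * (2 * X) * ‖κ‖ ^ 2 + |c| * ‖κ‖ + (2 * X + |A| / a) := by
      rw [← norm_pow, e]
      refine (norm_sub_le _ _).trans (add_le_add ((norm_add_le _ _).trans (add_le_add ?_ ?_))
        ((norm_add_le _ _).trans (add_le_add hvle ?_)))
      · rw [norm_mul, norm_mul, norm_pow, norm_real, norm_eq_abs]; gcongr
      · rw [norm_mul, norm_real, norm_eq_abs]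
      · rw [norm_div, norm_real, norm_eq_abs]; gcongr
    have : 0 ≤ |t3| * (2 * X) := by positivity
    have p2 : 0 ≤ |c| := abs_nonneg _
    have : 0 ≤ 2 * X + |A| / a := by positivity
    have : 1 ≤ ‖κ‖ ^ 2 := one_le_pow₀ h1.le
    have n2 : ‖κ‖ * ‖κ‖ ^ 2 ≤ (|t3| * (2 * X) + |c| + (2 * X + |A| / a)) * ‖κ‖ ^ 2 := by
      nlinarith [mul_nonneg p2 (show 0 ≤ ‖κ‖ * (‖κ‖ - 1) by nlinarith)]
    have := le_of_mul_le_mul_right n2 (by positivity)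
    rw [hB]; linarith
  set r := -KfunR t0 t3 m (-y) with hr
  have hroot : y * (r ^ 3 - t3 * y * r ^ 2 - c * r) = -y ^ 2 - A := by
    have hny : ((-y : ℝ) : ℂ) ∉ segC X :=
      not_mem_segC_of_re_nonpos (by simpa using hy0.ne') (by simpa using hy0.le)
    have := hA _ hny
    unfold curveFun at this
    rw [Kfun_ofReal, ← hc] at this
    norm_cast at this
    rw [hr]
    linear_combination this
  have hΔ : 0 ≤ (r - t3 * y) ^ 2 - 4 * (r ^ 2 - t3 * y * r - c) := by
    have hAe : A = -y ^ 2 - y * (r ^ 3 - t3 * y * r ^ 2 - c * r) := by linarith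
    have e : ddisc t3 c A (y ^ 2) = ((r - t3 * y) ^ 2 - 4 * (r ^ 2 - t3 * y * r - c)) *
        (y * (3 * r ^ 2 - 2 * t3 * y * r - c)) ^ 2 := by
      rw [hAe]; unfold ddisc; ring
    have hpos := hD y ⟨hya, hyb⟩
    rw [e] at hpos
    by_contra hneg
    push Not at hneg
    exact hpos.not_ge (mul_nonpos_of_nonpos_of_nonneg hneg.le (sq_nonneg _))
  have : |κ.im| ^ 3 ≤ ε * (M / a) := by
    have h1 := abs_im_pow_three_le (r := r) (b := r - t3 * y) (e := r ^ 2 - t3 * y * r - c) hΔ κ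
    have e : (κ - r) * (κ ^ 2 + ((r - t3 * y : ℝ) : ℂ) * κ + ((r ^ 2 - t3 * y * r - c : ℝ) : ℂ)) =
        -((v - y) * (κ ^ 3 - t3 * (v + y) * κ ^ 2 - c * κ + (v + y))) / y := by
      have hroot' : (y : ℂ) * (r ^ 3 - t3 * y * r ^ 2 - c * r) = -y ^ 2 - A := by
        exact_mod_cast congrArg Complex.ofReal hroot
      have hy0' : (y : ℂ) ≠ 0 := by exact_mod_cast hy0.ne'
      rw [eq_div_iff hy0']; push_cast
      linear_combination hcurve - hroot'
    rw [e, norm_div, norm_neg, norm_mul, hvy, norm_real, norm_of_nonneg hy0.le] at h1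
    refine h1.trans ?_
    rw [mul_div_assoc]
    have hvy' : ‖v + y‖ ≤ 3 * X := by
      refine (norm_add_le _ _).trans ?_
      rw [norm_real, norm_of_nonneg hy0.le]; linarith
    have n1 : ‖κ ^ 3 - t3 * (v + y) * κ ^ 2 - c * κ + (v + y)‖ ≤ M := by
      rw [hM]
      refine (norm_add_le _ _).trans (add_le_add ((norm_sub_le _ _).trans (add_le_add
        ((norm_sub_le _ _).trans (add_le_add ?_ ?_)) ?_)) hvy')
      · rw [norm_pow]; gcongr
      · rw [norm_mul, norm_mul, norm_pow, norm_real, norm_eq_abs]; gcongr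
      · rw [norm_mul, norm_real, norm_eq_abs]; gcongr
    have : 0 ≤ M := (norm_nonneg _).trans n1
    gcongr
  have hm := h.measure_Icc_le y hε0
  rw [← hv, ← hκ, show y - ε = u by rw [hy, hε]; ring, show y + ε = w by rw [hy, hε]; ring] at hm
  calc m.real (Icc u w) ^ 3 ≤ (4 * ε / t0 * |κ.im|) ^ 3 :=
        pow_le_pow_left₀ measureReal_nonneg hm 3
    _ = (4 * ε / t0) ^ 3 * |κ.im| ^ 3 := by ring
    _ ≤ (4 * ε / t0) ^ 3 * (ε * (M / a)) := by gcongr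
    _ = (4 / t0) ^ 3 * (M / a) / 16 * (w - u) ^ 4 := by
        have : w - u = 2 * ε := by rw [hε]; ring
        rw [this]; ring

lemma continuous_ddisc (t c A : ℝ) : Continuous fun s => ddisc t c A s := by
  unfold ddisc; fun_prop

/-- On the support two of the three roots are complex conjugates. -/
lemma ddisc_nonpos (h : IsLoopLaw t0 t3 X m)
    (hA : ∀ v, v ∉ segC X → curveFun t0 t3 m v = -v ^ 2 - A) {y : ℝ} (hy : y ∈ Set.Ioo 0 X) :
    ddisc t3 (t0 * t3 + 1 / t3) A (y ^ 2) ≤ 0 := by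
  by_contra! hpos
  have hcont : Continuous fun y : ℝ => ddisc t3 (t0 * t3 + 1 / t3) A (y ^ 2) :=
    (continuous_ddisc _ _ _).comp (continuous_pow 2)
  have hev := (hcont.continuousAt.eventually_const_lt hpos).and (Ioo_mem_nhds hy.1 hy.2)
  obtain ⟨δ, hδ, hb⟩ := Metric.eventually_nhds_iff_ball.1 hev
  have hD : ∀ u ∈ Icc (y - δ / 2) (y + δ / 2), u ∈ Metric.ball y δ := fun u hu => by
    rw [Real.ball_eq_Ioo]
    exact ⟨by linarith [hu.1], by linarith [hu.2]⟩
  have h1 := hb _ (hD (y - δ / 2) ⟨le_rfl, by linarith⟩)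
  have h2 := hb _ (hD (y + δ / 2) ⟨by linarith, le_rfl⟩)
  have hz := h.measureReal_eq_zero_of_ddisc_pos hA h1.2.1 (by linarith) h2.2.2.le
    fun u hu => (hb u (hD u hu)).1
  have := h.prob
  have hp := h.pos (y - δ / 2) (y + δ / 2) h1.2.1.le (by linarith) h2.2.2.le
  rw [measureReal_eq_zero_iff] at hz
  exact hp.ne' (measure_mono_null Set.Ioo_subset_Icc_self hz)

lemma exists_sq_eq (s : ℂ) (hs : ∀ u : ℝ, u ∈ Icc 0 (X ^ 2) → s ≠ u) :
    ∃ v : ℂ, v ^ 2 = s ∧ v ∉ segC X ∧ -v ∉ segC X := by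
  obtain ⟨v, hv⟩ := IsAlgClosed.exists_pow_nat_eq s (n := 2) (by norm_num)
  have key : ∀ w : ℂ, w ^ 2 = s → w ∉ segC X := by
    rintro w hw ⟨u, hu, rfl⟩
    exact hs (u ^ 2) ⟨sq_nonneg u, pow_le_pow_left₀ hu.1 hu.2 2⟩ (by rw [← hw]; push_cast; rfl)
  exact ⟨v, hv, key v hv, key (-v) (by rw [neg_sq, hv])⟩

/-- The discriminant has a simple zero at the end of the support, and a double zero. -/
theorem exists_double_root (h : IsLoopLaw t0 t3 X m)
    (hA : ∀ v, v ∉ segC X → curveFun t0 t3 m v = -v ^ 2 - A) :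
    ∃ r : ℝ, 4 * t3 ^ 3 * A + 18 * t3 * (t0 * t3 + 1 / t3) + t3 ^ 2 * (t0 * t3 + 1 / t3) ^ 2 - 27 =
        -(4 * t3 ^ 3 * (X ^ 2 + 2 * r)) ∧
      18 * t3 * (t0 * t3 + 1 / t3) * A + 4 * (t0 * t3 + 1 / t3) ^ 3 - 54 * A =
        4 * t3 ^ 3 * (2 * X ^ 2 * r + r ^ 2) ∧
      27 * A ^ 2 = 4 * t3 ^ 3 * (X ^ 2 * r ^ 2) := by
  have hX := h.X_pos
  have ht3 := h.t3_pos
  set c := t0 * t3 + 1 / t3 with hc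
  set S := X ^ 2
  have hS0 : 0 < S := by positivity
  have hcont := continuous_ddisc t3 c A
  have hD0 : ddisc t3 c A S = 0 := by
    have hcont' : Continuous fun y : ℝ => ddisc t3 c A (y ^ 2) := hcont.comp (continuous_pow 2)
    refine le_antisymm ?_ ?_
    · refine le_of_tendsto ((hcont'.tendsto X).mono_left (nhdsWithin_le_nhds (s := Set.Iio X))) ?_
      filter_upwards [Ioo_mem_nhdsLT hX] with y hy using h.ddisc_nonpos hA hy
    · refine ge_of_tendsto ((hcont'.tendsto X).mono_left (nhdsWithin_le_nhds (s := Ioi X))) ?_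
      filter_upwards [self_mem_nhdsWithin] with y hy using h.ddisc_nonneg hA hy
  set d2 := 4 * t3 ^ 3 * A + 18 * t3 * c + t3 ^ 2 * c ^ 2 - 27 with hd2
  set d1 := 18 * t3 * c * A + 4 * c ^ 3 - 54 * A with hd1
  set b := d2 / (4 * t3 ^ 3) + S with hb
  set e := d1 / (4 * t3 ^ 3) + S * b with he
  have e2 : d2 = 4 * t3 ^ 3 * (b - S) := by rw [hb]; field_simp; ring
  have e1 : d1 = 4 * t3 ^ 3 * (e - S * b) := by rw [he]; field_simp; ring
  have e0 : 27 * A ^ 2 = 4 * t3 ^ 3 * (S * e) := by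
    have h1 : 4 * t3 ^ 3 * S ^ 3 + d2 * S ^ 2 + d1 * S - 27 * A ^ 2 = 0 := by
      rw [← hD0]; rfl
    rw [e2, e1] at h1
    linear_combination -h1
  -- the other roots of the discriminant satisfy `s² + b s + e = 0`
  have hroot : ∀ s : ℂ, s ^ 2 + b * s + e = 0 → (∀ u : ℝ, u ∈ Icc 0 S → s ≠ u) →
      2 * s + b = 0 := by
    intro s hs hns
    obtain ⟨v, rfl, hv, hv'⟩ := exists_sq_eq s hns
    have e2' : 4 * (t3 : ℂ) ^ 3 * A + 18 * t3 * c + t3 ^ 2 * c ^ 2 - 27 = 4 * t3 ^ 3 * (b - S) := by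
      exact_mod_cast congrArg Complex.ofReal (hd2.symm.trans e2)
    have e1' : 18 * (t3 : ℂ) * c * A + 4 * c ^ 3 - 54 * A = 4 * t3 ^ 3 * (e - S * b) := by
      exact_mod_cast congrArg Complex.ofReal (hd1.symm.trans e1)
    have e0' : 27 * (A : ℂ) ^ 2 = 4 * t3 ^ 3 * (S * e) := by
      exact_mod_cast congrArg Complex.ofReal e0
    have h1 : ddisc (t3 : ℂ) c A (v ^ 2) = 0 := by
      unfold ddisc
      rw [e2', e1', e0']
      linear_combination (4 * (t3 : ℂ) ^ 3 * (v ^ 2 - S)) * hs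
    have h2 := h.ddiscDeriv_eq_zero hA hv hv' h1
    unfold ddiscDeriv at h2
    rw [← hc, e2', e1'] at h2
    have h3 : 4 * (t3 : ℂ) ^ 3 * (v ^ 2 - S) * (2 * v ^ 2 + b) = 0 := by
      linear_combination h2 - 4 * t3 ^ 3 * hs
    have h4 : v ^ 2 - S ≠ 0 := sub_ne_zero.2 (hns S ⟨hS0.le, le_rfl⟩)
    have h5 : (t3 : ℂ) ≠ 0 := by exact_mod_cast ht3.ne'
    simpa [h4, h5] using h3
  have hΔ : b ^ 2 = 4 * e := by
    by_contra hne
    rcases lt_or_gt_of_ne hne with hlt | hgt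
    · set d := √(4 * e - b ^ 2) with hd
      have hdp : 0 < d := sqrt_pos.2 (by linarith)
      have hd' : (d : ℂ) ^ 2 = 4 * e - b ^ 2 := by
        have : d ^ 2 = 4 * e - b ^ 2 := sq_sqrt (by linarith)
        exact_mod_cast congrArg Complex.ofReal this
      have := hroot ((-b + d * I) / 2)
        (by linear_combination (-(1 : ℂ) / 4) * hd' + ((d : ℂ) ^ 2 / 4) * I_sq) (by
          intro u _ hu
          have := congrArg Complex.im hu
          simp at this
          exact hdp.ne' this)
      have := congrArg Complex.im this
      simp at this
      exact hdp.ne' this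
    · set d := √(b ^ 2 - 4 * e) with hd
      have hdp : 0 < d := sqrt_pos.2 (by linarith)
      have hd' : d ^ 2 = b ^ 2 - 4 * e := sq_sqrt (by linarith)
      have key : ∀ s : ℝ, s ^ 2 + b * s + e = 0 → 2 * s + b ≠ 0 → s ∈ Icc 0 S := by
        intro s hs hne
        by_contra hns
        refine hne ?_
        have := hroot s (by exact_mod_cast congrArg Complex.ofReal hs)
          fun u hu hsu => hns (by rwa [Complex.ofReal_inj.1 hsu])
        exact_mod_cast this
      have k1 := key ((-b + d) / 2) (by linear_combination hd' / 4) (by linarith)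
      have k2 := key ((-b - d) / 2) (by linear_combination hd' / 4) (by linarith)
      have hs0 : 0 < -b / 2 := by linarith [k2.1]
      have hsS : -b / 2 < S := by linarith [k1.2]
      have hval : ddisc t3 c A (-b / 2) = 4 * t3 ^ 3 * (S + b / 2) * (d ^ 2 / 4) := by
        have : ddisc t3 c A (-b / 2) = 4 * t3 ^ 3 * (-b / 2) ^ 3 + d2 * (-b / 2) ^ 2 +
          d1 * (-b / 2) - 27 * A ^ 2 := rfl
        rw [this, e2, e1, e0, hd']; ring
      have hneg := h.ddisc_nonpos hA (y := √(-b / 2)) ⟨sqrt_pos.2 hs0, by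
        rw [Real.sqrt_lt' hX]; exact hsS⟩
      rw [sq_sqrt hs0.le, hval] at hneg
      have : 0 < 4 * t3 ^ 3 * (S + b / 2) * (d ^ 2 / 4) := by
        have : 0 < S + b / 2 := by linarith
        positivity
      linarith
  refine ⟨-b / 2, ?_, ?_, ?_⟩
  · rw [e2]; ring
  · rw [e1]; linear_combination (-t3 ^ 3) * hΔ
  · rw [e0]; linear_combination (-t3 ^ 3 * S) * hΔ

lemma nonneg_of_curve (h : IsLoopLaw t0 t3 X m)
    (hA : ∀ v, v ∉ segC X → curveFun t0 t3 m v = -v ^ 2 - A) : 0 ≤ A := by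
  set c := t0 * t3 + 1 / t3 with hc
  have hlim : Tendsto (fun v : ℝ => v * KfunR t0 t3 m v) (𝓝[<] 0) (𝓝 0) := by
    have h1 : Tendsto (fun v : ℝ => (v : ℂ)) (𝓝[<] 0) (𝓝[{v | v.re ≤ 0}] 0) := by
      refine tendsto_nhdsWithin_iff.2 ⟨?_, ?_⟩
      · simpa using (Complex.continuous_ofReal.tendsto 0).mono_left nhdsWithin_le_nhds
      · filter_upwards [self_mem_nhdsWithin] with v hv
        simpa using (Set.mem_Iio.1 hv).le
    have h2 := (continuous_re.tendsto _).comp (h.tendsto_mul_Kfun.comp h1)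
    refine h2.congr fun v => ?_
    simp [Kfun_ofReal]
  have hlim0 : Tendsto (fun v : ℝ => v) (𝓝[<] 0) (𝓝 0) := nhdsWithin_le_nhds
  have hlim2 : Tendsto (fun v : ℝ => -v ^ 2 + t3 * (v * KfunR t0 t3 m v) ^ 2 +
      c * (v * KfunR t0 t3 m v)) (𝓝[<] 0) (𝓝 (-0 ^ 2 + t3 * 0 ^ 2 + c * 0)) :=
    ((hlim0.pow 2).neg.add ((hlim.pow 2).const_mul _)).add (hlim.const_mul _)
  have e0 : -(0 : ℝ) ^ 2 + t3 * 0 ^ 2 + c * 0 = 0 := by ring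
  rw [e0] at hlim2
  refine le_of_tendsto hlim2 ?_
  filter_upwards [self_mem_nhdsWithin] with v hv
  have hv : v < 0 := hv
  have h0 : (v : ℂ) ≠ 0 := by exact_mod_cast hv.ne
  have hre : (v : ℂ).re ≤ 0 := by simpa using hv.le
  have h1 := hA _ (not_mem_segC_of_re_nonpos h0 hre)
  have h2 := h.le_re_Kfun h0 hre
  unfold curveFun at h1
  rw [Kfun_ofReal, ← hc] at h1
  rw [Kfun_ofReal, ofReal_re] at h2
  norm_cast at h1
  have h3 : 0 ≤ KfunR t0 t3 m v := le_trans (by positivity) h2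
  nlinarith [mul_nonneg (neg_nonneg.2 hv.le) (pow_nonneg h3 3)]

end IsLoopLaw

/-- The coefficient equations for a double zero of the discriminant, in normalised variables. The
second solution belongs to a triple root of the cubic. -/
lemma double_root_cases {h C B r : ℝ} (hh : 0 < h) (hC : 1 < C) (hB : 0 ≤ B)
    (e1 : 4 * B + 18 * C + C ^ 2 - 27 = -(27 * h ^ 2) - 8 * r)
    (e2 : 18 * C * B + 4 * C ^ 3 - 54 * B = 54 * h ^ 2 * r + 4 * r ^ 2)
    (e3 : B ^ 2 = h ^ 2 * r ^ 2) :
    (C = 1 + h - 2 * h ^ 2 ∧ r = (1 - h) ^ 3 ∧ B = h * (1 - h) ^ 3) ∨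
      (C = 9 * (1 - h) ∧ r = -27 * (1 - h) ∧ B = 27 * h * (1 - h)) := by
  have key : ∀ g : ℝ, B = g * r → h ^ 2 = g ^ 2 →
      C = 1 + g - 2 * g ^ 2 ∨ C = 9 * (1 + g) := by
    intro g hg hhg
    rw [hg, hhg] at e1 e2
    have : (C - (1 + g - 2 * g ^ 2)) * (C - 9 * (1 + g)) ^ 3 = 0 := by
      linear_combination (-(8 + 4 * g) ^ 2 / 4) * e2 +
        ((8 + 4 * g) * (18 * C * g - 54 * g - 54 * g ^ 2) / 4 -
          (8 * r + 4 * g * r + (27 - 18 * C - C ^ 2 - 27 * g ^ 2))) * e1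
    rcases mul_eq_zero.1 this with h1 | h1
    · exact Or.inl (by linarith)
    · exact Or.inr (by linarith [pow_eq_zero_iff (n := 3) (by norm_num) |>.1 h1])
  rcases sq_eq_sq_iff_eq_or_eq_neg.1 (e3.trans (mul_pow h r 2).symm) with hB' | hB'
  · left
    have hr0 : 0 ≤ r := by
      by_contra! hr
      nlinarith
    rcases key h hB' rfl with hC' | hC'
    · have : (2 + h) * (r - (1 - h) ^ 3) = 0 := by
        rw [hB', hC'] at e1
        linear_combination e1 / 4
      have hr : r = (1 - h) ^ 3 := by
        rcases mul_eq_zero.1 this with h1 | h1 <;> linarith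
      exact ⟨hC', hr, by rw [hB', hr]⟩
    · exfalso
      rw [hB', hC'] at e1
      nlinarith [mul_nonneg hr0 hh.le]
  · right
    rcases key (-h) (by linarith) (by ring) with hC' | hC'
    · exfalso
      nlinarith
    · have : h < 1 := by linarith
      have : (2 - h) * (r + 27 * (1 - h)) = 0 := by
        rw [hB', hC'] at e1
        linear_combination e1 / 4
      have hr : r = -27 * (1 - h) := by
        rcases mul_eq_zero.1 this with h1 | h1 <;> linarith
      exact ⟨by linarith, hr, by rw [hB', hr]; ring⟩

namespace IsLoopLaw
variable {t0 t3 X A : ℝ} {m : Measure ℝ}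

lemma stieltjesR_anti (h : IsLoopLaw t0 t3 X m) {v w : ℝ} (hv : X < v) (hvw : v ≤ w) :
    0 ≤ stieltjesR m v ∧ stieltjesR m w ≤ stieltjesR m v := by
  have := h.prob
  have hint : ∀ u : ℝ, X < u → Integrable (fun y : ℝ => 1 / (u - y)) m := fun u hu => by
    refine Integrable.of_bound (Measurable.aestronglyMeasurable (by fun_prop)) (1 / (u - X)) ?_
    filter_upwards [h.ae_mem] with y hy
    have : 0 < u - X := by linarith
    rw [norm_of_nonneg (by have := hy.2; exact one_div_nonneg.2 (by linarith))]
    exact one_div_le_one_div_of_le this (by linarith [hy.2])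
  refine ⟨integral_nonneg_of_ae ?_, integral_mono_ae (hint w (by linarith)) (hint v hv) ?_⟩
  · filter_upwards [h.ae_mem] with y hy
    exact one_div_nonneg.2 (by linarith [hy.2])
  · filter_upwards [h.ae_mem] with y hy
    exact one_div_le_one_div_of_le (by linarith [hy.2]) (by linarith)

lemma KfunR_le (h : IsLoopLaw t0 t3 X m) {v w : ℝ} (hv : X < v) (hvw : v ≤ w) :
    KfunR t0 t3 m v ≤ 1 / √t3 ∧ KfunR t0 t3 m v ≤ KfunR t0 t3 m w := by
  have := h.stieltjesR_anti hv hvw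
  have := h.t0_pos
  unfold KfunR
  constructor <;> nlinarith

/-- The constants of the spectral curve, in terms of a parameter `η` with
`t₀ t₃² = η - 2 η²`. -/
theorem exists_param (h : IsLoopLaw t0 t3 X m)
    (hA : ∀ v, v ∉ segC X → curveFun t0 t3 m v = -v ^ 2 - A) :
    ∃ η, 0 < η ∧ t0 * t3 ^ 2 = η - 2 * η ^ 2 ∧ 4 * t3 ^ 3 * X ^ 2 = 27 * η ^ 2 ∧
      A * t3 ^ 3 = η * (1 - η) ^ 3 := by
  obtain ⟨r, e1, e2, e3⟩ := h.exists_double_root hA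
  have := h.X_pos
  have ht3 := h.t3_pos
  have := h.t0_pos
  have := h.nonneg_of_curve hA
  set η := √(4 * t3 ^ 3 * X ^ 2 / 27)
  have hη0 : 0 < η := sqrt_pos.2 (by positivity)
  have : η ^ 2 = 4 * t3 ^ 3 * X ^ 2 / 27 := sq_sqrt (by positivity)
  have hX : 4 * t3 ^ 3 * X ^ 2 = 27 * η ^ 2 := by linarith
  set c := t0 * t3 + 1 / t3 with hc
  have hcC : c * t3 = 1 + t0 * t3 ^ 2 := by rw [hc]; field_simp; ring
  generalize hCd : 1 + t0 * t3 ^ 2 = C at hcC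
  have hC1 : 1 < C := by rw [← hCd]; linarith [show 0 < t0 * t3 ^ 2 by positivity]
  have hcase := double_root_cases (h := η) (C := C) (B := A * t3 ^ 3) (r := r * t3 ^ 3) hη0 hC1
    (by positivity)
    (by rw [← hcC]; linear_combination e1 - hX)
    (by rw [← hcC]; linear_combination t3 ^ 3 * e2 + 2 * r * t3 ^ 3 * hX)
    (by linear_combination (t3 ^ 6 / 27) * e3 + (t3 ^ 6 * r ^ 2 / 27) * hX)
  rcases hcase with ⟨h1, h2, h3⟩ | ⟨h1, h2, h3⟩
  · exact ⟨η, hη0, by linarith, hX, h3⟩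
  · exfalso
    have : η < 1 := by linarith
    have : r < 0 := by
      have : r * t3 ^ 3 < 0 := by rw [h2]; linarith
      by_contra! hge
      have : 0 ≤ r * t3 ^ 3 := by positivity
      linarith
    set d := √(-r)
    have hd0 : 0 < d := sqrt_pos.2 (by linarith)
    have hd2 : d ^ 2 = -r := sq_sqrt (by linarith)
    set v : ℂ := d * I with hv
    have hre : v.re ≤ 0 := by simp [hv]
    have hv0 : v ≠ 0 := by simp [hv, hd0.ne']
    have hv2 : v ^ 2 = r := by rw [hv, mul_pow, I_sq, ← ofReal_pow, hd2]; push_cast; ring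
    have hcurve := hA v (not_mem_segC_of_re_nonpos hv0 hre)
    have hK := h.le_re_Kfun hv0 hre
    unfold curveFun at hcurve
    rw [← hc] at hcurve
    set κ := Kfun t0 t3 m v
    have f1 : (c : ℂ) = -(t3 ^ 2 * r / 3) := by
      have : c * t3 = -(t3 ^ 2 * r / 3) * t3 := by rw [hcC, h1]; linear_combination h2 / 3
      have := mul_right_cancel₀ ht3.ne' this
      exact_mod_cast congrArg Complex.ofReal this
    have f2 : (r + A : ℂ) = -(t3 ^ 3 * r ^ 2 / 27) := by
      have : (r + A) * t3 ^ 3 = -(t3 ^ 3 * r ^ 2 / 27) * t3 ^ 3 := by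
        linear_combination h3 + h2 + (r * t3 ^ 3 - 27 * (1 - η)) * h2 / 27
      have := mul_right_cancel₀ (by positivity) this
      exact_mod_cast congrArg Complex.ofReal this
    have htriple : v * (κ - t3 * v / 3) ^ 3 = 0 := by
      rw [f1] at hcurve
      linear_combination hcurve - f2 + (t3 ^ 2 * v * κ / 3 - t3 ^ 3 * (v ^ 2 + r) / 27 - 1) * hv2
    have hκ' : κ = t3 * v / 3 := by
      have := (mul_eq_zero.1 htriple).resolve_left hv0
      linear_combination pow_eq_zero_iff (n := 3) (by norm_num) |>.1 this
    have : κ.re = 0 := by rw [hκ', hv]; simp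
    rw [this] at hK
    have : 0 < 1 / √t3 := by positivity
    linarith

end IsLoopLaw

/-! ### The rational parametrisation of the sheets -/

lemma exists_cubic_roots (a b c : ℂ) : ∃ r1 r2 r3 : ℂ,
    r1 + r2 + r3 = a ∧ r1 * r2 + r1 * r3 + r2 * r3 = b ∧ r1 * r2 * r3 = c := by
  obtain ⟨r1, h1⟩ := IsAlgClosed.exists_root (X ^ 3 - C a * X ^ 2 + C b * X - C c : ℂ[X]) (by
    have : (X ^ 3 - C a * X ^ 2 + C b * X - C c : ℂ[X]).degree = 3 := by compute_degree!
    rw [this]; norm_num)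
  simp only [IsRoot.def, eval_sub, eval_add, eval_mul, eval_pow, eval_X, eval_C] at h1
  obtain ⟨s, hs⟩ := IsAlgClosed.exists_pow_nat_eq ((a - r1) ^ 2 - 4 * (b - r1 * (a - r1)))
    (n := 2) (by norm_num)
  refine ⟨r1, ((a - r1) + s) / 2, ((a - r1) - s) / 2, by ring, ?_, ?_⟩
  · linear_combination -hs / 4
  · linear_combination h1 - r1 * hs / 4

/-- The three closed regions of the finite `u`-plane that `u ↦ x (2 u + u⁻²) / 3` maps onto the
sector `0 ≤ arg z ≤ π / 3` of the three sheets. The bound `1 / 4` only excludes `0`. -/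
def region : Fin 3 → Set ℂ :=
  ![{u | 0 ≤ u.im ∧ u.im ≤ √3 * u.re ∧ u.re ≤ normSq u ^ 2 ∧ 1 / 4 ≤ normSq u},
    {u | u.im ≤ 0 ∧ 0 ≤ √3 * u.re + u.im ∧ normSq u ^ 2 ≤ u.re ∧
      -(u.re + √3 * u.im) ≤ 2 * normSq u ^ 2},
    {u | 0 ≤ u.im ∧ √3 * u.re + u.im ≤ 0 ∧
      2 * normSq u ^ 2 ≤ -(u.re + √3 * u.im)}]

lemma mem_region_zero {u : ℂ} : u ∈ region 0 ↔ 0 ≤ u.im ∧ u.im ≤ √3 * u.re ∧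
    u.re ≤ normSq u ^ 2 ∧ 1 / 4 ≤ normSq u := Iff.rfl

lemma mem_region_one {u : ℂ} : u ∈ region 1 ↔ u.im ≤ 0 ∧ 0 ≤ √3 * u.re + u.im ∧
    normSq u ^ 2 ≤ u.re ∧ -(u.re + √3 * u.im) ≤ 2 * normSq u ^ 2 := Iff.rfl

lemma mem_region_two {u : ℂ} : u ∈ region 2 ↔ 0 ≤ u.im ∧ √3 * u.re + u.im ≤ 0 ∧
    2 * normSq u ^ 2 ≤ -(u.re + √3 * u.im) := Iff.rfl

lemma isClosed_region (k : Fin 3) : IsClosed (region k) := by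
  have : Continuous fun u : ℂ => normSq u := Complex.continuous_normSq
  have := continuous_re
  have := continuous_im
  fin_cases k
  · change IsClosed ({u : ℂ | 0 ≤ u.im} ∩ ({u | u.im ≤ √3 * u.re} ∩
      ({u | u.re ≤ normSq u ^ 2} ∩ {u | 1 / 4 ≤ normSq u})))
    refine (isClosed_le ?_ ?_).inter ((isClosed_le ?_ ?_).inter ((isClosed_le ?_ ?_).inter
      (isClosed_le ?_ ?_))) <;> fun_prop
  · change IsClosed ({u : ℂ | u.im ≤ 0} ∩ ({u | 0 ≤ √3 * u.re + u.im} ∩ ({u | normSq u ^ 2 ≤ u.re} ∩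
        {u | -(u.re + √3 * u.im) ≤ 2 * normSq u ^ 2})))
    refine (isClosed_le ?_ ?_).inter ((isClosed_le ?_ ?_).inter ((isClosed_le ?_ ?_).inter
      (isClosed_le ?_ ?_))) <;> fun_prop
  · change IsClosed ({u : ℂ | 0 ≤ u.im} ∩ ({u | √3 * u.re + u.im ≤ 0} ∩
      {u | 2 * normSq u ^ 2 ≤ -(u.re + √3 * u.im)}))
    refine (isClosed_le ?_ ?_).inter ((isClosed_le ?_ ?_).inter (isClosed_le ?_ ?_)) <;> fun_prop

lemma sqrt3_sq : √3 * √3 = 3 := Real.mul_self_sqrt (by norm_num)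

lemma sqrt3_pos : 0 < √3 := by positivity

/-- The closed sector `0 ≤ arg z ≤ π / 3` of the plane. -/
def sectorC : Set ℂ := {w | 0 ≤ w.im ∧ w.im ≤ √3 * w.re}

/-- The projection `u ↦ x (2 u + u⁻²) / 3`. -/
def zC (x : ℝ) (u : ℂ) : ℂ := x / 3 * (2 * u + (u ^ 2)⁻¹)

lemma zC_im {x : ℝ} {u : ℂ} (hu : u ≠ 0) : (zC x u).im =
    2 * x / (3 * normSq u ^ 2) * (u.im * (normSq u ^ 2 - u.re)) := by
  have : normSq u ≠ 0 := by simpa using hu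
  unfold zC
  rw [show (x / 3 : ℂ) = ((x / 3 : ℝ) : ℂ) by push_cast; rfl, im_ofReal_mul,
    add_im, inv_im, map_pow]
  simp only [mul_im, re_ofNat, im_ofNat, zero_mul, add_zero, pow_two]; field_simp; ring

lemma zC_skew {x : ℝ} {u : ℂ} (hu : u ≠ 0) : √3 * (zC x u).re - (zC x u).im =
    x / (3 * normSq u ^ 2) *
      ((√3 * u.re - u.im) * (2 * normSq u ^ 2 + u.re + √3 * u.im)) := by
  have : normSq u ≠ 0 := by simpa using hu
  unfold zC
  rw [show (x / 3 : ℂ) = ((x / 3 : ℝ) : ℂ) by push_cast; rfl, im_ofReal_mul,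
    re_ofReal_mul, add_im, add_re, inv_im, inv_re, map_pow]
  simp only [mul_im, mul_re, re_ofNat, im_ofNat, zero_mul, add_zero, sub_zero, pow_two]
  field_simp
  linear_combination (-x * u.re * u.im) * sqrt3_sq

lemma zC_mem_sectorC_iff {x : ℝ} (hx : 0 < x) {u : ℂ} (hu : u ≠ 0) : zC x u ∈ sectorC ↔
    0 ≤ u.im * (normSq u ^ 2 - u.re) ∧
      0 ≤ (√3 * u.re - u.im) * (2 * normSq u ^ 2 + u.re + √3 * u.im) := by
  have : 0 < normSq u := normSq_pos.2 hu
  have h1 := zC_im (x := x) hu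
  have h2 := zC_skew (x := x) hu
  have h3 : zC x u ∈ sectorC ↔ 0 ≤ (zC x u).im ∧ 0 ≤ √3 * (zC x u).re - (zC x u).im := by
    rw [sub_nonneg]; rfl
  rw [h3, h2, h1]
  exact and_congr (mul_nonneg_iff_of_pos_left (by positivity))
    (mul_nonneg_iff_of_pos_left (by positivity))

lemma exists_mem_region {x : ℝ} (hx : 0 < x) {u : ℂ} (hu : u ≠ 0) (h : zC x u ∈ sectorC) :
    ∃ k, u ∈ region k := by
  obtain ⟨h1, h2⟩ := (zC_mem_sectorC_iff hx hu).1 h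
  have hN : 0 < normSq u := normSq_pos.2 hu
  have : 0 < normSq u ^ 2 := by positivity
  have hNe : normSq u = u.re * u.re + u.im * u.im := normSq_apply u
  have := sqrt3_sq
  have := sqrt3_pos
  rcases le_or_gt 0 (√3 * u.re - u.im) with hs | hs
  · rcases le_or_gt 0 u.im with hi | hi
    · have hre : 0 ≤ u.re := by nlinarith
      rcases le_or_gt u.re (normSq u ^ 2) with hle | hlt
      · refine ⟨0, hi, by linarith, hle, ?_⟩
        by_contra! hlt
        have : normSq u ≤ 4 * u.re ^ 2 := by rw [hNe]; nlinarith
        have : u.re ^ 2 ≤ (normSq u ^ 2) ^ 2 := pow_le_pow_left₀ hre hle 2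
        have : normSq u ^ 3 < (1 / 4) ^ 3 := pow_lt_pow_left₀ hlt hN.le (by norm_num)
        nlinarith
      · have hi0 : u.im = 0 := by
          by_contra hne
          have : 0 < u.im := lt_of_le_of_ne hi (Ne.symm hne)
          nlinarith
        exact ⟨1, hi0.le, by rw [hi0]; positivity, hlt.le, by rw [hi0]; nlinarith⟩
    · have hle : normSq u ^ 2 ≤ u.re := by
        by_contra! hlt
        nlinarith
      have hs' : 0 < √3 * u.re - u.im := by nlinarith
      have h3 := nonneg_of_mul_nonneg_right h2 hs'
      exact ⟨1, hi.le, by nlinarith, hle, by linarith⟩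
  · have h3 : 2 * normSq u ^ 2 + u.re + √3 * u.im ≤ 0 := by
      by_contra! hlt
      nlinarith
    rcases le_or_gt 0 u.im with hi | hi
    · refine ⟨2, hi, ?_, by linarith⟩
      rcases hi.eq_or_lt with hi0 | hi0
      · rw [← hi0] at hs ⊢; linarith
      · have := nonneg_of_mul_nonneg_right h1 hi0
        nlinarith
    · exfalso
      have hle : normSq u ^ 2 ≤ u.re := by
        by_contra! hlt
        nlinarith
      nlinarith

lemma two_mul_sq_mul_sq {x : ℝ} (hx : 0 < x) {u u' : ℂ} (hu : u ≠ 0) (hu' : u' ≠ 0)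
    (hz : zC x u = zC x u') (hne : u ≠ u') : 2 * (u ^ 2 * u' ^ 2) = u + u' := by
  have hx' : (x / 3 : ℂ) ≠ 0 := by
    have : (x : ℂ) ≠ 0 := by exact_mod_cast hx.ne'
    simpa using this
  have h1 := mul_left_cancel₀ hx' hz
  field_simp at h1
  have h2 : (u - u') * (2 * (u ^ 2 * u' ^ 2) - (u + u')) = 0 := by linear_combination h1
  exact sub_eq_zero.1 ((mul_eq_zero.1 h2).resolve_left (sub_ne_zero.2 hne))

/-- Two points in the same right angle `0 ≤ arg u ≤ π / 2` with the same projection are real. -/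
lemma im_eq_zero_of_pair {u u' : ℂ} (hu : u ≠ 0) (hu' : u' ≠ 0)
    (h : 2 * (u ^ 2 * u' ^ 2) = u + u') (h1 : 0 ≤ u.im) (h2 : 0 ≤ u'.im) (h3 : 0 ≤ u.re)
    (h4 : 0 ≤ u'.re) : u.im = 0 ∧ u'.im = 0 := by
  have hN : 0 < normSq u := normSq_pos.2 hu
  have hN' : 0 < normSq u' := normSq_pos.2 hu'
  have e1 := Complex.mul_conj u
  have e2 := Complex.mul_conj u'
  have e : ((2 * (normSq u * normSq u') : ℝ) : ℂ) * (u * u') =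
      (normSq u : ℂ) * conj u' + (normSq u' : ℂ) * conj u := by
    push_cast
    rw [← e1, ← e2]
    linear_combination (conj u * conj u') * h
  have him := congrArg Complex.im e
  rw [im_ofReal_mul, add_im, im_ofReal_mul, im_ofReal_mul, conj_im, conj_im, mul_im] at him
  have : 0 ≤ 2 * (normSq u * normSq u') * (u.re * u'.im + u.im * u'.re) := by positivity
  have : 0 ≤ normSq u * u'.im := by positivity
  have : 0 ≤ normSq u' * u.im := by positivity
  have q2 : normSq u * u'.im = 0 := by linarith
  have q3 : normSq u' * u.im = 0 := by linarith
  exact ⟨(mul_eq_zero.1 q3).resolve_left hN'.ne', (mul_eq_zero.1 q2).resolve_left hN.ne'⟩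

lemma re_eq_of_pair {a c : ℝ} (ha : 0 < a) (hc : 0 < c) (h : 2 * (a ^ 2 * c ^ 2) = a + c)
    (h' : (1 ≤ a ∧ 1 ≤ c) ∨ (a ≤ 1 ∧ c ≤ 1)) : a = c := by
  have : a * (a * c ^ 2 - 1) + c * (a ^ 2 * c - 1) = 0 := by linarith
  have key : a * c ^ 2 = 1 ∧ a ^ 2 * c = 1 := by
    rcases h' with ⟨h1, h2⟩ | ⟨h1, h2⟩
    · have i1 : 1 ≤ a * c ^ 2 := one_le_mul_of_one_le_of_one_le h1 (one_le_pow₀ h2)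
      have i2 : 1 ≤ a ^ 2 * c := one_le_mul_of_one_le_of_one_le (one_le_pow₀ h1) h2
      constructor <;> nlinarith
    · have i1 : a * c ^ 2 ≤ 1 := mul_le_one₀ h1 (by positivity) (pow_le_one₀ hc.le h2)
      have i2 : a ^ 2 * c ≤ 1 := mul_le_one₀ (pow_le_one₀ ha.le h1) hc.le h2
      constructor <;> nlinarith
  have : a * c * (c - a) = 0 := by linarith [key.1, key.2]
  have := (mul_eq_zero.1 this).resolve_left (by positivity)
  linarith

lemma zC_injOn_region {x : ℝ} (hx : 0 < x) {u u' : ℂ} (hu : u ≠ 0) (hu' : u' ≠ 0)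
    (hz : zC x u = zC x u') {k : Fin 3} (hk : u ∈ region k) (hk' : u' ∈ region k) : u = u' := by
  by_contra hne
  have h := two_mul_sq_mul_sq hx hu hu' hz hne
  have := sqrt3_pos
  have hpos : ∀ v : ℂ, v ≠ 0 → v.im = 0 → 0 ≤ v.re → 0 < v.re := fun v hv h1 h2 =>
    lt_of_le_of_ne h2 fun h3 => hv (Complex.ext h3.symm h1)
  have hreal : u.im = 0 → u'.im = 0 → 2 * (u.re ^ 2 * u'.re ^ 2) = u.re + u'.re := by
    intro h1 h2
    have e1 : u = (u.re : ℂ) := Complex.ext rfl (by simpa using h1)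
    have e2 : u' = (u'.re : ℂ) := Complex.ext rfl (by simpa using h2)
    rw [e1, e2] at h
    exact_mod_cast h
  have hN4 : ∀ v : ℂ, v.im = 0 → normSq v ^ 2 = v.re ^ 4 := fun v hv => by
    rw [normSq_apply, hv]; ring
  fin_cases k
  · obtain ⟨h1, h2, h3, -⟩ := mem_region_zero.1 hk
    obtain ⟨h1', h2', h3', -⟩ := mem_region_zero.1 hk'
    have hr : 0 ≤ u.re := by nlinarith
    have hr' : 0 ≤ u'.re := by nlinarith
    obtain ⟨i1, i2⟩ := im_eq_zero_of_pair hu hu' h h1 h1' hr hr'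
    have key : ∀ v : ℂ, v.im = 0 → 0 < v.re → v.re ≤ normSq v ^ 2 → 1 ≤ v.re := by
      intro v hv hp hle
      rw [hN4 v hv] at hle
      by_contra! hlt
      nlinarith [pow_lt_one₀ hp.le hlt (n := 3) (by norm_num)]
    have p1 := hpos u hu i1 hr
    have p2 := hpos u' hu' i2 hr'
    exact hne (Complex.ext (re_eq_of_pair p1 p2 (hreal i1 i2)
      (Or.inl ⟨key u i1 p1 h3, key u' i2 p2 h3'⟩)) (i1.trans i2.symm))
  · obtain ⟨h1, h2, h3, -⟩ := mem_region_one.1 hk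
    obtain ⟨h1', h2', h3', -⟩ := mem_region_one.1 hk'
    have hr : 0 ≤ u.re := le_trans (by positivity) h3
    have hr' : 0 ≤ u'.re := le_trans (by positivity) h3'
    have hc : 2 * (conj u ^ 2 * conj u' ^ 2) =
        conj u + conj u' := by
      simpa only [map_mul, map_pow, map_add, map_ofNat] using congrArg conj h
    obtain ⟨i1, i2⟩ := im_eq_zero_of_pair (by simpa using hu) (by simpa using hu') hc
      (by simpa using h1) (by simpa using h1') (by simpa using hr) (by simpa using hr')
    replace i1 : u.im = 0 := by simpa using i1
    replace i2 : u'.im = 0 := by simpa using i2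
    have key : ∀ v : ℂ, v.im = 0 → 0 < v.re → normSq v ^ 2 ≤ v.re → v.re ≤ 1 := by
      intro v hv hp hle
      rw [hN4 v hv] at hle
      by_contra! hlt
      nlinarith [one_lt_pow₀ hlt (n := 3) (by norm_num)]
    have p1 := hpos u hu i1 hr
    have p2 := hpos u' hu' i2 hr'
    exact hne (Complex.ext (re_eq_of_pair p1 p2 (hreal i1 i2)
      (Or.inr ⟨key u i1 p1 h3, key u' i2 p2 h3'⟩)) (i1.trans i2.symm))
  · obtain ⟨h1, h2, h3⟩ := mem_region_two.1 hk
    obtain ⟨h1', h2', h3'⟩ := mem_region_two.1 hk'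
    have hr : u.re ≤ 0 := by nlinarith
    have hr' : u'.re ≤ 0 := by nlinarith
    -- turn the angle `2π/3 ≤ arg u ≤ π` to the real axis
    set α : ℂ := ⟨-1 / 2, -√3 / 2⟩ with hα
    have hα3 : α ^ 3 = 1 := by
      apply Complex.ext
      · simp only [hα, pow_succ, pow_zero, one_mul, mul_re, mul_im, one_re]
        linear_combination (3 / 8) * sqrt3_sq
      · simp only [hα, pow_succ, pow_zero, one_mul, mul_re, mul_im, one_im]
        linear_combination (√3 / 8) * sqrt3_sq
    have hα0 : α ≠ 0 := by
      intro h0; rw [h0] at hα3; norm_num at hα3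
    have him : ∀ v : ℂ, (α * v).im = -(√3 * v.re + v.im) / 2 := fun v => by
      simp only [hα, mul_im]; ring
    have hre : ∀ v : ℂ, (α * v).re = (√3 * v.im - v.re) / 2 := fun v => by
      simp only [hα, mul_re]; ring
    have hc : 2 * ((α * u) ^ 2 * (α * u') ^ 2) = α * u + α * u' := by
      linear_combination α * h + 2 * (u ^ 2 * u' ^ 2) * α * hα3
    obtain ⟨i1, -⟩ := im_eq_zero_of_pair (mul_ne_zero hα0 hu) (mul_ne_zero hα0 hu') hc
      (by rw [him]; linarith) (by rw [him]; linarith) (by rw [hre]; nlinarith)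
      (by rw [hre]; nlinarith)
    rw [him] at i1
    have : 0 < normSq u ^ 2 := pow_pos (normSq_pos.2 hu) 2
    have : √3 * (√3 * u.re + u.im) = 0 := by rw [show √3 * u.re + u.im = 0 by linarith, mul_zero]
    nlinarith [sqrt3_sq]

/-- The preimages of `w`, as roots of a cubic. -/
lemma exists_zC_roots {x : ℝ} (hx : 0 < x) (w : ℂ) : ∃ s : Fin 3 → ℂ, (∀ i, s i ≠ 0) ∧
    (∀ i, zC x (s i) = w) ∧ s 0 + s 1 + s 2 = 3 * w / (2 * x) ∧
    s 0 * s 1 + s 0 * s 2 + s 1 * s 2 = 0 ∧ s 0 * s 1 * s 2 = -1 / 2 := by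
  have : (x : ℂ) ≠ 0 := by exact_mod_cast hx.ne'
  obtain ⟨r1, r2, r3, h1, h2, h3⟩ := exists_cubic_roots (3 * w / (2 * x)) 0 (-1 / 2)
  have hne : r1 * r2 * r3 ≠ 0 := by rw [h3]; norm_num
  have key : ∀ r, r ≠ 0 → r ^ 3 - 3 * w / (2 * x) * r ^ 2 + 1 / 2 = 0 → zC x r = w := by
    intro r hr h
    unfold zC
    field_simp at h ⊢
    linear_combination h
  have n1 : r1 ≠ 0 := by rintro rfl; simp at hne
  have n2 : r2 ≠ 0 := by rintro rfl; simp at hne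
  have n3 : r3 ≠ 0 := by rintro rfl; simp at hne
  refine ⟨![r1, r2, r3], ?_, ?_, h1, h2, h3⟩
  · intro i; fin_cases i <;> assumption
  · intro i
    fin_cases i
    · exact key r1 n1 (by linear_combination r1 ^ 2 * h1 - r1 * h2 + h3)
    · exact key r2 n2 (by linear_combination r2 ^ 2 * h1 - r2 * h2 + h3)
    · exact key r3 n3 (by linear_combination r3 ^ 2 * h1 - r3 * h2 + h3)

lemma cube_eq_of_double_root {r r' : ℂ} (h2 : r * r + r * r' + r * r' = 0)
    (h3 : r * r * r' = -1 / 2) : r ^ 3 = 1 ∧ r + r + r' = 3 * r / 2 := by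
  have hr : r ≠ 0 := by rintro rfl; norm_num at h3
  have : r + 2 * r' = 0 := by
    have : r * (r + 2 * r') = 0 := by linear_combination h2
    exact (mul_eq_zero.1 this).resolve_left hr
  constructor
  · linear_combination r ^ 2 * this - 2 * h3
  · linear_combination this / 2

lemma zC_roots_injective {x : ℝ} (hx : 0 < x) {w : ℂ} (hw : w ^ 3 ≠ x ^ 3) {s : Fin 3 → ℂ}
    (h1 : s 0 + s 1 + s 2 = 3 * w / (2 * x)) (h2 : s 0 * s 1 + s 0 * s 2 + s 1 * s 2 = 0)
    (h3 : s 0 * s 1 * s 2 = -1 / 2) : Injective s := by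
  have : (x : ℂ) ≠ 0 := by exact_mod_cast hx.ne'
  have key : ∀ r r' : ℂ, r + r + r' = 3 * w / (2 * x) → r * r + r * r' + r * r' = 0 →
      r * r * r' ≠ -1 / 2 := by
    intro r r' e1 e2 e3
    obtain ⟨f1, f2⟩ := cube_eq_of_double_root e2 e3
    have : w = x * r := by
      rw [f2] at e1
      field_simp at e1
      linear_combination -e1
    exact hw (by rw [this, mul_pow, f1, mul_one])
  have a01 : s 0 ≠ s 1 := fun e => key (s 1) (s 2) (by rw [← h1, e]) (by rw [← h2, e])
    (by rw [← h3, e])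
  have a02 : s 0 ≠ s 2 := fun e => key (s 2) (s 1) (by rw [← h1, e]; ring)
    (by rw [← h2, e]; ring) (by rw [← h3, e]; ring)
  have a12 : s 1 ≠ s 2 := fun e => key (s 2) (s 0) (by rw [← h1, e]; ring)
    (by rw [← h2, e]; ring) (by rw [← h3, e]; ring)
  intro i j hij
  fin_cases i <;> fin_cases j <;> first
    | rfl
    | exact absurd hij a01
    | exact absurd hij a02
    | exact absurd hij a12
    | exact absurd hij.symm a01
    | exact absurd hij.symm a02
    | exact absurd hij.symm a12

lemma eq_of_mem_sectorC_of_cube {x : ℝ} (hx : 0 < x) {w : ℂ} (hw : w ∈ sectorC)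
    (h : w ^ 3 = x ^ 3) : w = x := by
  obtain ⟨h1, h2⟩ := hw
  have : (x : ℂ) ≠ 0 := by exact_mod_cast hx.ne'
  have him := congrArg Complex.im h
  have hre := congrArg Complex.re h
  rw [← ofReal_pow] at him hre
  simp only [pow_succ, pow_zero, one_mul, mul_im, mul_re, ofReal_im, ofReal_re] at him hre
  have := sqrt3_pos
  have hr : 0 ≤ w.re := by nlinarith
  have e1 : w.im * (3 * w.re ^ 2 - w.im ^ 2) = 0 := by linear_combination him
  have e2 : w.re * (w.re ^ 2 - 3 * w.im ^ 2) = x ^ 3 := by linear_combination hre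
  have hi : w.im = 0 := by
    rcases mul_eq_zero.1 e1 with h0 | h0
    · exact h0
    · have : w.re * (-8 * w.re ^ 2) = x ^ 3 := by rw [← e2]; linear_combination (-3 * w.re) * h0
      have := pow_pos hx 3
      nlinarith [pow_nonneg hr 3]
  rw [hi] at e2
  have : w.re ^ 3 = x ^ 3 := by linear_combination e2
  exact Complex.ext (by simpa using (pow_left_inj₀ hr hx.le (by norm_num)).1 this)
    (by simpa using hi)

/-- Each point of the closed sector has exactly one preimage in each of the three regions. -/
lemma exists_mem_region_zC {x : ℝ} (hx : 0 < x) {w : ℂ} (hw : w ∈ sectorC) (k : Fin 3) :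
    ∃ u, u ≠ 0 ∧ u ∈ region k ∧ zC x u = w := by
  by_cases hwx : w = x
  · subst hwx
    have := sqrt3_pos
    fin_cases k
    · refine ⟨1, one_ne_zero, mem_region_zero.2 ?_, by unfold zC; norm_num⟩
      norm_num
    · refine ⟨1, one_ne_zero, mem_region_one.2 ?_, by unfold zC; norm_num⟩
      norm_num
    · refine ⟨-1 / 2, by norm_num, mem_region_two.2 ?_, by unfold zC; ring_nf⟩
      have e : (-1 / 2 : ℂ) = ((-1 / 2 : ℝ) : ℂ) := by push_cast; rfl
      rw [e]
      simp only [ofReal_re, ofReal_im, normSq_ofReal]; norm_num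
  · obtain ⟨s, hs0, hsw, h1, h2, h3⟩ := exists_zC_roots hx w
    have hinj := zC_roots_injective hx (fun h => hwx (eq_of_mem_sectorC_of_cube hx hw h)) h1 h2 h3
    have hreg : ∀ i, ∃ k, s i ∈ region k := fun i =>
      exists_mem_region hx (hs0 i) (by rw [hsw]; exact hw)
    choose f hf using hreg
    have hfi : Injective f := fun i j hij => hinj
      (zC_injOn_region hx (hs0 i) (hs0 j) ((hsw i).trans (hsw j).symm) (hf i) (hij ▸ hf j))
    obtain ⟨i, hi⟩ := Finite.injective_iff_surjective.1 hfi k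
    exact ⟨s i, hs0 i, hi ▸ hf i, hsw i⟩

/-! ### Symmetries of the parametrisation -/

lemma zeta6_eq : zeta6 = ⟨1 / 2, √3 / 2⟩ := by
  unfold zeta6
  rw [show (π * I / 3 : ℂ) = ((π / 3 : ℝ) : ℂ) * I by push_cast; ring,
    Complex.exp_mul_I, ← Complex.ofReal_cos, ← Complex.ofReal_sin, Real.cos_pi_div_three,
    Real.sin_pi_div_three]
  apply Complex.ext <;> simp

lemma zeta6_sq : zeta6 ^ 2 = zeta6 - 1 := by
  rw [zeta6_eq]
  apply Complex.ext
  · simp only [pow_two, mul_re, sub_re, one_re]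
    linear_combination (-1 / 4) * sqrt3_sq
  · simp only [pow_two, mul_im, sub_im, one_im]; ring

lemma zeta6_cube : zeta6 ^ 3 = -1 := by linear_combination (zeta6 + 1) * zeta6_sq

lemma zeta6_pow_six : zeta6 ^ 6 = 1 := by
  rw [show 6 = 3 * 2 by norm_num, pow_mul, zeta6_cube]; norm_num

lemma zeta6_ne_zero : zeta6 ≠ 0 := Complex.exp_ne_zero _

lemma conj_zeta6 : conj zeta6 = 1 - zeta6 := by
  rw [zeta6_eq]
  apply Complex.ext <;> simp
  norm_num

lemma zeta6_mul_conj : zeta6 * conj zeta6 = 1 := by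
  rw [conj_zeta6]; linear_combination -zeta6_sq

lemma zeta6_pow_mul_conj (n : ℕ) : zeta6 ^ n * conj (zeta6 ^ n) = 1 := by
  rw [map_pow, ← mul_pow, zeta6_mul_conj, one_pow]

lemma zeta6_pow_add (m n : Fin 6) :
    zeta6 ^ ((m + n : Fin 6) : ℕ) = zeta6 ^ (m : ℕ) * zeta6 ^ (n : ℕ) := by
  rw [Fin.val_add, ← pow_eq_pow_mod _ zeta6_pow_six, pow_add]

/-- The isometry of the plane, holomorphic or antiholomorphic, that maps the sector of number `0`
onto the sector of number `m`, and rays with even numbers onto rays with even numbers. -/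
def gmap (m : Fin 6) (u : ℂ) : ℂ :=
  if Even (m : ℕ) then zeta6 ^ (m : ℕ) * u else zeta6 ^ ((m : ℕ) + 1) * conj u

/-- The inverse of `gmap m`. -/
def gmapInv (m : Fin 6) (u : ℂ) : ℂ := if Even (m : ℕ) then conj (zeta6 ^ (m : ℕ)) * u
  else zeta6 ^ ((m : ℕ) + 1) * conj u

lemma gmapInv_gmap (m : Fin 6) (u : ℂ) : gmapInv m (gmap m u) = u := by
  unfold gmap gmapInv
  split_ifs
  · linear_combination u * zeta6_pow_mul_conj m
  · rw [map_mul, conj_conj]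
    linear_combination u * zeta6_pow_mul_conj (m + 1)

lemma gmap_gmapInv (m : Fin 6) (u : ℂ) : gmap m (gmapInv m u) = u := by
  unfold gmap gmapInv
  split_ifs
  · linear_combination u * zeta6_pow_mul_conj m
  · rw [map_mul, conj_conj]
    linear_combination u * zeta6_pow_mul_conj (m + 1)

lemma continuous_gmap (m : Fin 6) : Continuous (gmap m) := by
  unfold gmap
  split_ifs <;> fun_prop

lemma continuous_gmapInv (m : Fin 6) : Continuous (gmapInv m) := by
  unfold gmapInv
  split_ifs <;> fun_prop

/-- `gmap m` as a homeomorphism. -/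
def gHomeo (m : Fin 6) : ℂ ≃ₜ ℂ where
  toFun := gmap m
  invFun := gmapInv m
  left_inv := gmapInv_gmap m
  right_inv := gmap_gmapInv m
  continuous_toFun := continuous_gmap m
  continuous_invFun := continuous_gmapInv m

/-- The extension of `gmap m` to the sphere. -/
def gHat (m : Fin 6) : OnePoint ℂ ≃ₜ OnePoint ℂ := (gHomeo m).onePointCongr

@[simp] lemma gHat_infty (m : Fin 6) : gHat m infty = infty := rfl

@[simp] lemma gHat_coe (m : Fin 6) (u : ℂ) : gHat m (u : OnePoint ℂ) = (gmap m u : ℂ) := rfl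

@[simp] lemma gHat_symm_coe (m : Fin 6) (u : ℂ) :
    (gHat m).symm (u : OnePoint ℂ) = (gmapInv m u : ℂ) := rfl

lemma gmap_zero (m : Fin 6) : gmap m 0 = 0 := by unfold gmap; simp

lemma gmap_even {m : Fin 6} (hm : Even (m : ℕ)) (u : ℂ) : gmap m u = zeta6 ^ (m : ℕ) * u :=
  if_pos hm

lemma gmap_odd {m : Fin 6} (hm : ¬ Even (m : ℕ)) (u : ℂ) :
    gmap m u = zeta6 ^ ((m : ℕ) + 1) * conj u := if_neg hm

lemma gmap_cube_pow (m : Fin 6) (hm : Even (m : ℕ)) : (zeta6 ^ (m : ℕ)) ^ 3 = 1 := by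
  rw [← pow_mul, mul_comm, pow_mul, zeta6_cube, hm.neg_one_pow]

lemma gmap_cube_pow' (m : Fin 6) (hm : ¬ Even (m : ℕ)) : (zeta6 ^ ((m : ℕ) + 1)) ^ 3 = 1 := by
  rw [← pow_mul, mul_comm, pow_mul, zeta6_cube,
    (Nat.even_add_one.2 hm).neg_one_pow]

lemma zC_mul {x : ℝ} {c u : ℂ} (hc : c ^ 3 = 1) : zC x (c * u) = c * zC x u := by
  have : c ≠ 0 := by rintro rfl; norm_num at hc
  have : (c ^ 2)⁻¹ = c := by
    field_simp; linear_combination -hc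
  unfold zC
  rw [mul_pow, mul_inv, this]; ring

lemma zC_conj (x : ℝ) (u : ℂ) : zC x (conj u) = conj (zC x u) := by
  unfold zC
  simp only [map_mul, map_add, map_div₀, map_inv₀, map_pow, conj_ofReal, map_ofNat]

lemma zC_gmap (x : ℝ) (m : Fin 6) (u : ℂ) : zC x (gmap m u) = gmap m (zC x u) := by
  unfold gmap
  split_ifs with hm
  · exact zC_mul (gmap_cube_pow m hm)
  · rw [zC_mul (gmap_cube_pow' m hm), zC_conj]

lemma gmap_succ_of_even {m : Fin 6} (hm : Even (m : ℕ)) (u : ℂ) :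
    gmap (m + 1) (gmap 1 u) = gmap m u := by
  have h1 : gmap 1 u = zeta6 ^ 2 * conj u := rfl
  have e : ∀ n : ℕ, zeta6 ^ (n + 2) * (conj (zeta6 ^ 2) * u) = zeta6 ^ n * u := fun n => by
    rw [pow_add]
    linear_combination (zeta6 ^ n * u) * zeta6_pow_mul_conj 2
  rw [h1, gmap_even hm]
  fin_cases m <;> first | (exfalso; revert hm; decide) | skip
  all_goals
    rw [gmap_odd (by decide), map_mul, conj_conj]
    exact e _

lemma gmap_succ_of_odd {m : Fin 6} (hm : ¬ Even (m : ℕ)) (u : ℂ) :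
    gmap (m + 1) (gmap 5 u) = gmap m u := by
  have h1 : gmap 5 u = conj u := by
    change zeta6 ^ 6 * _ = _
    rw [zeta6_pow_six, one_mul]
  rw [h1, gmap_odd hm]
  fin_cases m <;> first | (exfalso; revert hm; decide) | skip
  · rfl
  · rfl
  · rw [gmap_even (by decide)]
    change zeta6 ^ 0 * _ = zeta6 ^ 6 * _
    rw [zeta6_pow_six, pow_zero]

lemma gmap_cone (m : Fin 6) (a b : ℝ) : gmap m (a + b * zeta6) = if Even (m : ℕ) then
      a * zeta6 ^ (m : ℕ) + b * zeta6 ^ ((m : ℕ) + 1) else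
      b * zeta6 ^ (m : ℕ) + a * zeta6 ^ ((m : ℕ) + 1) := by
  unfold gmap
  split_ifs
  · ring
  · simp only [map_add, map_mul, conj_ofReal]
    rw [pow_succ]
    linear_combination (b * zeta6 ^ (m : ℕ)) * zeta6_mul_conj

lemma mem_sector_iff {m : Fin 6} {P : OnePoint ℂ} : P ∈ sector m ↔ P = infty ∨
      ∃ a b : ℝ, 0 ≤ a ∧ 0 ≤ b ∧ P = (gmap m (a + b * zeta6) : ℂ) := by
  refine or_congr Iff.rfl ?_
  constructor
  · rintro ⟨a, b, ha, hb, rfl⟩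
    by_cases hm : Even (m : ℕ)
    · exact ⟨a, b, ha, hb, by rw [gmap_cone, if_pos hm]⟩
    · exact ⟨b, a, hb, ha, by rw [gmap_cone, if_neg hm]⟩
  · rintro ⟨a, b, ha, hb, rfl⟩
    by_cases hm : Even (m : ℕ)
    · exact ⟨a, b, ha, hb, by rw [gmap_cone, if_pos hm]⟩
    · exact ⟨b, a, hb, ha, by rw [gmap_cone, if_neg hm]⟩

lemma mem_sectorC_iff {w : ℂ} : w ∈ sectorC ↔ ∃ a b : ℝ, 0 ≤ a ∧ 0 ≤ b ∧ w = a + b * zeta6 := by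
  have s0 := sqrt3_pos
  constructor
  · rintro ⟨h1, h2⟩
    refine ⟨w.re - w.im / √3, 2 * w.im / √3, ?_, by positivity, ?_⟩
    · rw [sub_nonneg, div_le_iff₀ s0]; linarith
    · rw [zeta6_eq]
      apply Complex.ext
      · simp; ring
      · simp; field_simp
  · rintro ⟨a, b, ha, hb, rfl⟩
    rw [zeta6_eq]
    unfold sectorC
    constructor
    · simp; positivity
    · simp
      nlinarith [sqrt3_sq, mul_nonneg s0.le ha]

lemma mem_sector_iff_gmap {m : Fin 6} {P : OnePoint ℂ} :
    P ∈ sector m ↔ P = infty ∨ ∃ w ∈ sectorC, P = (gmap m w : ℂ) := by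
  rw [mem_sector_iff]
  refine or_congr Iff.rfl ⟨?_, ?_⟩
  · rintro ⟨a, b, ha, hb, rfl⟩
    exact ⟨_, mem_sectorC_iff.2 ⟨a, b, ha, hb, rfl⟩, rfl⟩
  · rintro ⟨w, hw, rfl⟩
    obtain ⟨a, b, ha, hb, rfl⟩ := mem_sectorC_iff.1 hw
    exact ⟨a, b, ha, hb, rfl⟩

lemma exists_real_coords (w : ℂ) : ∃ p q : ℝ, w = p + q * zeta6 := by
  refine ⟨w.re - w.im / √3, 2 * w.im / √3, ?_⟩
  have := sqrt3_pos
  rw [zeta6_eq]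
  apply Complex.ext
  · simp; ring
  · simp; field_simp

lemma real_coords_unique {p q p' q' : ℝ} (h : (p + q * zeta6 : ℂ) = p' + q' * zeta6) :
    p = p' ∧ q = q' := by
  have := sqrt3_pos
  rw [zeta6_eq] at h
  have h1 := congrArg Complex.re h
  have h2 := congrArg Complex.im h
  simp at h1 h2
  subst h2
  exact ⟨by linarith, rfl⟩

lemma exists_mem_sector (P : OnePoint ℂ) : ∃ m, P ∈ sector m := by
  induction P using OnePoint.rec with
  | infty => exact ⟨0, Or.inl rfl⟩
  | coe w =>
    obtain ⟨p, q, rfl⟩ := exists_real_coords w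
    have z2 := zeta6_sq
    have z3 := zeta6_cube
    rcases le_total 0 p with hp | hp <;> rcases le_total 0 q with hq | hq <;>
      rcases le_total 0 (p + q) with hs | hs
    · exact ⟨0, Or.inr ⟨p, q, hp, hq, by simp⟩⟩
    · exact ⟨0, Or.inr ⟨p, q, hp, hq, by simp⟩⟩
    · refine ⟨5, Or.inr ⟨-q, p + q, by linarith, hs, congrArg _ ?_⟩⟩
      change _ = _ * zeta6 ^ 5 + _ * zeta6 ^ 6
      push_cast
      linear_combination (q * zeta6 ^ 2 - (p + q) * (zeta6 ^ 3 - 1)) * z3 - q * z2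
    · refine ⟨4, Or.inr ⟨-q - p, p, by linarith, hp, congrArg _ ?_⟩⟩
      change _ = _ * zeta6 ^ 4 + _ * zeta6 ^ 5
      push_cast
      linear_combination ((q + p) * zeta6 - p * zeta6 ^ 2) * z3 + p * z2
    · refine ⟨1, Or.inr ⟨p + q, -p, hs, by linarith, congrArg _ ?_⟩⟩
      change _ = _ * zeta6 ^ 1 + _ * zeta6 ^ 2
      push_cast
      linear_combination p * z2
    · refine ⟨2, Or.inr ⟨q, -p - q, hq, by linarith, congrArg _ ?_⟩⟩
      change _ = _ * zeta6 ^ 2 + _ * zeta6 ^ 3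
      push_cast
      linear_combination (p + q) * z3 - q * z2
    · refine ⟨3, Or.inr ⟨-p, -q, by linarith, by linarith, congrArg _ ?_⟩⟩
      change _ = _ * zeta6 ^ 3 + _ * zeta6 ^ 4
      push_cast
      linear_combination (p + q * zeta6) * z3
    · refine ⟨3, Or.inr ⟨-p, -q, by linarith, by linarith, congrArg _ ?_⟩⟩
      change _ = _ * zeta6 ^ 3 + _ * zeta6 ^ 4
      push_cast
      linear_combination (p + q * zeta6) * z3

/-- Two different sectors meet in `0`, `∞` and a common ray. -/
lemma sector_inter {m d : Fin 6} {w : ℂ} (h1 : (w : OnePoint ℂ) ∈ sector m)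
    (h2 : (w : OnePoint ℂ) ∈ sector (m + d)) : w = 0 ∨ d = 0 ∨
      (d = 1 ∧ ∃ a : ℝ, 0 ≤ a ∧ w = a * zeta6 ^ ((m + 1 : Fin 6) : ℕ)) ∨
      (d = 5 ∧ ∃ a : ℝ, 0 ≤ a ∧ w = a * zeta6 ^ (m : ℕ)) := by
  rcases h1 with h1 | ⟨a, b, ha, hb, h1⟩
  · exact absurd h1 (coe_ne_infty w)
  rcases h2 with h2 | ⟨a', b', ha', hb', h2⟩
  · exact absurd h2 (coe_ne_infty w)
  replace h1 := OnePoint.coe_injective h1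
  replace h2 := OnePoint.coe_injective h2
  rw [pow_succ, zeta6_pow_add] at h2
  have hz : zeta6 ^ (m : ℕ) ≠ 0 := pow_ne_zero _ zeta6_ne_zero
  have h3 : (a + b * zeta6 : ℂ) = a' * zeta6 ^ (d : ℕ) + b' * (zeta6 ^ (d : ℕ) * zeta6) := by
    apply mul_left_cancel₀ hz
    rw [pow_succ] at h1
    linear_combination h2 - h1
  have z2 := zeta6_sq
  have z3 := zeta6_cube
  have key : ∀ p q : ℝ, (a' * zeta6 ^ (d : ℕ) + b' * (zeta6 ^ (d : ℕ) * zeta6) : ℂ) =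
      p + q * zeta6 → a = p ∧ b = q := fun p q h => real_coords_unique (h3.trans h)
  have w0 : a = 0 → b = 0 → w = 0 := fun h h' => by rw [h1, h, h']; simp
  fin_cases d
  · exact Or.inr (Or.inl rfl)
  · obtain ⟨e1, e2⟩ := key (-b') (a' + b') (by
      change (a' * zeta6 ^ 1 + b' * (zeta6 ^ 1 * zeta6) : ℂ) = _
      push_cast
      linear_combination (b' : ℂ) * z2)
    have e3 : a = 0 := by linarith
    refine Or.inr (Or.inr (Or.inl ⟨rfl, b, hb, ?_⟩))
    rw [h1, e3, zeta6_pow_add, pow_succ]; simp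
  · obtain ⟨e1, e2⟩ := key (-(a' + b')) a' (by
      change (a' * zeta6 ^ 2 + b' * (zeta6 ^ 2 * zeta6) : ℂ) = _
      push_cast
      linear_combination (a' : ℂ) * z2 + (b' : ℂ) * z3)
    exact Or.inl (w0 (by linarith) (by linarith))
  · obtain ⟨e1, e2⟩ := key (-a') (-b') (by
      change (a' * zeta6 ^ 3 + b' * (zeta6 ^ 3 * zeta6) : ℂ) = _
      push_cast
      linear_combination (a' + b' * zeta6 : ℂ) * z3)
    exact Or.inl (w0 (by linarith) (by linarith))
  · obtain ⟨e1, e2⟩ := key b' (-(a' + b')) (by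
      change (a' * zeta6 ^ 4 + b' * (zeta6 ^ 4 * zeta6) : ℂ) = _
      push_cast
      linear_combination (a' * zeta6 + b' * zeta6 ^ 2 : ℂ) * z3 - (b' : ℂ) * z2)
    exact Or.inl (w0 (by linarith) (by linarith))
  · obtain ⟨e1, e2⟩ := key (a' + b') (-a') (by
      change (a' * zeta6 ^ 5 + b' * (zeta6 ^ 5 * zeta6) : ℂ) = _
      push_cast
      linear_combination (a' * zeta6 ^ 2 + b' * (zeta6 ^ 3 - 1) : ℂ) * z3 - (a' : ℂ) * z2)
    have e3 : b = 0 := by linarith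
    refine Or.inr (Or.inr (Or.inr ⟨rfl, a, ha, ?_⟩))
    rw [h1, e3]; simp

/-! ### The regions over the boundary of the sector -/

lemma zC_ne_zero_mul {x : ℝ} (hx : 0 < x) {u : ℂ} (hu : u ≠ 0) :
    0 < 2 * x / (3 * normSq u ^ 2) := by
  have := normSq_pos.2 hu
  positivity

lemma im_cases {x : ℝ} (hx : 0 < x) {u : ℂ} (hu : u ≠ 0) (hw : (zC x u).im = 0) :
    u.im = 0 ∨ normSq u ^ 2 = u.re := by
  rw [zC_im hu] at hw
  rcases mul_eq_zero.1 ((mul_eq_zero.1 hw).resolve_left (zC_ne_zero_mul hx hu).ne') with h | h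
  · exact Or.inl h
  · exact Or.inr (by linarith)

lemma zC_re {x : ℝ} {u : ℂ} (hu : u ≠ 0) : (zC x u).re * (3 * normSq u ^ 2) =
    x * (2 * u.re * normSq u ^ 2 + u.re ^ 2 - u.im ^ 2) := by
  have : normSq u ≠ 0 := by simpa using hu
  unfold zC
  rw [show (x / 3 : ℂ) = ((x / 3 : ℝ) : ℂ) by push_cast; rfl,
    re_ofReal_mul, add_re, inv_re, map_pow]
  simp only [mul_re, re_ofNat, im_ofNat, zero_mul, sub_zero, pow_two]; field_simp; ring

/-- Over the part of the real axis outside the cut, the preimages in the first two regions are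
real. -/
lemma im_eq_zero_of_outer {x : ℝ} (hx : 0 < x) {u : ℂ} (hu : u ≠ 0) (hw : (zC x u).im = 0)
    (hre : x ≤ (zC x u).re) : u.im = 0 := by
  rcases im_cases hx hu hw with h | h
  · exact h
  have := normSq_pos.2 hu
  have hNe := normSq_apply u
  have hz := zC_re (x := x) hu
  generalize normSq u = n at *
  have : 3 * n ^ 2 ≤ 4 * n ^ 4 - n := by
    have : x * (3 * n ^ 2) ≤ x * (2 * u.re * n ^ 2 + u.re ^ 2 - u.im ^ 2) := by
      rw [← hz]
      exact mul_le_mul_of_nonneg_right hre (by positivity)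
    have h2 := le_of_mul_le_mul_left this hx
    rw [← h] at h2 hNe; nlinarith
  have h2 : 1 ≤ n := by
    by_contra! hlt
    have : 0 ≤ (n - 1) * (n * (2 * n + 1) ^ 2) := by nlinarith
    have : 0 < n * (2 * n + 1) ^ 2 := by positivity
    nlinarith
  rw [← h] at hNe
  have : n ≤ n ^ 4 := by nlinarith [one_le_pow₀ h2 (n := 3)]
  nlinarith [sq_nonneg u.im]

/-- Over the cut on the real axis, the first two regions are exchanged by conjugation. -/
lemma conj_mem_region_one {x : ℝ} (hx : 0 < x) {u : ℂ} (hu : u ≠ 0) (hw : (zC x u).im = 0)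
    (hre : (zC x u).re ≤ x) (hk : u ∈ region 0) : conj u ∈ region 1 := by
  obtain ⟨h1, h2, h3, -⟩ := mem_region_zero.1 hk
  have := sqrt3_pos
  have := sqrt3_sq
  have hr : 0 ≤ u.re := by nlinarith
  have hN : normSq u ^ 2 = u.re := by
    rcases im_cases hx hu hw with h | h
    · have hNe : normSq u = u.re ^ 2 := by rw [normSq_apply, h]; ring
      have hz := zC_re (x := x) hu
      have : 0 < u.re := lt_of_le_of_ne hr fun h0 => hu (Complex.ext h0.symm h)
      rw [hNe, h] at hz
      rw [hNe] at h3 ⊢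
      generalize u.re = a at *
      have : 2 * a ^ 5 + a ^ 2 ≤ 3 * a ^ 4 := by
        have : x * (2 * a ^ 5 + a ^ 2) ≤ x * (3 * a ^ 4) := by
          nlinarith [mul_le_mul_of_nonneg_right hre (show 0 ≤ 3 * (a ^ 2) ^ 2 by positivity)]
        exact le_of_mul_le_mul_left this hx
      have : (a - 1) ^ 2 * (a ^ 2 * (2 * a + 1)) ≤ 0 := by linarith
      have h6 : (a - 1) ^ 2 = 0 := by
        have : 0 < a ^ 2 * (2 * a + 1) := by positivity
        nlinarith [sq_nonneg (a - 1)]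
      have : a = 1 := by linarith [pow_eq_zero_iff two_ne_zero |>.1 h6]
      rw [this]; norm_num
    · exact h
  refine mem_region_one.2 ?_
  rw [Complex.normSq_conj, conj_re, conj_im]
  exact ⟨by linarith, by linarith, hN.le, by rw [hN]; nlinarith⟩

/-- The reflection in the ray `arg u = π / 3`. -/
lemma gmap_one_re (u : ℂ) : (gmap 1 u).re = (-u.re + √3 * u.im) / 2 := by
  change (zeta6 ^ 2 * conj u).re = _
  rw [zeta6_sq, zeta6_eq]
  simp only [mul_re, sub_re, sub_im, one_re, one_im, conj_re, conj_im]
  ring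

lemma gmap_one_im (u : ℂ) : (gmap 1 u).im = (√3 * u.re + u.im) / 2 := by
  change (zeta6 ^ 2 * conj u).im = _
  rw [zeta6_sq, zeta6_eq]
  simp only [mul_im, sub_re, sub_im, one_re, one_im, conj_re, conj_im]
  ring

lemma normSq_gmap_one (u : ℂ) : normSq (gmap 1 u) = normSq u := by
  rw [normSq_apply, normSq_apply, gmap_one_re, gmap_one_im]
  linear_combination ((u.re * u.re + u.im * u.im) / 4) * sqrt3_sq

lemma skew_cases {x : ℝ} (hx : 0 < x) {u : ℂ} (hu : u ≠ 0) (hw : (zC x u).im = √3 * (zC x u).re) :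
    √3 * u.re = u.im ∨ 2 * normSq u ^ 2 + u.re + √3 * u.im = 0 := by
  have h := zC_skew (x := x) hu
  rw [hw, sub_self] at h
  have := zC_ne_zero_mul hx hu
  rcases mul_eq_zero.1 ((mul_eq_zero.1 h.symm).resolve_left (by
    have := normSq_pos.2 hu; positivity)) with h | h
  · exact Or.inl (by linarith)
  · exact Or.inr h

lemma gmap_one_eq_self {u : ℂ} (h : √3 * u.re = u.im) : gmap 1 u = u := by
  apply Complex.ext
  · rw [gmap_one_re, ← h]; linear_combination (u.re / 2) * sqrt3_sq
  · rw [gmap_one_im, h]; ring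

/-- Over the ray `arg w = π / 3`, the first region is fixed by the reflection. -/
lemma gmap_one_eq_of_mem_region_zero {x : ℝ} (hx : 0 < x) {u : ℂ} (hu : u ≠ 0)
    (hw : (zC x u).im = √3 * (zC x u).re) (hk : u ∈ region 0) : gmap 1 u = u := by
  obtain ⟨h1, h2, h3, -⟩ := mem_region_zero.1 hk
  have s0 := sqrt3_pos
  rcases skew_cases hx hu hw with h | h
  · exact gmap_one_eq_self h
  · exfalso
    have : 0 ≤ u.re := by nlinarith
    have : 0 < normSq u ^ 2 := pow_pos (normSq_pos.2 hu) 2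
    nlinarith [mul_nonneg s0.le h1]

/-- Over the ray `arg w = π / 3`, the last two regions are exchanged by the reflection. -/
lemma gmap_one_mem_region_two {x : ℝ} (hx : 0 < x) {u : ℂ} (hu : u ≠ 0)
    (hw : (zC x u).im = √3 * (zC x u).re) (hk : u ∈ region 1) : gmap 1 u ∈ region 2 := by
  obtain ⟨h1, h2, h3, -⟩ := mem_region_one.1 hk
  have := sqrt3_pos
  have := sqrt3_sq
  have : 0 < normSq u ^ 2 := pow_pos (normSq_pos.2 hu) 2
  rcases skew_cases hx hu hw with h | h
  · exfalso
    nlinarith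
  · refine mem_region_two.2 ?_
    rw [normSq_gmap_one, gmap_one_re, gmap_one_im]
    refine ⟨by linarith, by nlinarith, by nlinarith⟩

lemma region_inter {u : ℂ} {k k' : Fin 3} (hk : u ∈ region k) (hk' : u ∈ region k') :
    k = k' ∨ (u = 1 ∧ k ≠ 2 ∧ k' ≠ 2) ∨ (u = 0 ∧ k ≠ 0 ∧ k' ≠ 0) := by
  have s0 := sqrt3_pos
  have := sqrt3_sq
  have k01 : u ∈ region 0 → u ∈ region 1 → u = 1 := by
    intro a b
    obtain ⟨h1, h2, h3, h4⟩ := mem_region_zero.1 a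
    obtain ⟨h1', -, h3', -⟩ := mem_region_one.1 b
    have hi : u.im = 0 := le_antisymm h1' h1
    have hN : normSq u = u.re ^ 2 := by rw [normSq_apply, hi]; ring
    have hr : 0 ≤ u.re := by nlinarith
    rw [hN] at h3 h3' h4
    have h5 : u.re ≠ 0 := fun h0 => by rw [h0] at h4; norm_num at h4
    have h6 : u.re * (u.re ^ 3 - 1) = 0 := by linarith
    have h7 : u.re ^ 3 = 1 ^ 3 := by linarith [(mul_eq_zero.1 h6).resolve_left h5]
    exact Complex.ext ((pow_left_inj₀ hr zero_le_one (by norm_num)).1 h7) hi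
  have k02 : u ∈ region 0 → u ∉ region 2 := by
    intro a b
    obtain ⟨h1, h2, h3, h4⟩ := mem_region_zero.1 a
    obtain ⟨h1', h2', -⟩ := mem_region_two.1 b
    have hi : u.im = 0 := by linarith
    have hr : u.re = 0 := by nlinarith
    rw [normSq_apply, hi, hr] at h4
    norm_num at h4
  have k12 : u ∈ region 1 → u ∈ region 2 → u = 0 := by
    intro a b
    obtain ⟨h1, h2, h3, h4⟩ := mem_region_one.1 a
    obtain ⟨h1', h2', -⟩ := mem_region_two.1 b
    have hi : u.im = 0 := le_antisymm h1 h1'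
    have hr : u.re = 0 := by
      rw [hi] at h2 h2'
      have : √3 * u.re = 0 := by linarith
      exact (mul_eq_zero.1 this).resolve_left s0.ne'
    exact Complex.ext hr hi
  fin_cases k <;> fin_cases k'
  · exact Or.inl rfl
  · exact Or.inr (Or.inl ⟨k01 hk hk', by decide, by decide⟩)
  · exact absurd hk' (k02 hk)
  · exact Or.inr (Or.inl ⟨k01 hk' hk, by decide, by decide⟩)
  · exact Or.inl rfl
  · exact Or.inr (Or.inr ⟨k12 hk hk', by decide, by decide⟩)
  · exact absurd hk (k02 hk')
  · exact Or.inr (Or.inr ⟨k12 hk' hk, by decide, by decide⟩)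
  · exact Or.inl rfl

/-! ### The parametrisation on the sphere -/

open Classical in
/-- The point `a / b` of the sphere. -/
def ratio (a b : ℂ) : OnePoint ℂ := if b = 0 then infty else ((a / b : ℂ) : OnePoint ℂ)

/-- The extension of `zC` to the sphere. -/
def zHat (x : ℝ) (P : OnePoint ℂ) : OnePoint ℂ :=
  P.elim infty fun u => ratio (x * (2 * u ^ 3 + 1)) (3 * u ^ 2)

@[simp] lemma zHat_infty (x : ℝ) : zHat x infty = infty := rfl

lemma zHat_zero (x : ℝ) : zHat x ((0 : ℂ) : OnePoint ℂ) = infty := if_pos (by simp)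

lemma zHat_coe {x : ℝ} {u : ℂ} (hu : u ≠ 0) : zHat x (u : OnePoint ℂ) = (zC x u : ℂ) := by
  refine (if_neg (by simpa using hu)).trans (congrArg _ ?_)
  unfold zC; field_simp

/-- `region` with the point at infinity in its place. -/
def regionHat (k : Fin 3) : Set (OnePoint ℂ) :=
  {P | (P = infty ∧ k = 0) ∨ ∃ u ∈ region k, P = (u : OnePoint ℂ)}

lemma coe_mem_regionHat {k : Fin 3} {u : ℂ} : (u : OnePoint ℂ) ∈ regionHat k ↔ u ∈ region k := by
  constructor
  · rintro (⟨h, -⟩ | ⟨v, hv, h⟩)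
    · exact absurd h (coe_ne_infty u)
    · rwa [OnePoint.coe_injective h]
  · exact fun h => Or.inr ⟨u, h, rfl⟩

lemma infty_mem_regionHat {k : Fin 3} : infty ∈ regionHat k ↔ k = 0 := by
  constructor
  · rintro (⟨-, h⟩ | ⟨v, -, h⟩)
    · exact h
    · exact absurd h.symm (coe_ne_infty v)
  · exact fun h => Or.inl ⟨rfl, h⟩

lemma zero_not_mem_region_zero : (0 : ℂ) ∉ region 0 := fun h => by
  have := (mem_region_zero.1 h).2.2.2
  norm_num at this

lemma zero_mem_region {k : Fin 3} (hk : k ≠ 0) : (0 : ℂ) ∈ region k := by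
  fin_cases k
  · exact absurd rfl hk
  · exact mem_region_one.2 (by simp)
  · exact mem_region_two.2 (by simp)

lemma normSq_le_one_of_mem_region {k : Fin 3} (hk : k ≠ 0) {u : ℂ} (hu : u ∈ region k) :
    normSq u ≤ 1 := by
  have := Complex.normSq_nonneg u
  have := sqrt3_sq
  have key : ∀ a : ℝ, a ^ 2 ≤ normSq u → normSq u ^ 2 ≤ a →
      normSq u ≤ 1 := by
    intro a h1 h2
    by_contra! hlt
    have : (normSq u ^ 2) ^ 2 ≤ a ^ 2 := pow_le_pow_left₀ (by positivity) h2 2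
    nlinarith [one_lt_pow₀ hlt (n := 3) (by norm_num)]
  have hNe := normSq_apply u
  fin_cases k
  · exact absurd rfl hk
  · exact key u.re (by rw [hNe]; nlinarith [sq_nonneg u.im]) (mem_region_one.1 hu).2.2.1
  · refine key (-(u.re + √3 * u.im) / 2) ?_ (by linarith [(mem_region_two.1 hu).2.2])
    rw [hNe]
    nlinarith [sq_nonneg (√3 * u.re - u.im)]

lemma isClosed_regionHat (k : Fin 3) : IsClosed (regionHat k) := by
  have hpre : ((↑) ⁻¹' regionHat k : Set ℂ) = region k := by ext u; exact coe_mem_regionHat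
  by_cases hk : k = 0
  · rw [OnePoint.isClosed_iff_of_mem (infty_mem_regionHat.2 hk), hpre]
    exact isClosed_region k
  · rw [OnePoint.isClosed_iff_of_notMem (fun h => hk (infty_mem_regionHat.1 h)), hpre]
    refine ⟨isClosed_region k, Metric.isCompact_of_isClosed_isBounded (isClosed_region k)
      (Metric.isBounded_closedBall.subset (?_ : region k ⊆ Metric.closedBall 0 1))⟩
    intro u hu
    rw [mem_closedBall_zero_iff, norm_def, Real.sqrt_le_one]
    exact normSq_le_one_of_mem_region hk hu

/-- The point of number `k` over a point of the closed sector. -/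
lemma existsUnique_regionHat {x : ℝ} (hx : 0 < x) (k : Fin 3) {Q : OnePoint ℂ}
    (hQ : Q = infty ∨ ∃ w ∈ sectorC, Q = (w : OnePoint ℂ)) :
    ∃! U, U ∈ regionHat k ∧ zHat x U = Q := by
  rcases hQ with rfl | ⟨w, hw, rfl⟩
  · have hun : ∀ U, U ∈ regionHat k ∧ zHat x U = infty →
        U = infty ∧ k = 0 ∨ U = ((0 : ℂ) : OnePoint ℂ) ∧ k ≠ 0 := by
      rintro U ⟨h1, h2⟩
      induction U using OnePoint.rec with
      | infty => exact Or.inl ⟨rfl, infty_mem_regionHat.1 h1⟩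
      | coe u =>
        by_cases hu : u = 0
        · subst hu
          refine Or.inr ⟨rfl, ?_⟩
          rintro rfl
          exact zero_not_mem_region_zero (coe_mem_regionHat.1 h1)
        · rw [zHat_coe hu] at h2
          exact absurd h2 (coe_ne_infty _)
    by_cases hk : k = 0
    · refine ⟨infty, ⟨infty_mem_regionHat.2 hk, rfl⟩, fun U hU => ?_⟩
      rcases hun U hU with h | h
      · exact h.1
      · exact absurd hk h.2
    · refine ⟨((0 : ℂ) : OnePoint ℂ), ⟨coe_mem_regionHat.2 (zero_mem_region hk), zHat_zero x⟩,
        fun U hU => ?_⟩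
      rcases hun U hU with h | h
      · exact absurd h.2 hk
      · exact h.1
  · obtain ⟨u, hu0, huk, huw⟩ := exists_mem_region_zC hx hw k
    refine ⟨u, ⟨coe_mem_regionHat.2 huk, by rw [zHat_coe hu0, huw]⟩, ?_⟩
    rintro V ⟨h1, h2⟩
    induction V using OnePoint.rec with
    | infty => exact absurd h2.symm (coe_ne_infty w)
    | coe v =>
      have hv0 : v ≠ 0 := by
        rintro rfl
        rw [zHat_zero] at h2
        exact coe_ne_infty w h2.symm
      rw [zHat_coe hv0] at h2
      rw [zC_injOn_region hx hv0 hu0 ((OnePoint.coe_injective h2).trans huw.symm)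
        (coe_mem_regionHat.1 h1) huk]

lemma zHat_gHat (x : ℝ) (m : Fin 6) (U : OnePoint ℂ) :
    zHat x (gHat m U) = gHat m (zHat x U) := by
  induction U using OnePoint.rec with
  | infty => rfl
  | coe u =>
    by_cases hu : u = 0
    · subst hu
      rw [gHat_coe, gmap_zero, zHat_zero, gHat_infty]
    · have : gmap m u ≠ 0 := fun h => hu ((gHomeo m).injective (h.trans (gmap_zero m).symm))
      rw [gHat_coe, zHat_coe this, zHat_coe hu, gHat_coe, zC_gmap]

/-- Over the ray of argument `π / 3`. -/
lemma gHat_one_mem {x : ℝ} (hx : 0 < x) {k : Fin 3} {U : OnePoint ℂ} (hU : U ∈ regionHat k)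
    (hQ : zHat x U = infty ∨ ∃ a : ℝ, 0 ≤ a ∧ zHat x U = ((a * zeta6 : ℂ) : OnePoint ℂ)) :
    gHat 1 U ∈ regionHat (Equiv.swap 1 2 k) := by
  have hsw : ∀ k : Fin 3, Equiv.swap (1 : Fin 3) 2 k = 0 ↔ k = 0 := by decide
  induction U using OnePoint.rec with
  | infty =>
    rw [infty_mem_regionHat] at hU
    rw [gHat_infty, infty_mem_regionHat, hsw]
    exact hU
  | coe u =>
    rw [coe_mem_regionHat] at hU
    rw [gHat_coe, coe_mem_regionHat]
    by_cases hu : u = 0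
    · subst hu
      rw [gmap_zero]
      refine zero_mem_region fun h => ?_
      rw [hsw] at h
      subst h
      exact zero_not_mem_region_zero hU
    rw [zHat_coe hu] at hQ
    rcases hQ with hQ | ⟨a, ha, hQ⟩
    · exact absurd hQ (coe_ne_infty _)
    replace hQ := OnePoint.coe_injective hQ
    have hskew : ∀ v, zC x v = a * zeta6 → (zC x v).im = √3 * (zC x v).re := by
      intro v hv
      rw [hv, zeta6_eq]; simp; ring
    fin_cases k
    · change gmap 1 u ∈ region 0
      rwa [gmap_one_eq_of_mem_region_zero hx hu (hskew u hQ) hU]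
    · exact gmap_one_mem_region_two hx hu (hskew u hQ) hU
    · change gmap 1 u ∈ region 1
      -- the reflection of the preimage in `region 1` lies in `region 2`, so it is `u`
      obtain ⟨v, hv0, hv1, hvw⟩ := exists_mem_region_zC hx (w := a * zeta6)
        (mem_sectorC_iff.2 ⟨0, a, le_rfl, ha, by simp⟩) 1
      have h2 := gmap_one_mem_region_two hx hv0 (hskew v hvw) hv1
      have hinv : gmap 1 (gmap 1 v) = v := gmapInv_gmap 1 v
      have h0 : gmap 1 v ≠ 0 := fun h => hv0 (by rw [← hinv, h, gmap_zero])
      have hfix : gmap 1 (a * zeta6) = a * zeta6 := by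
        have := gmap_cone 1 0 a
        rw [if_neg (by decide)] at this
        simpa using this
      have : u = gmap 1 v := zC_injOn_region hx hu h0 (by rw [zC_gmap, hvw, hQ, hfix]) hU h2
      rw [this, hinv]
      exact hv1

/-- Over the cut on the real axis. -/
lemma gHat_five_mem_of_inner {x : ℝ} (hx : 0 < x) {k : Fin 3} {U : OnePoint ℂ}
    (hU : U ∈ regionHat k) {a : ℝ} (ha : 0 ≤ a) (hax : a ≤ x)
    (hQ : zHat x U = ((a : ℂ) : OnePoint ℂ)) : gHat 5 U ∈ regionHat (Equiv.swap 0 1 k) := by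
  have h5 : ∀ u, gmap 5 u = conj u := fun u => by
    change zeta6 ^ 6 * _ = _
    rw [zeta6_pow_six, one_mul]
  induction U using OnePoint.rec with
  | infty => exact absurd hQ.symm (coe_ne_infty _)
  | coe u =>
    have hu : u ≠ 0 := by
      rintro rfl
      rw [zHat_zero] at hQ
      exact coe_ne_infty _ hQ.symm
    rw [zHat_coe hu] at hQ
    replace hQ := OnePoint.coe_injective hQ
    rw [coe_mem_regionHat] at hU
    rw [gHat_coe, coe_mem_regionHat, h5]
    fin_cases k
    · exact conj_mem_region_one hx hu (by rw [hQ]; simp) (by rw [hQ]; simpa using hax) hU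
    · change conj u ∈ region 0
      obtain ⟨v, hv0, hv1, hvw⟩ := exists_mem_region_zC hx (w := a)
        (mem_sectorC_iff.2 ⟨a, 0, ha, le_rfl, by simp⟩) 0
      have h2 := conj_mem_region_one hx hv0 (by rw [hvw]; simp) (by rw [hvw]; simpa using hax) hv1
      have h0 : conj v ≠ 0 := by simpa using hv0
      have : u = conj v := zC_injOn_region hx hu h0
        (by rw [zC_conj, hvw, hQ, conj_ofReal]) hU h2
      rw [this, conj_conj]
      exact hv1
    · change conj u ∈ region 2
      have hi : u.im = 0 := by
        rcases im_cases hx hu (by rw [hQ]; simp) with h | h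
        · exact h
        · obtain ⟨h1, h2, -⟩ := mem_region_two.1 hU
          have : 0 < normSq u ^ 2 := pow_pos (normSq_pos.2 hu) 2
          nlinarith [sqrt3_pos]
      rwa [Complex.conj_eq_iff_im.2 hi]

/-- Over the rest of the positive real axis. -/
lemma gHat_five_mem_of_outer {x : ℝ} (hx : 0 < x) {k : Fin 3} {U : OnePoint ℂ}
    (hU : U ∈ regionHat k)
    (hQ : zHat x U = infty ∨ ∃ a : ℝ, x ≤ a ∧ zHat x U = ((a : ℂ) : OnePoint ℂ)) :
    gHat 5 U ∈ regionHat k := by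
  have h5 : ∀ u, gmap 5 u = conj u := fun u => by
    change zeta6 ^ 6 * _ = _
    rw [zeta6_pow_six, one_mul]
  induction U using OnePoint.rec with
  | infty => exact hU
  | coe u =>
    rw [coe_mem_regionHat] at hU
    rw [gHat_coe, coe_mem_regionHat, h5]
    by_cases hu : u = 0
    · subst hu; simpa using hU
    rw [zHat_coe hu] at hQ
    rcases hQ with hQ | ⟨a, ha, hQ⟩
    · exact absurd hQ (coe_ne_infty _)
    replace hQ := OnePoint.coe_injective hQ
    have hi : u.im = 0 := im_eq_zero_of_outer hx hu (by rw [hQ]; simp) (by rw [hQ]; simpa using ha)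
    rwa [Complex.conj_eq_iff_im.2 hi]

/-! ### Holomorphic maps into the sphere -/

lemma tendsto_inv_zero_infty :
    Tendsto (fun w : ℂ => ((w⁻¹ : ℂ) : OnePoint ℂ)) (𝓝[≠] 0) (𝓝 infty) := by
  refine OnePoint.tendsto_coe_infty.comp ?_
  rw [coclosedCompact_eq_cocompact, ← Metric.cobounded_eq_cocompact]
  exact tendsto_inv₀_nhdsNE_zero

lemma sphereInv_of_ne {w : ℂ} (hw : w ≠ 0) : sphereInv w = ((w⁻¹ : ℂ) : OnePoint ℂ) := if_neg hw

@[simp] lemma sphereInv_zero : sphereInv 0 = infty := if_pos rfl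

lemma continuous_sphereInv : Continuous sphereInv := by
  rw [continuous_iff_continuousAt]
  intro w
  by_cases hw : w = 0
  · subst hw
    rw [ContinuousAt, sphereInv_zero, ← nhdsNE_sup_pure, tendsto_sup]
    constructor
    · refine tendsto_inv_zero_infty.congr' ?_
      filter_upwards [self_mem_nhdsWithin] with w hw using (sphereInv_of_ne hw).symm
    · rw [tendsto_pure_left]
      intro s hs
      rw [sphereInv_zero]
      exact mem_of_mem_nhds hs
  · have : ContinuousAt (fun w : ℂ => ((w⁻¹ : ℂ) : OnePoint ℂ)) w :=
      continuous_coe.continuousAt.comp (continuousAt_inv₀ hw)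
    refine this.congr ?_
    filter_upwards [isOpen_ne.mem_nhds hw] with v hv using (sphereInv_of_ne hv).symm

/-- The inversion of the sphere. -/
def sInv (P : OnePoint ℂ) : OnePoint ℂ := P.elim ((0 : ℂ) : OnePoint ℂ) sphereInv

@[simp] lemma sInv_infty : sInv infty = ((0 : ℂ) : OnePoint ℂ) := rfl

@[simp] lemma sInv_coe (w : ℂ) : sInv (w : OnePoint ℂ) = sphereInv w := rfl

lemma sInv_sInv (P : OnePoint ℂ) : sInv (sInv P) = P := by
  induction P using OnePoint.rec with
  | infty => simp
  | coe w =>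
    by_cases hw : w = 0
    · simp [hw]
    · rw [sInv_coe, sphereInv_of_ne hw, sInv_coe, sphereInv_of_ne (inv_ne_zero hw), inv_inv]

lemma continuous_sInv : Continuous sInv := by
  rw [OnePoint.continuous_iff]
  refine ⟨?_, continuous_sphereInv⟩
  rw [coclosedCompact_eq_cocompact, ← Metric.cobounded_eq_cocompact]
  have : Tendsto (fun w : ℂ => ((w⁻¹ : ℂ) : OnePoint ℂ)) (Bornology.cobounded ℂ)
      (𝓝 ((0 : ℂ) : OnePoint ℂ)) :=
    (continuous_coe.tendsto 0).comp tendsto_inv₀_cobounded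
  refine this.congr' ?_
  filter_upwards [Bornology.eventually_ne_cobounded 0] with w hw using (sphereInv_of_ne hw).symm

/-- The inversion as a homeomorphism. -/
def sInvHomeo : OnePoint ℂ ≃ₜ OnePoint ℂ where
  toFun := sInv
  invFun := sInv
  left_inv := sInv_sInv
  right_inv := sInv_sInv
  continuous_toFun := continuous_sInv
  continuous_invFun := continuous_sInv

lemma SphereHolAt.continuousAt {g : ℂ → OnePoint ℂ} {w : ℂ} (h : SphereHolAt g w) :
    ContinuousAt g w := by
  obtain ⟨f, hf, h | h⟩ := h
  · exact (continuous_coe.continuousAt.comp hf.continuousAt).congr h.symm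
  · exact (continuous_sphereInv.continuousAt.comp hf.continuousAt).congr h.symm

lemma ratio_of_ne {a b : ℂ} (hb : b ≠ 0) : ratio a b = ((a / b : ℂ) : OnePoint ℂ) := if_neg hb

@[simp] lemma ratio_zero (a : ℂ) : ratio a 0 = infty := if_pos rfl

lemma sphereHolAt_ratio {n d : ℂ → ℂ} {w : ℂ} (hn : AnalyticAt ℂ n w) (hd : AnalyticAt ℂ d w)
    (h : d w = 0 → n w ≠ 0) : SphereHolAt (fun u => ratio (n u) (d u)) w := by
  by_cases h0 : d w = 0
  · refine ⟨fun u => d u / n u, hd.div hn (h h0), Or.inr ?_⟩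
    filter_upwards [hn.continuousAt.eventually_ne (h h0)] with u hu
    by_cases hdu : d u = 0
    · simp [hdu]
    · rw [ratio_of_ne hdu, sphereInv_of_ne (div_ne_zero hdu hu), inv_div]
  · refine ⟨fun u => n u / d u, hn.div hd h0, Or.inl ?_⟩
    filter_upwards [hd.continuousAt.eventually_ne h0] with u hu using ratio_of_ne hu

/-- The meromorphic function `κ (u⁻¹ + g u²)` on the sphere. -/
def xiHat (κ g : ℂ) (P : OnePoint ℂ) : OnePoint ℂ :=
  P.elim infty fun u => ratio (κ * (1 + g * u ^ 3)) u

lemma sphereHolAt_zHat {x : ℝ} (hx : 0 < x) (w : ℂ) :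
    SphereHolAt (fun u : ℂ => zHat x (u : OnePoint ℂ)) w := by
  have hx' : (x : ℂ) ≠ 0 := by exact_mod_cast hx.ne'
  refine sphereHolAt_ratio (by fun_prop) (by fun_prop) fun h => ?_
  have : w = 0 := by simpa using h
  simpa [this] using hx'

lemma zHat_sphereInv (x : ℝ) (u : ℂ) :
    zHat x (sphereInv u) = ratio (x * (2 + u ^ 3)) (3 * u) := by
  by_cases hu : u = 0
  · simp [hu]
  · rw [sphereInv_of_ne hu, zHat_coe (inv_ne_zero hu), ratio_of_ne (by simpa using hu)]
    refine congrArg _ ?_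
    unfold zC; field_simp

lemma sphereHolAt_zHat_inv {x : ℝ} (hx : 0 < x) (w : ℂ) :
    SphereHolAt (fun u : ℂ => zHat x (sphereInv u)) w := by
  have hx' : (x : ℂ) ≠ 0 := by exact_mod_cast hx.ne'
  simp only [zHat_sphereInv]
  refine sphereHolAt_ratio (by fun_prop) (by fun_prop) fun h => ?_
  have : w = 0 := by simpa using h
  simpa [this] using hx'

lemma continuous_zHat {x : ℝ} (hx : 0 < x) : Continuous (zHat x) := by
  rw [OnePoint.continuous_iff]
  refine ⟨?_, continuous_iff_continuousAt.2 fun w => (sphereHolAt_zHat hx w).continuousAt⟩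
  have h0 : Tendsto (fun P => zHat x (sInv P)) (𝓝 ((0 : ℂ) : OnePoint ℂ)) (𝓝 infty) := by
    have := (sphereHolAt_zHat_inv hx 0).continuousAt.tendsto
    rw [OnePoint.nhds_coe_eq, tendsto_map'_iff]
    simpa [comp_def] using this
  have h1 := h0.comp (continuous_sInv.tendsto infty)
  have h2 := (OnePoint.tendsto_nhds_infty'.1 h1).2
  refine h2.congr fun u => ?_
  simp only [Function.comp_apply, sInv_sInv]

lemma sphereHolAt_xiHat {κ : ℂ} (hκ : κ ≠ 0) (g w : ℂ) :
    SphereHolAt (fun u : ℂ => xiHat κ g (u : OnePoint ℂ)) w := by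
  refine sphereHolAt_ratio (by fun_prop) (by fun_prop) fun h => ?_
  simpa [h] using hκ

lemma xiHat_coe {κ g u : ℂ} (hu : u ≠ 0) :
    xiHat κ g (u : OnePoint ℂ) = ((κ * (u⁻¹ + g * u ^ 2) : ℂ) : OnePoint ℂ) := by
  refine (ratio_of_ne hu).trans (congrArg _ ?_)
  field_simp

lemma sphereHolAt_xiHat_inv {κ g : ℂ} (hκ : κ ≠ 0) (hg : g ≠ 0) (w : ℂ) :
    SphereHolAt (fun u : ℂ => xiHat κ g (sphereInv u)) w := by
  have h : ∀ u : ℂ, xiHat κ g (sphereInv u) = ratio (κ * (u ^ 3 + g)) (u ^ 2) := by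
    intro u
    by_cases hu : u = 0
    · simp [hu, xiHat]
    · rw [sphereInv_of_ne hu, xiHat_coe (inv_ne_zero hu), ratio_of_ne (by simpa using hu)]
      refine congrArg _ ?_
      field_simp
  simp only [h]
  refine sphereHolAt_ratio (by fun_prop) (by fun_prop) fun h => ?_
  have : w = 0 := by simpa using h
  simp [this, hκ, hg]

/-! ### The surface is a sphere -/

lemma isClosed_sector (m : Fin 6) : IsClosed (sector m) := by
  have h0 : IsClosed {P : OnePoint ℂ | P = infty ∨ ∃ w ∈ sectorC, P = (w : OnePoint ℂ)} := by
    rw [OnePoint.isClosed_iff_of_mem (Or.inl rfl)]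
    have e : ((↑) ⁻¹' {P : OnePoint ℂ | P = infty ∨ ∃ w ∈ sectorC, P = (w : OnePoint ℂ)} :
        Set ℂ) = {w | 0 ≤ w.im} ∩ {w | w.im ≤ √3 * w.re} := by
      ext w
      constructor
      · rintro (h | ⟨v, hv, h⟩)
        · exact absurd h (coe_ne_infty w)
        · rw [OnePoint.coe_injective h]; exact hv
      · exact fun h => Or.inr ⟨w, h, rfl⟩
    rw [e]
    exact (isClosed_le continuous_const continuous_im).inter
      (isClosed_le continuous_im (by fun_prop))
  have e : sector m = (gHat m).symm ⁻¹'
      {P : OnePoint ℂ | P = infty ∨ ∃ w ∈ sectorC, P = (w : OnePoint ℂ)} := by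
    ext P
    rw [mem_sector_iff_gmap, Set.mem_preimage]
    constructor
    · rintro (rfl | ⟨w, hw, rfl⟩)
      · exact Or.inl rfl
      · exact Or.inr ⟨w, hw, by rw [gHat_symm_coe, gmapInv_gmap]⟩
    · rintro (h | ⟨w, hw, h⟩)
      · exact Or.inl (by rw [← (gHat m).apply_symm_apply P, h, gHat_infty])
      · exact Or.inr ⟨w, hw, by rw [← (gHat m).apply_symm_apply P, h, gHat_coe]⟩
  rw [e]
  exact h0.preimage (gHat m).symm.continuous

lemma isClosed_of_finite_index {α β ι : Type*} [TopologicalSpace α] [TopologicalSpace β]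
    [TopologicalSpace ι] [DiscreteTopology ι] [Finite ι] {f : α → ι} (hf : Continuous f)
    {s : ι → Set α} (hs : ∀ i, IsClosed (s i)) : IsClosed {a | a ∈ s (f a)} := by
  have e : {a | a ∈ s (f a)} = ⋃ i, f ⁻¹' {i} ∩ s i := by ext a; simp
  rw [e]
  exact isClosed_iUnion_of_finite fun i => ((isClosed_discrete {i}).preimage hf).inter (hs i)

instance : CompactSpace Piece := by
  refine isCompact_iff_compactSpace.1 (IsClosed.isCompact ?_)
  exact isClosed_of_finite_index (β := ℂ) (f := fun p : Fin 3 × Fin 6 × OnePoint ℂ => p.2.1)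
    (by fun_prop) (s := fun m => {p : Fin 3 × Fin 6 × OnePoint ℂ | p.2.2 ∈ sector m})
    fun m => (isClosed_sector m).preimage (by fun_prop)

instance (x : ℝ) : CompactSpace (Surface x) := inferInstanceAs (CompactSpace (Quot (Glue x)))

lemma existsUnique_pieceMap {x : ℝ} (hx : 0 < x) (p : Piece) :
    ∃! V, (gHat p.sec).symm V ∈ regionHat p.sheet ∧ zHat x V = p.pt := by
  obtain ⟨Q, hQ, hQP⟩ : ∃ Q : OnePoint ℂ, (Q = infty ∨
      ∃ w ∈ sectorC, Q = (w : OnePoint ℂ)) ∧ p.pt = gHat p.sec Q := by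
    rcases mem_sector_iff_gmap.1 p.2 with h | ⟨w, hw, h⟩
    · exact ⟨infty, Or.inl rfl, h⟩
    · exact ⟨w, Or.inr ⟨w, hw, rfl⟩, h⟩
  obtain ⟨U, ⟨h1, h2⟩, h3⟩ := existsUnique_regionHat hx p.sheet hQ
  refine ⟨gHat p.sec U, ⟨by rwa [Homeomorph.symm_apply_apply], by rw [zHat_gHat, h2, hQP]⟩, ?_⟩
  rintro V ⟨e1, e2⟩
  rw [← h3 ((gHat p.sec).symm V) ⟨e1, ?_⟩, Homeomorph.apply_symm_apply]
  apply (gHat p.sec).injective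
  rw [← zHat_gHat, Homeomorph.apply_symm_apply, e2, hQP]

/-- The uniformising map on the pieces. -/
def pieceMap {x : ℝ} (hx : 0 < x) (p : Piece) : OnePoint ℂ := (existsUnique_pieceMap hx p).choose

lemma pieceMap_mem {x : ℝ} (hx : 0 < x) (p : Piece) :
    (gHat p.sec).symm (pieceMap hx p) ∈ regionHat p.sheet :=
  (existsUnique_pieceMap hx p).choose_spec.1.1

lemma zHat_pieceMap {x : ℝ} (hx : 0 < x) (p : Piece) : zHat x (pieceMap hx p) = p.pt :=
  (existsUnique_pieceMap hx p).choose_spec.1.2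

lemma eq_pieceMap {x : ℝ} (hx : 0 < x) {p : Piece} {V : OnePoint ℂ}
    (h1 : (gHat p.sec).symm V ∈ regionHat p.sheet) (h2 : zHat x V = p.pt) : V = pieceMap hx p :=
  (existsUnique_pieceMap hx p).unique ⟨h1, h2⟩ ⟨pieceMap_mem hx p, zHat_pieceMap hx p⟩

lemma continuous_of_isClosed_graph {α β : Type*} [TopologicalSpace α] [TopologicalSpace β]
    [CompactSpace β] {f : α → β} (hf : IsClosed {q : α × β | q.2 = f q.1}) : Continuous f := by
  refine continuous_iff_isClosed.2 fun s hs => ?_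
  have e : f ⁻¹' s = Prod.fst '' ({q : α × β | q.2 = f q.1} ∩ Prod.snd ⁻¹' s) := by
    ext a
    constructor
    · exact fun h => ⟨(a, f a), ⟨rfl, h⟩, rfl⟩
    · rintro ⟨⟨a', b⟩, ⟨h1, h2⟩, rfl⟩
      have h1 : b = f a' := h1
      change f a' ∈ s
      rw [← h1]; exact h2
  rw [e]
  exact isClosedMap_fst_of_compactSpace _ (hf.inter (hs.preimage continuous_snd))

lemma continuous_pieceMap {x : ℝ} (hx : 0 < x) : Continuous (pieceMap hx) := by
  refine continuous_of_isClosed_graph ?_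
  have e : {q : Piece × OnePoint ℂ | q.2 = pieceMap hx q.1} =
      {q | q ∈ {q : Piece × OnePoint ℂ | (gHat q.1.1.2.1).symm q.2 ∈ regionHat q.1.1.1}} ∩
        {q | zHat x q.2 = q.1.1.2.2} := by
    ext q
    constructor
    · intro h
      have h : q.2 = pieceMap hx q.1 := h
      exact ⟨by rw [mem_ofPred_eq, mem_ofPred_eq, h]; exact pieceMap_mem hx q.1,
        by rw [mem_ofPred_eq, h]; exact zHat_pieceMap hx q.1⟩
    · exact fun h => eq_pieceMap hx h.1 h.2
  rw [e]
  refine IsClosed.inter ?_ (isClosed_eq ((continuous_zHat hx).comp continuous_snd) (by fun_prop))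
  exact isClosed_of_finite_index (β := ℂ) (f := fun q : Piece × OnePoint ℂ => (q.1.1.1, q.1.1.2.1))
    (by fun_prop) (s := fun i => {q : Piece × OnePoint ℂ | (gHat i.2).symm q.2 ∈ regionHat i.1})
    fun i => (isClosed_regionHat i.1).preimage ((gHat i.2).symm.continuous.comp continuous_snd)

lemma gHat_succ_of_even {m : Fin 6} (hm : Even (m : ℕ)) (U : OnePoint ℂ) :
    gHat (m + 1) (gHat 1 U) = gHat m U := by
  induction U using OnePoint.rec with
  | infty => rfl
  | coe u => rw [gHat_coe, gHat_coe, gHat_coe, gmap_succ_of_even hm]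

lemma gHat_succ_of_odd {m : Fin 6} (hm : ¬ Even (m : ℕ)) (U : OnePoint ℂ) :
    gHat (m + 1) (gHat 5 U) = gHat m U := by
  induction U using OnePoint.rec with
  | infty => rfl
  | coe u => rw [gHat_coe, gHat_coe, gHat_coe, gmap_succ_of_odd hm]

lemma even_succ_iff (m : Fin 6) : Even ((m + 1 : Fin 6) : ℕ) ↔ ¬ Even (m : ℕ) := by revert m; decide

lemma gmap_ray_of_even {m : Fin 6} (hm : Even (m : ℕ)) (a : ℝ) :
    gmap m (a * zeta6) = a * zeta6 ^ ((m + 1 : Fin 6) : ℕ) := by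
  rw [gmap_even hm, zeta6_pow_add]
  change _ = _ * (_ * zeta6 ^ 1)
  ring

lemma gmap_ray_of_odd {m : Fin 6} (hm : ¬ Even (m : ℕ)) (a : ℝ) :
    gmap m a = a * zeta6 ^ ((m + 1 : Fin 6) : ℕ) := by
  rw [gmap_odd hm, zeta6_pow_add, conj_ofReal]
  change _ = _ * (_ * zeta6 ^ 1)
  ring

lemma pieceMap_eq_of_glue {x : ℝ} (hx : 0 < x) {p q : Piece} (h : Glue x p q) :
    pieceMap hx p = pieceMap hx q := by
  obtain ⟨hsec, hpt, h⟩ := h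
  set U := (gHat p.sec).symm (pieceMap hx p) with hU
  have hUm : U ∈ regionHat p.sheet := pieceMap_mem hx p
  have hV : pieceMap hx p = gHat p.sec U := by rw [hU, Homeomorph.apply_symm_apply]
  have hz : gHat p.sec (zHat x U) = p.pt := by rw [← zHat_gHat, ← hV, zHat_pieceMap]
  refine eq_pieceMap hx ?_ ((zHat_pieceMap hx p).trans hpt.symm)
  rw [hsec] at h ⊢
  have hinj : ∀ Q : OnePoint ℂ, p.pt = gHat p.sec Q → zHat x U = Q := fun Q hQ =>
    (gHat p.sec).injective (hz.trans hQ)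
  rcases h with ⟨he, ⟨a, ha, hax, hP⟩, hs⟩ | ⟨he, hP, hs⟩ | ⟨ho, hP, hs⟩
  · have hm := (even_succ_iff _).1 he
    rw [hV, ← gHat_succ_of_odd hm, Homeomorph.symm_apply_apply, hs]
    exact gHat_five_mem_of_inner hx hUm ha hax (hinj _ (by rw [gHat_coe, gmap_ray_of_odd hm, hP]))
  · have hm := (even_succ_iff _).1 he
    rw [hV, ← gHat_succ_of_odd hm, Homeomorph.symm_apply_apply, hs]
    refine gHat_five_mem_of_outer hx hUm ?_
    rcases hP with hP | ⟨a, ha, hP⟩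
    · exact Or.inl (hinj _ hP)
    · exact Or.inr ⟨a, ha, hinj _ (by rw [gHat_coe, gmap_ray_of_odd hm, hP])⟩
  · have hm : Even (p.sec : ℕ) := by
      by_contra hne
      exact (Nat.not_even_iff_odd.2 ho) ((even_succ_iff _).2 hne)
    rw [hV, ← gHat_succ_of_even hm, Homeomorph.symm_apply_apply, hs]
    refine gHat_one_mem hx hUm ?_
    rcases hP with hP | ⟨a, ha, hP⟩
    · exact Or.inl (hinj _ hP)
    · exact Or.inr ⟨a, ha, hinj _ (by rw [gHat_coe, gmap_ray_of_even hm, hP])⟩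

/-- The uniformising map. -/
def surfaceMap {x : ℝ} (hx : 0 < x) : Surface x → OnePoint ℂ :=
  Quot.lift (pieceMap hx) fun _ _ h => pieceMap_eq_of_glue hx h

lemma continuous_surfaceMap {x : ℝ} (hx : 0 < x) : Continuous (surfaceMap hx) :=
  continuous_quot_lift _ (continuous_pieceMap hx)

lemma zHat_surfaceMap {x : ℝ} (hx : 0 < x) (P : Surface x) : zHat x (surfaceMap hx P) = P.proj := by
  induction P using Quot.ind with
  | mk p => exact zHat_pieceMap hx p

lemma surjective_surfaceMap {x : ℝ} (hx : 0 < x) : Function.Surjective (surfaceMap hx) := by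
  intro V
  obtain ⟨m, hm⟩ := exists_mem_sector (zHat x V)
  obtain ⟨U, hV⟩ : ∃ U, V = gHat m U := ⟨_, ((gHat m).apply_symm_apply V).symm⟩
  have hz : zHat x V = gHat m (zHat x U) := by rw [hV, zHat_gHat]
  obtain ⟨k, hk⟩ : ∃ k, U ∈ regionHat k := by
    induction U using OnePoint.rec with
    | infty => exact ⟨0, infty_mem_regionHat.2 rfl⟩
    | coe u =>
      by_cases hu : u = 0
      · exact ⟨1, coe_mem_regionHat.2 (hu ▸ zero_mem_region (by decide))⟩
      · rw [zHat_coe hu, gHat_coe] at hz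
        rcases mem_sector_iff_gmap.1 hm with h | ⟨w, hw, h⟩
        · exact absurd (hz.symm.trans h) (coe_ne_infty _)
        · have : zC x u = w := (gHomeo m).injective (OnePoint.coe_injective (hz.symm.trans h))
          obtain ⟨k, hk⟩ := exists_mem_region hx hu (by rw [this]; exact hw)
          exact ⟨k, coe_mem_regionHat.2 hk⟩
  refine ⟨Surface.mk x ⟨(k, m, zHat x V), hm⟩, Eq.symm ?_⟩
  refine eq_pieceMap hx (p := ⟨(k, m, zHat x V), hm⟩) ?_ rfl
  change (gHat m).symm V ∈ regionHat k
  rw [hV, Homeomorph.symm_apply_apply]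
  exact hk

/-- The point of the surface over `P` in the sector of number `m` of the sheet of number `k`. -/
def mkS (x : ℝ) (k : Fin 3) (m : Fin 6) (P : OnePoint ℂ) (h : P ∈ sector m) : Surface x :=
  Surface.mk x ⟨(k, m, P), h⟩

lemma mkS_even {x : ℝ} {m : Fin 6} (hm : Even (m : ℕ)) {P : OnePoint ℂ} (h : P ∈ sector m)
    (h' : P ∈ sector (m + 1)) (hP : P ∈ outerRay 0 (m + 1)) (k : Fin 3) :
    mkS x k m P h = mkS x (Equiv.swap 1 2 k) (m + 1) P h' :=
  Quot.sound ⟨rfl, rfl, Or.inr (Or.inr ⟨Nat.not_even_iff_odd.1 fun he => (even_succ_iff m).1 he hm,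
    hP, rfl⟩)⟩

lemma mkS_inner {x : ℝ} {m : Fin 6} (hm : ¬ Even (m : ℕ)) {P : OnePoint ℂ} (h : P ∈ sector m)
    (h' : P ∈ sector (m + 1)) (hP : P ∈ innerRay x (m + 1)) (k : Fin 3) :
    mkS x k m P h = mkS x (Equiv.swap 0 1 k) (m + 1) P h' :=
  Quot.sound ⟨rfl, rfl, Or.inl ⟨(even_succ_iff m).2 hm, hP, rfl⟩⟩

lemma mkS_outer {x : ℝ} {m : Fin 6} (hm : ¬ Even (m : ℕ)) {P : OnePoint ℂ} (h : P ∈ sector m)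
    (h' : P ∈ sector (m + 1)) (hP : P ∈ outerRay x (m + 1)) (k : Fin 3) :
    mkS x k m P h = mkS x k (m + 1) P h' :=
  Quot.sound ⟨rfl, rfl, Or.inr (Or.inl ⟨(even_succ_iff m).2 hm, hP, rfl⟩)⟩

lemma mkS_succ (x : ℝ) {m : Fin 6} {P : OnePoint ℂ} (h : P ∈ sector m)
    (h' : P ∈ sector (m + 1)) (hP : P ∈ outerRay 0 (m + 1)) :
    ∃ σ : Equiv.Perm (Fin 3), ∀ k, mkS x k m P h = mkS x (σ k) (m + 1) P h' := by
  by_cases hm : Even (m : ℕ)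
  · exact ⟨_, mkS_even hm h h' hP⟩
  · rcases hP with rfl | ⟨a, ha, rfl⟩
    · exact ⟨Equiv.refl _, mkS_outer hm h h' (Or.inl rfl)⟩
    · rcases le_total a x with hax | hax
      · exact ⟨_, mkS_inner hm h h' ⟨a, ha, hax, rfl⟩⟩
      · exact ⟨Equiv.refl _, mkS_outer hm h h' (Or.inr ⟨a, hax, rfl⟩)⟩

lemma mkS_add (x : ℝ) {P : OnePoint ℂ} (hs : ∀ m, P ∈ sector m) (hP : ∀ m, P ∈ outerRay 0 m)
    (m : Fin 6) (n : ℕ) : ∀ m' : Fin 6, (m' : ℕ) = ((m : ℕ) + n) % 6 →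
      ∃ σ : Equiv.Perm (Fin 3), ∀ k, mkS x k m P (hs m) = mkS x (σ k) m' P (hs _) := by
  induction n with
  | zero =>
    intro m' hm'
    obtain rfl : m' = m := Fin.ext (by omega)
    exact ⟨Equiv.refl _, fun k => rfl⟩
  | succ n ih =>
    intro m' hm'
    obtain ⟨σ, hσ⟩ := ih ⟨((m : ℕ) + n) % 6, Nat.mod_lt _ (by norm_num)⟩ rfl
    obtain ⟨τ, hτ⟩ := mkS_succ x (hs ⟨((m : ℕ) + n) % 6, Nat.mod_lt _ (by norm_num)⟩) (hs _) (hP _)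
    have : m' = ⟨((m : ℕ) + n) % 6, Nat.mod_lt _ (by norm_num)⟩ + 1 := by
      refine Fin.ext ?_
      rw [hm', Fin.val_add]
      change _ = (((m : ℕ) + n) % 6 + 1) % 6
      omega
    subst this
    exact ⟨σ.trans τ, fun k => (hσ k).trans (hτ (σ k))⟩

lemma fin_six_sub (m m' : Fin 6) : m' = m + (m' - m) := by revert m m'; decide

lemma fin_six_five (m : Fin 6) : m + 5 + 1 = m := by revert m; decide

lemma mkS_move (x : ℝ) {m m' : Fin 6} {P : OnePoint ℂ} (h : P ∈ sector m) (h' : P ∈ sector m') :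
    ∃ σ : Equiv.Perm (Fin 3), ∀ k, mkS x k m P h = mkS x (σ k) m' P h' := by
  obtain ⟨d, rfl⟩ : ∃ d, m' = m + d := ⟨m' - m, fin_six_sub m m'⟩
  have hall : (∀ m, P ∈ sector m) → (∀ m, P ∈ outerRay 0 m) →
      ∃ σ : Equiv.Perm (Fin 3), ∀ k, mkS x k m P h = mkS x (σ k) (m + d) P h' := fun h1 h2 =>
    mkS_add x h1 h2 m (d : ℕ) _ (Fin.val_add m d)
  induction P using OnePoint.rec with
  | infty => exact hall (fun _ => Or.inl rfl) fun _ => Or.inl rfl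
  | coe w =>
    rcases sector_inter h h' with rfl | rfl | ⟨rfl, a, ha, hw⟩ | ⟨rfl, a, ha, hw⟩
    · exact hall (fun _ => Or.inr ⟨0, 0, le_rfl, le_rfl, by simp⟩)
        fun _ => Or.inr ⟨0, le_rfl, by simp⟩
    · refine ⟨Equiv.refl _, fun k => ?_⟩
      congr 1; simp
    · exact mkS_succ x h h' (Or.inr ⟨a, ha, by rw [hw]⟩)
    · have e := fin_six_five m
      obtain ⟨σ, hσ⟩ := mkS_succ x h' (by rw [e]; exact h) (Or.inr ⟨a, ha, by rw [e, hw]⟩)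
      refine ⟨σ.symm, fun k => ?_⟩
      have := hσ (σ.symm k)
      rw [this, Equiv.apply_symm_apply]
      simp only [e]

lemma mkS_infty (x : ℝ) (m : Fin 6) (h : infty ∈ sector m) :
    mkS x 1 m infty h = mkS x 2 m infty h := by
  have hs : ∀ m, infty ∈ sector m := fun _ => Or.inl rfl
  have even : ∀ {m : Fin 6}, Even (m : ℕ) → ∀ k, mkS x k m infty (hs m) =
      mkS x (Equiv.swap 1 2 k) (m + 1) infty (hs _) := fun hm k =>
    mkS_even hm _ _ (Or.inl rfl) k
  have odd : ∀ {m : Fin 6}, ¬ Even (m : ℕ) → ∀ k, mkS x k m infty (hs m) =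
      mkS x k (m + 1) infty (hs _) := fun hm k =>
    mkS_outer hm _ _ (Or.inl rfl) k
  have q0 : mkS x 1 0 infty (hs 0) = mkS x 2 0 infty (hs 0) :=
    (even (m := 0) (by decide) 1).trans <| (odd (m := 1) (by decide) 2).trans <|
    (even (m := 2) (by decide) 2).trans <| (odd (m := 3) (by decide) 1).trans <|
    (even (m := 4) (by decide) 1).trans <| odd (m := 5) (by decide) 2
  have step : ∀ m, mkS x 1 m infty (hs m) = mkS x 2 m infty (hs m) →
      mkS x 1 (m + 1) infty (hs _) = mkS x 2 (m + 1) infty (hs _) := by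
    intro m hq
    by_cases hm : Even (m : ℕ)
    · exact (even hm 2).symm.trans (hq.symm.trans (even hm 1))
    · exact (odd hm 1).symm.trans (hq.trans (odd hm 2))
  have q1 := step 0 q0
  have q2 := step 1 q1
  have q3 := step 2 q2
  have q4 := step 3 q3
  fin_cases m
  exacts [q0, q1, q2, q3, q4, step 4 q4]

lemma mkS_critical {x : ℝ} (hx : 0 < x) (m : Fin 6) (h : gHat m ((x : ℂ) : OnePoint ℂ) ∈ sector m)
    (k : Fin 3) : mkS x k m _ h = mkS x (Equiv.swap 0 1 k) m _ h := by
  by_cases hm : Even (m : ℕ)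
  · obtain ⟨n, hn⟩ : ∃ n : Fin 6, m = n + 1 := ⟨m + 5, (fin_six_five m).symm⟩
    subst hn
    have hm' := (even_succ_iff n).1 hm
    have hP : gHat (n + 1) ((x : ℂ) : OnePoint ℂ) =
        ((x * zeta6 ^ ((n + 1 : Fin 6) : ℕ) : ℂ) : OnePoint ℂ) := by
      rw [gHat_coe, gmap_even hm, mul_comm]
    have hin : gHat (n + 1) ((x : ℂ) : OnePoint ℂ) ∈ innerRay x (n + 1) := ⟨x, hx.le, le_rfl, hP⟩
    have hout : gHat (n + 1) ((x : ℂ) : OnePoint ℂ) ∈ outerRay x (n + 1) := Or.inr ⟨x, le_rfl, hP⟩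
    have hsec : gHat (n + 1) ((x : ℂ) : OnePoint ℂ) ∈ sector n := by
      rw [hP, mem_sector_iff_gmap]
      exact Or.inr ⟨x, mem_sectorC_iff.2 ⟨x, 0, hx.le, le_rfl, by simp⟩, by
        rw [gmap_ray_of_odd hm']⟩
    exact (mkS_outer hm' hsec h hout k).symm.trans (mkS_inner hm' hsec h hin k)
  · have hP : gHat m ((x : ℂ) : OnePoint ℂ) =
        ((x * zeta6 ^ ((m + 1 : Fin 6) : ℕ) : ℂ) : OnePoint ℂ) := by
      rw [gHat_coe, gmap_ray_of_odd hm]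
    have hin : gHat m ((x : ℂ) : OnePoint ℂ) ∈ innerRay x (m + 1) := ⟨x, hx.le, le_rfl, hP⟩
    have hout : gHat m ((x : ℂ) : OnePoint ℂ) ∈ outerRay x (m + 1) := Or.inr ⟨x, le_rfl, hP⟩
    have hsec : gHat m ((x : ℂ) : OnePoint ℂ) ∈ sector (m + 1) := by
      rw [hP]
      exact Or.inr ⟨x, 0, hx.le, le_rfl, by simp⟩
    have h1 := mkS_inner hm h hsec hin (Equiv.swap 0 1 k)
    rw [Equiv.swap_apply_self] at h1
    exact (mkS_outer hm h hsec hout k).trans h1.symm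

lemma injective_surfaceMap {x : ℝ} (hx : 0 < x) : Injective (surfaceMap hx) := by
  rintro ⟨p⟩ ⟨q⟩ hpq
  have hpq : pieceMap hx p = pieceMap hx q := hpq
  have hpt : p.pt = q.pt := by rw [← zHat_pieceMap hx p, hpq, zHat_pieceMap]
  obtain ⟨⟨k', m', P⟩, hp⟩ := p
  obtain ⟨⟨k, m, P'⟩, hq⟩ := q
  have hpt : P = P' := hpt
  subst hpt
  obtain ⟨σ, hσ⟩ := mkS_move x hp hq
  -- move to the same sector
  have h1 : pieceMap hx ⟨(k', m', P), hp⟩ = pieceMap hx ⟨(σ k', m, P), hq⟩ :=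
    congrArg (surfaceMap hx) (hσ k')
  change mkS x k' m' P hp = mkS x k m P hq
  rw [hσ k']
  generalize σ k' = j at *
  rw [h1] at hpq
  have m1 := pieceMap_mem hx ⟨(j, m, P), hq⟩
  have m2 := pieceMap_mem hx ⟨(k, m, P), hq⟩
  have hz := zHat_pieceMap hx ⟨(j, m, P), hq⟩
  rw [← hpq] at m2
  generalize pieceMap hx ⟨(j, m, P), hq⟩ = V at *
  change (gHat m).symm V ∈ regionHat j at m1
  change (gHat m).symm V ∈ regionHat k at m2
  change zHat x V = P at hz
  obtain ⟨U, rfl⟩ := (gHat m).surjective V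
  rw [Homeomorph.symm_apply_apply] at m1 m2
  rw [zHat_gHat] at hz
  induction U using OnePoint.rec with
  | infty => rw [infty_mem_regionHat.1 m1, infty_mem_regionHat.1 m2]
  | coe u =>
    rw [coe_mem_regionHat] at m1 m2
    rcases region_inter m1 m2 with rfl | ⟨rfl, h1, h2⟩ | ⟨rfl, h1, h2⟩
    · rfl
    · have e : zHat x ((1 : ℂ) : OnePoint ℂ) = ((x : ℂ) : OnePoint ℂ) := by
        rw [zHat_coe one_ne_zero]
        refine congrArg _ ?_
        unfold zC; norm_num
      rw [e] at hz
      subst hz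
      have := mkS_critical hx m hq
      fin_cases j <;> fin_cases k
      exacts [rfl, this 0, absurd rfl h2, this 1, rfl, absurd rfl h2, absurd rfl h1,
        absurd rfl h1, rfl]
    · rw [zHat_zero, gHat_infty] at hz
      subst hz
      have := mkS_infty x m hq
      fin_cases j <;> fin_cases k
      exacts [rfl, absurd rfl h1, absurd rfl h1, absurd rfl h2, rfl, this, absurd rfl h2, this.symm,
        rfl]

/-- The surface is homeomorphic to the sphere. -/
def surfaceHomeo {x : ℝ} (hx : 0 < x) : Surface x ≃ₜ OnePoint ℂ :=
  Continuous.homeoOfEquivCompactToT2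
    (f := Equiv.ofBijective (surfaceMap hx) ⟨injective_surfaceMap hx, surjective_surfaceMap hx⟩)
    (continuous_surfaceMap hx)

lemma surfaceHomeo_mk {x : ℝ} (hx : 0 < x) (p : Piece) :
    surfaceHomeo hx (Surface.mk x p) = pieceMap hx p := rfl

lemma proj_surfaceHomeo_symm {x : ℝ} (hx : 0 < x) (V : OnePoint ℂ) :
    ((surfaceHomeo hx).symm V).proj = zHat x V := by
  rw [← zHat_surfaceMap hx]
  exact congrArg _ ((surfaceHomeo hx).apply_symm_apply V)

/-- A homeomorphism of the surface onto the sphere gives a chart. -/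
def sphereChart {x : ℝ} (Φ : Surface x ≃ₜ OnePoint ℂ) : OpenPartialHomeomorph (Surface x) ℂ :=
  Φ.toOpenPartialHomeomorph.trans
    (OnePoint.isOpenEmbedding_coe.toOpenPartialHomeomorph ((↑) : ℂ → OnePoint ℂ)).symm

lemma sphereChart_symm_apply {x : ℝ} (Φ : Surface x ≃ₜ OnePoint ℂ) (u : ℂ) :
    (sphereChart Φ).symm u = Φ.symm (u : OnePoint ℂ) := rfl

lemma mem_sphereChart_source {x : ℝ} (Φ : Surface x ≃ₜ OnePoint ℂ) {P : Surface x} {u : ℂ}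
    (h : Φ P = (u : OnePoint ℂ)) : P ∈ (sphereChart Φ).source := by
  unfold sphereChart
  rw [OpenPartialHomeomorph.trans_source]
  refine ⟨trivial, ?_⟩
  rw [OpenPartialHomeomorph.symm_source]
  exact ⟨u, trivial, h.symm⟩

theorem isMeromorphicOnSurface_xiHat {x : ℝ} (hx : 0 < x) {κ g : ℂ} (hκ : κ ≠ 0) (hg : g ≠ 0) :
    IsMeromorphicOnSurface fun P => xiHat κ g (surfaceHomeo hx P) := by
  refine ⟨⟨(surfaceHomeo hx).symm ((1 : ℂ) : OnePoint ℂ), ?_⟩, fun P => ?_⟩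
  · change xiHat κ g (surfaceHomeo hx _) ≠ _
    rw [Homeomorph.apply_symm_apply, xiHat_coe one_ne_zero]
    exact coe_ne_infty _
  · by_cases h : surfaceHomeo hx P = infty
    · refine ⟨sphereChart ((surfaceHomeo hx).trans sInvHomeo), mem_sphereChart_source _ (u := 0) ?_,
        fun w _ => ?_, ?_⟩
      · change sInv (surfaceHomeo hx P) = _
        rw [h, sInv_infty]
      · simp only [sphereChart_symm_apply]
        change SphereHolAt (fun u => ((surfaceHomeo hx).symm (sInv (u : OnePoint ℂ))).proj) w
        simp only [proj_surfaceHomeo_symm, sInv_coe]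
        exact sphereHolAt_zHat_inv hx w
      · simp only [sphereChart_symm_apply]
        change SphereHolAt (fun u => xiHat κ g (surfaceHomeo hx ((surfaceHomeo hx).symm
          (sInv (u : OnePoint ℂ))))) _
        simp only [Homeomorph.apply_symm_apply, sInv_coe]
        exact sphereHolAt_xiHat_inv hκ hg _
    · obtain ⟨u, hu⟩ := OnePoint.ne_infty_iff_exists.1 h
      refine ⟨sphereChart (surfaceHomeo hx), mem_sphereChart_source _ hu.symm, fun w _ => ?_, ?_⟩
      · simp only [sphereChart_symm_apply, proj_surfaceHomeo_symm]
        exact sphereHolAt_zHat hx w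
      · simp only [sphereChart_symm_apply, Homeomorph.apply_symm_apply]
        exact sphereHolAt_xiHat hκ g _

lemma xiHat_eq_infty_iff {x : ℝ} (hx : 0 < x) (κ g : ℂ) (P : Surface x) :
    xiHat κ g (surfaceHomeo hx P) = infty ↔ P.proj = infty := by
  rw [← (surfaceHomeo hx).symm_apply_apply P, proj_surfaceHomeo_symm, Homeomorph.apply_symm_apply]
  generalize surfaceHomeo hx P = V
  induction V using OnePoint.rec with
  | infty => simp [xiHat]
  | coe u =>
    by_cases hu : u = 0
    · subst hu
      simp [xiHat, zHat_zero]
    · rw [xiHat_coe hu, zHat_coe hu]; simp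

/-! ### The spectral curve and its rational uniformization -/

/-- The coefficients of the spectral curve are given by the parameter `γ` of its rational
uniformization `u ↦ (γ² / t₃ (2 u + u⁻²), γ / t₃ (u⁻¹ + 4 γ³ u²))`; the curve has its nodes over
the points `ω ^ j y`. -/
structure IsCurveParam (t0 t3 x y A γ : ℝ) : Prop where
  t0_pos : 0 < t0
  t3_pos : 0 < t3
  pos : 0 < γ
  t0_eq : t0 = (2 * γ ^ 3 - 8 * γ ^ 6) / t3 ^ 2
  x_eq : x = 3 * γ ^ 2 / t3
  y_eq : y = (1 - 2 * γ ^ 3) / t3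
  A_eq : A = 2 * γ ^ 3 * (1 - 2 * γ ^ 3) ^ 3 / t3 ^ 3

lemma eval_spectralPoly (t0 t3 A : ℝ) (z ξ : ℂ) : (spectralPoly t0 t3 A z).eval ξ =
    ξ ^ 3 - t3 * z ^ 2 * ξ ^ 2 - ((t0 * t3 + 1 / t3 : ℝ) : ℂ) * z * ξ + (z ^ 3 + A) := by
  simp [spectralPoly]

lemma spectralPoly_eq_prod_iff {t0 t3 A : ℝ} {z : ℂ} {r : Fin 3 → ℂ} :
    spectralPoly t0 t3 A z = ∏ i, (X - C (r i)) ↔ r 0 + r 1 + r 2 = t3 * z ^ 2 ∧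
      r 0 * r 1 + r 0 * r 2 + r 1 * r 2 = -(((t0 * t3 + 1 / t3 : ℝ) : ℂ) * z) ∧
      r 0 * r 1 * r 2 = -(z ^ 3 + A) := by
  have key (y : ℂ) : (∏ i, (X - C (r i))).eval y = (y - r 0) * (y - r 1) * (y - r 2) := by
    simp [Fin.prod_univ_three]
  constructor
  · intro h
    have e (y : ℂ) := (eval_spectralPoly t0 t3 A z y).symm.trans ((congrArg (eval y) h).trans (key y))
    refine ⟨?_, ?_, ?_⟩
    · linear_combination e 1 / 2 + e (-1) / 2 - e 0
    · linear_combination e (-1) / 2 - e 1 / 2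
    · linear_combination e 0
  · rintro ⟨h1, h2, h3⟩
    refine Polynomial.funext fun y => ?_
    rw [eval_spectralPoly, key]
    linear_combination y ^ 2 * h1 - y * h2 + h3

lemma discr_spectralPoly (t0 t3 A : ℝ) (z : ℂ) : (spectralPoly t0 t3 A z).discr =
    (t3 * z ^ 2) ^ 2 * (((t0 * t3 + 1 / t3 : ℝ) : ℂ) * z) ^ 2 +
      4 * (((t0 * t3 + 1 / t3 : ℝ) : ℂ) * z) ^ 3 + 4 * (t3 * z ^ 2) ^ 3 * (z ^ 3 + A) -
      27 * (z ^ 3 + A) ^ 2 +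
      18 * (t3 * z ^ 2) * (((t0 * t3 + 1 / t3 : ℝ) : ℂ) * z) * (z ^ 3 + A) := by
  have h : spectralPoly t0 t3 A z = C 1 * X ^ 3 + C (-(t3 * z ^ 2)) * X ^ 2 +
      C (-(((t0 * t3 + 1 / t3 : ℝ) : ℂ) * z)) * X + C (z ^ 3 + A) := by
    simp only [spectralPoly, C_neg, C_1]; ring
  rw [h, discr_of_degree_eq_three (degree_cubic one_ne_zero), ← h]
  simp only [h, coeff_add, coeff_C_mul, coeff_X_pow, coeff_X, coeff_C]; norm_num; ring

lemma discr_eq_of_roots {t0 t3 A : ℝ} {z : ℂ} {r : Fin 3 → ℂ}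
    (h : spectralPoly t0 t3 A z = ∏ i, (X - C (r i))) : (spectralPoly t0 t3 A z).discr =
      ((r 0 - r 1) * (r 0 - r 2) * (r 1 - r 2)) ^ 2 := by
  obtain ⟨h1, h2, h3⟩ := spectralPoly_eq_prod_iff.1 h
  rw [discr_spectralPoly, ← h1, ← neg_eq_iff_eq_neg.2 h2, ← neg_eq_iff_eq_neg.2 h3]; ring

lemma injective_of_discr_ne_zero {t0 t3 A : ℝ} {z : ℂ} {r : Fin 3 → ℂ}
    (h : spectralPoly t0 t3 A z = ∏ i, (X - C (r i))) (h0 : (spectralPoly t0 t3 A z).discr ≠ 0) :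
    Injective r := by
  rw [discr_eq_of_roots h, ne_eq, sq_eq_zero_iff, mul_eq_zero, mul_eq_zero, sub_eq_zero,
    sub_eq_zero, sub_eq_zero] at h0
  push Not at h0
  obtain ⟨⟨h1, h2⟩, h3⟩ := h0
  intro i j hij
  fin_cases i <;> fin_cases j <;> first | rfl | exact absurd hij ‹_› | exact absurd hij.symm ‹_›

/-- Three distinct preimages of a point under `u ↦ x / 3 (2 u + u⁻²)` are the roots of
`2 u³ - (3 w / x) u² + 1`. -/
lemma zC_vieta {x : ℝ} (hx : 0 < x) {w : ℂ} {s : Fin 3 → ℂ} (h0 : ∀ i, s i ≠ 0)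
    (hs : ∀ i, zC x (s i) = w) (hi : Injective s) :
    s 0 + s 1 + s 2 = 3 * w / (2 * x) ∧ s 0 * s 1 + s 0 * s 2 + s 1 * s 2 = 0 ∧
      s 0 * s 1 * s 2 = -1 / 2 := by
  have key (i j : Fin 3) (h : i ≠ j) := two_mul_sq_mul_sq hx (h0 i) (h0 j)
    ((hs i).trans (hs j).symm) (hi.ne h)
  have h01 := key 0 1 (by decide)
  have h02 := key 0 2 (by decide)
  have h12 := key 1 2 (by decide)
  have n (i j : Fin 3) (h : i ≠ j) : s i - s j ≠ 0 := sub_ne_zero.2 (hi.ne h)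
  have a0 : 2 * s 0 ^ 2 * (s 1 + s 2) = 1 :=
    mul_right_cancel₀ (n 1 2 (by decide)) (by linear_combination h01 - h02)
  have a1 : 2 * s 1 ^ 2 * (s 0 + s 2) = 1 :=
    mul_right_cancel₀ (n 0 2 (by decide)) (by linear_combination h01 - h12)
  have e2 : s 0 * s 1 + s 0 * s 2 + s 1 * s 2 = 0 :=
    mul_right_cancel₀ (n 0 1 (by decide)) (by linear_combination (a0 - a1) / 2)
  refine ⟨?_, e2, by linear_combination s 0 * e2 - a0 / 2⟩
  have : (x : ℂ) ≠ 0 := by exact_mod_cast hx.ne'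
  have hz := hs 0
  rw [zC, inv_eq_of_mul_eq_one_right (b := 2 * (s 1 + s 2)) (by linear_combination a0)] at hz
  rw [← hz]; field_simp; ring

namespace IsCurveParam
variable {t0 t3 x y A γ : ℝ}

lemma x_pos (h : IsCurveParam t0 t3 x y A γ) : 0 < x := by
  rw [h.x_eq]; have := h.t3_pos; have := h.pos; positivity

lemma sqrt_eq (h : IsCurveParam t0 t3 x y A γ) (hle : 8 * γ ^ 3 ≤ 1) :
    √(1 - 8 * t0 * t3 ^ 2) = 1 - 8 * γ ^ 3 := by
  have := h.t3_pos
  rw [← Real.sqrt_sq (sub_nonneg.2 hle), h.t0_eq]; congr 1; field_simp; ring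

lemma eq_xHat (h : IsCurveParam t0 t3 x y A γ) (hle : 8 * γ ^ 3 ≤ 1) : y = xHat t0 t3 := by
  have := h.t3_pos
  rw [h.y_eq, xHat, h.sqrt_eq hle]; field_simp; ring

lemma eq_constA (h : IsCurveParam t0 t3 x y A γ) (hle : 8 * γ ^ 3 ≤ 1) : A = constA t0 t3 := by
  have := h.t3_pos
  have h1 : 1 - 8 * t0 * t3 ^ 2 = (1 - 8 * γ ^ 3) ^ (2 : ℝ) := by
    rw [h.t0_eq, Real.rpow_two]; field_simp; ring
  rw [h.A_eq, constA, h1, ← rpow_mul (sub_nonneg.2 hle), show (2 : ℝ) * (3 / 2) = (3 : ℕ) by norm_num,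
    rpow_natCast, h.t0_eq]
  field_simp; ring

lemma eq_xStar (h : IsCurveParam t0 t3 x y A γ) (hle : 8 * γ ^ 3 ≤ 1) : x = xStar t0 t3 := by
  have := h.t3_pos
  rw [xStar, h.sqrt_eq hle, h.x_eq, show 1 - (1 - 8 * γ ^ 3) = (2 * γ) ^ (3 : ℝ) by norm_cast; ring,
    ← rpow_mul (by linarith [h.pos]), show (3 : ℝ) * (2 / 3) = (2 : ℕ) by norm_num,
    rpow_natCast]
  field_simp; ring

lemma le_crit (h : IsCurveParam t0 t3 x y A γ) : t0 ≤ 1 / (8 * t3 ^ 2) := by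
  have := h.t3_pos
  rw [h.t0_eq, div_le_div_iff₀ (by positivity) (by positivity)]
  nlinarith [mul_nonneg (sq_nonneg (8 * γ ^ 3 - 1)) (sq_nonneg t3)]

lemma eq_crit_iff (h : IsCurveParam t0 t3 x y A γ) : t0 = 1 / (8 * t3 ^ 2) ↔ 8 * γ ^ 3 = 1 := by
  have := h.t3_pos
  rw [h.t0_eq, div_eq_div_iff (by positivity) (by positivity)]
  refine ⟨fun e => ?_, fun e => ?_⟩
  · have : t3 ^ 2 * (8 * γ ^ 3 - 1) ^ 2 = 0 := by linear_combination -e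
    rcases mul_eq_zero.1 this with h0 | h0
    · exact absurd h0 (by positivity)
    · linarith [pow_eq_zero_iff (two_ne_zero) |>.1 h0]
  · linear_combination -t3 ^ 2 * (8 * γ ^ 3 - 1) * e

lemma x_le (h : IsCurveParam t0 t3 x y A γ) (hle : 8 * γ ^ 3 ≤ 1) : x ≤ y := by
  have h1 : γ ≤ 1 / 2 := by
    by_contra! hc
    have := pow_lt_pow_left₀ hc (by norm_num) (three_ne_zero)
    linarith
  rw [h.y_eq, h.x_eq, div_le_div_iff_of_pos_right h.t3_pos]
  nlinarith [mul_nonneg (sq_nonneg (γ + 1)) (sub_nonneg.2 h1)]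

lemma x_eq_iff (h : IsCurveParam t0 t3 x y A γ) : x = y ↔ 8 * γ ^ 3 = 1 := by
  rw [h.y_eq, h.x_eq, div_left_inj' h.t3_pos.ne']
  refine ⟨fun e => ?_, fun e => ?_⟩
  · have : (γ + 1) ^ 2 * (2 * γ - 1) = 0 := by linear_combination e
    rcases mul_eq_zero.1 this with h0 | h0
    · have := h.pos; exact absurd h0 (by positivity)
    · rw [show γ = 1 / 2 by linarith]; norm_num
  · have : (2 * γ - 1) * (4 * γ ^ 2 + 2 * γ + 1) = 0 := by linear_combination e
    rcases mul_eq_zero.1 this with h0 | h0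
    · rw [show γ = 1 / 2 by linarith]; norm_num
    · have := h.pos; exact absurd h0 (by positivity)

lemma y_pos (h : IsCurveParam t0 t3 x y A γ) : 0 < y := by
  have := h.t3_pos
  have h1 := pow_pos h.pos 3
  have h2 := h.t0_eq ▸ h.t0_pos
  rw [div_pos_iff_of_pos_right (by positivity)] at h2
  rw [h.y_eq]
  exact div_pos (by nlinarith) this

lemma t3_ne (h : IsCurveParam t0 t3 x y A γ) : (t3 : ℂ) ≠ 0 := by exact_mod_cast h.t3_pos.ne'

lemma coeff_eq (h : IsCurveParam t0 t3 x y A γ) :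
    ((t0 * t3 + 1 / t3 : ℝ) : ℂ) = (1 + 2 * γ ^ 3 - 8 * γ ^ 6) / t3 := by
  have := h.t3_ne
  rw [h.t0_eq]; push_cast; field_simp; ring

lemma A_coe (h : IsCurveParam t0 t3 x y A γ) :
    (A : ℂ) = 2 * γ ^ 3 * (1 - 2 * γ ^ 3) ^ 3 / t3 ^ 3 := by
  rw [h.A_eq]; push_cast; rfl

lemma discr_eq (h : IsCurveParam t0 t3 x y A γ) (z : ℂ) : (spectralPoly t0 t3 A z).discr =
      4 * t3 ^ 3 * ((z ^ 3 - x ^ 3) * (z ^ 3 - y ^ 3) ^ 2) := by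
  have := h.t3_ne
  rw [discr_spectralPoly, h.coeff_eq, h.A_coe, h.y_eq, h.x_eq]; push_cast; field_simp; ring

/-- The solutions `ξ` of the spectral curve over `z = zC x u` are the values of the second
coordinate of the uniformization. -/
lemma spectralPoly_eq_prod (h : IsCurveParam t0 t3 x y A γ) {w : ℂ} {s : Fin 3 → ℂ}
    (h1 : s 0 + s 1 + s 2 = 3 * w / (2 * x)) (h2 : s 0 * s 1 + s 0 * s 2 + s 1 * s 2 = 0)
    (h3 : s 0 * s 1 * s 2 = -1 / 2) : spectralPoly t0 t3 A w =
      ∏ i, (X - C (γ / t3 * ((s i)⁻¹ + 4 * γ ^ 3 * s i ^ 2))) := by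
  have := h.t3_ne
  have : (γ : ℂ) ≠ 0 := by exact_mod_cast h.pos.ne'
  have hw : w = 2 * γ ^ 2 / t3 * (s 0 + s 1 + s 2) := by rw [h1, h.x_eq]; push_cast; field_simp
  have i0 : (s 0)⁻¹ = -2 * (s 1 * s 2) := inv_eq_of_mul_eq_one_right (by linear_combination -2 * h3)
  have i1 : (s 1)⁻¹ = -2 * (s 0 * s 2) := inv_eq_of_mul_eq_one_right (by linear_combination -2 * h3)
  have i2 : (s 2)⁻¹ = -2 * (s 0 * s 1) := inv_eq_of_mul_eq_one_right (by linear_combination -2 * h3)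
  rw [spectralPoly_eq_prod_iff, i0, i1, i2, h.coeff_eq, h.A_coe, hw]
  generalize s 0 = a, s 1 = b, s 2 = c at h2 h3
  clear h1 hw i0 i1 i2
  refine ⟨?_, ?_, ?_⟩
  · field_simp
    linear_combination (-2 - 8 * γ ^ 3) * h2
  · linear_combination (γ / t3 : ℂ) ^ 2 * ((-8 * γ ^ 3 * (a ^ 2 + b ^ 2 + c ^ 2) +
      16 * γ ^ 6 * (a * b + a * c + b * c)) * h2 + (4 + 8 * γ ^ 3 - 32 * γ ^ 6) * (a + b + c) * h3)
  · linear_combination (γ / t3 : ℂ) ^ 3 * ((-48 * γ ^ 3 * (a + b + c) * (a * b * c) -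
      32 * γ ^ 6 * ((a * b + a * c + b * c) ^ 2 - 3 * (a + b + c) * (a * b * c))) * h2 +
      (16 * γ ^ 3 * (a + b + c) ^ 3 + (a * b * c - 1 / 2) *
        (-8 + 48 * γ ^ 3 - 96 * γ ^ 6 + 64 * γ ^ 9)) * h3)
end IsCurveParam

lemma cube_eq_iff {z : ℂ} {r : ℝ} :
    z ^ 3 = r ^ 3 ↔ ∃ j : Fin 3, z = omega ^ (j : ℕ) * r := by
  constructor
  · intro h
    have := prod_sub_omega z r
    rw [h, sub_self, mul_eq_zero, mul_eq_zero, sub_eq_zero, sub_eq_zero, sub_eq_zero] at this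
    rcases this with (h | h) | h
    · exact ⟨0, by simpa using h⟩
    · exact ⟨1, by simpa using h⟩
    · exact ⟨2, by simpa using h⟩
  · rintro ⟨j, rfl⟩
    rw [mul_pow, omega_pow_cube, one_mul]

/-- The preimages `s` of a point that is not a critical value of `zC` depend analytically on the
point. -/
lemma exists_analytic_zC_section {x : ℝ} (hx : 0 < x) {s : ℂ} (hs : s ≠ 0)
    (h : zC x s ^ 3 ≠ x ^ 3) : ∃ φ : ℂ → ℂ, AnalyticAt ℂ φ (zC x s) ∧ φ (zC x s) = s ∧
      ∀ᶠ z in 𝓝 (zC x s), zC x (φ z) = z := by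
  have ha : AnalyticAt ℂ (zC x) s := by
    unfold zC
    exact analyticAt_const.mul ((by fun_prop : AnalyticAt ℂ (fun u : ℂ => 2 * u) s).add
      (AnalyticAt.inv (by fun_prop) (pow_ne_zero 2 hs)))
  have hd : HasDerivAt (zC x) (x / 3 * (2 * 1 + -(2 * s) / (s ^ 2) ^ 2)) s :=
    (((hasDerivAt_id s).const_mul 2).add
      (((hasDerivAt_pow 2 s).inv (pow_ne_zero 2 hs)).congr_deriv (by simp))).const_mul _
  have hd' : deriv (zC x) s ≠ 0 := by
    rw [hd.deriv]
    intro h0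
    have hx' : (x : ℂ) ≠ 0 := by exact_mod_cast hx.ne'
    field_simp at h0
    have h1 : s ^ 3 = 1 := mul_left_cancel₀ hx' (by linear_combination h0 / 2)
    refine h ?_
    rw [zC, show (s ^ 2)⁻¹ = s from inv_eq_of_mul_eq_one_right (by linear_combination h1)]
    linear_combination x ^ 3 * h1
  exact ⟨_, ha.analyticAt_localInverse hd', HasStrictFDerivAt.localInverse_apply_image ..,
    HasStrictDerivAt.eventually_right_inverse ..⟩

namespace IsCurveParam
variable {t0 t3 x y A γ : ℝ}

lemma discr_eq_zero_iff (h : IsCurveParam t0 t3 x y A γ) (z : ℂ) :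
    (spectralPoly t0 t3 A z).discr = 0 ↔
      ∃ j : Fin 3, z = omega ^ (j : ℕ) * x ∨ z = omega ^ (j : ℕ) * y := by
  rw [h.discr_eq, mul_eq_zero, or_iff_right (by simpa using h.t3_ne),
    mul_eq_zero, sq_eq_zero_iff, sub_eq_zero, sub_eq_zero, cube_eq_iff, cube_eq_iff, exists_or]

lemma isBranchPoint_iff (h : IsCurveParam t0 t3 x y A γ) (z : ℂ) :
    IsBranchPoint (spectralPoly t0 t3 A) z ↔
      ∃ j : Fin 3, z = omega ^ (j : ℕ) * x := by
  rw [← cube_eq_iff, IsBranchPoint, ← not_iff_not, not_not]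
  have hx := h.x_pos
  constructor
  · rintro ⟨g, hg, hP⟩ hz
    -- the discriminant is a square near `z`, but vanishes there to an odd order
    have e : (fun w => ((g 0 w - g 1 w) * (g 0 w - g 2 w) * (g 1 w - g 2 w))) ^ 2 =ᶠ[𝓝 z]
        (fun _ => (4 * t3 ^ 3 : ℂ)) * ((fun w => w ^ 3 - z ^ 3) *
          (fun w => w ^ 3 - (y : ℂ) ^ 3) ^ 2) := by
      filter_upwards [hP] with w hw
      have := discr_eq_of_roots hw
      rw [h.discr_eq, ← hz] at this
      exact this.symm
    have hz0 : z ≠ 0 := by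
      rintro rfl
      exact pow_ne_zero 3 (Complex.ofReal_ne_zero.2 hx.ne') (by simpa using hz.symm)
    have a1 : AnalyticAt ℂ (fun w => w ^ 3 - z ^ 3) z := by fun_prop
    have a2 : AnalyticAt ℂ (fun w => w ^ 3 - (y : ℂ) ^ 3) z := by fun_prop
    have a3 : AnalyticAt ℂ (fun _ => (4 * t3 ^ 3 : ℂ)) z := analyticAt_const
    have o1 : analyticOrderAt (fun w => w ^ 3 - z ^ 3) z = 1 :=
      AnalyticAt.analyticOrderAt_sub_eq_one_of_deriv_ne_zero (f := fun w => w ^ 3) (by fun_prop)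
        (by simpa using hz0)
    have o3 : analyticOrderAt (fun _ => (4 * t3 ^ 3 : ℂ)) z = 0 :=
      a3.analyticOrderAt_eq_zero.2 (by simpa using h.t3_pos.ne')
    have o2 : analyticOrderAt (fun w => w ^ 3 - (y : ℂ) ^ 3) z ≠ ⊤ := by
      intro ht
      rw [analyticOrderAt_eq_top] at ht
      have hd : deriv (fun w => w ^ 3 - (y : ℂ) ^ 3) z = 0 := by
        rw [EventuallyEq.deriv_eq (f := fun _ => 0) ht, deriv_const]
      simp [hz0] at hd
    have := analyticOrderAt_congr e
    rw [analyticOrderAt_pow (by fun_prop), analyticOrderAt_mul a3 (a1.mul (a2.pow 2)),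
      analyticOrderAt_mul a1 (a2.pow 2), analyticOrderAt_pow a2, o1, o3, zero_add] at this
    obtain ⟨n, hn⟩ := ENat.ne_top_iff_exists.1 o2
    rw [← hn] at this
    generalize analyticOrderAt (fun w => ((g 0 w - g 1 w) * (g 0 w - g 2 w) * (g 1 w - g 2 w))) z =
      m at this
    induction m using ENat.recTopCoe with
    | top => simp at this; exact absurd this (by exact_mod_cast ENat.top_ne_natCast (1 + 2 * n))
    | coe m => simp only [nsmul_eq_mul] at this; norm_cast at this; omega
  · intro hz
    obtain ⟨s, h0, hs, h1, h2, h3⟩ := exists_zC_roots hx z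
    have hi := zC_roots_injective hx hz h1 h2 h3
    have hφ (i : Fin 3) : ∃ φ : ℂ → ℂ, AnalyticAt ℂ φ z ∧ φ z = s i ∧
        ∀ᶠ w in 𝓝 z, zC x (φ w) = w := by
      simpa only [hs i] using exists_analytic_zC_section hx (h0 i) (by rwa [hs i])
    choose φ ha hφz hφ using hφ
    refine ⟨fun i w => γ / t3 * ((φ i w)⁻¹ + 4 * γ ^ 3 * φ i w ^ 2), fun i => ?_, ?_⟩
    · exact analyticAt_const.mul (((ha i).inv (by rw [hφz]; exact h0 i)).add
        (analyticAt_const.mul ((ha i).pow 2)))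
    · have hne (i : Fin 3) : ∀ᶠ w in 𝓝 z, φ i w ≠ 0 :=
        (ha i).continuousAt.eventually_ne (by rw [hφz]; exact h0 i)
      have hne' (i j : Fin 3) (hij : i ≠ j) : ∀ᶠ w in 𝓝 z, φ i w ≠ φ j w :=
        ((ha i).continuousAt.ne_iff_eventually_ne (ha j).continuousAt).1
          (by rw [hφz, hφz]; exact hi.ne hij)
      filter_upwards [eventually_all.2 hφ, eventually_all.2 hne, hne' 0 1 (by decide),
        hne' 0 2 (by decide), hne' 1 2 (by decide)] with w w1 w2 w01 w02 w12
      have hw : Injective fun i => φ i w := by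
        intro i j hij
        fin_cases i <;> fin_cases j <;>
          first | rfl | exact absurd hij ‹_› | exact absurd hij.symm ‹_›
      obtain ⟨v1, v2, v3⟩ := zC_vieta hx w2 w1 hw
      exact h.spectralPoly_eq_prod v1 v2 v3

lemma deriv_cubic (a b c d z : ℂ) {f : ℂ → ℂ} (hf : ∀ u, f u = a * u ^ 3 + b * u ^ 2 + c * u + d) :
    deriv f z = 3 * a * z ^ 2 + 2 * b * z + c := by
  have : f = fun u => (C a * X ^ 3 + C b * X ^ 2 + C c * X + C d).eval u := by
    funext u; rw [hf]; simp
  rw [this, Polynomial.deriv]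
  simp [-map_pow]; ring

lemma deriv_fst (t0 t3 A : ℝ) (z ξ : ℂ) : deriv (fun u => (spectralPoly t0 t3 A u).eval ξ) z =
      -(2 * t3 * z * ξ ^ 2) - ((t0 * t3 + 1 / t3 : ℝ) : ℂ) * ξ + 3 * z ^ 2 :=
  (deriv_cubic 1 (-(t3 * ξ ^ 2)) (-(((t0 * t3 + 1 / t3 : ℝ) : ℂ) * ξ)) (ξ ^ 3 + A) z
    fun u => by rw [eval_spectralPoly]; ring).trans (by ring)

lemma deriv_snd (t0 t3 A : ℝ) (z ξ : ℂ) : deriv (fun v => (spectralPoly t0 t3 A z).eval v) ξ =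
      3 * ξ ^ 2 - 2 * t3 * z ^ 2 * ξ - ((t0 * t3 + 1 / t3 : ℝ) : ℂ) * z :=
  (deriv_cubic 1 (-(t3 * z ^ 2)) (-(((t0 * t3 + 1 / t3 : ℝ) : ℂ) * z)) (z ^ 3 + A) ξ
    fun u => by rw [eval_spectralPoly]; ring).trans (by ring)

lemma coeff_node (h : IsCurveParam t0 t3 x y A γ) :
    ((t0 * t3 + 1 / t3 : ℝ) : ℂ) = 3 * y - 2 * t3 * y ^ 2 := by
  have := h.t3_ne
  rw [h.coeff_eq, h.y_eq]; push_cast; field_simp; ring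

lemma A_eq_node (h : IsCurveParam t0 t3 x y A γ) :
    (A : ℂ) = y ^ 3 - t3 * y ^ 4 := by
  have := h.t3_ne
  rw [h.A_coe, h.y_eq]; push_cast; field_simp; ring

lemma isSingularPoint_mul (h : IsCurveParam t0 t3 x y A γ) {c : ℂ} (hc : c ^ 3 = 1) :
    IsSingularPoint (fun z ξ => (spectralPoly t0 t3 A z).eval ξ)
      (c * y) (c ^ 2 * y) := by
  refine ⟨(eval_spectralPoly ..).trans ?_, (deriv_fst ..).trans ?_, (deriv_snd ..).trans ?_⟩ <;>
    rw [h.coeff_node]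
  · rw [h.A_eq_node]
    linear_combination (y ^ 3 - t3 * y ^ 4) * (c ^ 3 - 1) * hc
  · linear_combination -(2 * t3 * y ^ 3 * c ^ 2) * hc
  · linear_combination c * (3 * y ^ 2 - 2 * t3 * y ^ 3) * hc

lemma isSingularPoint_iff (h : IsCurveParam t0 t3 x y A γ) (z ξ : ℂ) :
    IsSingularPoint (fun z ξ => (spectralPoly t0 t3 A z).eval ξ) z ξ ↔
        ∃ j : Fin 3, z = omega ^ (j : ℕ) * y ∧
          ξ = omega ^ (2 * (j : ℕ)) * y := by
  constructor
  · rintro ⟨h1, h2, h3⟩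
    rw [deriv_fst, h.coeff_node] at h2
    rw [deriv_snd, h.coeff_node] at h3
    replace h1 := (eval_spectralPoly ..).symm.trans h1
    rw [h.coeff_node, h.A_eq_node] at h1
    have hA : (y : ℂ) ^ 3 - t3 * y ^ 4 ≠ 0 := by
      have h2 : A = 2 * γ ^ 3 * y ^ 3 := by rw [h.A_eq, h.y_eq]; ring
      have := h.y_pos
      have := h.pos
      rw [← h.A_eq_node, h2]
      exact_mod_cast (by positivity : 2 * γ ^ 3 * y ^ 3 ≠ 0)
    -- Euler's identity for the weights that make the cubic terms isobaric
    have h4 : ξ ^ 3 = z ^ 3 := by linear_combination (ξ * h3 - z * h2) / 3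
    have hz : z ≠ 0 := by
      rintro rfl
      have : ξ = 0 := by simpa using h4
      exact hA (by simpa [this] using h1)
    obtain ⟨κ, rfl⟩ : ∃ κ, ξ = κ * z := ⟨ξ / z, by field_simp⟩
    have hκ : κ ^ 3 = 1 := mul_right_cancel₀ (pow_ne_zero 3 hz) (by linear_combination h4)
    have h5 : 3 * (κ ^ 2 * z) - 2 * t3 * (κ ^ 2 * z) ^ 2 = 3 * y - 2 * t3 * y ^ 2 :=
      mul_right_cancel₀ hz (by linear_combination h3 - 2 * t3 * z ^ 3 * κ * hκ)
    have h6 : κ ^ 2 * z = y := by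
      refine sub_eq_zero.1 (pow_eq_zero_iff three_ne_zero |>.1 ?_)
      have h7 : 2 * (κ ^ 2 * z) ^ 3 - t3 * (κ ^ 2 * z) ^ 4 - (3 * y - 2 * t3 * y ^ 2) *
          (κ ^ 2 * z) ^ 2 + (y ^ 3 - t3 * y ^ 4) = 0 := by
        linear_combination h1 + ((2 * κ ^ 3 + 1) * z ^ 3 - t3 * κ ^ 2 * (κ ^ 3 + 1) * z ^ 4 -
          (3 * y - 2 * t3 * y ^ 2) * κ * z ^ 2) * hκ
      linear_combination 2 * h7 + (y ^ 2 - (κ ^ 2 * z) ^ 2) * h5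
    obtain ⟨j, hj⟩ := cube_eq_iff (r := 1).1 (by simpa using hκ)
    rw [Complex.ofReal_one, mul_one] at hj
    refine ⟨j, ?_, ?_⟩
    · rw [← hj]; linear_combination κ * h6 - z * hκ
    · rw [mul_comm 2, pow_mul, ← hj]; linear_combination κ ^ 2 * h6 - κ * z * hκ
  · rintro ⟨j, rfl, rfl⟩
    rw [mul_comm 2, pow_mul]
    exact h.isSingularPoint_mul (omega_pow_cube _)

lemma isNode (h : IsCurveParam t0 t3 x y A γ) (h8 : 8 * γ ^ 3 ≠ 1) (j : Fin 3) :
    IsNode (fun z ξ => (spectralPoly t0 t3 A z).eval ξ)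
          (omega ^ (j : ℕ) * y) (omega ^ (2 * (j : ℕ)) * y) := by
  refine ⟨(h.isSingularPoint_iff _ _).2 ⟨j, rfl, rfl⟩, ?_⟩
  have hc := omega_pow_cube (j : ℕ)
  rw [mul_comm 2, pow_mul]
  generalize omega ^ (j : ℕ) = c at hc
  have d1 : deriv (fun u => (spectralPoly t0 t3 A u).eval (c ^ 2 * y)) = _ :=
    funext fun u => deriv_fst ..
  have d2 : deriv (fun v => (spectralPoly t0 t3 A (c * y)).eval v) = _ :=
    funext fun u => deriv_snd ..
  simp only [iteratedDeriv_succ, iteratedDeriv_zero, deriv_snd, d1, d2]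
  rw [deriv_cubic 0 3 (-(2 * t3 * (c ^ 2 * y) ^ 2))
      (-(((t0 * t3 + 1 / t3 : ℝ) : ℂ) * (c ^ 2 * y))) _ fun u => by ring,
    deriv_cubic 0 3 (-(2 * t3 * (c * y) ^ 2))
      (-(((t0 * t3 + 1 / t3 : ℝ) : ℂ) * (c * y))) _ fun u => by ring,
    deriv_cubic 0 (-(2 * t3 * (c ^ 2 * y))) (-((t0 * t3 + 1 / t3 : ℝ) : ℂ))
      (3 * (c ^ 2 * y) ^ 2) _ fun u => by ring, h.coeff_node]
  have e : (9 * y ^ 2 * (8 * γ ^ 3 - 1) : ℂ) ≠ 0 := by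
    have := h.y_pos
    have := sub_ne_zero.2 h8
    exact_mod_cast (by positivity : 9 * y ^ 2 * (8 * γ ^ 3 - 1) ≠ 0)
  have e' : (t3 * y : ℂ) = 1 - 2 * γ ^ 3 := by
    have := h.t3_ne
    rw [h.y_eq]; push_cast; field_simp
  convert e using 1
  linear_combination ((6 * y - 2 * t3 * y ^ 2 * (c ^ 3 + 1)) * (6 * y - 2 * t3 * y ^ 2) -
    4 * t3 * y ^ 2 * (4 * t3 * c ^ 3 * y ^ 2 + 6 * y)) * hc - 36 * y ^ 2 * e'
end IsCurveParam

/-! ### The three functions as branches of the spectral curve -/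

lemma exists_continuousAt_sqrt {z0 q0 : ℂ} (h : q0 ^ 2 = z0) (hz : z0 ≠ 0) :
    ∃ ρ : ℂ → ℂ, ContinuousAt ρ z0 ∧ ρ z0 = q0 ∧ ∀ z, ρ z ^ 2 = z := by
  refine ⟨fun z => q0 * (z / z0) ^ (1 / 2 : ℂ), ?_, by simp [hz], fun z => ?_⟩
  · refine continuousAt_const.mul (ContinuousAt.cpow (by fun_prop) continuousAt_const ?_)
    simp [hz]
  · rw [mul_pow, cpow_half_sq, h]; field_simp

lemma zero_mem_Sigma1 {x : ℝ} (hx : 0 < x) : (0 : ℂ) ∈ Sigma1 x :=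
  ⟨0, le_rfl, by positivity, by simp⟩

lemma continuousAt_qroot {z : ℂ} (hz : z ∉ Sigma2) : ContinuousAt qroot z := by
  obtain ⟨ρ, h1, h2, h3⟩ := exists_continuousAt_sqrt (qroot_sq z)
    (fun h => hz (h ▸ zero_mem_Sigma2))
  refine h1.congr ?_
  have h4 : ContinuousAt (fun z => (ρ z ^ 3).re) z := continuous_re.continuousAt.comp (h1.pow 3)
  have h5 : 0 < (ρ z ^ 3).re := h2 ▸ re_qroot_cube_pos hz
  filter_upwards [h4.eventually (lt_mem_nhds h5), isClosed_Sigma2.isOpen_compl.mem_nhds hz]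
    with w hw hw'
  exact eq_qroot_of_sq (h3 w) hw hw'

/-- The properties of the functions `ξ₁, ξ₂, ξ₃` from which their position on the surface is
read off. -/
structure IsXiTriple (t0 t3 x y A γ : ℝ) (ξ : Fin 3 → ℂ → ℂ) : Prop where
  param : IsCurveParam t0 t3 x y A γ
  root : ∀ k, ∀ z ∈ sheetDomain x k, (spectralPoly t0 t3 A z).IsRoot (ξ k z)
  prod : ∀ z ∉ Sigma1 x ∪ Sigma2, spectralPoly t0 t3 A z = ∏ k : Fin 3, (X - C (ξ k z))
  cont : ∀ k, ∀ z ∈ sheetDomain x k, ContinuousAt (ξ k) z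
  mul : ∀ k, ∀ z ∈ sheetDomain x k, ∀ c : ℂ, c ^ 3 = 1 → ξ k (c * z) = c ^ 2 * ξ k z
  map_conj : ∀ k, ∀ z ∈ sheetDomain x k, ξ k (conj z) = conj (ξ k z)
  neg : ∀ r : ℝ, 0 < r → (ξ 2 r).re < 0
  small : ∀ r : ℝ, x < r → (ξ 1 r).re ≤ √r * (1 / √t3)
  mono : ∀ r s : ℝ, x < r → r ≤ s → √s * (ξ 1 r).re ≤ √r * (ξ 1 s).re

lemma mul_mem_Sigma1_iff {x : ℝ} {c z : ℂ} (hc : c ^ 3 = 1) :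
    c * z ∈ Sigma1 x ↔ z ∈ Sigma1 x := by
  simp only [Sigma1, mem_ofPred_eq, mul_pow, hc, one_mul]

lemma mul_mem_Sigma2_iff {c z : ℂ} (hc : c ^ 3 = 1) : c * z ∈ Sigma2 ↔ z ∈ Sigma2 := by
  simp only [Sigma2, mem_ofPred_eq, mul_pow, hc, one_mul]

lemma conj_cube_eq_iff {z : ℂ} {r : ℝ} : conj z ^ 3 = r ↔ z ^ 3 = r := by
  rw [← map_pow, ← conj_ofReal, (starRingEnd ℂ).injective.eq_iff, conj_ofReal]

lemma conj_mem_Sigma1_iff {x : ℝ} {z : ℂ} : conj z ∈ Sigma1 x ↔ z ∈ Sigma1 x := by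
  simp only [Sigma1, mem_ofPred_eq, conj_cube_eq_iff]

lemma conj_mem_Sigma2_iff {z : ℂ} : conj z ∈ Sigma2 ↔ z ∈ Sigma2 := by
  simp only [Sigma2, mem_ofPred_eq, conj_cube_eq_iff]

lemma qroot_mul {c z : ℂ} (hc : c ^ 3 = 1) (hz : z ∉ Sigma2) : qroot (c * z) = c ^ 2 * qroot z := by
  refine (eq_qroot_of_sq ?_ ?_ (by rwa [mul_mem_Sigma2_iff hc])).symm
  · rw [mul_pow, qroot_sq]; linear_combination c * z * hc
  · rw [mul_pow, show (c ^ 2) ^ 3 = 1 by linear_combination (c ^ 3 + 1) * hc, one_mul]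
    exact re_qroot_cube_pos hz

lemma qroot_conj {z : ℂ} (hz : z ∉ Sigma2) :
    qroot (conj z) = conj (qroot z) := by
  refine (eq_qroot_of_sq ?_ ?_ (by rwa [conj_mem_Sigma2_iff])).symm
  · rw [← map_pow, qroot_sq]
  · rw [← map_pow, conj_re]
    exact re_qroot_cube_pos hz

lemma ofReal_not_mem_Sigma2 {r : ℝ} (hr : 0 < r) : (r : ℂ) ∉ Sigma2 := by
  rintro ⟨s, hs, h⟩
  have : r ^ 3 = s := by exact_mod_cast h
  linarith [pow_pos hr 3]

lemma qroot_ofReal {r : ℝ} (hr : 0 < r) : qroot r = √r := by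
  refine (eq_qroot_of_sq ?_ ?_ (ofReal_not_mem_Sigma2 hr)).symm
  · exact_mod_cast sq_sqrt hr.le
  · exact_mod_cast (by positivity : 0 < √r ^ 3)

lemma ofReal_not_mem_Sigma1 {x r : ℝ} (hx : 0 < x) (hr : x < r) : (r : ℂ) ∉ Sigma1 x := by
  rintro ⟨s, -, hs, h⟩
  have : r ^ 3 = s := by exact_mod_cast h
  linarith [pow_lt_pow_left₀ hr hx.le three_ne_zero]

lemma isXiTriple {t0 t3 x y A γ : ℝ} {μ : Measure ℂ} (hp : IsCurveParam t0 t3 x y A γ)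
    (h : RotInv μ) [IsFiniteMeasure μ] (hf : IsLogFinite μ) (hμ : μ (Sigma1 x)ᶜ = 0)
    (hl : IsLoopLaw t0 t3 (x ^ (3 / 2 : ℝ)) (radialLaw μ))
    (hA : ∀ v, v ∉ segC (x ^ (3 / 2 : ℝ)) →
      IsLoopLaw.curveFun t0 t3 (radialLaw μ) v = -v ^ 2 - A) :
    IsXiTriple t0 t3 x y A γ (xi t0 t3 μ (halfBalayage μ)) := by
  have hx := hp.x_pos
  set K := Kfun t0 t3 (radialLaw μ) with hK
  set ξ := xi t0 t3 μ (halfBalayage μ)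
  have x0 {z q : ℂ} (hq : q ^ 2 = z) (hz : z ∉ Sigma1 x) :
      ξ 0 z = q * (t3 * q ^ 3 - K (q ^ 3) + K (-q ^ 3)) :=
    xi_zero_eq h hx hμ _ hq hz
  have x1 {z : ℂ} (hz : z ∉ Sigma1 x ∪ Sigma2) :
      ξ 1 z = qroot z * K (qroot z ^ 3) := xi_one_eq h hf hx hμ hz
  have x2 {z : ℂ} (hz : z ∉ Sigma2) : ξ 2 z = -(qroot z * K (-qroot z ^ 3)) := xi_two_eq h hf hμ hz
  have prodq {z q : ℂ} (hq : q ^ 2 = z) (hz : z ∉ Sigma1 x) : spectralPoly t0 t3 A z = ∏ i, (X - C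
        ((![q * (t3 * q ^ 3 - K (q ^ 3) + K (-q ^ 3)), q * K (q ^ 3), -(q * K (-q ^ 3))] :
          Fin 3 → ℂ) i)) := by
    obtain ⟨h1, h2⟩ := not_mem_segC_of_sq hx hq hz
    obtain ⟨r1, r2⟩ := hl.roots hA h1 h2
    rw [← hK] at r1 r2
    rw [spectralPoly_eq_prod_iff, r1, r2, ← hq]
    simp only [Matrix.cons_val]
    exact ⟨by ring, by ring, by ring⟩
  have prod : ∀ z ∉ Sigma1 x ∪ Sigma2, spectralPoly t0 t3 A z =
      ∏ k : Fin 3, (X - C (ξ k z)) := by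
    intro z hz
    rw [prodq (qroot_sq z) fun h => hz (.inl h), Fin.prod_univ_three, Fin.prod_univ_three,
      x0 (qroot_sq z) fun h => hz (.inl h), x1 hz, x2 fun h => hz (.inr h)]
    rfl
  have hseg {z : ℂ} (hz : z ∉ Sigma2) : -qroot z ^ 3 ∉ segC (x ^ (3 / 2 : ℝ)) := by
    have := re_qroot_cube_pos hz
    refine IsLoopLaw.not_mem_segC_of_re_nonpos (fun h => ?_) (by rw [neg_re]; linarith)
    rw [neg_eq_zero.1 h] at this
    simp at this
  have x1r {r : ℝ} (hr : x < r) : (ξ 1 r).re =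
      √r * KfunR t0 t3 (radialLaw μ) (√r ^ 3) := by
    have hr0 := hx.trans hr
    rw [x1 fun h => h.elim (ofReal_not_mem_Sigma1 hx hr) (ofReal_not_mem_Sigma2 hr0),
      qroot_ofReal hr0, re_ofReal_mul, ← ofReal_pow, hK, Kfun_ofReal,
      ofReal_re]
  have hv {r : ℝ} (hr : x < r) : x ^ (3 / 2 : ℝ) < √r ^ 3 := by
    refine lt_of_pow_lt_pow_left₀ 2 (by positivity) ?_
    rw [rpow_three_halves_sq hx.le, ← pow_mul, mul_comm, pow_mul, sq_sqrt (hx.trans hr).le]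
    exact pow_lt_pow_left₀ hr hx.le three_ne_zero
  have hopen (k : Fin 3) : IsOpen (sheetDomain x k) := by
    fin_cases k
    · exact (isClosed_Sigma1 x).isOpen_compl
    · exact ((isClosed_Sigma1 x).union isClosed_Sigma2).isOpen_compl
    · exact isClosed_Sigma2.isOpen_compl
  refine ⟨hp, fun k z hz => ?_, prod, fun k z hz => ?_, fun k z hz c hc => ?_, fun k z hz => ?_,
    fun r hr => ?_, fun r hr => ?_, fun r s hr hrs => ?_⟩
  · fin_cases k
    · change IsRoot _ (ξ 0 z)
      rw [x0 (qroot_sq z) hz, prodq (qroot_sq z) hz, IsRoot, eval_prod]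
      exact Finset.prod_eq_zero (Finset.mem_univ 0) (by simp)
    · rw [prod z hz, IsRoot, eval_prod]
      exact Finset.prod_eq_zero (Finset.mem_univ 1) (by simp)
    · change IsRoot _ (ξ 2 z)
      have := hA _ (hseg hz)
      rw [IsLoopLaw.curveFun, ← hK] at this
      rw [x2 hz, IsRoot, eval_spectralPoly]
      have e := qroot_sq z
      generalize qroot z = q at this e ⊢
      rw [← e]
      linear_combination this
  · have hev := (hopen k).mem_nhds hz
    fin_cases k
    · obtain ⟨ρ, h1, h2, h3⟩ := exists_continuousAt_sqrt (qroot_sq z)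
        (fun h => hz (h ▸ zero_mem_Sigma1 hx))
      refine ContinuousAt.congr (f := fun z => ρ z * (t3 * ρ z ^ 3 - K (ρ z ^ 3) + K (-ρ z ^ 3))) ?_
        (by filter_upwards [hev] with w hw using (x0 (h3 w) hw).symm)
      obtain ⟨s1, s2⟩ := not_mem_segC_of_sq hx (h3 z) hz
      exact h1.mul (((h1.pow 3).const_mul _).sub ((hl.differentiableAt s1).continuousAt.comp
        (f := fun z => ρ z ^ 3) (h1.pow 3)) |>.add ((hl.differentiableAt s2).continuousAt.comp
        (f := fun z => -ρ z ^ 3) (h1.pow 3).neg))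
    · refine ContinuousAt.congr (f := fun z => qroot z * K (qroot z ^ 3)) ?_
        (by filter_upwards [hev] with w hw using (x1 hw).symm)
      have h1 := continuousAt_qroot fun h => hz (.inr h)
      obtain ⟨s1, s2⟩ := not_mem_segC_of_sq hx (qroot_sq z) fun h => hz (.inl h)
      exact h1.mul ((hl.differentiableAt s1).continuousAt.comp
        (f := fun z => qroot z ^ 3) (h1.pow 3))
    · refine ContinuousAt.congr (f := fun z => -(qroot z * K (-qroot z ^ 3))) ?_
        (by filter_upwards [hev] with w hw using (x2 hw).symm)
      have h1 := continuousAt_qroot hz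
      exact (h1.mul ((hl.differentiableAt (hseg hz)).continuousAt.comp
        (f := fun z => -qroot z ^ 3) (h1.pow 3).neg)).neg
  · have h6 : (c ^ 2) ^ 3 = 1 := by linear_combination (c ^ 3 + 1) * hc
    have hq : (c ^ 2 * qroot z) ^ 2 = c * z := by
      rw [mul_pow, qroot_sq]; linear_combination c * z * hc
    fin_cases k
    · change ξ 0 _ = _ * ξ 0 _
      rw [x0 hq fun h => hz ((mul_mem_Sigma1_iff hc).1 h), x0 (qroot_sq z) hz, mul_pow, h6]
      simp only [one_mul]; ring
    · change ξ 1 _ = _ * ξ 1 _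
      rw [x1 fun h => hz (h.imp (mul_mem_Sigma1_iff hc).1 (mul_mem_Sigma2_iff hc).1), x1 hz,
        qroot_mul hc fun h => hz (.inr h), mul_pow, h6, one_mul]
      ring
    · change ξ 2 _ = _ * ξ 2 _
      rw [x2 fun h => hz ((mul_mem_Sigma2_iff hc).1 h), x2 hz, qroot_mul hc hz, mul_pow, h6,
        one_mul]
      ring
  · have hq : (conj (qroot z)) ^ 2 = conj z := by rw [← map_pow, qroot_sq]
    fin_cases k
    · change ξ 0 _ = conj (ξ 0 _)
      rw [x0 hq fun h => hz (conj_mem_Sigma1_iff.1 h), x0 (qroot_sq z) hz]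
      simp only [map_mul, map_add, map_sub, map_pow, map_neg, conj_ofReal, hK, ← Kfun_conj]
    · change ξ 1 _ = conj (ξ 1 _)
      rw [x1 fun h => hz (h.imp conj_mem_Sigma1_iff.1 conj_mem_Sigma2_iff.1), x1 hz,
        qroot_conj fun h => hz (.inr h)]
      simp only [map_mul, map_pow, hK, ← Kfun_conj]
    · change ξ 2 _ = conj (ξ 2 _)
      rw [x2 fun h => hz (conj_mem_Sigma2_iff.1 h), x2 hz, qroot_conj hz]
      simp only [map_mul, map_pow, map_neg, hK, ← Kfun_conj]
  · have h1 := hl.le_re_Kfun (v := -((√r : ℝ) : ℂ) ^ 3) (by simpa using (sqrt_pos.2 hr).ne') (by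
        rw [neg_re, ← ofReal_pow, ofReal_re, neg_nonpos]; positivity)
    have := hp.t3_pos
    rw [x2 (ofReal_not_mem_Sigma2 hr), qroot_ofReal hr, neg_re, re_ofReal_mul, neg_lt_zero]
    exact mul_pos (sqrt_pos.2 hr) (lt_of_lt_of_le (by positivity) h1)
  · rw [x1r hr]
    exact mul_le_mul_of_nonneg_left (hl.KfunR_le (hv hr) le_rfl).1 (sqrt_nonneg _)
  · have := (hl.KfunR_le (hv hr) (pow_le_pow_left₀ (sqrt_nonneg r) (Real.sqrt_le_sqrt hrs) 3)).2
    rw [x1r hr, x1r (hr.trans_le hrs), mul_left_comm]; gcongr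

/-! ### Matching the branches with the sheets -/

lemma exists_forall_eq_of_injective {α β ι : Type*} [TopologicalSpace α] [PreconnectedSpace α]
    [Nonempty α] [TopologicalSpace β] [T2Space β] [TopologicalSpace ι] [DiscreteTopology ι]
    [Finite ι] {f : α → β} {g : ι → α → β} (hf : Continuous f) (hg : ∀ i, Continuous (g i))
    (hi : ∀ a, Injective fun i => g i a) (h : ∀ a, ∃ i, f a = g i a) :
    ∃ i, ∀ a, f a = g i a := by
  choose σ hσ using h
  have e : {q : α × ι | q.2 = σ q.1} = {q | q.1 ∈ {a | f a = g q.2 a}} := by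
    ext q
    exact ⟨fun hq => by rw [mem_ofPred_eq, mem_ofPred_eq, show q.2 = _ from hq, ← hσ],
      fun hq => hi q.1 (hq.symm.trans (hσ q.1))⟩
  have hc : Continuous σ := continuous_of_isClosed_graph (by
    rw [e]
    exact isClosed_of_finite_index (β := ℂ) (f := Prod.snd) continuous_snd
      (s := fun i => {q : α × ι | f q.1 = g i q.1})
      fun i => isClosed_eq (hf.comp continuous_fst) ((hg i).comp continuous_fst))
  obtain ⟨a⟩ := ‹Nonempty α›
  exact ⟨σ a, fun b => PreconnectedSpace.constant ‹_› hc (x := b) (y := a) ▸ hσ b⟩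

/-- The point `w` of the first sector, as a point of the sheet `k`. -/
def basePiece (k : Fin 3) (w : sectorC) : Piece :=
  ⟨(k, 0, ((w : ℂ) : OnePoint ℂ)), mem_sector_iff_gmap.2
    (.inr ⟨w, w.2, by rw [gmap_even (m := 0) (by decide)]; simp⟩)⟩

lemma gHat_zero_symm (P : OnePoint ℂ) : (gHat 0).symm P = P := by
  rw [Homeomorph.symm_apply_eq]
  induction P using OnePoint.rec with
  | infty => rfl
  | coe u => rw [gHat_coe, gmap_even (by decide)]; simp

lemma pieceMap_basePiece {x : ℝ} (hx : 0 < x) {k : Fin 3} {w : sectorC} {u : ℂ} (hu : u ≠ 0)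
    (hk : u ∈ region k) (hz : zC x u = w) : pieceMap hx (basePiece k w) = u :=
  (eq_pieceMap hx (by
    change (gHat 0).symm _ ∈ _
    rw [gHat_zero_symm]; exact coe_mem_regionHat.2 hk) (by rw [zHat_coe hu, hz]; rfl)).symm

lemma continuous_xiHat {κ g : ℂ} (hκ : κ ≠ 0) {α : Type*} [TopologicalSpace α] {F : α → OnePoint ℂ}
    (hF : Continuous F) (h : ∀ a, F a ≠ infty) : Continuous fun a => xiHat κ g (F a) := by
  refine continuous_iff_continuousAt.2 fun a => ContinuousAt.comp (g := xiHat κ g) ?_ hF.continuousAt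
  obtain ⟨u, hu⟩ := OnePoint.ne_infty_iff_exists.1 (h a)
  rw [← hu, OnePoint.continuousAt_coe]
  exact (sphereHolAt_xiHat hκ g u).continuousAt

lemma im_cube_pos {w : ℂ} (h1 : 0 < w.im) (h2 : w.im < √3 * w.re) : 0 < (w ^ 3).im := by
  have e : (w ^ 3).im = w.im * (3 * w.re ^ 2 - w.im ^ 2) := by
    simp [pow_succ]; ring
  have := sqrt3_sq
  rw [e]
  exact mul_pos h1 (by nlinarith)

lemma mul_mem_sheetDomain_iff {x : ℝ} {k : Fin 3} {c z : ℂ} (hc : c ^ 3 = 1) :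
    c * z ∈ sheetDomain x k ↔ z ∈ sheetDomain x k := by
  fin_cases k <;> simp [sheetDomain, mul_mem_Sigma1_iff hc, mul_mem_Sigma2_iff hc]

lemma conj_mem_sheetDomain_iff {x : ℝ} {k : Fin 3} {z : ℂ} :
    conj z ∈ sheetDomain x k ↔ z ∈ sheetDomain x k := by
  fin_cases k <;> simp [sheetDomain, conj_mem_Sigma1_iff, conj_mem_Sigma2_iff]

lemma mem_sheetDomain {x : ℝ} {z : ℂ} (h : z ∉ Sigma1 x ∪ Sigma2) (k : Fin 3) :
    z ∈ sheetDomain x k := by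
  fin_cases k
  · exact fun h' => h (.inl h')
  · exact h
  · exact fun h' => h (.inr h')

namespace IsXiTriple
variable {t0 t3 x y A γ : ℝ} {ξ : Fin 3 → ℂ → ℂ}

/-- The second coordinate of the uniformization, on the first sector of the sheet `k`. -/
def branch (h : IsXiTriple t0 t3 x y A γ ξ) (k : Fin 3) (w : sectorC) : OnePoint ℂ :=
  xiHat (γ / t3 : ℂ) (4 * γ ^ 3 : ℂ) (pieceMap h.param.x_pos (basePiece k w))

lemma kappa_ne (h : IsXiTriple t0 t3 x y A γ ξ) : (γ / t3 : ℂ) ≠ 0 :=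
  div_ne_zero (by exact_mod_cast h.param.pos.ne') h.param.t3_ne

lemma branch_eq (h : IsXiTriple t0 t3 x y A γ ξ) {k : Fin 3} {w : sectorC} {u : ℂ} (hu : u ≠ 0)
    (hk : u ∈ region k) (hz : zC x u = w) :
    h.branch k w = ((γ / t3 * (u⁻¹ + 4 * γ ^ 3 * u ^ 2) : ℂ) : OnePoint ℂ) := by
  rw [branch, pieceMap_basePiece _ hu hk hz, xiHat_coe hu]

lemma continuous_branch (h : IsXiTriple t0 t3 x y A γ ξ) (k : Fin 3) : Continuous (h.branch k) := by
  refine continuous_xiHat h.kappa_ne ((continuous_pieceMap _).comp ?_) fun w => ?_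
  · exact Continuous.subtype_mk (continuous_const.prodMk (continuous_const.prodMk
      (continuous_coe.comp continuous_subtype_val))) _
  · obtain ⟨u, hu, hk, hz⟩ := exists_mem_region_zC h.param.x_pos w.2 k
    rw [pieceMap_basePiece _ hu hk hz]
    exact coe_ne_infty u

lemma branch_of_interior (h : IsXiTriple t0 t3 x y A γ ξ) {w : sectorC} (h1 : 0 < (w : ℂ).im)
    (h2 : (w : ℂ).im < √3 * (w : ℂ).re) : (w : ℂ) ∉ Sigma1 x ∪ Sigma2 ∧
      Injective (h.branch · w) ∧ Injective (ξ · w) ∧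
      ∀ k, ∃ i, (ξ k w : OnePoint ℂ) = h.branch i w := by
  have hx := h.param.x_pos
  have him := im_cube_pos h1 h2
  have hne (r : ℝ) : (w : ℂ) ^ 3 ≠ r := fun e => by simp [e] at him
  have hS : (w : ℂ) ∉ Sigma1 x ∪ Sigma2 := by
    rintro (⟨r, -, -, e⟩ | ⟨r, -, e⟩) <;> exact hne r e
  choose u hu hk hz using exists_mem_region_zC hx w.2
  have hi : Injective u := by
    intro i j hij
    rcases region_inter (hk i) (hij ▸ hk j) with e | ⟨e, -⟩ | ⟨e, -⟩
    · exact e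
    · refine absurd ?_ (hne (x ^ 3))
      rw [← hz i, e, zC]; push_cast; ring
    · exact absurd e (hu i)
  obtain ⟨v1, v2, v3⟩ := zC_vieta hx hu hz hi
  have hP := h.param.spectralPoly_eq_prod v1 v2 v3
  have hd : (spectralPoly t0 t3 A w).discr ≠ 0 := by
    rw [h.param.discr_eq]
    have := h.param.t3_ne
    have a1 := hne (x ^ 3)
    have a2 := hne (y ^ 3)
    push_cast at a1 a2
    exact mul_ne_zero (by simpa) (mul_ne_zero (sub_ne_zero.2 a1) (pow_ne_zero 2 (sub_ne_zero.2 a2)))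
  refine ⟨hS, fun i j hij => ?_, injective_of_discr_ne_zero (h.prod w hS) hd, fun k => ?_⟩
  · simp only [h.branch_eq (hu _) (hk _) (hz _)] at hij
    exact injective_of_discr_ne_zero hP hd (OnePoint.coe_injective hij)
  · have := h.root k w (mem_sheetDomain hS k)
    rw [hP, IsRoot, eval_prod, Finset.prod_eq_zero_iff] at this
    obtain ⟨i, -, hi⟩ := this
    exact ⟨i, by rw [h.branch_eq (hu i) (hk i) (hz i)]; simpa [sub_eq_zero] using hi⟩

/-- On the first sector the functions `ξ` are the branches, up to a permutation. -/
lemma exists_branch (h : IsXiTriple t0 t3 x y A γ ξ) (k : Fin 3) :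
    ∃ i, ∀ w : sectorC, (w : ℂ) ∈ sheetDomain x k → (ξ k w : OnePoint ℂ) = h.branch i w := by
  have hs := sqrt3_pos
  let O : Set ℂ := {w | 0 < w.im ∧ w.im < √3 * w.re}
  have hO : Convex ℝ O := by
    intro a ha b hb s t hs ht hst
    simp only [O, mem_ofPred_eq, add_im, real_smul, re_ofReal_mul, im_ofReal_mul, add_re] at ha hb ⊢
    rcases hs.eq_or_lt with rfl | hs
    · rw [zero_add] at hst; subst hst; simpa using hb
    · constructor <;> nlinarith [mul_pos hs ha.1, mul_pos hs (sub_pos.2 ha.2),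
        mul_nonneg ht hb.1.le, mul_nonneg ht (sub_pos.2 hb.2).le]
  have hO' : ∀ w ∈ O, w ∈ sectorC := fun w hw => ⟨hw.1.le, hw.2.le⟩
  have : PreconnectedSpace O := Subtype.preconnectedSpace hO.isPreconnected
  have one_mem : (1 + I) ∈ O := by
    refine ⟨by simp, ?_⟩
    have := sqrt3_sq
    simp only [add_im, one_im, I_im, add_re, one_re, I_re]
    nlinarith
  have : Nonempty O := ⟨⟨_, one_mem⟩⟩
  have hb (w : O) := h.branch_of_interior (w := ⟨w, hO' w w.2⟩) w.2.1 w.2.2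
  obtain ⟨i, hi⟩ := exists_forall_eq_of_injective (α := O) (f := fun w => (ξ k w : OnePoint ℂ))
    (g := fun i w => h.branch i ⟨w, hO' w w.2⟩)
    (continuous_coe.comp (continuous_iff_continuousAt.2 fun w =>
      (h.cont k w (mem_sheetDomain (hb w).1 k)).comp continuous_subtype_val.continuousAt))
    (fun i => (h.continuous_branch i).comp (by fun_prop)) (fun w => (hb w).2.1)
    (fun w => (hb w).2.2.2 k)
  refine ⟨i, fun w hw => ?_⟩
  -- the boundary points of the sector are limits of interior points
  have hp (ε : ℝ) : (w : ℂ) + |ε| * (1 + I) ∈ sectorC ∧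
      (ε ≠ 0 → (w : ℂ) + |ε| * (1 + I) ∈ O) := by
    obtain ⟨h1, h2⟩ := w.2
    obtain ⟨h3, h4⟩ := one_mem
    simp only [O, sectorC, mem_ofPred_eq, add_im, add_re, re_ofReal_mul, im_ofReal_mul] at h3 h4 ⊢
    refine ⟨⟨?_, ?_⟩, fun h0 => ⟨?_, ?_⟩⟩
    · nlinarith [abs_nonneg ε]
    · nlinarith [abs_nonneg ε]
    · nlinarith [abs_pos.2 h0]
    · nlinarith [abs_pos.2 h0]
  have t1 : Tendsto (fun ε : ℝ => (ξ k (w + |ε| * (1 + I)) : OnePoint ℂ)) (𝓝[≠] 0)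
      (𝓝 (ξ k w : OnePoint ℂ)) := by
    refine (continuous_coe.tendsto _).comp ((h.cont k w hw).tendsto.comp ?_)
    refine tendsto_nhdsWithin_of_tendsto_nhds ?_
    exact (by fun_prop : Continuous fun ε : ℝ => (w : ℂ) + |ε| * (1 + I)).tendsto' _ _ (by simp)
  have t2 : Tendsto (fun ε : ℝ => h.branch i ⟨_, (hp ε).1⟩) (𝓝[≠] 0) (𝓝 (h.branch i w)) := by
    refine tendsto_nhdsWithin_of_tendsto_nhds (((h.continuous_branch i).comp (Continuous.subtype_mk
      (by fun_prop : Continuous fun ε : ℝ => (w : ℂ) + |ε| * (1 + I)) _)).tendsto' _ _ ?_)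
    simp
  exact tendsto_nhds_unique (t1.congr' (by
    filter_upwards [self_mem_nhdsWithin] with ε hε using hi ⟨_, (hp ε).2 hε⟩)) t2

lemma eq_branch (h : IsXiTriple t0 t3 x y A γ ξ) (k : Fin 3) (w : sectorC)
    (hw : (w : ℂ) ∈ sheetDomain x k) : (ξ k w : OnePoint ℂ) = h.branch k w := by
  have hx := h.param.x_pos
  have := h.param.pos
  have ht := h.param.t3_pos
  choose σ hσ using h.exists_branch
  suffices hid : ∀ k, σ k = k by rw [hσ k w hw, hid]
  have : Injective σ := by
    have := sqrt3_sq
    have m1 : (0 : ℝ) < (1 + I).im := by simp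
    have m2 : (1 + I).im < √3 * (1 + I).re := by
      simp only [add_im, one_im, I_im, add_re, one_re, I_re]
      nlinarith [sqrt3_pos]
    obtain ⟨b1, -, b2, -⟩ := h.branch_of_interior (w := ⟨1 + I, m1.le, m2.le⟩) m1 m2
    intro i j hij
    have := hσ i ⟨1 + I, m1.le, m2.le⟩ (mem_sheetDomain b1 i)
    rw [hij, ← hσ j _ (mem_sheetDomain b1 j)] at this
    exact b2 (OnePoint.coe_injective this)
  -- a real point to the right of the cut, over which the branches are told apart by their size
  set b : ℝ := 1 + 3 / (16 * γ ^ 6) with hb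
  have hb1 : 1 < b := by rw [hb]; linarith [(by positivity : 0 < 3 / (16 * γ ^ 6))]
  set r : ℝ := x / 3 * (2 * b + (b ^ 2)⁻¹) with hr
  have hzb : zC x b = r := by rw [zC, hr]; push_cast; rfl
  have hxr : x < r := by
    have e : r - x = x * ((b - 1) ^ 2 * (2 * b + 1)) / (3 * b ^ 2) := by rw [hr]; field_simp; ring
    have : 0 < b - 1 := by linarith
    have : 0 < x * ((b - 1) ^ 2 * (2 * b + 1)) / (3 * b ^ 2) := by positivity
    linarith
  have hr0 := hx.trans hxr
  have hrs : (r : ℂ) ∈ sectorC := ⟨by simp, by simpa using (mul_pos sqrt3_pos hr0).le⟩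
  have hrD (k : Fin 3) : (r : ℂ) ∈ sheetDomain x k := mem_sheetDomain
    (fun h => h.elim (ofReal_not_mem_Sigma1 hx hxr) (ofReal_not_mem_Sigma2 hr0)) k
  have hbr : (b : ℂ) ∈ region 0 := by
    rw [mem_region_zero]
    simp only [ofReal_im, ofReal_re, normSq_ofReal]
    refine ⟨le_rfl, by positivity, ?_, ?_⟩
    · nlinarith [pow_le_pow_left₀ zero_le_one hb1.le 3]
    · nlinarith
  have v (i k : Fin 3) (a : ℝ) (ha : 0 < a) (hk : (a : ℂ) ∈ region k) (hz : zC x a = r)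
      (hi : σ i = k) : (ξ i r).re = γ / t3 * (a⁻¹ + 4 * γ ^ 3 * a ^ 2) := by
    have := hσ i ⟨r, hrs⟩ (hrD i)
    rw [hi, h.branch_eq (by exact_mod_cast ha.ne') hk hz] at this
    rw [OnePoint.coe_injective this]; norm_cast
  have : σ 2 ≠ 0 := fun e => by
    have := v 2 0 b (by positivity) hbr hzb e
    have : 0 < γ / t3 * (b⁻¹ + 4 * γ ^ 3 * b ^ 2) := by positivity
    linarith [h.neg r hr0]
  have : σ 2 ≠ 1 := fun e => by
    obtain ⟨u, hu, hk, hz⟩ := exists_mem_region_zC hx hrs 1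
    have him := im_eq_zero_of_outer hx hu (by rw [hz, ofReal_im])
      (by rw [hz, ofReal_re]; exact hxr.le)
    obtain ⟨a, rfl⟩ : ∃ a : ℝ, u = a := ⟨u.re, Complex.ext rfl him⟩
    have ha : 0 < a := by
      have := (mem_region_one.1 hk).2.1
      rw [ofReal_re, ofReal_im, add_zero] at this
      exact (nonneg_of_mul_nonneg_right this sqrt3_pos).lt_of_ne' (by exact_mod_cast hu)
    have := v 2 1 a ha hk hz e
    have : 0 < γ / t3 * (a⁻¹ + 4 * γ ^ 3 * a ^ 2) := by positivity
    linarith [h.neg r hr0]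
  have : σ 1 ≠ 0 := fun e => by
    have := v 1 0 b (by positivity) hbr hzb e
    have := h.small r hxr
    have : √r * (1 / √t3) < γ / t3 * (b⁻¹ + 4 * γ ^ 3 * b ^ 2) := by
      rw [mul_one_div, ← Real.sqrt_div hr0.le]
      have hr1 : r ≤ 3 * γ ^ 2 / t3 * b := by
        rw [← h.param.x_eq, hr]
        have : (b ^ 2)⁻¹ ≤ 1 := inv_le_one_of_one_le₀ (by nlinarith)
        nlinarith
      have hb3 : 3 < 16 * γ ^ 6 * b ^ 3 := by
        have : 16 * γ ^ 6 * b = 16 * γ ^ 6 + 3 := by rw [hb]; field_simp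
        have : 0 < γ ^ 6 := by positivity
        nlinarith [mul_pos this (mul_pos (sub_pos.2 hb1) (by positivity : 0 < b * (b + 1)))]
      calc √(r / t3) < γ / t3 * (4 * γ ^ 3 * b ^ 2) := by
            rw [Real.sqrt_lt' (by positivity), div_lt_iff₀ ht]
            refine hr1.trans_lt ?_
            have : (γ / t3 * (4 * γ ^ 3 * b ^ 2)) ^ 2 * t3 =
              γ ^ 2 / t3 * b * (16 * γ ^ 6 * b ^ 3) := by field_simp; ring
            rw [this, show 3 * γ ^ 2 / t3 * b = γ ^ 2 / t3 * b * 3 by ring]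
            exact mul_lt_mul_of_pos_left hb3 (by positivity)
        _ ≤ _ := by
            refine mul_le_mul_of_nonneg_left ?_ (by positivity)
            linarith [(by positivity : 0 < b⁻¹)]
    linarith
  clear v hσ
  revert σ
  decide

/-- The parameter is subcritical: beyond this range `ξ₂ / √z` would decrease near the end of the
cut. -/
lemma le (h : IsXiTriple t0 t3 x y A γ ξ) : 8 * γ ^ 3 ≤ 1 := by
  have hx := h.param.x_pos
  have hg := h.param.pos
  have := h.param.t3_pos
  have v (a : ℝ) (ha : 0 < a) (ha1 : a < 1) : x < x / 3 * (2 * a + (a ^ 2)⁻¹) ∧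
      (ξ 1 (x / 3 * (2 * a + (a ^ 2)⁻¹) : ℝ)).re = γ / t3 * (a⁻¹ + 4 * γ ^ 3 * a ^ 2) := by
    have hr : x < x / 3 * (2 * a + (a ^ 2)⁻¹) := by
      have e : x / 3 * (2 * a + (a ^ 2)⁻¹) - x =
        x * ((1 - a) ^ 2 * (2 * a + 1)) / (3 * a ^ 2) := by field_simp; ring
      have : 0 < 1 - a := by linarith
      have : 0 < x * ((1 - a) ^ 2 * (2 * a + 1)) / (3 * a ^ 2) := by positivity
      linarith
    have hr0 := hx.trans hr
    have := h.eq_branch 1 ⟨_, show ((x / 3 * (2 * a + (a ^ 2)⁻¹) : ℝ) : ℂ) ∈ sectorC from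
      ⟨(ofReal_im _).ge, by rw [ofReal_im, ofReal_re]; positivity⟩⟩ (mem_sheetDomain
        (fun h => h.elim (ofReal_not_mem_Sigma1 hx hr) (ofReal_not_mem_Sigma2 hr0)) 1)
    rw [h.branch_eq (u := a) (by exact_mod_cast ha.ne') _ (by rw [zC]; push_cast; rfl)] at this
    · refine ⟨hr, ?_⟩
      rw [OnePoint.coe_injective this]; norm_cast
    · rw [mem_region_one]
      simp only [ofReal_im, ofReal_re, normSq_ofReal]
      refine ⟨le_rfl, by positivity, ?_, ?_⟩
      · nlinarith [pow_le_pow_left₀ ha.le ha1.le 3]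
      · nlinarith [sq_nonneg (a ^ 2)]
  -- monotonicity over the points with the parameters `a` and `a ^ 2`
  have key (a : ℝ) (ha : 0 < a) (ha1 : a < 1) : 8 * γ ^ 3 - 2 + 16 * γ ^ 6 * (a ^ 3 + a ^ 6) +
      32 * γ ^ 6 * a ^ 9 ≤ 0 := by
    obtain ⟨r1, e1⟩ := v a ha ha1
    obtain ⟨r2, e2⟩ := v (a ^ 2) (by positivity) (by nlinarith)
    have : 0 < a ^ 3 - a ^ 6 := sub_pos.2 (pow_lt_pow_right_of_lt_one₀ ha ha1 (by norm_num))
    have hrs : x / 3 * (2 * a + (a ^ 2)⁻¹) ≤ x / 3 * (2 * a ^ 2 + ((a ^ 2) ^ 2)⁻¹) := by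
      have e : x / 3 * (2 * a ^ 2 + ((a ^ 2) ^ 2)⁻¹) - x / 3 * (2 * a + (a ^ 2)⁻¹) =
        x * ((1 - a) * (1 - a + 2 * a * (1 - a ^ 4))) / (3 * a ^ 4) := by
        field_simp; ring
      have : 0 < 1 - a := by linarith
      have : 0 < 1 - a ^ 4 := sub_pos.2 (pow_lt_one₀ ha.le ha1 (by norm_num))
      have : 0 < x * ((1 - a) * (1 - a + 2 * a * (1 - a ^ 4))) / (3 * a ^ 4) := by positivity
      linarith
    have hm := pow_le_pow_left₀ (by rw [e1]; positivity) (h.mono _ _ r1 hrs) 2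
    rw [mul_pow, mul_pow, sq_sqrt (by positivity), sq_sqrt (by positivity), e1, e2,
      ← sub_nonpos] at hm
    refine nonpos_of_mul_nonpos_right (a := x / 3 * (γ / t3) ^ 2 / a ^ 6 * (a ^ 3 - a ^ 6)) ?_
      (by positivity)
    convert hm using 1
    field_simp; ring
  have hlim : Tendsto (fun a : ℝ => 8 * γ ^ 3 - 2 + 16 * γ ^ 6 * (a ^ 3 + a ^ 6) +
      32 * γ ^ 6 * a ^ 9) (𝓝[<] 1) (𝓝 (8 * γ ^ 3 - 2 + 16 * γ ^ 6 * (1 ^ 3 + 1 ^ 6) +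
      32 * γ ^ 6 * 1 ^ 9)) :=
    ((by fun_prop : Continuous _).tendsto 1).mono_left nhdsWithin_le_nhds
  have := le_of_tendsto hlim (by
    filter_upwards [Ioo_mem_nhdsLT (zero_lt_one' ℝ)] with a ha using key a ha.1 ha.2)
  have := pow_pos hg 3
  nlinarith

/-- The functions `ξ` are the branches of the meromorphic function `xiHat` on the surface. -/
theorem xiHat_surfaceHomeo (h : IsXiTriple t0 t3 x y A γ ξ) (p : Piece) (z : ℂ)
    (hp : p.pt = (z : OnePoint ℂ)) (hz : z ∈ sheetDomain x p.sheet) :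
    xiHat (γ / t3 : ℂ) (4 * γ ^ 3 : ℂ) (surfaceHomeo h.param.x_pos (Surface.mk x p)) =
      ((ξ p.sheet z : ℂ) : OnePoint ℂ) := by
  have hx := h.param.x_pos
  rcases mem_sector_iff_gmap.1 p.2 with hi | ⟨w, hw, hP⟩
  · exact absurd (hp.symm.trans hi) (coe_ne_infty z)
  obtain rfl : z = gmap p.sec w := OnePoint.coe_injective (hp.symm.trans hP)
  obtain ⟨u, hu, hk, hzu⟩ := exists_mem_region_zC hx hw p.sheet
  have e1 : pieceMap hx p = (gmap p.sec u : ℂ) := by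
    refine (eq_pieceMap hx ?_ ?_).symm
    · rw [gHat_symm_coe, gmapInv_gmap]; exact coe_mem_regionHat.2 hk
    · rw [← gHat_coe, zHat_gHat, zHat_coe hu, hzu, hp]; rfl
  have e2 := h.eq_branch p.sheet ⟨w, hw⟩
  rw [h.branch_eq hu hk hzu] at e2
  rw [surfaceHomeo_mk, e1]
  by_cases hm : Even (p.sec : ℕ)
  · have hc := gmap_cube_pow p.sec hm
    rw [gmap_even hm] at hz ⊢
    rw [gmap_even hm]
    generalize zeta6 ^ (p.sec : ℕ) = c at *
    have hc0 : c ≠ 0 := by rintro rfl; simp at hc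
    have hw' := (mul_mem_sheetDomain_iff hc).1 hz
    rw [xiHat_coe (mul_ne_zero hc0 hu), h.mul _ w hw' c hc, OnePoint.coe_injective (e2 hw'),
      mul_inv, show c⁻¹ = c ^ 2 from inv_eq_of_mul_eq_one_right (by linear_combination hc)]
    congr 1; ring
  · have hc := gmap_cube_pow' p.sec hm
    rw [gmap_odd hm] at hz ⊢
    rw [gmap_odd hm]
    generalize zeta6 ^ ((p.sec : ℕ) + 1) = c at *
    have hc0 : c ≠ 0 := by rintro rfl; simp at hc
    have hw' := (mul_mem_sheetDomain_iff hc).1 hz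
    have hw2 := conj_mem_sheetDomain_iff.1 hw'
    rw [xiHat_coe (mul_ne_zero hc0 (by simpa)), h.mul _ _ hw' c hc, h.map_conj _ _ hw2,
      OnePoint.coe_injective (e2 hw2), mul_inv,
      show c⁻¹ = c ^ 2 from inv_eq_of_mul_eq_one_right (by linear_combination hc)]
    simp only [map_mul, map_add, map_div₀, map_pow, map_inv₀, conj_ofReal, map_ofNat]; congr 1; ring
end IsXiTriple

/-! ### The values at the nodes -/

lemma tendsto_zero_of_add_of_mul {α : Type*} {l : Filter α} {a b : α → ℂ}
    (h1 : Tendsto (fun z => a z + b z) l (𝓝 0)) (h2 : Tendsto (fun z => a z * b z) l (𝓝 0)) :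
    Tendsto a l (𝓝 0) ∧ Tendsto b l (𝓝 0) := by
  have h3 : Tendsto (fun z => (a z - b z) ^ 2) l (𝓝 0) := by
    have := (h1.pow 2).sub (h2.const_mul 4)
    simp only [ne_eq, OfNat.ofNat_ne_zero, not_false_eq_true, zero_pow, mul_zero, sub_zero] at this
    exact this.congr fun z => by ring
  have h4 : Tendsto (fun z => a z - b z) l (𝓝 0) := by
    rw [tendsto_zero_iff_norm_tendsto_zero] at h3 ⊢
    simpa [comp_def] using (Real.continuous_sqrt.tendsto 0).comp h3
  constructor
  · simpa using ((h1.add h4).div_const 2).congr fun z => by ring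
  · simpa using ((h1.sub h4).div_const 2).congr fun z => by ring

namespace IsXiTriple
variable {t0 t3 x y A γ : ℝ} {ξ : Fin 3 → ℂ → ℂ}

lemma tendsto_node (h : IsXiTriple t0 t3 x y A γ ξ) {c : ℂ} (hc : c ^ 3 = 1) :
    Tendsto (ξ 0) (𝓝[sheetDomain x 0] (c * y)) (𝓝 (c ^ 2 * y)) ∧
      Tendsto (ξ 1) (𝓝[sheetDomain x 1] (c * y)) (𝓝 (c ^ 2 * y)) := by
  have hy := h.param.y_pos
  have hS := ofReal_not_mem_Sigma2 hy
  have hS' : c * y ∉ Sigma2 := by rwa [mul_mem_Sigma2_iff hc]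
  have hcont := h.cont 2 _ hS'
  have hneg := h.neg _ hy
  have hroot := h.root 2 _ hS
  have hmul := h.mul 2 _ hS c hc
  have hyre : (y : ℂ) ≠ ξ 2 (y) := fun e => by
    rw [← e, ofReal_re] at hneg; linarith
  have hcoef := h.param.coeff_node
  have hA := h.param.A_eq_node
  rw [IsRoot, eval_spectralPoly, hcoef, hA] at hroot
  -- `y` is a double root of the equation over `y`, so the third root is determined by the sum
  have h2 : ξ 2 y = t3 * y ^ 2 - 2 * y := by
    have : (y - ξ 2 y) ^ 2 * (ξ 2 y - (t3 * y ^ 2 - 2 * y)) = 0 := by linear_combination hroot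
    exact sub_eq_zero.1 ((mul_eq_zero.1 this).resolve_left (pow_ne_zero 2 (sub_ne_zero.2 hyre)))
  have hc0 : c ≠ 0 := by rintro rfl; simp at hc
  have hne : c ^ 2 * y - ξ 2 (c * y) ≠ 0 := by
    rw [hmul, ← mul_sub]; exact mul_ne_zero (pow_ne_zero 2 hc0) (sub_ne_zero.2 hyre)
  have hlim : Tendsto (ξ 2) (𝓝[(Sigma1 x ∪ Sigma2)ᶜ] (c * y)) (𝓝 (ξ 2 (c * y))) :=
    hcont.tendsto.mono_left nhdsWithin_le_nhds
  have hid : Tendsto (fun z : ℂ => z) (𝓝[(Sigma1 x ∪ Sigma2)ᶜ] (c * y)) (𝓝 (c * y)) :=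
    tendsto_id.mono_left nhdsWithin_le_nhds
  have hself : ∀ᶠ z in 𝓝[(Sigma1 x ∪ Sigma2)ᶜ] (c * y), z ∉ Sigma1 x ∪ Sigma2 := self_mem_nhdsWithin
  have hsum : Tendsto (fun z => (c ^ 2 * y - ξ 0 z) + (c ^ 2 * y - ξ 1 z))
      (𝓝[(Sigma1 x ∪ Sigma2)ᶜ] (c * y)) (𝓝 0) := by
    have := (((hid.pow 2).const_mul (t3 : ℂ)).const_sub (2 * (c ^ 2 * y))).add hlim
    rw [hmul, h2, show 2 * (c ^ 2 * y) - t3 * (c * y) ^ 2 + c ^ 2 * (t3 * y ^ 2 - 2 * y) = 0 by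
      ring] at this
    refine this.congr' ?_
    filter_upwards [hself] with z hz
    linear_combination (spectralPoly_eq_prod_iff.1 (h.prod z hz)).1
  have hprod : Tendsto (fun z => (c ^ 2 * y - ξ 0 z) * (c ^ 2 * y - ξ 1 z))
      (𝓝[(Sigma1 x ∪ Sigma2)ᶜ] (c * y)) (𝓝 0) := by
    have hcon : Continuous fun z => (spectralPoly t0 t3 A z).eval (c ^ 2 * y) := by
      simp only [eval_spectralPoly]; fun_prop
    have := ((hcon.tendsto (c * y)).mono_left nhdsWithin_le_nhds).div (hlim.const_sub (c ^ 2 * y))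
      hne
    have h0 : (spectralPoly t0 t3 A (c * y)).eval (c ^ 2 * y) = 0 := by
      rw [eval_spectralPoly, hcoef, hA]
      linear_combination (y ^ 3 - t3 * y ^ 4) * (c ^ 3 - 1) * hc
    rw [h0, zero_div] at this
    refine this.congr' ?_
    filter_upwards [hself, (hlim.const_sub (c ^ 2 * y)).eventually_ne hne] with z hz hz'
    have := h.prod z hz
    rw [Pi.div_apply, this, eval_prod, Fin.prod_univ_three, div_eq_iff hz']; simp
  obtain ⟨l0, l1⟩ := tendsto_zero_of_add_of_mul hsum hprod
  have e : 𝓝[sheetDomain x 0] (c * y) = 𝓝[(Sigma1 x ∪ Sigma2)ᶜ] (c * y) := by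
    rw [Set.compl_union]
    exact (nhdsWithin_inter_of_mem' (mem_nhdsWithin_of_mem_nhds
      (isClosed_Sigma2.isOpen_compl.mem_nhds hS'))).symm
  rw [e]
  change _ ∧ Tendsto _ (𝓝[(Sigma1 x ∪ Sigma2)ᶜ] (c * y)) _
  exact ⟨by simpa using (l0.const_sub (c ^ 2 * y)).congr fun z => sub_sub_cancel _ (ξ 0 z),
    by simpa using (l1.const_sub (c ^ 2 * y)).congr fun z => sub_sub_cancel _ (ξ 1 z)⟩

lemma eq_node (h : IsXiTriple t0 t3 x y A γ ξ) (h8 : 8 * γ ^ 3 ≠ 1) {c : ℂ} (hc : c ^ 3 = 1) :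
    ξ 0 (c * y) = c ^ 2 * y ∧ ξ 1 (c * y) = c ^ 2 * y := by
  have hx := h.param.x_pos
  have hlt := h.param.x_le h.le |>.lt_of_ne (h8 ∘ h.param.x_eq_iff.1)
  have hD (k : Fin 3) : c * y ∈ sheetDomain x k :=
    (mul_mem_sheetDomain_iff hc).2 (mem_sheetDomain (fun h => h.elim (ofReal_not_mem_Sigma1 hx hlt)
      (ofReal_not_mem_Sigma2 (hx.trans hlt))) k)
  obtain ⟨h0, h1⟩ := h.tendsto_node hc
  have t (k : Fin 3) := (h.cont k _ (hD k)).tendsto.mono_left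
    (nhdsWithin_le_nhds (s := sheetDomain x k))
  have (k : Fin 3) : (𝓝[sheetDomain x k] (c * y)).NeBot :=
    mem_closure_iff_nhdsWithin_neBot.1 (subset_closure (hD k))
  exact ⟨tendsto_nhds_unique (t 0) h0, tendsto_nhds_unique (t 1) h1⟩
end IsXiTriple

/-- The parameter equations in rational form. -/
lemma exists_isCurveParam {t0 t3 x η A : ℝ} (ht0 : 0 < t0) (ht3 : 0 < t3) (hx : 0 < x) (h0 : 0 < η)
    (h2 : t0 * t3 ^ 2 = η - 2 * η ^ 2) (h3 : 4 * t3 ^ 3 * x ^ 3 = 27 * η ^ 2)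
    (h4 : A * t3 ^ 3 = η * (1 - η) ^ 3) : ∃ y γ, IsCurveParam t0 t3 x y A γ := by
  have hs : √(t3 * x / 3) ^ 2 = t3 * x / 3 := sq_sqrt (by positivity)
  have hg : 2 * √(t3 * x / 3) ^ 3 = η := by
    refine (pow_left_inj₀ (by positivity) h0.le two_ne_zero).1 ?_
    linear_combination 4 * ((√(t3 * x / 3) ^ 2) ^ 2 + √(t3 * x / 3) ^ 2 * (t3 * x / 3) +
      (t3 * x / 3) ^ 2) * hs + h3 / 27
  refine ⟨_, √(t3 * x / 3), ht0, ht3, by positivity, ?_, by rw [hs]; field_simp, rfl, ?_⟩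
  · rw [eq_div_iff (by positivity), h2, ← hg]; ring
  · rw [hg, eq_div_iff (by positivity), h4]

end

end CubicNMM

theorem lemma4p2 (t0 t3 x : ℝ) (ht0 : 0 < t0) (ht3 : 0 < t3) (hx : 0 < x)
    (μ1 μ2 : Measure ℂ) (hmin : IsEquilibriumPair t0 t3 x μ1 μ2)
    (hsupp : μ1.support = Sigma1 x) (hdens : DensityVanishesAtEndpoints x μ1) :
    t0 ≤ 1 / (8 * t3 ^ 2) ∧
    -- (a)
    (∃ f : Surface x → OnePoint ℂ, IsMeromorphicOnSurface f ∧
      (∀ (p : Piece) (z : ℂ), p.pt = (z : OnePoint ℂ) → z ∈ sheetDomain x p.sheet →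
        f (Surface.mk x p) = ((xi t0 t3 μ1 μ2 p.sheet z : ℂ) : OnePoint ℂ)) ∧
      (∀ P : Surface x, f P = OnePoint.infty ↔ P.proj = OnePoint.infty)) ∧
    -- (b)
    ((∀ k : Fin 3, ∀ z ∈ sheetDomain x k,
        (spectralPoly t0 t3 (constA t0 t3) z).IsRoot (xi t0 t3 μ1 μ2 k z)) ∧
      (∀ z ∉ Sigma1 x ∪ Sigma2,
        spectralPoly t0 t3 (constA t0 t3) z = ∏ k : Fin 3, (X - C (xi t0 t3 μ1 μ2 k z)))) ∧
    -- (c)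
    (x = xStar t0 t3 ∧
      (∀ z : ℂ, IsBranchPoint (spectralPoly t0 t3 (constA t0 t3)) z ↔
        ∃ j : Fin 3, z = omega ^ (j : ℕ) * x) ∧
      (∀ z ξ : ℂ, IsSingularPoint (fun z ξ => (spectralPoly t0 t3 (constA t0 t3) z).eval ξ) z ξ ↔
        ∃ j : Fin 3, z = omega ^ (j : ℕ) * xHat t0 t3 ∧
          ξ = omega ^ (2 * (j : ℕ)) * xHat t0 t3) ∧
      (t0 < 1 / (8 * t3 ^ 2) → ∀ j : Fin 3,
        IsNode (fun z ξ => (spectralPoly t0 t3 (constA t0 t3) z).eval ξ)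
          (omega ^ (j : ℕ) * xHat t0 t3) (omega ^ (2 * (j : ℕ)) * xHat t0 t3)) ∧
      (∀ z : ℂ, (spectralPoly t0 t3 (constA t0 t3) z).discr = 0 ↔
        ∃ j : Fin 3, z = omega ^ (j : ℕ) * x ∨ z = omega ^ (j : ℕ) * xHat t0 t3)) ∧
    -- (d)
    (0 < x ∧ x ≤ xHat t0 t3 ∧ (x = xHat t0 t3 ↔ t0 = 1 / (8 * t3 ^ 2)) ∧
      (t0 < 1 / (8 * t3 ^ 2) → ∀ j : Fin 3,
        xi t0 t3 μ1 μ2 0 (omega ^ (j : ℕ) * xHat t0 t3) = omega ^ (2 * (j : ℕ)) * xHat t0 t3 ∧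
        xi t0 t3 μ1 μ2 1 (omega ^ (j : ℕ) * xHat t0 t3) = omega ^ (2 * (j : ℕ)) * xHat t0 t3) ∧
      (∀ j : Fin 3,
        Tendsto (xi t0 t3 μ1 μ2 0) (𝓝[sheetDomain x 0] (omega ^ (j : ℕ) * xHat t0 t3))
          (𝓝 (omega ^ (2 * (j : ℕ)) * xHat t0 t3)) ∧
        Tendsto (xi t0 t3 μ1 μ2 1) (𝓝[sheetDomain x 1] (omega ^ (j : ℕ) * xHat t0 t3))
          (𝓝 (omega ^ (2 * (j : ℕ)) * xHat t0 t3)))) := by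
  obtain ⟨hrot, hbal⟩ := hmin.rotInv_and_eq hx
  obtain ⟨hf, -⟩ := hmin.1.isLogFinite
  have hfin := hf.finite
  have hμ := measure_compl_of_support_subset hmin.1.supp1
  have hl := hmin.isLoopLaw hx ht0 ht3 hsupp hdens
  obtain ⟨A, hA⟩ := hl.exists_curve
  obtain ⟨η, h0, h2, h3, h4⟩ := hl.exists_param hA
  rw [rpow_three_halves_sq hx.le] at h3
  obtain ⟨y, γ, hp⟩ := exists_isCurveParam ht0 ht3 hx h0 h2 h3 h4
  have h := isXiTriple hp hrot hf hμ hl hA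
  rw [← hbal] at h
  have hle := h.le
  obtain rfl := hp.eq_xHat hle
  obtain rfl := hp.eq_constA hle
  have h8 (hlt : t0 < 1 / (8 * t3 ^ 2)) : 8 * γ ^ 3 ≠ 1 := fun e => hlt.ne (hp.eq_crit_iff.2 e)
  have hω (j : Fin 3) : omega ^ (2 * (j : ℕ)) = (omega ^ (j : ℕ)) ^ 2 := by
    rw [mul_comm, pow_mul]
  refine ⟨hp.le_crit, ⟨_, isMeromorphicOnSurface_xiHat hx h.kappa_ne
    (g := (4 * γ ^ 3 : ℂ)) ?_, h.xiHat_surfaceHomeo, xiHat_eq_infty_iff hx _ _⟩,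
    ⟨h.root, h.prod⟩, ⟨hp.eq_xStar hle, hp.isBranchPoint_iff, hp.isSingularPoint_iff,
      fun hlt => hp.isNode (h8 hlt), hp.discr_eq_zero_iff⟩,
    hx, hp.x_le hle, hp.x_eq_iff.trans hp.eq_crit_iff.symm, fun hlt j => ?_, fun j => ?_⟩
  · have : (γ : ℂ) ≠ 0 := by exact_mod_cast hp.pos.ne'
    simpa
  · rw [hω]; exact h.eq_node (h8 hlt) (omega_pow_cube j)
  · rw [hω]; exact h.tendsto_node (omega_pow_cube j)
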